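/- **Setting.** Let $m\ge 1$, let $t_0,\dots,t_m\in\mathbb C$, let $T,U\subset\mathbb C$ be open, $U\neq\emptyset$. All large-$N$ expansions are formal series in $1/N$, and $\dot f:=\frac1N\partial_t f$. The modified Gelfand–Dikii polynomials are $\hat R_0(u)=u$, $\check R_0(u)=\frac{u^2}{2}$, $\hat R_{k+1}(u)=u\check R_k(u)-\frac14\ddot{\hat R}_k(u)$, where $\check R_k(u)$ is the differential polynomial in $u$ without constant term such that $\dot{\check R}_k(u)=u\,\dot{\hat R}_k(u)$. Let $u(t)=\sum_{j\ge0}u_j(t)N^{-2j}$, with $u_j$ analytic on $T$ and $u_0(t)\ne0$ on $T$, be a formal solution of the string equation $$\sum_{k=0}^m t_k\hat R_k(u(t))=-t\,u(t).$$ Put $A_0=B_0=0$, $C_0=1$, $A_{k+1}=x^2A_k+\frac12\dot{\hat R}_k(u)$, $B_{k+1}=x^2B_k+\hat R_k(u)$, $C_{k+1}=x^2C_k+\check R_k(u)$, and $$\mathcal R=\begin{pmatrix}0&x+u\\-x+u&0\end{pmatrix},\qquad \mathcal D=\sum_{k=0}^m t_k\begin{pmatrix}-A_k&xB_k+C_k\\xB_k-C_k&A_k\end{pmatrix}+t\begin{pmatrix}0&1\\-1&0\end{pmatrix}.$$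 The spectral curve of $\mathcal D$ is $y^2=(u_0^2-x^2)M(x)^2$ with $M(x)=\sum_{j=1}^m t_j\sum_{k=0}^{j-1}\frac{(2k)!}{2^{2k}(k!)^2}u_0^{2k}x^{2(j-k)-1}$. It is parametrized by $$x(z)=\frac{u_0}{2}\Big(z+\frac1z\Big),\quad \sqrt{u_0^2-x^2}=\frac{iu_0}{2z}(z^2-1),\quad y(z)=\frac{iu_0}{2z}(z^2-1)\,M(x(z)),\quad x'(z)=\frac{u_0(z^2-1)}{2z^2}.$$ Let $\Psi=\begin{pmatrix}\psi&\phi\\\tilde\psi&\tilde\phi\end{pmatrix}$ be a formal large-$N$ solution on $U\times T$ of $\frac1N\partial_x\Psi=\mathcal D\Psi$, $\frac1N\partial_t\Psi=\mathcal R\Psi$, $\det\Psi=1$, of the form $$\psi,\ -\phi=\tfrac1{\sqrt2}\Big(\tfrac{u_0+x}{u_0-x}\Big)^{1/4}e^{\pm N\int^x y\,dx}\Big(1+O(\tfrac1N)\Big),\qquad \tilde\psi,\ \tilde\phi=\tfrac1{\sqrt2}\Big(\tfrac{u_0-x}{u_0+x}\Big)^{1/4}e^{\pm N\int^x y\,dx}\Big(1+O(\tfrac1N)\Big)$$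 (upper sign for $\psi,\tilde\psi$, lower sign for $\phi,\tilde\phi$), where $1+O(\frac1N)$ stands for a formal series in $1/N$ with coefficients analytic in $(x,t)\in U\times T$, and analytic branches of $\sqrt{u_0^2-x^2}\neq0$ and of the fourth root are fixed compatibly, so that $\big(\frac{u_0+x}{u_0-x}\big)^{1/2}=\frac{u_0+x}{\sqrt{u_0^2-x^2}}$. Let $$K(x_1,x_2)=\frac{\psi(x_1)\tilde\phi(x_2)-\tilde\psi(x_1)\phi(x_2)}{x_1-x_2},\quad W_1=\psi'\tilde\phi-\tilde\psi'\phi,\quad W_n(x_1,\dots,x_n)=-\frac{\delta_{n,2}}{(x_1-x_2)^2}-(-1)^n\sum_{\sigma}\prod_{i=1}^nK(x_i,x_{\sigma(i)})\ \ (n\ge2),$$ where $\sigma$ runs over the cyclic permutations of all $n$ indices (the exponentials cancel, so $W_n$ is a formal Laurent series in $1/N$). Let $W_n^{(g)}$ be the coefficient of $N^{2-2g-n}$ in $W_n$, and $$\mathcal W_n^{(g)}(z_1,\dots,z_n)=W_n^{(g)}(x(z_1),\dots,x(z_n))\,x'(z_1)\cdots x'(z_n)+\delta_{n,2}\delta_{g,0}\frac{x'(z_1)x'(z_2)}{(x(z_1)-x(z_2))^2},$$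 the coefficient of $dz_1\cdots dz_n$ of a differential; here $z_i$ is the point of the curve given by $x_i\in U$ and the chosen branch of $\sqrt{u_0^2-x_i^2}$, and the $x_i$ are pairwise distinct. **Theorem.** Fix $t\in T$. Then $W_n=\sum_{g\ge0}N^{2-2g-n}W_n^{(g)}$ for all $n\ge1$; $\mathcal W_1^{(0)}(z)=y(z)x'(z)$, $\mathcal W_2^{(0)}(z_1,z_2)=\frac1{(z_1-z_2)^2}$; for $2g-2+n>0$, $n\geq 1$, $\mathcal W_n^{(g)}$ extends to a rational function of $z_1,\dots,z_n$ with poles only at $z_i=\pm1$. With these extensions, for all $g,n\ge0$ with $2g+n\ge2$ and all $J=(z_1,\dots,z_n)$, $z_{n+1}$ in $\mathbb C\setminus\{\pm1\}$, with $\bar z=\frac1z$, $$\mathcal W_{n+1}^{(g)}(z_1,\dots,z_{n+1})=\sum_{a=\pm1}\operatorname*{Res}_{z\to a}\ \frac{1}{2u_0\,y(z)\,(1-\frac{z_{n+1}}{z})(\frac1z-z_{n+1})}\Big[\mathcal W_{n+2}^{(g-1)}(z,\bar z,J)+\sum_{h=0}^g\sum_{I\subset J}{}^{'}\,\mathcal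 W_{1+|I|}^{(h)}(z,I)\,\mathcal W_{n+1-|I|}^{(g-h)}(\bar z,J\setminus I)\Big]\,d\bar z,\qquad d\bar z=-\frac{dz}{z^2},$$ where $\mathcal W_{n+2}^{(-1)}:=0$ and the prime means that the terms $(h,I)=(0,\emptyset)$ and $(h,I)=(g,J)$ are excluded. -/

import Mathlib

open Filter Topology

noncomputable section

namespace PainleveII

/-! ### Modified Gelfand–Dikii polynomials -/

section GelfandDikii

variable {A : Type*} [CommRing A] [Algebra ℂ A]

/-- The pairs `(R̂ₖ(u), Řₖ(u))` of modified Gelfand–Dikii polynomials of an element `u` of a ring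
with derivation `δ`:  `R̂₀ = u`, `Ř₀ = u²/2`, `R̂ₖ₊₁ = u Řₖ - δ²R̂ₖ/4`, and `Řₖ` is the differential
polynomial in `u` without constant term that satisfies `δ Řₖ = u δ R̂ₖ`.  The primitive `Řₖ₊₁` is
written out as
`(∑_{i+j=k+1} R̂ᵢR̂ⱼ - ∑_{i+j=k} ŘᵢŘⱼ + ¼ ∑_{i+j=k} δR̂ᵢ δR̂ⱼ) / 2`;
`gdCheck_deriv` below proves that this is the required primitive. -/
def gelfandDikii (δ : A → A) (u : A) : ℕ → A × A
  | 0 => (u, (1 / 2 : ℂ) • u ^ 2)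
  | k + 1 =>
    (u * (gelfandDikii δ u k).2 - (1 / 4 : ℂ) • δ (δ (gelfandDikii δ u k).1),
      (1 / 2 : ℂ) •
        (2 * (u * (u * (gelfandDikii δ u k).2 - (1 / 4 : ℂ) • δ (δ (gelfandDikii δ u k).1)))
          + ∑ i : Fin k, (gelfandDikii δ u (i + 1)).1 * (gelfandDikii δ u (k - i)).1
          - ∑ i : Fin (k + 1), (gelfandDikii δ u i).2 * (gelfandDikii δ u (k - i)).2
          + (1 / 4 : ℂ) • ∑ i : Fin (k + 1),
              δ (gelfandDikii δ u i).1 * δ (gelfandDikii δ u (k - i)).1))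
  decreasing_by all_goals omega

/-- `R̂ₖ(u)`. -/
def gdHat (δ : A → A) (u : A) (k : ℕ) : A := (gelfandDikii δ u k).1

/-- `Řₖ(u)`. -/
def gdCheck (δ : A → A) (u : A) (k : ℕ) : A := (gelfandDikii δ u k).2

theorem gdHat_zero (δ : A → A) (u : A) : gdHat δ u 0 = u := by
  simp [gdHat, gelfandDikii]

theorem gdCheck_zero (δ : A → A) (u : A) : gdCheck δ u 0 = (1 / 2 : ℂ) • u ^ 2 := by
  simp [gdCheck, gelfandDikii]

theorem gdHat_succ (δ : A → A) (u : A) (k : ℕ) :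
    gdHat δ u (k + 1) = u * gdCheck δ u k - (1 / 4 : ℂ) • δ (δ (gdHat δ u k)) := by
  simp only [gdHat, gdCheck]
  rw [gelfandDikii]

theorem gdCheck_succ (δ : A → A) (u : A) (k : ℕ) :
    (2 : ℂ) • gdCheck δ u (k + 1)
      = 2 * (u * gdHat δ u (k + 1))
          + ∑ i ∈ Finset.range k, gdHat δ u (i + 1) * gdHat δ u (k - i)
          - ∑ i ∈ Finset.range (k + 1), gdCheck δ u i * gdCheck δ u (k - i)
          + (1 / 4 : ℂ) • ∑ i ∈ Finset.range (k + 1),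
              δ (gdHat δ u i) * δ (gdHat δ u (k - i)) := by
  rw [gdHat_succ]
  simp only [gdHat, gdCheck]
  rw [gelfandDikii]
  simp only [Finset.sum_range, smul_smul]
  norm_num

/-- The defining property of `Řₖ`, for every derivation. -/
theorem gdCheck_deriv (δ : Derivation ℂ A A) (u : A) (k : ℕ) :
    δ (gdCheck δ u k) = u * δ (gdHat δ u k) := by
  induction k using Nat.strong_induction_on with
  | _ k ih =>
  cases k with
  | zero =>
    rw [gdCheck_zero, gdHat_zero, Derivation.map_smul, sq, Derivation.leibniz]
    simp only [smul_eq_mul, Algebra.smul_def]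
    have : (algebraMap ℂ A (1 / 2)) * 2 = 1 := by
      rw [← map_ofNat (algebraMap ℂ A) 2, ← map_mul]; norm_num
    linear_combination (u * δ u) * this
  | succ k =>
    have h2 : IsUnit (algebraMap ℂ A 2) := (IsUnit.mk0 (2 : ℂ) two_ne_zero).map _
    have h := congrArg δ (gdCheck_succ (δ := δ) u k)
    set a := gdHat (δ : A → A) u with ha
    set c := gdCheck (δ : A → A) u with hc
    have hs : ∀ i, a (i + 1) = u * c i - (1 / 4 : ℂ) • δ (δ (a i)) := fun i => gdHat_succ _ u i
    have h0 : a 0 = u := gdHat_zero _ u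
    simp only [map_add, map_sub, Derivation.map_smul, map_sum, Derivation.leibniz,
      smul_eq_mul, Finset.sum_add_distrib] at h
    have hd2 : δ (2 : A) = 0 := by
      have := δ.map_natCast 2
      simpa using this
    rw [hd2] at h
    -- reflect the second halves of the symmetric sums
    have refl : ∀ f g : ℕ → A, ∑ i ∈ Finset.range (k + 1), f (k - i) * g i
        = ∑ i ∈ Finset.range (k + 1), f i * g (k - i) := by
      intro f g
      rw [← Finset.sum_range_reflect]
      refine Finset.sum_congr rfl fun i hi => ?_
      have := Finset.mem_range.1 hi
      congr 2 <;> omega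
    have refl' : ∑ i ∈ Finset.range k, a (k - i) * δ (a (i + 1))
        = ∑ i ∈ Finset.range k, a (i + 1) * δ (a (k - i)) := by
      rw [← Finset.sum_range_reflect]
      refine Finset.sum_congr rfl fun i hi => ?_
      have := Finset.mem_range.1 hi
      congr 3 <;> omega
    rw [refl', refl c (fun i => δ (c i)),
      refl (fun i => δ (a i)) (fun i => δ (δ (a i)))] at h
    have e1 : ∑ i ∈ Finset.range (k + 1), c i * δ (c (k - i))
        = ∑ i ∈ Finset.range (k + 1), a (i + 1) * δ (a (k - i))
          + (1 / 4 : ℂ) • ∑ i ∈ Finset.range (k + 1), δ (a i) * δ (δ (a (k - i))) := by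
      rw [← refl (fun i => δ (a i)) (fun i => δ (δ (a i))), Finset.smul_sum,
        ← Finset.sum_add_distrib]
      refine Finset.sum_congr rfl fun i hi => ?_
      rw [ih (k - i) (by omega), hs i, Algebra.smul_def, Algebra.smul_def]
      ring
    rw [e1, Finset.sum_range_succ (fun i => a (i + 1) * δ (a (k - i)))] at h
    simp only [Nat.sub_self, h0, Algebra.smul_def] at h ⊢
    refine h2.mul_left_cancel ?_
    have h2' : (algebraMap ℂ A 2) = 2 := map_ofNat _ 2
    rw [h2'] at h ⊢
    linear_combination h

end GelfandDikii


/-! ### The string equation and the Lax matrices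

Formal series in `ħ = 1/N` are elements of `PowerSeries ℂ`, with `PowerSeries.X` in the role of
`ħ`.  A formal series whose coefficients are functions of `t` (or of `x` and `t`) is a function
`ℂ → PowerSeries ℂ` (or `ℂ → ℂ → PowerSeries ℂ`). -/

/-- The normalised time derivative `ḟ = (1/N) ∂f/∂t`, coefficient by coefficient. -/
def dotT (f : ℂ → PowerSeries ℂ) : ℂ → PowerSeries ℂ := fun t =>
  PowerSeries.X * PowerSeries.mk fun k => deriv (fun t' => PowerSeries.coeff k (f t')) t

/-- The formal series `u(t) = ∑ⱼ uⱼ(t) N^{-2j}`. -/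
def uSeries (u : ℕ → ℂ → ℂ) : ℂ → PowerSeries ℂ := fun t =>
  PowerSeries.mk fun k => if Even k then u (k / 2) t else 0

/-- `u(t) = ∑ⱼ uⱼ(t) N^{-2j}`, with analytic coefficients on `T` and non-vanishing leading term,
solves the string equation `∑_{k=0}^m tₖ R̂ₖ(u(t)) = -t u(t)` as a formal series in `1/N`.  The
constants `tₖ` are the values `τ k`. -/
structure IsStringSolution (m : ℕ) (τ : ℕ → ℂ) (T : Set ℂ) (u : ℕ → ℂ → ℂ) : Prop where
  analytic : ∀ j, AnalyticOnNhd ℂ (u j) T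
  leading_ne_zero : ∀ t ∈ T, u 0 t ≠ 0
  string_eq : ∀ t ∈ T,
    ∑ k ∈ Finset.range (m + 1), τ k • gdHat dotT (uSeries u) k t = -(t • uSeries u t)

/-- `Aₖ(x,t)`: `A₀ = 0`, `Aₖ₊₁ = x² Aₖ + (1/2) d/dt R̂ₖ(u)` (normalised derivative). -/
def laxA (u : ℕ → ℂ → ℂ) : ℕ → ℂ → ℂ → PowerSeries ℂ
  | 0, _, _ => 0
  | k + 1, x, t => x ^ 2 • laxA u k x t + (1 / 2 : ℂ) • dotT (gdHat dotT (uSeries u) k) t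

/-- `Bₖ(x,t)`: `B₀ = 0`, `Bₖ₊₁ = x² Bₖ + R̂ₖ(u)`. -/
def laxB (u : ℕ → ℂ → ℂ) : ℕ → ℂ → ℂ → PowerSeries ℂ
  | 0, _, _ => 0
  | k + 1, x, t => x ^ 2 • laxB u k x t + gdHat dotT (uSeries u) k t

/-- `Cₖ(x,t)`: `C₀ = 1`, `Cₖ₊₁ = x² Cₖ + Řₖ(u)`. -/
def laxC (u : ℕ → ℂ → ℂ) : ℕ → ℂ → ℂ → PowerSeries ℂ
  | 0, _, _ => 1
  | k + 1, x, t => x ^ 2 • laxC u k x t + gdCheck dotT (uSeries u) k t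

/-- The matrix `𝓡(x,t)` of the Lax pair. -/
def laxR (u : ℕ → ℂ → ℂ) (x t : ℂ) : Matrix (Fin 2) (Fin 2) (PowerSeries ℂ) :=
  !![0, PowerSeries.C x + uSeries u t;
    -PowerSeries.C x + uSeries u t, 0]

/-- The matrix `𝓓(x,t)` of the Lax pair, `∑_{k=0}^m tₖ 𝓓ₖ(x,t)` plus the term `t 𝓓₀` that makes the
compatibility condition equivalent to the string equation. -/
def laxD (m : ℕ) (τ : ℕ → ℂ) (u : ℕ → ℂ → ℂ) (x t : ℂ) :
    Matrix (Fin 2) (Fin 2) (PowerSeries ℂ) :=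
  ∑ k ∈ Finset.range (m + 1), τ k •
      !![-laxA u k x t, x • laxB u k x t + laxC u k x t;
        x • laxB u k x t - laxC u k x t, laxA u k x t]
    + t • !![0, 1; -1, 0]

/-! ### The spectral curve -/

/-- `∑_{j=1}^m tⱼ ∑_{k=0}^{j-1} x^{2(j-k)-1} (2k)!/(2^{2k} k!²) u₀^{2k}`; the spectral curve is
`y² = (u₀² - x²) (curveFactor x)²`. -/
def curveFactor (m : ℕ) (τ : ℕ → ℂ) (u₀ x : ℂ) : ℂ :=
  ∑ j ∈ Finset.Icc 1 m, τ j * ∑ k ∈ Finset.range j,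
    x ^ (2 * (j - k) - 1) * ((Nat.factorial (2 * k) : ℂ) / (2 ^ (2 * k) * (Nat.factorial k : ℂ) ^ 2))
      * u₀ ^ (2 * k)

/-- The uniformisation `x(z) = u₀ (z + 1/z) / 2` of the spectral curve. -/
def xParam (u₀ z : ℂ) : ℂ := u₀ / 2 * (z + 1 / z)

/-- The derivative `x'(z) = u₀ (z² - 1) / (2 z²)`. -/
def dxParam (u₀ z : ℂ) : ℂ := u₀ * (z ^ 2 - 1) / (2 * z ^ 2)

/-- `y(z)`: in the coordinate `z` one has `√(u₀² - x²) = (i u₀ / (2z)) (z + 1)(z - 1)`. -/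
def yParam (m : ℕ) (τ : ℕ → ℂ) (u₀ z : ℂ) : ℂ :=
  Complex.I * u₀ / (2 * z) * (z + 1) * (z - 1) * curveFactor m τ u₀ (xParam u₀ z)

/-! ### Formal WKB solutions of the Lax system -/

/-- A formal large-`N` solution `Ψ = (ψ, φ; ψ̃, φ̃)` of the Lax system on `U × T` (`x ∈ U`, `t ∈ T`):
```
  ψ  =  (1/√2) ((u₀+x)/(u₀-x))^{1/4} exp(N S) (1 + ∑ ψₖ N^{-k})
  φ  = -(1/√2) ((u₀+x)/(u₀-x))^{1/4} exp(-N S) (1 + ∑ φₖ N^{-k})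
  ψ̃  =  (1/√2) ((u₀-x)/(u₀+x))^{1/4} exp(N S) (1 + ∑ ψ̃ₖ N^{-k})
  φ̃  =  (1/√2) ((u₀-x)/(u₀+x))^{1/4} exp(-N S) (1 + ∑ φ̃ₖ N^{-k})
```
with `∂S/∂x = y`.  Here `root` is a branch of `√(u₀² - x²)`, `quart` the compatible branch of
`((u₀+x)/(u₀-x))^{1/4}` (its square is `(u₀+x)/√(u₀²-x²)`), and `coef i j k` is the `k`-th
coefficient of the series in entry `(i, j)`.  The formal exponentials are kept as the exponent `S`:
`Ψ = amp · diag(exp(N S), exp(-N S))`, so that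
`(1/N) ∂Ψ = (amp · diag(∂S, -∂S) + (1/N) ∂amp) · diag(exp(N S), exp(-N S))` and `det Ψ = det amp`. -/
structure WKBSolution (m : ℕ) (τ : ℕ → ℂ) (u : ℕ → ℂ → ℂ) (U T : Set ℂ) where
  root : ℂ → ℂ → ℂ
  quart : ℂ → ℂ → ℂ
  S : ℂ → ℂ → ℂ
  coef : Fin 2 → Fin 2 → ℕ → ℂ → ℂ → ℂ
  amp : ℂ → ℂ → Matrix (Fin 2) (Fin 2) (PowerSeries ℂ)
  amp_def : ∀ x t, amp x t = fun i j =>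
    PowerSeries.C ((!![quart x t, -quart x t; (quart x t)⁻¹, (quart x t)⁻¹] i j)
        / ((Real.sqrt 2 : ℝ) : ℂ))
      * PowerSeries.mk fun k => coef i j k x t
  root_analytic : AnalyticOnNhd ℂ (fun p : ℂ × ℂ => root p.1 p.2) (U ×ˢ T)
  quart_analytic : AnalyticOnNhd ℂ (fun p : ℂ × ℂ => quart p.1 p.2) (U ×ˢ T)
  S_analytic : AnalyticOnNhd ℂ (fun p : ℂ × ℂ => S p.1 p.2) (U ×ˢ T)
  coef_analytic : ∀ i j k, AnalyticOnNhd ℂ (fun p : ℂ × ℂ => coef i j k p.1 p.2) (U ×ˢ T)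
  root_ne_zero : ∀ x ∈ U, ∀ t ∈ T, root x t ≠ 0
  root_sq : ∀ x ∈ U, ∀ t ∈ T, root x t ^ 2 = u 0 t ^ 2 - x ^ 2
  quart_sq : ∀ x ∈ U, ∀ t ∈ T, quart x t ^ 2 = (u 0 t + x) / root x t
  S_deriv : ∀ x ∈ U, ∀ t ∈ T,
    HasDerivAt (fun x' => S x' t) (root x t * curveFactor m τ (u 0 t) x) x
  coef_zero : ∀ i j, ∀ x ∈ U, ∀ t ∈ T, coef i j 0 x t = 1
  lax_x : ∀ x ∈ U, ∀ t ∈ T,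
    amp x t * Matrix.diagonal ![PowerSeries.C (deriv (fun x' => S x' t) x),
          -PowerSeries.C (deriv (fun x' => S x' t) x)]
        + Matrix.of (fun i j => PowerSeries.X *
            PowerSeries.mk fun k => deriv (fun x' => PowerSeries.coeff k (amp x' t i j)) x)
      = laxD m τ u x t * amp x t
  lax_t : ∀ x ∈ U, ∀ t ∈ T,
    amp x t * Matrix.diagonal ![PowerSeries.C (deriv (fun t' => S x t') t),
          -PowerSeries.C (deriv (fun t' => S x t') t)]
        + Matrix.of (fun i j => PowerSeries.X *
            PowerSeries.mk fun k => deriv (fun t' => PowerSeries.coeff k (amp x t' i j)) t)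
      = laxR u x t * amp x t
  det_eq_one : ∀ x ∈ U, ∀ t ∈ T, (amp x t).det = 1

namespace WKBSolution

variable {m : ℕ} {τ : ℕ → ℂ} {u : ℕ → ℂ → ℂ} {U T : Set ℂ}

/-- The coordinate `z` of the point `(x, √(u₀² - x²))` of the curve: the solution of
`x = u₀ (z + 1/z)/2`, `√(u₀² - x²) = i u₀ (z - 1/z)/2`. -/
def zCoord (Ψ : WKBSolution m τ u U T) (t x : ℂ) : ℂ :=
  (x - Complex.I * Ψ.root x t) / u 0 t

/-- The kernel `K(x₁,x₂) = (ψ(x₁) φ̃(x₂) - ψ̃(x₁) φ(x₂)) / (x₁ - x₂)` without its formal exponential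
factor `exp(N (S(x₁) - S(x₂)))`; in a product `∏ᵢ K(xᵢ, x_{σ(i)})` over a permutation `σ` these
factors multiply to `1`. -/
def kernel (Ψ : WKBSolution m τ u U T) (t x₁ x₂ : ℂ) : PowerSeries ℂ :=
  PowerSeries.C ((x₁ - x₂)⁻¹) *
    (Ψ.amp x₁ t 0 0 * Ψ.amp x₂ t 1 1 - Ψ.amp x₁ t 1 0 * Ψ.amp x₂ t 0 1)

/-- `∂/∂x` of `exp(N S) amp_{i0}`, divided by `exp(N S)`: the series `N S' a + a'` for
`a = amp_{i0}`. -/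
def firstColumnDeriv (Ψ : WKBSolution m τ u U T) (t x : ℂ) (i : Fin 2) : LaurentSeries ℂ :=
  HahnSeries.single (-1 : ℤ) (deriv (fun x' => Ψ.S x' t) x)
      * ((Ψ.amp x t i 0 : PowerSeries ℂ) : LaurentSeries ℂ)
    + ((PowerSeries.mk fun k => deriv (fun x' => PowerSeries.coeff k (Ψ.amp x' t i 0)) x :
        PowerSeries ℂ) : LaurentSeries ℂ)

/-- `W₁(x) = ψ'(x) φ̃(x) - ψ̃'(x) φ(x)`. -/
def corrOne (Ψ : WKBSolution m τ u U T) (t x : ℂ) : LaurentSeries ℂ :=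
  Ψ.firstColumnDeriv t x 0 * ((Ψ.amp x t 1 1 : PowerSeries ℂ) : LaurentSeries ℂ)
    - Ψ.firstColumnDeriv t x 1 * ((Ψ.amp x t 0 1 : PowerSeries ℂ) : LaurentSeries ℂ)

open Classical in
/-- `∑_σ ∏ᵢ K(xᵢ, x_{σ(i)})` over the cyclic permutations `σ` of all `n` points. -/
def cycleSum (Ψ : WKBSolution m τ u U T) (t : ℂ) (n : ℕ) (x : Fin n → ℂ) : PowerSeries ℂ :=
  ∑ σ : Equiv.Perm (Fin n) with σ.IsCycle ∧ ∀ i, σ i ≠ i, ∏ i, Ψ.kernel t (x i) (x (σ i))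

/-- The connected determinantal correlation functions `Wₙ(x₁,…,xₙ)`, as formal Laurent series in
`1/N`. -/
def corr (Ψ : WKBSolution m τ u U T) (t : ℂ) : (n : ℕ) → (Fin n → ℂ) → LaurentSeries ℂ
  | 1, x => Ψ.corrOne t (x 0)
  | 2, x => ((-PowerSeries.C (1 / (x 0 - x 1) ^ 2) - Ψ.cycleSum t 2 x : PowerSeries ℂ) :
      LaurentSeries ℂ)
  | n, x => ((-((-1) ^ n * Ψ.cycleSum t n x) : PowerSeries ℂ) : LaurentSeries ℂ)

/-- `Wₙ^{(g)}`: the coefficient of `N^{2-2g-n}` in `Wₙ`. -/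
def corrCoeff (Ψ : WKBSolution m τ u U T) (t : ℂ) (g n : ℕ) (x : Fin n → ℂ) : ℂ :=
  (Ψ.corr t n x).coeff (2 * (g : ℤ) - 2 + (n : ℤ))

end WKBSolution

/-- The term `δ_{n,2} δ_{g,0} x'(z₁) x'(z₂) / (x(z₁) - x(z₂))²`. -/
def diagonalTerm (u₀ : ℂ) : ℕ → (n : ℕ) → (Fin n → ℂ) → ℂ
  | 0, 2, z => dxParam u₀ (z 0) * dxParam u₀ (z 1) / (xParam u₀ (z 0) - xParam u₀ (z 1)) ^ 2
  | _, _, _ => 0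

/-- The differential `𝓦ₙ^{(g)}` (coefficient of `dz₁⋯dzₙ`) at the points `zᵢ` of the curve over
`xᵢ ∈ U`. -/
def WKBSolution.differential {m : ℕ} {τ : ℕ → ℂ} {u : ℕ → ℂ → ℂ} {U T : Set ℂ}
    (Ψ : WKBSolution m τ u U T) (t : ℂ) (g n : ℕ) (x : Fin n → ℂ) : ℂ :=
  Ψ.corrCoeff t g n x * ∏ i, dxParam (u 0 t) (Ψ.zCoord t (x i))
    + diagonalTerm (u 0 t) g n (fun i => Ψ.zCoord t (x i))

/-! ### Residues and the recursion -/

/-- `F` is holomorphic in a punctured neighbourhood of `a` and has residue `r` at `a`. -/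
def HasResidueAt (F : ℂ → ℂ) (a r : ℂ) : Prop :=
  (∀ᶠ z in 𝓝[≠] a, AnalyticAt ℂ F z) ∧
    ∀ᶠ ρ : ℝ in 𝓝[>] 0, (2 * (Real.pi : ℂ) * Complex.I)⁻¹ * (∮ z in C(a, ρ), F z) = r

/-- The bracket of the recursion, at the point `w` with conjugate point `1/w`:
`𝓦_{n+2}^{(g-1)}(w, 1/w, J) + ∑_{h=0}^g ∑'_{I ⊂ J} 𝓦_{1+|I|}^{(h)}(w, I) 𝓦_{1+n-|I|}^{(g-h)}(1/w, J∖I)`,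
with `J = (z₁,…,zₙ)`, where `(h, I) = (0, ∅)` and `(h, I) = (g, J)` are left out of the sum and the
first term is absent for `g = 0`. -/
def recursionBracket (ω : ℕ → (n : ℕ) → (Fin n → ℂ) → ℂ) (g n : ℕ) (z : Fin n → ℂ) (w : ℂ) : ℂ :=
  (if g = 0 then 0 else ω (g - 1) (n + 2) (Fin.cons w (Fin.cons (1 / w) z)))
    + ∑ h ∈ Finset.range (g + 1), ∑ I : Finset (Fin n),
        if (h = 0 ∧ I = ∅) ∨ (h = g ∧ I = Finset.univ) then 0
        else ω h (I.card + 1) (Fin.cons w fun i => z (I.orderEmbOfFin rfl i))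
          * ω (g - h) (Iᶜ.card + 1) (Fin.cons (1 / w) fun i => z (Iᶜ.orderEmbOfFin rfl i))

/-- The coefficient of `dw` in the recursion: the kernel
`1 / (2 u₀ y(w) (1 - p/w) (1/w - p))` times the bracket, whose entries at the conjugate point
`w̄ = 1/w` are differentials in `w̄`, `dw̄ = -dw/w²`. -/
def recursionIntegrand (m : ℕ) (τ : ℕ → ℂ) (u₀ : ℂ) (ω : ℕ → (n : ℕ) → (Fin n → ℂ) → ℂ)
    (g n : ℕ) (z : Fin n → ℂ) (p w : ℂ) : ℂ :=
  1 / (2 * u₀ * yParam m τ u₀ w * (1 - p / w) * (1 / w - p))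
    * (recursionBracket ω g n z w * (-1 / w ^ 2))

end PainleveII

end

noncomputable section

namespace PainleveII

/-! ### Sums over the orderings of a finite set of points -/

section PathSum

/-! Write ħ for 1/N. The correlation functions depend on `Ψ` only through the projector `M = Ψ
diag(1,0) Ψ⁻¹`, in which the formal exponentials cancel. It satisfies `M² = M`, `tr M = 1`, `ħ ∂ₓM =
[𝓓, M]` and `ħ ∂ₜM = [𝓡, M]`. The kernel is a row of `Ψ⁻¹` times a column of `Ψ`, divided by `x₁ -
x₂`. Hence the sum over the cycles through `x` and a set `J` is, up to sign and a factor ħ, the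
trace `tr(Λ_J(x) M(x))`, where `Λ_J` sums products of the `M(j)` over all orderings of `J`
(`cycleSum_eq`, `pathSum`) and `Λ_∅ = 𝓓`.

Loop equations. Replacing `M` by `1 - M` passes to the other sheet. In a basis where `M = diag(1,0)`
the polarised determinant of the `Λ_I` splits into diagonal products, which are products of
correlation functions on the two sheets, and off-diagonal products. The latter are turned by `ħM' =
[𝓓, M]` into the limit of the correlation function with one more point, put on the other sheet and
moved to `x` (`exists_loop_equation`). The resulting right hand side contains `M` only at the points
of `J`: as a function of `x` it is rational with poles in `J` alone, hence regular at the branch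
points `±u₀`.

Analytic form. Solving the equation in `t` order by order divides only by `u₀` and by powers of `s =
√(u₀² - x²)`, so the coefficients of `M` of positive order are polynomials in `x` over odd powers of
`s` (`IsTimeProjector.exists_isTimeForm`). It follows that the correlation functions beyond the
unstable ones decay at infinity and are singular only at the branch points. For one point this also
uses the loop equation for `J = ∅` and the fact that the corrections to `det 𝓓` have smaller degree
than the factor of the curve (`coeff_detForm_eq_zero`).

Topological expansion. If `p / s^{2d+1}` decays and its product with `y` is regular at the branch
points, it vanishes (`SpectralSystem.eq_zero_of_curve_mul`). This needs the factor of the curve to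
be nonzero at `±u₀`, which the two Lax equations force (`WKBSolution.curve_eval_ne`). Induction on
the order in ħ then removes all orders except those of the genus expansion
(`SpectralSystem.coeff_amp_eq_zero`).

Recursion. In the coordinate `z` a stable differential is odd under `z ↦ 1/z`, decays, and has poles
at `±1` only, so Cauchy's formula recovers it from its residues at `±1`
(`exists_hasResidueAt_kernel_mul`). By the loop equation the bracket of the recursion, completed by
the two excluded terms, is `x'(w)²` times a function regular at `w = ±1`. Its double zeros beat the
simple poles of the recursion kernel, so the bracket may be replaced by minus the excluded terms,
that is by the differential itself. The loop equation concerns distinct points over `U`; rationality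
in the parameters carries the double zeros over to all points (`IsParametric.exists_double_zero`).
-/

theorem sum_powerset_sum_erase {ι B : Type*} [DecidableEq ι] [AddCommMonoid B] (J : Finset ι)
    (g : ι → Finset ι → B) :
    ∑ I ∈ J.powerset, ∑ j ∈ I, g j (I.erase j)
      = ∑ j ∈ J, ∑ I ∈ (J.erase j).powerset, g j I := by
  rw [Finset.sum_sigma', Finset.sum_sigma']
  refine Finset.sum_bij' (fun p _ => ⟨p.2, p.1.erase p.2⟩) (fun p _ => ⟨insert p.1 p.2, p.1⟩)
    ?_ ?_ ?_ ?_ ?_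
  · rintro ⟨I, j⟩ h
    simp only [Finset.mem_sigma, Finset.mem_powerset] at h ⊢
    exact ⟨h.1 h.2, Finset.erase_subset_erase _ h.1⟩
  · rintro ⟨j, I⟩ h
    simp only [Finset.mem_sigma, Finset.mem_powerset] at h ⊢
    exact ⟨Finset.insert_subset h.1 (h.2.trans (Finset.erase_subset _ _)),
      Finset.mem_insert_self _ _⟩
  · rintro ⟨I, j⟩ h
    simp only [Finset.mem_sigma, Finset.mem_powerset] at h
    simp [Finset.insert_erase h.2]
  · rintro ⟨j, I⟩ h
    simp only [Finset.mem_sigma, Finset.mem_powerset] at h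
    have : j ∉ I := fun hj => Finset.notMem_erase j J (h.2 hj)
    simp [Finset.erase_insert this]
  · rintro ⟨I, j⟩ h
    rfl

/-- The form in which a sum over the set `I` of points visited before a marked one is reduced to
smaller sets: `j` is the first point visited. -/
theorem sum_powerset_eq_empty_add {ι B : Type*} [DecidableEq ι] [AddCommMonoid B] (J : Finset ι)
    (f : Finset ι → B) (g : ι → Finset ι → B)
    (h : ∀ I ⊆ J, I.Nonempty → f I = ∑ j ∈ I, g j (I.erase j)) :
    ∑ I ∈ J.powerset, f I = f ∅ + ∑ j ∈ J, ∑ I ∈ (J.erase j).powerset, g j I := by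
  rw [← sum_powerset_sum_erase]
  have e : ∅ ∈ J.powerset := Finset.empty_mem_powerset J
  rw [← Finset.add_sum_erase _ _ e, ← Finset.add_sum_erase _ (fun I => ∑ j ∈ I, g j (I.erase j)) e]
  simp only [Finset.sum_empty, zero_add]
  congr 1
  refine Finset.sum_congr rfl fun I hI => ?_
  rw [Finset.mem_erase, Finset.mem_powerset] at hI
  exact h I hI.2 (Finset.nonempty_iff_ne_empty.2 hI.1)

variable {A : Type*} [Ring A] [Algebra ℂ A]

/-- The sum over all orderings `π₁, …, πₙ` of `J` of
`M(πₙ) ⋯ M(π₁) / ((a - π₁) (π₁ - π₂) ⋯ (πₙ - b))`. -/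
def pathSum (M : ℂ → A) (J : Finset ℂ) (a b : ℂ) : A :=
  if J = ∅ then (a - b)⁻¹ • 1
  else ∑ j ∈ J.attach, (a - j)⁻¹ • (pathSum M (J.erase j) j b * M j)
  termination_by J.card
  decreasing_by exact Finset.card_erase_lt_of_mem j.2

theorem pathSum_empty (M : ℂ → A) (a b : ℂ) : pathSum M ∅ a b = (a - b)⁻¹ • 1 := by
  rw [pathSum]; simp

theorem pathSum_of_nonempty (M : ℂ → A) {J : Finset ℂ} (hJ : J.Nonempty) (a b : ℂ) :
    pathSum M J a b = ∑ j ∈ J, (a - j)⁻¹ • (pathSum M (J.erase j) j b * M j) := by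
  rw [pathSum, if_neg hJ.ne_empty,
    Finset.sum_attach J (fun j => (a - j)⁻¹ • (pathSum M (J.erase j) j b * M j))]

/-- The definition peels off the first point of a path. By induction the removals of the first and
of the last point can be interchanged. -/
theorem pathSum_last (M : ℂ → A) {J : Finset ℂ} (hJ : J.Nonempty) (a b : ℂ) :
    pathSum M J a b = ∑ k ∈ J, (k - b)⁻¹ • (M k * pathSum M (J.erase k) a k) := by
  induction hn : J.card using Nat.strong_induction_on generalizing J a with
  | _ n ih =>
  rcases Finset.eq_singleton_or_nontrivial hJ.choose_spec with h1 | h2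
  · rw [pathSum_of_nonempty M hJ, h1]
    simp [pathSum_empty, smul_smul, mul_comm]
  · have hne : ∀ j ∈ J, (J.erase j).Nonempty := fun j hj => (Finset.erase_nonempty hj).2 h2
    rw [pathSum_of_nonempty M hJ]
    have e1 : ∀ j ∈ J, (a - j)⁻¹ • (pathSum M (J.erase j) j b * M j)
        = ∑ k ∈ J.erase j, (a - j)⁻¹ • ((k - b)⁻¹ •
          (M k * pathSum M ((J.erase j).erase k) j k) * M j) := by
      intro j hj
      rw [ih _ (hn ▸ Finset.card_erase_lt_of_mem hj) (hne j hj) j rfl, Finset.sum_mul,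
        Finset.smul_sum]
    have e2 : ∀ k ∈ J, (k - b)⁻¹ • (M k * pathSum M (J.erase k) a k)
        = ∑ j ∈ J.erase k, (k - b)⁻¹ • (M k *
          ((a - j)⁻¹ • (pathSum M ((J.erase k).erase j) j k * M j))) := by
      intro k hk
      rw [pathSum_of_nonempty M (hne k hk), Finset.mul_sum, Finset.smul_sum]
    rw [Finset.sum_congr rfl e1, Finset.sum_congr rfl e2]
    rw [Finset.sum_comm' (t' := J) (s' := fun k => J.erase k)]
    · refine Finset.sum_congr rfl fun k _ => Finset.sum_congr rfl fun j _ => ?_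
      rw [Finset.erase_right_comm, smul_mul_assoc, mul_smul_comm, smul_smul, smul_smul,
        mul_comm, mul_assoc]
    · intro x y
      simp only [Finset.mem_erase]
      tauto

/-- An ordering of `insert q J` is cut at `q`: `I` is the set of points visited before `q`, and `J \
I` comes after. -/
theorem pathSum_insert (M : ℂ → A) {J : Finset ℂ} {q : ℂ} (hq : q ∉ J) (a b : ℂ) :
    pathSum M (insert q J) a b
      = ∑ I ∈ J.powerset, pathSum M (J \ I) q b * M q * pathSum M I a q := by
  induction hn : J.card using Nat.strong_induction_on generalizing J a with
  | _ n ih =>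
  rw [sum_powerset_eq_empty_add J _ (fun j I => (a - j)⁻¹ •
    (pathSum M (J.erase j \ I) q b * M q * pathSum M I j q * M j))]
  · rw [pathSum_of_nonempty M (Finset.insert_nonempty q J), Finset.sum_insert hq,
      Finset.erase_insert hq, Finset.sdiff_empty, pathSum_empty, mul_smul_comm, mul_one]
    congr 1
    refine Finset.sum_congr rfl fun j hj => ?_
    have hjq : j ≠ q := fun h => hq (h ▸ hj)
    rw [Finset.erase_insert_of_ne hjq.symm,
      ih _ (hn ▸ Finset.card_erase_lt_of_mem hj) (fun h => hq (Finset.mem_of_mem_erase h)) j rfl,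
      Finset.sum_mul, Finset.smul_sum]
  · intro I hI hI0
    rw [pathSum_of_nonempty M hI0, Finset.mul_sum]
    refine Finset.sum_congr rfl fun j hj => ?_
    have : J.erase j \ I.erase j = J \ I := by
      ext x; simp only [Finset.mem_sdiff, Finset.mem_erase]
      constructor
      · rintro ⟨⟨h1, h2⟩, h3⟩; exact ⟨h2, fun h => h3 ⟨h1, h⟩⟩
      · rintro ⟨h1, h2⟩
        exact ⟨⟨fun h => h2 (h ▸ hj), h1⟩, fun h => h2 h.2⟩
    rw [this, mul_smul_comm, mul_assoc, mul_assoc, mul_assoc]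

/-- Inserting `q` without a matrix between consecutive points `p` and `p'` multiplies a path by `(p
- p')/((p - q)(q - p')) = 1/(p - q) - 1/(p' - q)`. Over all positions of `q` this telescopes,
leaving the factor of the two end points. In particular closed paths with `a = b` contribute zero.
-/
theorem sum_pathSum_mul_pathSum (M : ℂ → A) {J : Finset ℂ} {a b q : ℂ} (haq : a ≠ q) (hqb : q ≠ b)
    (hJ : ∀ j ∈ J, j ≠ a ∧ j ≠ b ∧ j ≠ q) (hab : J.Nonempty ∨ a ≠ b) :
    ∑ I ∈ J.powerset, pathSum M (J \ I) q b * pathSum M I a q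
      = ((a - b) / ((a - q) * (q - b))) • pathSum M J a b := by
  have haq' := sub_ne_zero.2 haq
  have hqb' := sub_ne_zero.2 hqb
  induction hn : J.card using Nat.strong_induction_on generalizing J a with
  | _ n ih =>
  rcases J.eq_empty_or_nonempty with rfl | hne
  · have hab' : a - b ≠ 0 := sub_ne_zero.2 (hab.resolve_left (by simp))
    simp only [Finset.powerset_empty, Finset.sum_singleton, Finset.sdiff_empty, pathSum_empty,
      smul_mul_smul_comm, one_mul, smul_smul]
    congr 1
    field_simp
  rw [sum_powerset_eq_empty_add J _ (fun j I => (a - j)⁻¹ •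
    (pathSum M (J.erase j \ I) q b * pathSum M I j q * M j))]
  · rw [Finset.sdiff_empty, pathSum_empty, mul_smul_comm, mul_one, pathSum_of_nonempty M hne q,
      pathSum_of_nonempty M hne a, Finset.smul_sum, Finset.smul_sum, ← Finset.sum_add_distrib]
    refine Finset.sum_congr rfl fun j hj => ?_
    obtain ⟨ja, jb, jq⟩ := hJ j hj
    rw [← Finset.smul_sum, ← Finset.sum_mul,
      ih _ (hn ▸ Finset.card_erase_lt_of_mem hj) jq
        (fun i hi => ⟨Finset.ne_of_mem_erase hi, (hJ i (Finset.mem_of_mem_erase hi)).2⟩)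
        (Or.inr jb) (sub_ne_zero.2 jq) rfl, smul_mul_assoc, smul_smul, smul_smul, smul_smul,
      ← add_smul]
    congr 1
    have h1 := sub_ne_zero.2 jq
    have h2 := sub_ne_zero.2 jq.symm
    have h3 := sub_ne_zero.2 ja.symm
    rw [← neg_sub j q] at *
    field_simp
    ring
  · intro I hI hI0
    rw [pathSum_of_nonempty M hI0, Finset.mul_sum]
    refine Finset.sum_congr rfl fun j hj => ?_
    have : J.erase j \ I.erase j = J \ I := by
      ext x; simp only [Finset.mem_sdiff, Finset.mem_erase]
      constructor
      · rintro ⟨⟨h1, h2⟩, h3⟩; exact ⟨h2, fun h => h3 ⟨h1, h⟩⟩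
      · rintro ⟨h1, h2⟩
        exact ⟨⟨fun h => h2 (h ▸ hj), h1⟩, fun h => h2 h.2⟩
    rw [this, mul_smul_comm, mul_assoc]

/-- The residue at `x = j` of the closed path sum `x ↦ pathSum M J x x`, when `J` has at least two
points. -/
def pathResidue (M : ℂ → A) (J : Finset ℂ) (j : ℂ) : A :=
  pathSum M (J.erase j) j j * M j - M j * pathSum M (J.erase j) j j

/-- With `j` and `k` the first and last points of a path, `1/((x - j)(k - x)) = (1/(k - j)) (1/(x -
j) + 1/(k - x))` is the partial fraction expansion in `x`. Each path contributes opposite residues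
at its two ends, so the residues sum to zero and the closed path sum is `O(x⁻²)`. -/
theorem pathSum_self (M : ℂ → A) {J : Finset ℂ} (hJ : J.Nontrivial) {x : ℂ} (hx : x ∉ J) :
    pathSum M J x x = ∑ j ∈ J, (x - j)⁻¹ • pathResidue M J j
      ∧ ∑ j ∈ J, pathResidue M J j = 0 := by
  have hne : ∀ j ∈ J, (J.erase j).Nonempty := fun j hj => (Finset.erase_nonempty hj).2 hJ
  set E : ℂ → ℂ → A := fun j k => M k * pathSum M ((J.erase j).erase k) j k * M j with hE
  have hfirst : ∀ j ∈ J, ∀ b, pathSum M (J.erase j) j b * M j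
      = ∑ k ∈ J.erase j, (k - b)⁻¹ • E j k := by
    intro j hj b
    rw [pathSum_last M (hne j hj), Finset.sum_mul]
    exact Finset.sum_congr rfl fun k _ => by rw [smul_mul_assoc]
  have hlast : ∀ j ∈ J, M j * pathSum M (J.erase j) j j
      = ∑ k ∈ J.erase j, (j - k)⁻¹ • E k j := by
    intro j hj
    rw [pathSum_of_nonempty M (hne j hj), Finset.mul_sum]
    refine Finset.sum_congr rfl fun k _ => ?_
    rw [mul_smul_comm, Finset.erase_right_comm]
    simp only [hE, mul_assoc]
  have hres : ∀ j ∈ J, pathResidue M J j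
      = ∑ k ∈ J.erase j, ((k - j)⁻¹ • E j k - (j - k)⁻¹ • E k j) := by
    intro j hj
    rw [pathResidue, hfirst j hj, hlast j hj, Finset.sum_sub_distrib]
  have hcomm : ∀ f : ℂ → ℂ → A, ∑ j ∈ J, ∑ k ∈ J.erase j, f j k
      = ∑ j ∈ J, ∑ k ∈ J.erase j, f k j := by
    intro f
    refine Finset.sum_comm' fun x y => ?_
    simp only [Finset.mem_erase]
    tauto
  constructor
  · rw [pathSum_of_nonempty M hJ.nonempty]
    have e1 : ∑ j ∈ J, (x - j)⁻¹ • (pathSum M (J.erase j) j x * M j)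
        = ∑ j ∈ J, ∑ k ∈ J.erase j, ((x - j)⁻¹ * (k - x)⁻¹) • E j k :=
      Finset.sum_congr rfl fun j hj => by
        rw [hfirst j hj, Finset.smul_sum]; simp only [smul_smul]
    have e2 : ∑ j ∈ J, (x - j)⁻¹ • pathResidue M J j
        = ∑ j ∈ J, ∑ k ∈ J.erase j, ((x - j)⁻¹ * (k - j)⁻¹) • E j k
          - ∑ j ∈ J, ∑ k ∈ J.erase j, ((x - j)⁻¹ * (j - k)⁻¹) • E k j := by
      rw [← Finset.sum_sub_distrib]
      refine Finset.sum_congr rfl fun j hj => ?_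
      rw [hres j hj, Finset.smul_sum, ← Finset.sum_sub_distrib]
      simp only [smul_sub, smul_smul]
    rw [e1, e2, hcomm (fun j k => ((x - j)⁻¹ * (j - k)⁻¹) • E k j), ← Finset.sum_sub_distrib]
    refine Finset.sum_congr rfl fun j hj => ?_
    rw [← Finset.sum_sub_distrib]
    refine Finset.sum_congr rfl fun k hk => ?_
    rw [← sub_smul]
    congr 1
    have h1 : x - j ≠ 0 := sub_ne_zero.2 fun h => hx (h ▸ hj)
    have h2 : x - k ≠ 0 := sub_ne_zero.2 fun h => hx (h ▸ Finset.mem_of_mem_erase hk)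
    have h3 : k - j ≠ 0 := sub_ne_zero.2 (Finset.ne_of_mem_erase hk)
    have h4 : k - x ≠ 0 := by rw [← neg_sub]; exact neg_ne_zero.2 h2
    field_simp
    ring
  · rw [Finset.sum_congr rfl hres]
    simp only [Finset.sum_sub_distrib]
    rw [hcomm (fun j k => (j - k)⁻¹ • E k j), sub_self]

end PathSum

end PainleveII

namespace PainleveII

/-! ### Sums over full cycles -/

section Cycles

variable {ι R : Type*} [DecidableEq ι] [CommRing R]

/-- The sum over all orderings `π₁, …, πₙ` of `J` of `k(a,π₁) k(π₁,π₂) ⋯ k(πₙ,b)`. -/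
def weightSum (k : ι → ι → R) (J : Finset ι) (a b : ι) : R :=
  if J = ∅ then k a b else ∑ j ∈ J.attach, k a j * weightSum k (J.erase j) j b
  termination_by J.card
  decreasing_by exact Finset.card_erase_lt_of_mem j.2

theorem weightSum_empty (k : ι → ι → R) (a b : ι) : weightSum k ∅ a b = k a b := by
  rw [weightSum]; simp

theorem weightSum_of_nonempty (k : ι → ι → R) {J : Finset ι} (hJ : J.Nonempty) (a b : ι) :
    weightSum k J a b = ∑ j ∈ J, k a j * weightSum k (J.erase j) j b := by
  rw [weightSum, if_neg hJ.ne_empty,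
    Finset.sum_attach J (fun j => k a j * weightSum k (J.erase j) j b)]

/-- The end point `b'` need not be the image of `b`; this freedom is what closes up a cycle from
which a point has been removed. -/
theorem weightSum_map {ι' : Type*} [DecidableEq ι'] (f : ι' ↪ ι) (k : ι → ι → R)
    (k' : ι' → ι' → R) {J : Finset ι'} {a b : ι'} {b' : ι}
    (h : ∀ i ∈ insert a J, ∀ j ∈ J, k (f i) (f j) = k' i j)
    (hb : ∀ i ∈ insert a J, k (f i) b' = k' i b) :
    weightSum k (J.map f) (f a) b' = weightSum k' J a b := by
  induction hn : J.card using Nat.strong_induction_on generalizing J a with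
  | _ n ih =>
  rcases J.eq_empty_or_nonempty with rfl | hne
  · simp only [Finset.map_empty, weightSum_empty]
    exact hb a (Finset.mem_insert_self _ _)
  · rw [weightSum_of_nonempty _ hne, weightSum_of_nonempty _ (hne.map), Finset.sum_map]
    refine Finset.sum_congr rfl fun j hj => ?_
    have hs : ∀ i ∈ insert j (J.erase j), i ∈ insert a J := fun i hi => by
      rw [Finset.insert_erase hj] at hi; exact Finset.mem_insert_of_mem hi
    rw [h a (Finset.mem_insert_self _ _) j hj, ← Finset.map_erase,
      ih _ (hn ▸ Finset.card_erase_lt_of_mem hj)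
        (fun i hi j' hj' => h i (hs i hi) j' (Finset.mem_of_mem_erase hj'))
        (fun i hi => hb i (hs i hi)) rfl]

/-- The sum of `∏ᵢ k(i, σ(i))` over the transitive permutations `σ`. -/
def transitiveSum [Fintype ι] (k : ι → ι → R) : R := by
  classical exact ∑ σ : Equiv.Perm ι with ∀ i j, σ.SameCycle i j, ∏ i, k i (σ i)

theorem transitiveSum_comp [Fintype ι] (k : ι → ι → R) (π : Equiv.Perm ι) :
    transitiveSum (fun i j => k (π i) (π j)) = transitiveSum k := by
  classical
  unfold transitiveSum
  refine Finset.sum_equiv (MulAut.conj π).toEquiv (fun σ => ?_) (fun σ _ => ?_)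
  · simp only [Finset.mem_filter, Finset.mem_univ, true_and]
    constructor
    · intro h i j
      have := h (π⁻¹ i) (π⁻¹ j)
      simpa [Equiv.Perm.sameCycle_conj] using this
    · intro h i j
      have := h (π i) (π j)
      simpa [Equiv.Perm.sameCycle_conj] using this
  · rw [← Equiv.prod_comp π (fun i => k i ((MulAut.conj π).toEquiv σ i))]
    simp

/-- The decomposed permutation inserts `0` into `σ` just before `p`: it maps `0` to `p`, and the
predecessor of `p` to `0`. For `p = 0` it fixes `0` and cannot be transitive. -/
theorem sameCycle_decomposeFin {n : ℕ} (p : Fin (n + 2)) (σ : Equiv.Perm (Fin (n + 1))) :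
    (∀ i j, (Equiv.Perm.decomposeFin.symm (p, σ)).SameCycle i j)
      ↔ p ≠ 0 ∧ ∀ i j, σ.SameCycle i j := by
  set τ := Equiv.Perm.decomposeFin.symm (p, σ) with hτ
  have h0 : τ 0 = p := Equiv.Perm.decomposeFin_symm_apply_zero p σ
  have hs : ∀ i, τ i.succ = Equiv.swap 0 p (σ i).succ :=
    fun i => Equiv.Perm.decomposeFin_symm_apply_succ σ p i
  constructor
  · intro h
    have hp : p ≠ 0 := by
      rintro rfl
      have h1 := h 0 1
      have : τ 0 = 0 := h0
      rw [Equiv.Perm.SameCycle] at h1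
      obtain ⟨i, hi⟩ := h1
      rw [Equiv.Perm.zpow_apply_eq_self_of_apply_eq_self this] at hi
      exact absurd hi (by simp)
    refine ⟨hp, ?_⟩
    obtain ⟨q, rfl⟩ := Fin.exists_succ_eq_of_ne_zero hp
    -- Collapsing the inserted point `0` onto its successor `q` turns each step of `τ` into a step
    -- of `σ` or into no step.
    set r : Fin (n + 2) → Fin (n + 1) := Fin.cases q id with hr
    have r0 : r 0 = q := rfl
    have rs : ∀ i : Fin (n + 1), r i.succ = i := fun i => rfl
    have step : ∀ x, σ.SameCycle (r x) (r (τ x)) := by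
      intro x
      refine Fin.cases ?_ (fun i => ?_) x
      · rw [h0, r0, rs]
      · rw [hs, rs]
        by_cases hi : σ i = q
        · rw [hi, Equiv.swap_apply_right, r0, ← hi]
          exact Equiv.Perm.sameCycle_apply_right.2 (Equiv.Perm.SameCycle.refl _ _)
        · rw [Equiv.swap_apply_of_ne_of_ne (Fin.succ_ne_zero _)
            (fun h => hi (Fin.succ_injective _ h)), rs]
          exact Equiv.Perm.sameCycle_apply_right.2 (Equiv.Perm.SameCycle.refl _ _)
    have steps : ∀ (N : ℕ) x, σ.SameCycle (r x) (r ((τ ^ N) x)) := by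
      intro N
      induction N with
      | zero => intro x; exact Equiv.Perm.SameCycle.refl _ _
      | succ N ih =>
        intro x
        rw [pow_succ', Equiv.Perm.mul_apply]
        exact (ih x).trans (step _)
    intro i j
    obtain ⟨N, hN⟩ := (h i.succ j.succ).exists_nat_pow_eq
    have := steps N i.succ
    rwa [hN, rs, rs] at this
  · rintro ⟨hp, h⟩
    obtain ⟨q, rfl⟩ := Fin.exists_succ_eq_of_ne_zero hp
    have step : ∀ i, τ.SameCycle i.succ (σ i).succ := by
      intro i
      by_cases hi : σ i = q
      · rw [hi]
        refine ⟨2, ?_⟩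
        have : (τ ^ (2 : ℤ)) i.succ = τ (τ i.succ) := rfl
        rw [this, hs, hi, Equiv.swap_apply_right, h0]
      · refine ⟨1, ?_⟩
        rw [zpow_one, hs, Equiv.swap_apply_of_ne_of_ne (Fin.succ_ne_zero _)
            (fun h => hi (Fin.succ_injective _ h))]
    have steps : ∀ (N : ℕ) i, τ.SameCycle i.succ ((σ ^ N) i).succ := by
      intro N
      induction N with
      | zero => intro x; exact Equiv.Perm.SameCycle.refl _ _
      | succ N ih =>
        intro x
        rw [pow_succ', Equiv.Perm.mul_apply]
        exact (ih x).trans (step _)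
    have hq : ∀ i, τ.SameCycle q.succ i := by
      intro i
      refine Fin.cases ?_ (fun i => ?_) i
      · rw [← h0]
        exact Equiv.Perm.sameCycle_apply_left.2 (Equiv.Perm.SameCycle.refl _ _)
      · obtain ⟨N, hN⟩ := (h q i).exists_nat_pow_eq
        have := steps N q
        rwa [hN] at this
    exact fun i j => (hq i).symm.trans (hq j)

/-- Following a transitive permutation from `r` lists every other point once before returning to
`r`. Transitivity is used instead of `Equiv.Perm.IsCycle` so that the induction can start at a
single point, where the identity counts. -/
theorem transitiveSum_eq_weightSum {n : ℕ} (k : Fin (n + 1) → Fin (n + 1) → R)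
    (r : Fin (n + 1)) : transitiveSum k = weightSum k (Finset.univ.erase r) r r := by
  classical
  induction n with
  | zero =>
    have : Subsingleton (Fin (0 + 1)) := inferInstanceAs (Subsingleton (Fin 1))
    have : Unique (Equiv.Perm (Fin (0 + 1))) := inferInstanceAs (Unique (Equiv.Perm (Fin 1)))
    have hr : r = 0 := Subsingleton.elim _ _
    subst hr
    have : (Finset.univ.erase (0 : Fin (0 + 1))) = ∅ := rfl
    rw [this, weightSum_empty, transitiveSum, Finset.filter_true_of_mem]
    · rw [Finset.univ_unique, Finset.sum_singleton, Fintype.prod_subsingleton _ (0 : Fin (0 + 1))]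
      congr 1
      exact Subsingleton.elim _ _
    · intro σ _ i j
      rw [Subsingleton.elim i j]
  | succ n ih =>
    -- Conjugating by the transposition of `0` and `r` moves the base point without changing the
    -- sum.
    wlog hr : r = 0 generalizing k r with H
    · rw [← transitiveSum_comp k (Equiv.swap 0 r), H _ 0 rfl]
      have e : (Finset.univ.erase r) = (Finset.univ.erase 0).map (Equiv.swap 0 r).toEmbedding := by
        rw [Finset.map_erase]; simp
      have := weightSum_map (R := R) (Equiv.swap 0 r).toEmbedding k
        (fun i j => k (Equiv.swap 0 r i) (Equiv.swap 0 r j)) (J := Finset.univ.erase 0) (a := 0)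
        (b := 0) (b' := r) (fun _ _ _ _ => rfl) (fun i _ => by simp)
      rw [← this, ← e]
      simp
    subst hr
    rw [weightSum_of_nonempty _ ⟨1, by simp⟩]
    -- After the point `0` is removed, arriving at its successor `q` in the shorter cycle stands for
    -- arriving at `0`; this is the transposition in the second argument of the weight.
    have h1 : transitiveSum k = ∑ q : Fin (n + 1), k 0 q.succ *
        transitiveSum (fun i j : Fin (n + 1) => k i.succ (Equiv.swap 0 q.succ j.succ)) := by
      rw [transitiveSum, Finset.sum_filter, ← Equiv.sum_comp Equiv.Perm.decomposeFin.symm,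
        Fintype.sum_prod_type, Fin.sum_univ_succ]
      simp only [sameCycle_decomposeFin, ne_eq, not_true_eq_false, false_and, if_false,
        Finset.sum_const_zero, zero_add, Fin.succ_ne_zero, not_false_eq_true, true_and]
      refine Finset.sum_congr rfl fun q _ => ?_
      rw [transitiveSum, Finset.sum_filter, Finset.mul_sum]
      refine Finset.sum_congr rfl fun σ _ => ?_
      rw [mul_ite, mul_zero, Fin.prod_univ_succ]
      simp only [Equiv.Perm.decomposeFin_symm_apply_zero,
        Equiv.Perm.decomposeFin_symm_apply_succ]
      split_ifs <;> rfl
    have h2 : (Finset.univ.erase (0 : Fin (n + 2))) = Finset.univ.map (Fin.succEmb (n + 1)) := by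
      ext i
      simp only [Finset.mem_erase, Finset.mem_univ, and_true, Finset.mem_map, true_and,
        Fin.coe_succEmb]
      exact ⟨fun h => Fin.exists_succ_eq_of_ne_zero h, fun ⟨a, h⟩ => h ▸ Fin.succ_ne_zero a⟩
    rw [h1, h2, Finset.sum_map]
    refine Finset.sum_congr rfl fun q _ => ?_
    rw [ih _ q, ← Finset.map_erase]
    congr 1
    refine (weightSum_map (Fin.succEmb (n + 1)) k _ (fun i _ j hj => ?_) (fun i _ => ?_)).symm
    · simp only [Fin.coe_succEmb]
      rw [Equiv.swap_apply_of_ne_of_ne (Fin.succ_ne_zero _)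
        (fun h => Finset.ne_of_mem_erase hj (Fin.succ_injective _ h))]
    · simp [Fin.coe_succEmb]

/-- At least two points are needed, since on one point the identity is transitive but is not a
cycle. -/
theorem isCycle_and_forall_ne_iff {n : ℕ} (σ : Equiv.Perm (Fin (n + 2))) :
    (σ.IsCycle ∧ ∀ i, σ i ≠ i) ↔ ∀ i j, σ.SameCycle i j := by
  constructor
  · rintro ⟨h1, h2⟩ i j
    exact h1.sameCycle (h2 i) (h2 j)
  · intro h
    have h2 : ∀ i, σ i ≠ i := by
      intro i hi
      obtain ⟨j, hj⟩ := exists_ne i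
      obtain ⟨z, hz⟩ := h i j
      rw [Equiv.Perm.zpow_apply_eq_self_of_apply_eq_self hi] at hz
      exact hj hz.symm
    exact ⟨⟨0, h2 0, fun y _ => h 0 y⟩, h2⟩

open Matrix in
-- For rank-one matrices `c rᵀ` the inner scalar products of a matrix product are exactly the
-- kernels between consecutive points.
theorem weightSum_eq_pathSum [Algebra ℂ R] (c r : ℂ → Fin 2 → R) (J : Finset ℂ) (a b : ℂ) :
    weightSum (fun x y => (x - y)⁻¹ • (r y ⬝ᵥ c x)) J a b
      = r b ⬝ᵥ (pathSum (fun x => vecMulVec (c x) (r x)) J a b *ᵥ c a) := by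
  induction hn : J.card using Nat.strong_induction_on generalizing J a with
  | _ n ih =>
  rcases J.eq_empty_or_nonempty with rfl | hne
  · rw [weightSum_empty, pathSum_empty, smul_mulVec, one_mulVec, dotProduct_smul]
  · rw [weightSum_of_nonempty _ hne, pathSum_of_nonempty _ hne, sum_mulVec, dotProduct_sum]
    refine Finset.sum_congr rfl fun j hj => ?_
    rw [ih _ (hn ▸ Finset.card_erase_lt_of_mem hj) _ j rfl, smul_mulVec, dotProduct_smul,
      ← mulVec_mulVec, vecMulVec_mulVec, smul_mul_assoc]
    congr 1
    rw [op_smul_eq_smul, mulVec_smul, dotProduct_smul, smul_eq_mul]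

open Matrix in
theorem transitiveSum_eq_trace [Algebra ℂ R] (c r : ℂ → Fin 2 → R) {n : ℕ} (x : Fin (n + 1) → ℂ)
    (hx : Function.Injective x) :
    transitiveSum (fun i j => (x i - x j)⁻¹ • (r (x j) ⬝ᵥ c (x i)))
      = trace (pathSum (fun x => vecMulVec (c x) (r x)) (Finset.univ.image (Fin.tail x)) (x 0) (x 0)
          * vecMulVec (c (x 0)) (r (x 0))) := by
  have h2 : (Finset.univ.erase (0 : Fin (n + 1))).map ⟨x, hx⟩
      = Finset.univ.image (Fin.tail x) := by
    ext i
    simp only [Finset.mem_erase, Finset.mem_univ, and_true, Finset.mem_map, true_and,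
      Finset.mem_image, Fin.tail]
    constructor
    · rintro ⟨a, ha, rfl⟩
      obtain ⟨b, rfl⟩ := Fin.exists_succ_eq_of_ne_zero ha
      exact ⟨b, rfl⟩
    · rintro ⟨a, rfl⟩
      exact ⟨a.succ, Fin.succ_ne_zero a, rfl⟩
  rw [transitiveSum_eq_weightSum _ 0,
    ← weightSum_map (⟨x, hx⟩ : Fin (n + 1) ↪ ℂ) (fun x y => (x - y)⁻¹ • (r y ⬝ᵥ c x))
      (fun i j => (x i - x j)⁻¹ • (r (x j) ⬝ᵥ c (x i))) (b' := x 0)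
      (fun _ _ _ _ => rfl) (fun _ _ => rfl), h2]
  show weightSum _ _ (x 0) (x 0) = _
  rw [weightSum_eq_pathSum, mul_vecMulVec, trace_vecMulVec, dotProduct_comm]

end Cycles

end PainleveII

namespace PainleveII

/-! ### The spectral system and its loop equations -/

section Loop

open Matrix PowerSeries.WithPiTopology

/-- Two by two matrices of formal series. -/
abbrev SeriesMatrix := Matrix (Fin 2) (Fin 2) (PowerSeries ℂ)

/-- In a basis where `M = diag(1,0)` both sides are `a₀₀b₁₁ + a₁₁b₀₀ - a₀₁b₁₀ - a₁₀b₀₁`, the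
polarisation of twice the determinant. The first two traces are its diagonal part, the other two its
off-diagonal part. -/
theorem trace_projector_identity {R : Type*} [CommRing R] (M A B : Matrix (Fin 2) (Fin 2) R)
    (h : M * M = M) (ht : trace M = 1) :
    trace (A * M) * trace (B * (1 - M)) + trace (B * M) * trace (A * (1 - M))
      - trace (B * (1 - M) * A * M) - trace (A * (1 - M) * B * M)
      = trace A * trace B - trace (A * B) := by
  have h00 := congrFun (congrFun h 0) 0
  have h01 := congrFun (congrFun h 0) 1
  have h10 := congrFun (congrFun h 1) 0
  have h11 := congrFun (congrFun h 1) 1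
  have e : M 1 1 = 1 - M 0 0 := by rw [trace_fin_two] at ht; linear_combination ht
  simp only [mul_apply, Fin.sum_univ_two, trace_fin_two, Matrix.sub_apply, one_apply_eq, ne_eq,
    zero_ne_one, not_false_eq_true, one_apply_ne, one_ne_zero, e] at *
  have h00' : M 0 1 * M 1 0 = M 0 0 - M 0 0 * M 0 0 := by linear_combination h00
  generalize M 0 0 = p at *
  generalize M 0 1 = q at *
  generalize M 1 0 = r at *
  generalize A 0 0 = a at *
  generalize A 0 1 = b at *
  generalize A 1 0 = c at *
  generalize A 1 1 = d at *
  generalize B 0 0 = a' at *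
  generalize B 0 1 = b' at *
  generalize B 1 0 = c' at *
  generalize B 1 1 = d' at *
  linear_combination (2 * (a * d' - b * c' - c * b' + d * a')) * h00'

theorem tendsto_seriesMatrix {l : Filter ℂ} {F : ℂ → SeriesMatrix} {L : SeriesMatrix} :
    Tendsto F l (𝓝 L)
      ↔ ∀ k i j, Tendsto (fun y => PowerSeries.coeff k (F y i j)) l
          (𝓝 (PowerSeries.coeff k (L i j))) := by
  refine Iff.trans (tendsto_pi_nhds (f := F) (g := L)) ?_
  constructor
  · intro h k i j
    have h1 := tendsto_pi_nhds.1 (h i) j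
    exact (tendsto_iff_coeff_tendsto ℂ _ _ _).1 h1 k
  · intro h i
    refine tendsto_pi_nhds.2 fun j => ?_
    exact (tendsto_iff_coeff_tendsto ℂ _ _ _).2 fun k => h k i j

theorem Tendsto.smul_series {l : Filter ℂ} {f : ℂ → ℂ} {c : ℂ} {F : ℂ → SeriesMatrix}
    {L : SeriesMatrix} (hf : Tendsto f l (𝓝 c)) (hF : Tendsto F l (𝓝 L)) :
    Tendsto (fun y => f y • F y) l (𝓝 (c • L)) := by
  rw [tendsto_seriesMatrix] at hF ⊢
  intro k i j
  simpa using hf.mul (hF k i j)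

theorem tendsto_pathSum_left (M : ℂ → SeriesMatrix) {J : Finset ℂ} (hJ : J.Nonempty) {x : ℂ}
    (hx : x ∉ J) (b : ℂ) :
    Tendsto (fun y => pathSum M J y b) (𝓝[≠] x) (𝓝 (pathSum M J x b)) := by
  simp only [pathSum_of_nonempty M hJ]
  refine tendsto_finsetSum _ fun j hj => Tendsto.smul_series ?_ tendsto_const_nhds
  have h1 : x - j ≠ 0 := sub_ne_zero.2 fun h => hx (h ▸ hj)
  exact ((continuous_id.sub continuous_const).continuousAt.inv₀ h1).mono_left nhdsWithin_le_nhds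

theorem tendsto_pathSum_right (M : ℂ → SeriesMatrix) {J : Finset ℂ} (hJ : J.Nonempty) {x : ℂ}
    (hx : x ∉ J) (a : ℂ) :
    Tendsto (fun y => pathSum M J a y) (𝓝[≠] x) (𝓝 (pathSum M J a x)) := by
  simp only [pathSum_last M hJ]
  refine tendsto_finsetSum _ fun j hj => Tendsto.smul_series ?_ tendsto_const_nhds
  have h1 : j - x ≠ 0 := sub_ne_zero.2 fun h => hx (h ▸ hj)
  exact ((continuous_const.sub continuous_id).continuousAt.inv₀ h1).mono_left nhdsWithin_le_nhds

/-- The insertion `Λ_J(x)`: `D(x)` if `J` is empty, and `(-1)^{|J|} ħ` times the closed path sum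
through `J` at `x` otherwise. -/
def insertion (M D : ℂ → SeriesMatrix) (J : Finset ℂ) (x : ℂ) : SeriesMatrix :=
  if J = ∅ then D x else ((PowerSeries.X : PowerSeries ℂ) * (-1) ^ J.card) • pathSum M J x x

/-- `ħ` times the correlation function of the points `x` and `J`. -/
def amplitude (M D : ℂ → SeriesMatrix) (J : Finset ℂ) (x : ℂ) : PowerSeries ℂ :=
  trace (insertion M D J x * M x)

/-- The correlation function with `x` and its conjugate point approached by `y → x` on the second
sheet. -/
def splitAmplitude (M D : ℂ → SeriesMatrix) (J : Finset ℂ) (x y : ℂ) : PowerSeries ℂ :=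
  (if J = ∅ then ((x - y) ^ 2)⁻¹ • (PowerSeries.X : PowerSeries ℂ) else 0)
    - amplitude M D (insert y J) x

/-- Changing `M y` into `1 - M y` adds the path sums in which `y` carries no matrix. By
`sum_pathSum_mul_pathSum` these cancel for nonempty `J`; for `J = ∅` they give exactly the
subtracted double pole. -/
theorem splitAmplitude_eq (M D : ℂ → SeriesMatrix) {J : Finset ℂ} {x y : ℂ} (hx : x ∉ J)
    (hy : y ∉ J) (hxy : x ≠ y) (htr : trace (M x) = 1) :
    splitAmplitude M D J x y = ((PowerSeries.X : PowerSeries ℂ) * (-1) ^ (J.card + 1)) *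
      ∑ I ∈ J.powerset, trace (pathSum M (J \ I) y x * (1 - M y) * pathSum M I x y * M x) := by
  have h1 : amplitude M D (insert y J) x = ((PowerSeries.X : PowerSeries ℂ) * (-1) ^ (J.card + 1)) *
      ∑ I ∈ J.powerset, trace (pathSum M (J \ I) y x * M y * pathSum M I x y * M x) := by
    rw [amplitude, insertion, if_neg (Finset.insert_ne_empty _ _), pathSum_insert M hy,
      Finset.card_insert_of_notMem hy, smul_mul_assoc, trace_smul, Finset.sum_mul, trace_sum,
      smul_eq_mul]
  have h2 : ∑ I ∈ J.powerset, trace (pathSum M (J \ I) y x * pathSum M I x y * M x)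
      = if J = ∅ then PowerSeries.C (-((x - y) ^ 2)⁻¹) else 0 := by
    split_ifs with hJ
    · subst hJ
      simp only [Finset.powerset_empty, Finset.sum_singleton, Finset.sdiff_empty, pathSum_empty,
        one_mul, smul_mul_assoc, trace_smul, htr]
      rw [PowerSeries.smul_eq_C_mul, PowerSeries.smul_eq_C_mul, mul_one, ← map_mul]
      congr 1
      have := sub_ne_zero.2 hxy
      have := sub_ne_zero.2 hxy.symm
      field_simp
      ring
    · rw [← trace_sum, ← Finset.sum_mul, sum_pathSum_mul_pathSum M hxy hxy.symm
        (fun j hj => ⟨fun h => hx (h ▸ hj), fun h => hx (h ▸ hj), fun h => hy (h ▸ hj)⟩)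
        (Or.inl (Finset.nonempty_iff_ne_empty.2 hJ)), sub_self, zero_div, zero_smul, zero_mul,
        trace_zero]
  rw [splitAmplitude, h1]
  simp only [mul_sub, mul_one, sub_mul, trace_sub, Finset.sum_sub_distrib]
  rw [h2]
  split_ifs with hJ
  · subst hJ
    rw [PowerSeries.smul_eq_C_mul, map_neg]
    simp
    ring
  · simp

/-- With respect to the two blocks of `M`, the commutator keeps only the off-diagonal blocks of `D`,
with opposite signs. -/
theorem trace_commutator_mul_self {R : Type*} [CommRing R] {M D : Matrix (Fin 2) (Fin 2) R}
    (h : M * M = M) : trace ((D * M - M * D) * (D * M - M * D))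
      = -2 * trace (D * (1 - M) * D * M) := by
  have a1 : trace (M * D * (D * M)) = trace (D * D * M) := by
    rw [mul_assoc, trace_mul_comm, mul_assoc, mul_assoc, mul_assoc, h]
  have a2 : D * M * (M * D) = D * M * D := by
    rw [mul_assoc, ← mul_assoc M, h, mul_assoc]
  have a3 : trace (D * M * D) = trace (D * D * M) := by
    rw [trace_mul_comm, ← mul_assoc]
  have a4 : trace (M * D * (M * D)) = trace (D * M * (D * M)) := by
    rw [mul_assoc, trace_mul_comm, mul_assoc, mul_assoc, mul_assoc]
  have a5 : trace (D * (1 - M) * D * M) = trace (D * D * M) - trace (D * M * (D * M)) := by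
    rw [mul_sub, mul_one, sub_mul, sub_mul, trace_sub, mul_assoc (D * M)]
  rw [a5, sub_mul, mul_sub, mul_sub, a2]
  simp only [trace_sub, a1, a3, a4]
  ring

/-- Exhibits `tr((1 - M(y)) M(x))` as quadratic in `M(y) - M(x)`, which is what compensates a double
pole at `y = x`. -/
theorem trace_sub_mul_self {R : Type*} [CommRing R] {M N : Matrix (Fin 2) (Fin 2) R}
    (hM : M * M = M) (hN : N * N = N) (htM : trace M = 1) (htN : trace N = 1) :
    trace ((N - M) * (N - M)) = 2 * trace ((1 - N) * M) := by
  rw [sub_mul, mul_sub, mul_sub, hM, hN, sub_mul, one_mul]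
  simp only [trace_sub, htM, htN, trace_mul_comm M N]
  ring

theorem tendsto_slope_seriesMatrix {M : ℂ → SeriesMatrix} {M' : SeriesMatrix} {x : ℂ}
    (hd : ∀ k i j, HasDerivAt (fun y => PowerSeries.coeff k (M y i j))
      (PowerSeries.coeff k (M' i j)) x) :
    Tendsto (fun y => (y - x)⁻¹ • (M y - M x)) (𝓝[≠] x) (𝓝 M') := by
  rw [tendsto_seriesMatrix]
  intro k i j
  refine (hd k i j).tendsto_slope.congr fun y => ?_
  have e : ((y - x)⁻¹ • (M y - M x)) i j = (y - x)⁻¹ • (M y i j - M x i j) := rfl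
  rw [slope_def_field, div_eq_inv_mul, ← smul_eq_mul, ← map_sub, ← map_smul]
  exact congrArg _ e.symm

theorem tendsto_trace {l : Filter ℂ} {F : ℂ → SeriesMatrix} {L : SeriesMatrix}
    (h : Tendsto F l (𝓝 L)) : Tendsto (fun y => trace (F y)) l (𝓝 (trace L)) :=
  ((continuous_id.matrix_trace).tendsto L).comp h

theorem C_half_mul_two : (PowerSeries.C (1 / 2 : ℂ)) * 2 = 1 := by
  rw [← map_ofNat (PowerSeries.C (R := ℂ)) 2, ← map_mul]; norm_num

/-! ### Coinciding points and the loop equation. -/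

section Limits

variable (M D : ℂ → SeriesMatrix) {J : Finset ℂ} {x : ℂ}
  (htr : ∀ᶠ y in 𝓝 x, trace (M y) = 1) (hM : ∀ᶠ y in 𝓝 x, M y * M y = M y)
  {M' : SeriesMatrix} (hM' : (PowerSeries.X : PowerSeries ℂ) • M' = D x * M x - M x * D x)
  (hd : ∀ k i j, HasDerivAt (fun y => PowerSeries.coeff k (M y i j))
      (PowerSeries.coeff k (M' i j)) x)

include htr hM hM' hd

/-- The split amplitude is `ħ/2` times the trace of the square of the difference quotient of `M`, so
it tends to `ħ tr(M'²)/2`; then `ħM' = [D, M]` is inserted twice. -/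
theorem exists_tendsto_splitAmplitude_empty :
    ∃ B : PowerSeries ℂ, Tendsto (fun y => splitAmplitude M D ∅ x y) (𝓝[≠] x) (𝓝 B) ∧
      PowerSeries.X * B = -trace (D x * (1 - M x) * D x * M x) := by
  have hMx := hM.self_of_nhds
  have hslope := tendsto_slope_seriesMatrix hd
  have hne : ∀ᶠ y in 𝓝[≠] x, y ≠ x := eventually_mem_nhdsWithin
  have htrx := htr.self_of_nhds
  refine ⟨PowerSeries.X * ((1 / 2 : ℂ) • trace (M' * M')), ?_, ?_⟩
  · have h1 : Tendsto (fun y => (PowerSeries.X : PowerSeries ℂ) * ((1 / 2 : ℂ) •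
          trace (((y - x)⁻¹ • (M y - M x)) * ((y - x)⁻¹ • (M y - M x))))) (𝓝[≠] x)
          (𝓝 (PowerSeries.X * ((1 / 2 : ℂ) • trace (M' * M')))) := by
      simp only [PowerSeries.smul_eq_C_mul]
      exact tendsto_const_nhds.mul (tendsto_const_nhds.mul (tendsto_trace (hslope.mul hslope)))
    refine h1.congr' ?_
    filter_upwards [hne, nhdsWithin_le_nhds hM, nhdsWithin_le_nhds htr] with y hy hMy hty
    rw [splitAmplitude_eq M D (by simp) (by simp) hy.symm htrx]
    simp only [Finset.card_empty, zero_add, pow_one, Finset.powerset_empty,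
      Finset.sum_singleton, Finset.sdiff_empty, pathSum_empty, one_mul,
      mul_one, smul_mul_assoc, trace_smul, mul_smul_comm, smul_smul]
    rw [trace_sub_mul_self hMx hMy htrx hty]
    have : (x - y)⁻¹ = -(y - x)⁻¹ := by
      rw [← neg_sub y x, inv_neg]
    rw [this]
    simp only [PowerSeries.smul_eq_C_mul, map_neg, map_mul]
    linear_combination (PowerSeries.X * PowerSeries.C (y - x)⁻¹ * PowerSeries.C (y - x)⁻¹
        * trace ((1 - M y) * M x)) * C_half_mul_two
  · have e1 : PowerSeries.X * (PowerSeries.X * ((1 / 2 : ℂ) • trace (M' * M')))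
          = (1 / 2 : ℂ) • trace ((D x * M x - M x * D x) * (D x * M x - M x * D x)) := by
      rw [← hM', smul_mul_smul_comm, trace_smul, smul_eq_mul, mul_smul_comm, mul_smul_comm,
          mul_assoc]
    rw [e1, trace_commutator_mul_self hMx]
    simp only [PowerSeries.smul_eq_C_mul]
    linear_combination (-trace (D x * (1 - M x) * D x * M x)) * C_half_mul_two

omit htr hM hM' hd in
-- Since `M(x)² = M(x)`, the product `(1 - M(y)) M(x)` equals `-(M(y) - M(x)) M(x)`, and the pole of
-- the empty path becomes a difference quotient.
theorem split_first (hMx : M x * M x = M x) (y : ℂ) (L : SeriesMatrix) :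
    trace (L * (((y - x)⁻¹ • (M y - M x)) * M x))
      = trace (L * (1 - M y) * pathSum M ∅ x y * M x) := by
  have hxy : (x - y)⁻¹ = -(y - x)⁻¹ := by
    rw [← neg_sub y x, inv_neg]
  have e : (1 - M y) * M x = -((M y - M x) * M x) := by
    rw [sub_mul, sub_mul, hMx, one_mul, neg_sub]
  rw [pathSum_empty, mul_smul_comm, mul_one, hxy, smul_mul_assoc, smul_mul_assoc, mul_assoc, e,
    mul_neg, smul_neg, neg_smul, neg_neg, mul_smul_comm]

omit htr hM hM' hd in
theorem split_last (hMx : M x * M x = M x) (y : ℂ) (L : SeriesMatrix) :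
    trace ((M x * (-((y - x)⁻¹ • (M y - M x)))) * L)
      = trace (pathSum M ∅ y x * (1 - M y) * L * M x) := by
  have e : M x * (1 - M y) = -(M x * (M y - M x)) := by
    rw [mul_sub, mul_sub, hMx, mul_one, neg_sub]
  rw [pathSum_empty, smul_mul_assoc, one_mul, smul_mul_assoc, smul_mul_assoc, trace_smul,
    trace_mul_comm ((1 - M y) * L), ← mul_assoc, e, mul_neg, mul_smul_comm, neg_mul, neg_mul,
    smul_mul_assoc, trace_neg, trace_neg, trace_smul, smul_neg]

/-- Only the terms `I = ∅` and `I = J` contain an empty path and are singular at `y = x`. Their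
limits contain `M'`, which `ħM' = [D, M]` converts into the insertion of `D` at the empty set; the
other terms converge by continuity. -/
theorem exists_tendsto_splitAmplitude_nonempty (hx : x ∉ J) (hJ : J.Nonempty) :
    ∃ B : PowerSeries ℂ, Tendsto (fun y => splitAmplitude M D J x y) (𝓝[≠] x) (𝓝 B) ∧
      PowerSeries.X * B = -∑ I ∈ J.powerset,
        trace (insertion M D (J \ I) x * (1 - M x) * insertion M D I x * M x) := by
  have hMx := hM.self_of_nhds
  have hslope := tendsto_slope_seriesMatrix hd
  have hcont : Tendsto M (𝓝[≠] x) (𝓝 (M x)) := by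
    rw [tendsto_seriesMatrix]
    intro k i j
    exact (hd k i j).continuousAt.tendsto.mono_left nhdsWithin_le_nhds
  have hne : ∀ᶠ y in 𝓝[≠] x, y ≠ x := eventually_mem_nhdsWithin
  have hyJ : ∀ᶠ y in 𝓝[≠] x, y ∉ J :=
    nhdsWithin_le_nhds ((J.finite_toSet.isClosed.isOpen_compl).mem_nhds hx)
  have htrx := htr.self_of_nhds
  -- The proper nonempty subsets: both path sums attached to them are continuous at `y = x`.
  set P : Finset (Finset ℂ) := (J.powerset.erase ∅).erase J with hP
  have hsplit : ∀ f : Finset ℂ → PowerSeries ℂ, ∑ I ∈ J.powerset, f I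
      = f ∅ + (f J + ∑ I ∈ P, f I) := by
    intro f
    rw [← Finset.add_sum_erase _ _ (Finset.empty_mem_powerset J), ← Finset.add_sum_erase _ _
      (Finset.mem_erase.2 ⟨hJ.ne_empty, Finset.mem_powerset_self J⟩)]
  have hPmem : ∀ I ∈ P, I.Nonempty ∧ (J \ I).Nonempty ∧ I ⊆ J := by
    intro I hI
    simp only [hP, Finset.mem_erase, Finset.mem_powerset] at hI
    refine ⟨Finset.nonempty_iff_ne_empty.2 hI.2.1, ?_, hI.2.2⟩
    rw [Finset.sdiff_nonempty]
    exact fun h => hI.1 (Finset.Subset.antisymm hI.2.2 h)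
  refine ⟨(PowerSeries.X * (-1) ^ (J.card + 1)) * (trace (pathSum M J x x * (M' * M x))
      + (trace ((M x * (-M')) * pathSum M J x x) + ∑ I ∈ P,
        trace (pathSum M (J \ I) x x * (1 - M x) * pathSum M I x x * M x))), ?_, ?_⟩
  · have h1 : Tendsto (fun y => trace (pathSum M J y x * (((y - x)⁻¹ • (M y - M x)) * M x)))
        (𝓝[≠] x) (𝓝 (trace (pathSum M J x x * (M' * M x)))) :=
      tendsto_trace ((tendsto_pathSum_left M hJ hx x).mul (hslope.mul tendsto_const_nhds))
    have h2 : Tendsto (fun y => trace ((M x * (-((y - x)⁻¹ • (M y - M x)))) * pathSum M J x y))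
        (𝓝[≠] x) (𝓝 (trace ((M x * (-M')) * pathSum M J x x))) :=
      tendsto_trace ((tendsto_const_nhds.mul hslope.neg).mul (tendsto_pathSum_right M hJ hx x))
    have h3 : ∀ I ∈ P, Tendsto (fun y => trace (pathSum M (J \ I) y x * (1 - M y) *
        pathSum M I x y * M x)) (𝓝[≠] x)
        (𝓝 (trace (pathSum M (J \ I) x x * (1 - M x) * pathSum M I x x * M x))) := by
      intro I hI
      obtain ⟨i1, i2, i3⟩ := hPmem I hI
      exact tendsto_trace (((tendsto_pathSum_left M i2 (fun h => hx (Finset.sdiff_subset h)) x).mul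
          (tendsto_const_nhds.sub hcont)).mul
          (tendsto_pathSum_right M i1 (fun h => hx (i3 h)) x) |>.mul tendsto_const_nhds)
    have h4 := (tendsto_const_nhds (x := ((PowerSeries.X : PowerSeries ℂ)
      * (-1) ^ (J.card + 1)))).mul (h1.add (h2.add (tendsto_finsetSum P h3)))
    refine h4.congr' ?_
    filter_upwards [hne, hyJ] with y hy hyJ
    rw [splitAmplitude_eq M D hx hyJ hy.symm htrx, hsplit]
    rw [split_first M hMx, split_last M hMx, Finset.sdiff_empty, Finset.sdiff_self]
  · rw [hsplit, Finset.sdiff_empty, Finset.sdiff_self]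
    simp only [insertion, if_true, if_neg hJ.ne_empty]
    have e1 : ∑ I ∈ P, trace ((if J \ I = ∅ then D x
        else ((PowerSeries.X : PowerSeries ℂ) * (-1) ^ (J \ I).card) • pathSum M (J \ I) x x)
          * (1 - M x) * (if I = ∅ then D x
        else ((PowerSeries.X : PowerSeries ℂ) * (-1) ^ I.card) • pathSum M I x x) * M x)
        = PowerSeries.X ^ 2 * (-1) ^ J.card * ∑ I ∈ P,
          trace (pathSum M (J \ I) x x * (1 - M x) * pathSum M I x x * M x) := by
      rw [Finset.mul_sum]
      refine Finset.sum_congr rfl fun I hI => ?_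
      obtain ⟨i1, i2, i3⟩ := hPmem I hI
      rw [if_neg i1.ne_empty, if_neg i2.ne_empty, ← Finset.card_sdiff_add_card_eq_card i3, pow_add]
      simp only [smul_mul_assoc, mul_smul_comm, trace_smul, smul_eq_mul]
      ring
    have e2 : PowerSeries.X * trace (pathSum M J x x * (M' * M x))
        = trace (pathSum M J x x * ((D x * M x - M x * D x) * M x)) := by
      rw [← hM', smul_mul_assoc, mul_smul_comm, trace_smul, smul_eq_mul]
    have e3 : PowerSeries.X * trace ((M x * (-M')) * pathSum M J x x)
        = trace ((M x * (-(D x * M x - M x * D x))) * pathSum M J x x) := by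
      rw [← hM', ← smul_neg, mul_smul_comm, smul_mul_assoc, trace_smul, smul_eq_mul]
    have e4 : (D x * M x - M x * D x) * M x = (1 - M x) * D x * M x := by
      rw [sub_mul, mul_assoc (D x), hMx, sub_mul, one_mul, sub_mul]
    have e5 : M x * (-(D x * M x - M x * D x)) = M x * D x * (1 - M x) := by
      rw [neg_sub, mul_sub, ← mul_assoc, hMx, mul_sub, mul_one, mul_assoc]
    have e6 : trace (M x * D x * (1 - M x) * pathSum M J x x)
        = trace (D x * (1 - M x) * pathSum M J x x * M x) := by
      rw [mul_assoc, mul_assoc, trace_mul_comm, ← mul_assoc]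
    have e7 : trace (pathSum M J x x * ((1 - M x) * D x * M x))
        = trace (pathSum M J x x * (1 - M x) * D x * M x) := by
      rw [← mul_assoc, ← mul_assoc]
    rw [e4, e7] at e2
    rw [e5, e6] at e3
    rw [e1]
    simp only [smul_mul_assoc, mul_smul_comm, trace_smul, smul_eq_mul]
    linear_combination (PowerSeries.X * (-1) ^ (J.card + 1)) * e2
      + (PowerSeries.X * (-1) ^ (J.card + 1)) * e3

/-- The loop equation. -/
theorem exists_loop_equation (hx : x ∉ J) :
    ∃ B : PowerSeries ℂ, Tendsto (fun y => splitAmplitude M D J x y) (𝓝[≠] x) (𝓝 B) ∧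
      ∑ I ∈ J.powerset, amplitude M D I x *
          (trace (insertion M D (J \ I) x) - amplitude M D (J \ I) x) + PowerSeries.X * B
        = (1 / 2 : ℂ) • ∑ I ∈ J.powerset,
          (trace (insertion M D I x) * trace (insertion M D (J \ I) x)
            - trace (insertion M D I x * insertion M D (J \ I) x)) := by
  have hMx := hM.self_of_nhds
  have htrx := htr.self_of_nhds
  obtain ⟨B, h1, h2⟩ : ∃ B : PowerSeries ℂ,
      Tendsto (fun y => splitAmplitude M D J x y) (𝓝[≠] x) (𝓝 B) ∧
      PowerSeries.X * B = -∑ I ∈ J.powerset,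
        trace (insertion M D (J \ I) x * (1 - M x) * insertion M D I x * M x) := by
    rcases J.eq_empty_or_nonempty with rfl | hJ
    · obtain ⟨B, h1, h2⟩ := exists_tendsto_splitAmplitude_empty M D htr hM hM' hd
      refine ⟨B, h1, ?_⟩
      rw [h2]
      simp [insertion]
    · exact exists_tendsto_splitAmplitude_nonempty M D htr hM hM' hd hx hJ
  refine ⟨B, h1, ?_⟩
  rw [h2]
  have hrefl : ∀ f : Finset ℂ → PowerSeries ℂ, ∑ I ∈ J.powerset, f (J \ I)
      = ∑ I ∈ J.powerset, f I := by
    intro f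
    refine Finset.sum_bij' (fun I _ => J \ I) (fun I _ => J \ I) ?_ ?_ ?_ ?_ ?_
    · exact fun I _ => Finset.mem_powerset.2 Finset.sdiff_subset
    · exact fun I _ => Finset.mem_powerset.2 Finset.sdiff_subset
    · exact fun I hI => Finset.sdiff_sdiff_eq_self (Finset.mem_powerset.1 hI)
    · exact fun I hI => Finset.sdiff_sdiff_eq_self (Finset.mem_powerset.1 hI)
    · exact fun I _ => rfl
  have hss : ∀ I ∈ J.powerset, J \ (J \ I) = I := fun I hI =>
    Finset.sdiff_sdiff_eq_self (Finset.mem_powerset.1 hI)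
  have ham : ∀ I, trace (insertion M D I x) - amplitude M D I x
      = trace (insertion M D I x * (1 - M x)) := by
    intro I
    rw [amplitude, mul_sub, mul_one, trace_sub]
  simp only [ham]
  simp only [amplitude]
  set Λ := fun I => insertion M D I x with hΛ
  set S1 := ∑ I ∈ J.powerset, trace (Λ I * M x) * trace (Λ (J \ I) * (1 - M x)) with hS1
  set S2 := ∑ I ∈ J.powerset, trace (Λ (J \ I) * (1 - M x) * Λ I * M x) with hS2
  set S3 := ∑ I ∈ J.powerset, (trace (Λ I) * trace (Λ (J \ I)) - trace (Λ I * Λ (J \ I))) with hS3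
  -- Symmetrising under `I ↦ J \ I` makes each summand the left side of `trace_projector_identity`.
  have key : 2 * S1 - 2 * S2 = S3 := by
    have a1 : S1 = ∑ I ∈ J.powerset, trace (Λ (J \ I) * M x) * trace (Λ I * (1 - M x)) := by
      rw [hS1, ← hrefl]
      exact Finset.sum_congr rfl fun I hI => by rw [hss I hI]
    have a2 : S2 = ∑ I ∈ J.powerset, trace (Λ I * (1 - M x) * Λ (J \ I) * M x) := by
      rw [hS2, ← hrefl]
      exact Finset.sum_congr rfl fun I hI => by rw [hss I hI]
    rw [two_mul, two_mul]
    nth_rewrite 2 [a1]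
    nth_rewrite 2 [a2]
    rw [hS1, hS2, hS3, ← Finset.sum_add_distrib, ← Finset.sum_add_distrib,
      ← Finset.sum_sub_distrib]
    refine Finset.sum_congr rfl fun I _ => ?_
    rw [← trace_projector_identity (M x) (Λ I) (Λ (J \ I)) hMx htrx]
    ring
  show S1 + -S2 = (1 / 2 : ℂ) • S3
  rw [← key, PowerSeries.smul_eq_C_mul]
  linear_combination (S2 - S1) * C_half_mul_two

end Limits

end Loop

end PainleveII

namespace PainleveII

/-! ### Functions of the form `p(x) / s(x)^N` -/

section Forms

/-- `f = p / s^N` on `V` for a polynomial `p` of degree less than `D`. -/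
def IsForm (V : Set ℂ) (s : ℂ → ℂ) (N D : ℕ) (f : ℂ → ℂ) : Prop :=
  ∃ p ∈ Polynomial.degreeLT ℂ D, ∀ x ∈ V, f x * s x ^ N = p.eval x

namespace IsForm

variable {V : Set ℂ} {s : ℂ → ℂ} {N D N' D' : ℕ} {f g : ℂ → ℂ}

theorem mono_set {V' : Set ℂ} (h : IsForm V s N D f) (hV : V' ⊆ V) : IsForm V' s N D f := by
  obtain ⟨p, hp, h⟩ := h
  exact ⟨p, hp, fun x hx => h x (hV hx)⟩

theorem mono_degree (h : IsForm V s N D f) (hD : D ≤ D') : IsForm V s N D' f := by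
  obtain ⟨p, hp, h⟩ := h
  exact ⟨p, Polynomial.degreeLT_mono hD hp, h⟩

theorem congr (h : IsForm V s N D f) (hfg : ∀ x ∈ V, g x = f x) : IsForm V s N D g := by
  obtain ⟨p, hp, h⟩ := h
  exact ⟨p, hp, fun x hx => by rw [hfg x hx, h x hx]⟩

theorem zero : IsForm V s N D (fun _ => 0) := ⟨0, Submodule.zero_mem _, by simp⟩

theorem add (hf : IsForm V s N D f) (hg : IsForm V s N D g) :
    IsForm V s N D (fun x => f x + g x) := by
  obtain ⟨p, hp, hf⟩ := hf
  obtain ⟨q, hq, hg⟩ := hg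
  exact ⟨p + q, Submodule.add_mem _ hp hq, fun x hx => by
    rw [add_mul, hf x hx, hg x hx, Polynomial.eval_add]⟩

theorem const_mul (c : ℂ) (hf : IsForm V s N D f) : IsForm V s N D (fun x => c * f x) := by
  obtain ⟨p, hp, hf⟩ := hf
  exact ⟨c • p, Submodule.smul_mem _ c hp, fun x hx => by
    rw [mul_assoc, hf x hx, Polynomial.eval_smul, smul_eq_mul]⟩

theorem sum {ι : Type*} (t : Finset ι) {F : ι → ℂ → ℂ} (h : ∀ i ∈ t, IsForm V s N D (F i)) :
    IsForm V s N D (fun x => ∑ i ∈ t, F i x) := by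
  classical
  induction t using Finset.induction_on with
  | empty => simpa using (zero : IsForm V s N D (fun _ => 0))
  | insert a t ha ih =>
    simp only [Finset.sum_insert ha]
    exact (h a (Finset.mem_insert_self _ _)).add (ih fun i hi => h i (Finset.mem_insert_of_mem hi))

theorem mul (hf : IsForm V s N D f) (hg : IsForm V s N' D' g) :
    IsForm V s (N + N') (D + D') (fun x => f x * g x) := by
  obtain ⟨p, hp, hf⟩ := hf
  obtain ⟨q, hq, hg⟩ := hg
  refine ⟨p * q, ?_, fun x hx => ?_⟩
  · rw [Polynomial.mem_degreeLT] at *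
    by_cases hp0 : p = 0
    · simp [hp0]
    by_cases hq0 : q = 0
    · simp [hq0]
    rw [Polynomial.degree_mul, Polynomial.degree_eq_natDegree hp0,
      Polynomial.degree_eq_natDegree hq0] at *
    norm_cast at *
    omega
  · rw [Polynomial.eval_mul, ← hf x hx, ← hg x hx]
    ring

theorem sub_sq_mem_degreeLT {p : Polynomial ℂ} (u₀ : ℂ) (hp : p ∈ Polynomial.degreeLT ℂ D) (c : ℕ) :
    p * (Polynomial.C (u₀ ^ 2) - Polynomial.X ^ 2) ^ c ∈ Polynomial.degreeLT ℂ (D + 2 * c) := by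
  by_cases hp0 : p = 0
  · rw [hp0, zero_mul]
    exact Submodule.zero_mem _
  rw [Polynomial.mem_degreeLT] at *
  have h2 : (Polynomial.C (u₀ ^ 2) - Polynomial.X ^ 2 : Polynomial ℂ).degree ≤ 2 := by
    refine (Polynomial.degree_sub_le _ _).trans (max_le ?_ ?_)
    · exact (Polynomial.degree_C_le).trans (by norm_num)
    · exact (Polynomial.degree_X_pow_le 2)
  have h3 : ((Polynomial.C (u₀ ^ 2) - Polynomial.X ^ 2 : Polynomial ℂ) ^ c).degree
      ≤ ((2 * c : ℕ) : WithBot ℕ) := by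
    refine (Polynomial.degree_pow_le _ _).trans ?_
    refine (nsmul_le_nsmul_right h2 c).trans ?_
    rw [nsmul_eq_mul, mul_comm]
    push_cast
    exact le_rfl
  rw [Polynomial.degree_mul, Nat.cast_add]
  refine lt_of_le_of_lt (add_le_add_right h3 _) ?_
  rw [Polynomial.degree_eq_natDegree hp0] at *
  norm_cast at *
  omega

theorem mono {u₀ : ℂ} (hs : ∀ x ∈ V, s x ^ 2 = u₀ ^ 2 - x ^ 2) (h : IsForm V s N D f) (c : ℕ) :
    IsForm V s (N + 2 * c) (D + 2 * c) f := by
  obtain ⟨p, hp, h⟩ := h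
  refine ⟨_, sub_sq_mem_degreeLT u₀ hp c, fun x hx => ?_⟩
  rw [pow_add, ← mul_assoc, h x hx, pow_mul, hs x hx]
  simp

/-- The coefficients of a product with a constant series. -/
theorem coeff_mul_left {K : ℕ} {F : ℂ → PowerSeries ℂ} (c : PowerSeries ℂ)
    (h : ∀ k ≤ K, IsForm V s N D (fun x => PowerSeries.coeff k (F x))) :
    ∀ k ≤ K, IsForm V s N D (fun x => PowerSeries.coeff k (c * F x)) := by
  intro k hk
  simp only [PowerSeries.coeff_mul]
  refine sum _ fun p hp => const_mul _ (h _ ?_)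
  have := Finset.HasAntidiagonal.mem_antidiagonal.1 hp
  omega

theorem coeff_mul {K : ℕ} {F G : ℂ → PowerSeries ℂ}
    (hF : ∀ k ≤ K, IsForm V s N D (fun x => PowerSeries.coeff k (F x)))
    (hG : ∀ k ≤ K, IsForm V s N' D' (fun x => PowerSeries.coeff k (G x))) :
    ∀ k ≤ K, IsForm V s (N + N') (D + D') (fun x => PowerSeries.coeff k (F x * G x)) := by
  intro k hk
  simp only [PowerSeries.coeff_mul]
  refine sum _ fun p hp => mul (hF _ ?_) (hG _ ?_)
  all_goals
    have := Finset.HasAntidiagonal.mem_antidiagonal.1 hp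
    omega

end IsForm

end Forms

/-! ### Spectral systems: what the recursion needs to know about the Lax pair. -/

open Matrix

/-- A projector `M(x)` of rank one, formal in `ħ`, with `ħ M' = [D, M]` for a traceless polynomial
matrix `D`, whose coefficients are polynomials in `x` divided by powers of `s = √(u₀² - x²)`. -/
structure SpectralSystem (U : Set ℂ) (u₀ : ℂ) where
  s : ℂ → ℂ
  M : ℂ → SeriesMatrix
  D : ℂ → SeriesMatrix
  curve : Polynomial ℂ
  isOpen : IsOpen U
  nonempty : U.Nonempty
  u₀_ne : u₀ ≠ 0
  s_sq : ∀ x ∈ U, s x ^ 2 = u₀ ^ 2 - x ^ 2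
  s_ne : ∀ x ∈ U, s x ≠ 0
  s_cont : ContinuousOn s U
  M_mul_self : ∀ x ∈ U, M x * M x = M x
  M_trace : ∀ x ∈ U, trace (M x) = 1
  D_trace : ∀ x ∈ U, trace (D x) = 0
  M_deriv : ∀ x ∈ U, ∃ M' : SeriesMatrix,
    (PowerSeries.X : PowerSeries ℂ) • M' = D x * M x - M x * D x ∧
      ∀ k i j, HasDerivAt (fun y => PowerSeries.coeff k (M y i j)) (PowerSeries.coeff k (M' i j)) x
  -- The degree bound makes every coefficient of positive order `O(1/x)` at infinity.
  M_form : ∀ K, ∃ d, ∀ k, 1 ≤ k → k ≤ K → ∀ i j,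
    IsForm U s (2 * d + 1) (2 * d + 1) (fun x => PowerSeries.coeff k (M x i j))
  M_zero : ∀ x ∈ U, ∀ i j, PowerSeries.coeff 0 (M x i j)
    = !![1 / 2, (u₀ + x) / (2 * s x); (u₀ - x) / (2 * s x), 1 / 2] i j
  D_form : ∀ k i j, ∃ q : Polynomial ℂ, ∀ x ∈ U, PowerSeries.coeff k (D x i j) = q.eval x
  -- The two conditions at `±u₀` make the zeros of `y` at the branch points simple in the coordinate
  -- `z`.
  curve_eval_ne : curve.eval u₀ ≠ 0
  curve_eval_neg_ne : curve.eval (-u₀) ≠ 0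
  trace_zero : ∀ x ∈ U, PowerSeries.coeff 0 (trace (D x * M x)) = s x * curve.eval x
  -- The corrections to the spectral curve are small enough for the one-point function to decay.
  det_form : ∀ k, 1 ≤ k → ∃ q : Polynomial ℂ, q.degree < curve.degree ∧
    ∀ x ∈ U, PowerSeries.coeff k (det (D x)) = q.eval x

namespace SpectralSystem

variable {U : Set ℂ} {u₀ : ℂ} (S : SpectralSystem U u₀)

/-- `ħ` times the correlation function of `x` and `J`. -/
def amp (J : Finset ℂ) (x : ℂ) : PowerSeries ℂ := amplitude S.M S.D J x

/-- The traceless part of `M`, multiplied by `s`. -/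
def W (x : ℂ) : SeriesMatrix := S.s x • (S.M x - (1 / 2 : ℂ) • 1)

/-- The constant matrix `(0, 1; -1, 0) / 2`. -/
def halfJ : SeriesMatrix := !![0, PowerSeries.C (1 / 2); -PowerSeries.C (1 / 2), 0]

/-- The difference quotient of `W`, without its limit at infinity. -/
def quot (j x : ℂ) : SeriesMatrix := (x - j)⁻¹ • (S.W x - S.W j) - halfJ

theorem W_eq (x : ℂ) {j : ℂ} (hx : x ≠ j) : S.W x = S.W j + (x - j) • (halfJ + S.quot j x) := by
  rw [quot, add_sub_cancel, smul_smul, mul_inv_cancel₀ (sub_ne_zero.2 hx), one_smul, add_sub_cancel]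

theorem coeff_W {k : ℕ} (hk : 1 ≤ k) (x : ℂ) (i j : Fin 2) :
    PowerSeries.coeff k (S.W x i j) = S.s x * PowerSeries.coeff k (S.M x i j) := by
  have e : S.W x i j = S.s x • (S.M x i j - (1 / 2 : ℂ) • (1 : SeriesMatrix) i j) := rfl
  rw [e, map_smul, map_sub, map_smul, smul_eq_mul, one_apply]
  have : k ≠ 0 := by omega
  split_ifs <;> simp [PowerSeries.coeff_one, this]

theorem coeff_zero_W {x : ℂ} (hx : x ∈ U) (i j : Fin 2) :
    PowerSeries.coeff 0 (S.W x i j) = !![0, (u₀ + x) / 2; (u₀ - x) / 2, 0] i j := by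
  have e : S.W x i j = S.s x • (S.M x i j - (1 / 2 : ℂ) • (1 : SeriesMatrix) i j) := rfl
  have hs := S.s_ne x hx
  rw [e, map_smul, map_sub, map_smul, smul_eq_mul, S.M_zero x hx]
  fin_cases i <;> fin_cases j <;> simp [PowerSeries.coeff_one] <;> field_simp

theorem coeff_quot (k : ℕ) (j x : ℂ) (a b : Fin 2) : PowerSeries.coeff k (S.quot j x a b)
    = (x - j)⁻¹ * (PowerSeries.coeff k (S.W x a b) - PowerSeries.coeff k (S.W j a b))
      - PowerSeries.coeff k (halfJ a b) := by
  have e : S.quot j x a b = (x - j)⁻¹ • (S.W x a b - S.W j a b) - halfJ a b := rfl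
  rw [e, map_sub, map_smul, map_sub, smul_eq_mul]

/-- In order zero `W` is affine in `x` with slope `halfJ`, so nothing is left. In higher order `W`
is bounded; the numerator of `W(x) - W(j)` vanishes at `j`, and division by `x - j` lowers its
degree by one. The exponent `d` does not depend on `j`. -/
theorem isForm_quot (K : ℕ) : ∃ d, ∀ k ≤ K, ∀ j ∈ U, ∀ a b, IsForm (U \ {j}) S.s (2 * d) (2 * d)
    (fun x => PowerSeries.coeff k (S.quot j x a b)) := by
  obtain ⟨d, hd⟩ := S.M_form K
  refine ⟨d, fun k hk j hj a b => ?_⟩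
  rcases Nat.eq_zero_or_pos k with rfl | hk1
  · refine IsForm.zero.congr fun x hx => ?_
    have hxj : x - j ≠ 0 := sub_ne_zero.2 hx.2
    rw [coeff_quot, S.coeff_zero_W hx.1, S.coeff_zero_W hj]
    fin_cases a <;> fin_cases b <;> simp [halfJ] <;> field_simp <;> ring
  · obtain ⟨v, hv, hv'⟩ := hd k hk1 hk a b
    set w := PowerSeries.coeff k (S.W j a b) with hw
    set n : Polynomial ℂ := v - Polynomial.C w *
      (Polynomial.C (u₀ ^ 2) - Polynomial.X ^ 2) ^ d with hn
    have hval : ∀ x ∈ U, PowerSeries.coeff k (S.W x a b) * S.s x ^ (2 * d) = v.eval x := by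
      intro x hx
      rw [S.coeff_W hk1, ← hv' x hx]; ring
    have hev : ∀ x ∈ U, n.eval x = (PowerSeries.coeff k (S.W x a b) - w) * S.s x ^ (2 * d) := by
      intro x hx
      rw [sub_mul, hval x hx, pow_mul, S.s_sq x hx]
      simp [hn]
    have hroot : n.IsRoot j := by
      rw [Polynomial.IsRoot, hev j hj, sub_self, zero_mul]
    obtain ⟨q, hq⟩ := Polynomial.dvd_iff_isRoot.2 hroot
    have hnd : n ∈ Polynomial.degreeLT ℂ (2 * d + 1) := by
      refine Submodule.sub_mem _ hv ?_
      have := IsForm.sub_sq_mem_degreeLT (D := 1) (p := Polynomial.C w) u₀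
        (Polynomial.mem_degreeLT.2 (lt_of_le_of_lt Polynomial.degree_C_le (by norm_num))) d
      rwa [add_comm]
    refine ⟨q, ?_, fun x hx => ?_⟩
    · by_cases hq0 : q = 0
      · rw [hq0]; exact Submodule.zero_mem _
      rw [Polynomial.mem_degreeLT] at *
      rw [hq, Polynomial.degree_mul, Polynomial.degree_X_sub_C,
        Polynomial.degree_eq_natDegree hq0] at hnd
      rw [Polynomial.degree_eq_natDegree hq0]
      norm_cast at *
      omega
    · have hxj : x - j ≠ 0 := sub_ne_zero.2 hx.2
      have h1 := hev x hx.1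
      rw [hq, Polynomial.eval_mul, Polynomial.eval_sub, Polynomial.eval_X, Polynomial.eval_C] at h1
      have h0 : PowerSeries.coeff k (halfJ a b) = 0 := by
        have : k ≠ 0 := by omega
        fin_cases a <;> fin_cases b <;> simp [halfJ, PowerSeries.coeff_C, this]
      show PowerSeries.coeff k (S.quot j x a b) * S.s x ^ (2 * d) = _
      rw [coeff_quot, h0, sub_zero, mul_assoc, ← h1, ← mul_assoc, inv_mul_cancel₀ hxj, one_mul]

theorem W_mul_self {x : ℂ} (hx : x ∈ U) :
    S.W x * S.W x = (S.s x ^ 2 / 4) • (1 : SeriesMatrix) := by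
  have h : (S.M x - (1 / 2 : ℂ) • 1) * (S.M x - (1 / 2 : ℂ) • 1)
      = (1 / 4 : ℂ) • (1 : SeriesMatrix) := by
    rw [sub_mul, mul_sub, mul_sub, S.M_mul_self x hx]
    simp only [smul_mul_assoc, mul_smul_comm, one_mul, mul_one, smul_smul]
    module
  rw [W, smul_mul_smul_comm, h, smul_smul]
  congr 1
  ring

theorem smul_M_eq (x : ℂ) : S.s x • S.M x = S.W x + (S.s x / 2) • (1 : SeriesMatrix) := by
  rw [W, smul_sub, smul_smul, sub_add]
  simp [div_eq_mul_inv]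

theorem trace_insertion_empty {x : ℂ} (hx : x ∈ U) : trace (insertion S.M S.D ∅ x) = 0 := by
  rw [insertion, if_pos rfl, S.D_trace x hx]

theorem trace_insertion_singleton {j x : ℂ} (hj : j ∈ U) (hx : x ≠ j) :
    trace (insertion S.M S.D {j} x) = PowerSeries.C (((x - j) ^ 2)⁻¹) * PowerSeries.X := by
  have hxj : x - j ≠ 0 := sub_ne_zero.2 hx
  have hjx : j - x ≠ 0 := sub_ne_zero.2 hx.symm
  rw [insertion, if_neg (Finset.singleton_ne_empty _),
    pathSum_of_nonempty _ (Finset.singleton_nonempty _)]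
  simp only [Finset.sum_singleton, Finset.erase_singleton, pathSum_empty, smul_mul_assoc, one_mul,
    trace_smul, S.M_trace j hj, Finset.card_singleton, smul_smul, PowerSeries.smul_eq_C_mul,
    smul_eq_mul, mul_one, pow_one]
  have : (x - j)⁻¹ * (j - x)⁻¹ = -((x - j) ^ 2)⁻¹ := by field_simp; ring
  rw [this, map_neg]
  ring

theorem trace_pathResidue {A : ℂ → SeriesMatrix} (J : Finset ℂ) (j : ℂ) :
    trace (pathResidue A J j) = 0 := by
  rw [pathResidue, trace_sub, trace_mul_comm, sub_self]

theorem trace_insertion_of_nontrivial {J : Finset ℂ} {x : ℂ} (hJ : J.Nontrivial) (hx : x ∉ J) :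
    trace (insertion S.M S.D J x) = 0 := by
  rw [insertion, if_neg hJ.nonempty.ne_empty, (pathSum_self S.M hJ hx).1, trace_smul, trace_sum]
  simp [trace_smul, trace_pathResidue]

/-- Expanding `W(x)` around each `j` in the partial fractions of the closed path sum, the value
`W(j)` drops out because the residue is a commutator with `M(j)`, and the slope `halfJ` drops out
because the residues sum to zero. Only the decaying `quot` remains. -/
theorem s_smul_amp {J : Finset ℂ} {x : ℂ} (hJ : J.Nontrivial) (hJU : ∀ j ∈ J, j ∈ U) (hx : x ∉ J) :
    S.s x • S.amp J x = ((PowerSeries.X : PowerSeries ℂ) * (-1) ^ J.card) *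
      ∑ j ∈ J, trace (pathResidue S.M J j * S.quot j x) := by
  have hres : ∀ j ∈ J, trace (pathResidue S.M J j * S.W j) = 0 := by
    intro j hj
    rw [W, mul_smul_comm, mul_sub, trace_smul, trace_sub, mul_smul_comm, mul_one, trace_smul,
      trace_pathResidue, pathResidue, sub_mul, trace_sub, mul_assoc (pathSum _ _ _ _),
      S.M_mul_self j (hJU j hj), trace_mul_comm (S.M j * _), ← mul_assoc,
      S.M_mul_self j (hJU j hj), trace_mul_comm]
    simp
  rw [amp, amplitude, insertion, if_neg hJ.nonempty.ne_empty, smul_mul_assoc, trace_smul, smul_eq_mul,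
    ← mul_smul_comm, ← trace_smul, ← mul_smul_comm, S.smul_M_eq, (pathSum_self S.M hJ hx).1,
    Finset.sum_mul, trace_sum]
  congr 1
  have h1 : ∀ j ∈ J, trace ((x - j)⁻¹ • pathResidue S.M J j *
      (S.W x + (S.s x / 2) • (1 : SeriesMatrix)))
      = trace (pathResidue S.M J j * halfJ) + trace (pathResidue S.M J j * S.quot j x) := by
    intro j hj
    have hxj : x ≠ j := fun h => hx (h ▸ hj)
    rw [S.W_eq x hxj, mul_add, mul_add, trace_add, trace_add, mul_smul_comm _ _ (1 : SeriesMatrix),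
      mul_one, smul_mul_assoc, trace_smul, hres j hj, trace_smul, trace_smul, trace_pathResidue,
      mul_smul_comm, smul_mul_assoc, smul_smul, mul_inv_cancel₀ (sub_ne_zero.2 hxj), one_smul,
      mul_add, trace_add]
    simp
  rw [Finset.sum_congr rfl h1, Finset.sum_add_distrib, ← trace_sum, ← Finset.sum_mul,
    (pathSum_self S.M hJ hx).2, zero_mul, Matrix.trace_zero, zero_add]

/-- The amplitude is `ħ tr(M(j) M(x)) / (x - j)²`. Because `W² = s²/4` is scalar, `tr(W(j) W(x))` is
a combination of `s(x)² + s(j)²` and the trace of `(W(x) - W(j))²`; the latter absorbs the double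
pole, which survives only in order one. -/
theorem s_mul_amp_singleton {j x : ℂ} (hj : j ∈ U) (hxU : x ∈ U) (hx : x ≠ j) :
    PowerSeries.C (S.s j * S.s x) * S.amp {j} x = PowerSeries.X *
      (PowerSeries.C ((S.s j * S.s x / 2 + (S.s x ^ 2 + S.s j ^ 2) / 4) / (x - j) ^ 2)
        - PowerSeries.C (1 / 2) * trace ((halfJ + S.quot j x) * (halfJ + S.quot j x))) := by
  have hxj : x - j ≠ 0 := sub_ne_zero.2 hx
  have hjx : j - x ≠ 0 := sub_ne_zero.2 hx.symm
  have e1 : S.amp {j} x = PowerSeries.X * (PowerSeries.C (((x - j) ^ 2)⁻¹) *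
      trace (S.M j * S.M x)) := by
    rw [amp, amplitude, insertion, if_neg (Finset.singleton_ne_empty _),
      pathSum_of_nonempty _ (Finset.singleton_nonempty _)]
    simp only [Finset.sum_singleton, Finset.erase_singleton, pathSum_empty, smul_mul_assoc, one_mul,
      trace_smul, Finset.card_singleton, smul_smul, PowerSeries.smul_eq_C_mul,
      smul_eq_mul, pow_one]
    have : (x - j)⁻¹ * (j - x)⁻¹ = -((x - j) ^ 2)⁻¹ := by field_simp; ring
    rw [this, map_neg]
    ring
  have e2 : PowerSeries.C (S.s j * S.s x) * trace (S.M j * S.M x)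
      = trace (S.W j * S.W x) + PowerSeries.C (S.s j * S.s x / 2) := by
    have t1 : trace (S.W j) = 0 := by
      rw [W, trace_smul, trace_sub, S.M_trace j hj, trace_smul, trace_one]
      simp [PowerSeries.smul_eq_C_mul, C_half_mul_two, -one_div]
    have t2 : trace (S.W x) = 0 := by
      rw [W, trace_smul, trace_sub, S.M_trace x hxU, trace_smul, trace_one]
      simp [PowerSeries.smul_eq_C_mul, C_half_mul_two, -one_div]
    have : trace ((S.s j • S.M j) * (S.s x • S.M x)) = PowerSeries.C (S.s j * S.s x)
        * trace (S.M j * S.M x) := by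
      rw [smul_mul_smul_comm, trace_smul, PowerSeries.smul_eq_C_mul]
    rw [← this, S.smul_M_eq, S.smul_M_eq]
    simp only [mul_add, add_mul, trace_add, smul_mul_assoc, mul_smul_comm, one_mul, mul_one,
      trace_smul, t1, t2, trace_one, PowerSeries.smul_eq_C_mul]
    rw [show S.s j * S.s x / 2 = S.s x / 2 * (S.s j / 2 * 2) by ring, map_mul, map_mul,
      map_ofNat]
    simp
  have e3 : PowerSeries.C 2 * trace (S.W j * S.W x) = PowerSeries.C ((S.s x ^ 2 + S.s j ^ 2) / 2)
      - PowerSeries.C ((x - j) ^ 2) * trace ((halfJ + S.quot j x) * (halfJ + S.quot j x)) := by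
    have h1 := S.W_eq x hx
    have h2 : trace ((S.W x - S.W j) * (S.W x - S.W j)) = PowerSeries.C ((x - j) ^ 2) *
        trace ((halfJ + S.quot j x) * (halfJ + S.quot j x)) := by
      rw [h1, add_sub_cancel_left, smul_mul_smul_comm, trace_smul, PowerSeries.smul_eq_C_mul, sq]
    rw [← h2, sub_mul, mul_sub, mul_sub, S.W_mul_self hxU, S.W_mul_self hj]
    simp only [trace_sub, trace_smul, trace_one, PowerSeries.smul_eq_C_mul,
      trace_mul_comm (S.W x) (S.W j)]
    have h4 : PowerSeries.C ((S.s x ^ 2 + S.s j ^ 2) / 2) = (PowerSeries.C (S.s x ^ 2 / 4)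
        + PowerSeries.C (S.s j ^ 2 / 4)) * PowerSeries.C 2 := by
      rw [← map_add, ← map_mul]; congr 1; ring
    have h5 : (PowerSeries.C (2 : ℂ)) = 2 := map_ofNat _ 2
    rw [h4, h5]
    simp
    ring
  have hC2 : (PowerSeries.C (2 : ℂ)) = 2 := map_ofNat _ 2
  have hq : PowerSeries.C (((x - j) ^ 2)⁻¹) * PowerSeries.C ((x - j) ^ 2) = 1 := by
    rw [← map_mul, inv_mul_cancel₀ (pow_ne_zero 2 hxj), map_one]
  have h6 : PowerSeries.C ((S.s j * S.s x / 2 + (S.s x ^ 2 + S.s j ^ 2) / 4) / (x - j) ^ 2)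
      = PowerSeries.C (((x - j) ^ 2)⁻¹) * (PowerSeries.C (S.s j * S.s x / 2)
        + PowerSeries.C (1 / 2) * PowerSeries.C ((S.s x ^ 2 + S.s j ^ 2) / 2)) := by
    rw [← map_mul, ← map_add, ← map_mul]; congr 1; field_simp; ring
  rw [e1, h6]
  rw [hC2] at e3
  linear_combination (PowerSeries.X * PowerSeries.C (((x - j) ^ 2)⁻¹)) * e2
    + (PowerSeries.X * PowerSeries.C (((x - j) ^ 2)⁻¹) * PowerSeries.C (1 / 2)) * e3
    - (PowerSeries.X * PowerSeries.C (((x - j) ^ 2)⁻¹) * trace (S.W j * S.W x)) * C_half_mul_two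
    - (PowerSeries.X * PowerSeries.C (1 / 2) *
      trace ((halfJ + S.quot j x) * (halfJ + S.quot j x))) * hq

end SpectralSystem

end PainleveII

namespace PainleveII

/-! ### Interpolation: separately polynomial functions are polynomial -/

section Interpolation

theorem degreeOf_aeval_X_le {n N : ℕ} {q : Polynomial ℂ} (hq : q ∈ Polynomial.degreeLT ℂ (N + 1))
    (i j : Fin n) : MvPolynomial.degreeOf i (Polynomial.aeval (MvPolynomial.X j : MvPolynomial
      (Fin n) ℂ) q) ≤ if i = j then N else 0 := by
  rw [Polynomial.aeval_eq_sum_range]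
  refine (MvPolynomial.degreeOf_sum_le _ _ _).trans (Finset.sup_le fun k hk => ?_)
  rw [MvPolynomial.smul_eq_C_mul]
  refine (MvPolynomial.degreeOf_C_mul_le _ _ _).trans ?_
  refine (MvPolynomial.degreeOf_pow_le _ _ _).trans ?_
  rw [MvPolynomial.degreeOf_X]
  have hN : q.natDegree ≤ N := by
    by_cases h0 : q = 0
    · simp [h0]
    rw [Polynomial.mem_degreeLT, Polynomial.degree_eq_natDegree h0] at hq
    norm_cast at hq
    omega
  have := Finset.mem_range.1 hk
  split_ifs <;> omega

theorem eval_aeval_X {n : ℕ} (q : Polynomial ℂ) (j : Fin n) (x : Fin n → ℂ) :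
    MvPolynomial.eval x (Polynomial.aeval (MvPolynomial.X j : MvPolynomial (Fin n) ℂ) q)
      = q.eval (x j) := by
  rw [Polynomial.aeval_def, Polynomial.hom_eval₂, MvPolynomial.eval_X]
  have : (MvPolynomial.eval x).comp (algebraMap ℂ (MvPolynomial (Fin n) ℂ)) = RingHom.id ℂ := by
    ext c; simp
  rw [this, Polynomial.eval₂_id]

/-- The restriction of a polynomial to the line in the direction of the `i`-th coordinate. -/
theorem exists_eval_update {n : ℕ} (P : MvPolynomial (Fin n) ℂ) (x : Fin n → ℂ) (i : Fin n) :
    ∃ q : Polynomial ℂ, ∀ y, MvPolynomial.eval (Function.update x i y) P = q.eval y := by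
  refine ⟨MvPolynomial.aeval (fun j => if j = i then Polynomial.X else Polynomial.C (x j)) P,
    fun y => ?_⟩
  rw [MvPolynomial.aeval_def, ← Polynomial.coe_evalRingHom, MvPolynomial.hom_eval₂]
  have h1 : (Polynomial.evalRingHom y).comp (algebraMap ℂ (Polynomial ℂ)) = RingHom.id ℂ := by
    ext c; simp
  rw [h1, ← MvPolynomial.eval₂_id]
  congr 1
  ext j
  by_cases h : j = i
  · subst h; simp
  · simp [h]

theorem injective_update {α β : Type*} [DecidableEq α] {f : α → β} (hf : Function.Injective f)
    {i : α} {y : β} (hy : ∀ j, y ≠ f j) : Function.Injective (Function.update f i y) := by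
  intro a b hab
  by_cases ha : a = i <;> by_cases hb : b = i
  · rw [ha, hb]
  · subst ha
    rw [Function.update_self, Function.update_of_ne hb] at hab
    exact absurd hab (hy b)
  · subst hb
    rw [Function.update_self, Function.update_of_ne ha] at hab
    exact absurd hab.symm (hy a)
  · rw [Function.update_of_ne ha, Function.update_of_ne hb] at hab
    exact hf hab

/-- Lagrange interpolation in the first variable at `N + 1` nodes, with values polynomial in the
rest by induction. Data exist only at tuples of distinct points, so the nodes must be kept away from
the other entries and restored afterwards. The uniform bound `N` is essential. -/
theorem exists_mvPolynomial_of_separately {n : ℕ} (N : ℕ) {U : Set ℂ} (hU : U.Infinite)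
    (g : (Fin n → ℂ) → ℂ)
    (h : ∀ x : Fin n → ℂ, (∀ i, x i ∈ U) → Function.Injective x → ∀ i,
      ∃ p ∈ Polynomial.degreeLT ℂ (N + 1), ∀ y ∈ U, (∀ j, j ≠ i → y ≠ x j) →
        g (Function.update x i y) = p.eval y) :
    ∃ P : MvPolynomial (Fin n) ℂ, (∀ i, MvPolynomial.degreeOf i P ≤ N) ∧
      ∀ x : Fin n → ℂ, (∀ i, x i ∈ U) → Function.Injective x → g x = MvPolynomial.eval x P := by
  induction n generalizing U with
  | zero =>
    refine ⟨MvPolynomial.C (g ![]), fun i => i.elim0, fun x _ _ => ?_⟩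
    rw [MvPolynomial.eval_C]
    congr 1
    exact Subsingleton.elim _ _
  | succ n ih =>
    obtain ⟨A, hAU, hA⟩ := hU.exists_subset_card_eq (N + 1)
    have hU' : (U \ A).Infinite := hU.sdiff A.finite_toSet
    have inj_cons : ∀ (a : ℂ) (x : Fin n → ℂ), Function.Injective x → (∀ i, x i ≠ a) →
        Function.Injective (Fin.cons a x : Fin (n + 1) → ℂ) := by
      intro a x hx ha
      rw [Fin.cons_injective_iff]
      exact ⟨by rintro ⟨i, hi⟩; exact ha i hi, hx⟩
    have step : ∀ a ∈ A, ∃ P : MvPolynomial (Fin n) ℂ, (∀ i, MvPolynomial.degreeOf i P ≤ N) ∧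
        ∀ x : Fin n → ℂ, (∀ i, x i ∈ U \ A) → Function.Injective x →
          g (Fin.cons a x) = MvPolynomial.eval x P := by
      intro a ha
      refine ih hU' (fun x => g (Fin.cons a x)) fun x hx hinj i => ?_
      obtain ⟨p, hp, hpe⟩ := h (Fin.cons a x)
        (fun j => Fin.cases (hAU ha) (fun j => (hx j).1) j)
        (inj_cons a x hinj fun j hj => (hx j).2 (hj ▸ ha)) i.succ
      refine ⟨p, hp, fun y hy hyx => ?_⟩
      rw [Fin.cons_update]
      refine hpe y hy.1 fun j => Fin.cases (fun _ => ?_) (fun j hj => ?_) j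
      · rintro rfl
        exact hy.2 ha
      · rw [Fin.cons_succ]
        exact hyx j fun e => hj (e ▸ rfl)
    choose! P hPdeg hPeval using step
    set Q : MvPolynomial (Fin (n + 1)) ℂ := ∑ a ∈ A,
      Polynomial.aeval (MvPolynomial.X 0 : MvPolynomial (Fin (n + 1)) ℂ) (Lagrange.basis A id a)
        * MvPolynomial.rename Fin.succ (P a) with hQ
    refine ⟨Q, fun i => ?_, ?_⟩
    · refine (MvPolynomial.degreeOf_sum_le _ _ _).trans (Finset.sup_le fun a ha => ?_)
      refine (MvPolynomial.degreeOf_mul_le _ _ _).trans ?_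
      have hb : Lagrange.basis A id a ∈ Polynomial.degreeLT ℂ (N + 1) := by
        rw [Polynomial.mem_degreeLT, Lagrange.degree_basis Function.injective_id.injOn ha, hA]
        norm_cast
        omega
      have h1 := degreeOf_aeval_X_le hb i (0 : Fin (n + 1))
      refine Fin.cases (fun h1 => ?_) (fun i h1 => ?_) i h1
      · have h2 : MvPolynomial.degreeOf 0 (MvPolynomial.rename Fin.succ (P a)) = 0 := by
          refine Nat.le_zero.1 (MvPolynomial.degreeOf_le_iff.2 fun m hm => ?_)
          obtain ⟨u, rfl, -⟩ := MvPolynomial.coeff_rename_ne_zero _ _ _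
            (MvPolynomial.mem_support_iff.1 hm)
          rw [Finsupp.mapDomain_of_notMem_range _ _ (by simp)]
        rw [h2]
        simpa using h1
      · rw [if_neg (Fin.succ_ne_zero i)] at h1
        rw [MvPolynomial.degreeOf_rename_of_injective (Fin.succ_injective n)]
        have := hPdeg a ha i
        omega
    -- Tuples whose later entries avoid the nodes: each node may then be substituted for the first
    -- entry without a collision.
    · have base : ∀ x : Fin (n + 1) → ℂ, (∀ i, x i ∈ U) → Function.Injective x →
          (∀ i : Fin n, x i.succ ∉ A) → g x = MvPolynomial.eval x Q := by
        intro x hx hinj hxA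
        obtain ⟨p, hp, hpe⟩ := h x hx hinj 0
        have hpi : p = Lagrange.interpolate A id (fun a => p.eval a) :=
          Lagrange.eq_interpolate Function.injective_id.injOn (by
            rw [hA]; exact Polynomial.mem_degreeLT.1 hp)
        have h0 : g x = p.eval (x 0) := by
          rw [← hpe (x 0) (hx 0) (fun j hj => fun e => hj (hinj e.symm)), Function.update_eq_self]
        rw [h0, hpi, Lagrange.interpolate_apply, Polynomial.eval_finsetSum, hQ, map_sum]
        refine Finset.sum_congr rfl fun a ha => ?_
        rw [map_mul, eval_aeval_X, MvPolynomial.eval_rename, Polynomial.eval_mul,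
          Polynomial.eval_C, mul_comm]
        congr 1
        have h1 := hpe a (hAU ha) (fun j hj e => by
          obtain ⟨i, rfl⟩ := Fin.exists_succ_eq_of_ne_zero hj
          exact hxA i (e ▸ ha))
        rw [← h1]
        have h2 : Function.update x 0 a = Fin.cons a (Fin.tail x) := by
          rw [← Fin.cons_self_tail x, Fin.update_cons_zero, Fin.tail_cons]
        rw [h2, hPeval a ha (Fin.tail x) (fun i => ⟨hx _, hxA i⟩)
          (fun i j hij => Fin.succ_injective _ (hinj hij))]
        rfl
      intro x hx hinj
      -- An entry equal to a node is moved along its coordinate line to points outside the nodes,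
      -- which lowers the count. The two polynomials on that line agree at infinitely many points,
      -- hence also at the original one.
      induction hc : (Finset.univ.filter fun i : Fin n => x i.succ ∈ A).card using
        Nat.strong_induction_on generalizing x with
      | _ c ihc =>
      by_cases hbad : ∀ i : Fin n, x i.succ ∉ A
      · exact base x hx hinj hbad
      push Not at hbad
      obtain ⟨i, hi⟩ := hbad
      obtain ⟨p, hp, hpe⟩ := h x hx hinj i.succ
      obtain ⟨q, hq⟩ := exists_eval_update Q x i.succ
      have hpq : p = q := by
        refine Polynomial.eq_of_infinite_eval_eq p q ((hU'.sdiff (Set.finite_range x)).mono ?_)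
        rintro y ⟨⟨hy1, hy2⟩, hy3⟩
        show p.eval y = q.eval y
        have hyx : ∀ j, y ≠ x j := fun j e => hy3 ⟨j, e.symm⟩
        rw [← hpe y hy1 (fun j _ => hyx j), ← hq]
        refine ihc _ ?_ _ ?_ ?_ rfl
        · rw [← hc]
          refine Finset.card_lt_card ⟨fun j hj => ?_, fun hsub => ?_⟩
          · simp only [Finset.mem_filter, Finset.mem_univ, true_and] at hj ⊢
            by_cases hji : j.succ = i.succ
            · rw [hji, Function.update_self] at hj
              exact absurd hj hy2
            · rwa [Function.update_of_ne hji] at hj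
          · have := hsub (Finset.mem_filter.2 ⟨Finset.mem_univ i, hi⟩)
            simp only [Finset.mem_filter, Function.update_self] at this
            exact hy2 this.2
        · intro j
          by_cases hj : j = i.succ
          · rw [hj, Function.update_self]; exact hy1
          · rw [Function.update_of_ne hj]; exact hx j
        · exact injective_update hinj hyx
      have h1 := hpe (x i.succ) (hx _) (fun j hj e => hj (hinj e.symm))
      rw [Function.update_eq_self] at h1
      rw [h1, hpq, ← hq, Function.update_eq_self]

end Interpolation

end PainleveII

namespace PainleveII

open Matrix

namespace SpectralSystem

variable {U : Set ℂ} {u₀ : ℂ} (S : SpectralSystem U u₀)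

/-! ### The amplitudes as functions of one point -/

theorem amp_eq_X_mul {J : Finset ℂ} (hJ : J.Nonempty) (x : ℂ) : S.amp J x
    = PowerSeries.X * ((-1) ^ J.card * trace (pathSum S.M J x x * S.M x)) := by
  rw [amp, amplitude, insertion, if_neg hJ.ne_empty, smul_mul_assoc, trace_smul, smul_eq_mul,
    mul_assoc]

theorem coeff_zero_amp {J : Finset ℂ} (hJ : J.Nonempty) (x : ℂ) :
    PowerSeries.coeff 0 (S.amp J x) = 0 := by
  rw [S.amp_eq_X_mul hJ, PowerSeries.coeff_zero_X_mul]

theorem amp_insert {J : Finset ℂ} {y : ℂ} (hy : y ∉ J) (x : ℂ) : S.amp (insert y J) x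
    = PowerSeries.X * ((-1) ^ (J.card + 1) * ∑ I ∈ J.powerset,
      trace (pathSum S.M (J \ I) y x * S.M y * pathSum S.M I x y * S.M x)) := by
  rw [S.amp_eq_X_mul (Finset.insert_nonempty _ _), pathSum_insert _ hy,
    Finset.card_insert_of_notMem hy, Finset.sum_mul, trace_sum]

/-- Cyclicity of the trace exchanges the two arcs between `x` and `y`, that is `I` and `J \ I`. -/
theorem amp_insert_comm {J : Finset ℂ} {x y : ℂ} (hx : x ∉ J) (hy : y ∉ J) :
    S.amp (insert y J) x = S.amp (insert x J) y := by
  have h : ∑ I ∈ J.powerset,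
        trace (pathSum S.M (J \ I) y x * S.M y * pathSum S.M I x y * S.M x)
      = ∑ I ∈ J.powerset,
        trace (pathSum S.M (J \ I) x y * S.M x * pathSum S.M I y x * S.M y) := by
    refine Finset.sum_bij' (fun I _ => J \ I) (fun I _ => J \ I)
      (fun I _ => Finset.mem_powerset.2 Finset.sdiff_subset)
      (fun I _ => Finset.mem_powerset.2 Finset.sdiff_subset)
      (fun I hI => Finset.sdiff_sdiff_eq_self (Finset.mem_powerset.1 hI))
      (fun I hI => Finset.sdiff_sdiff_eq_self (Finset.mem_powerset.1 hI)) fun I hI => ?_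
    rw [Finset.sdiff_sdiff_eq_self (Finset.mem_powerset.1 hI), mul_assoc _ _ (S.M x),
      trace_mul_comm, ← mul_assoc]
  rw [S.amp_insert hy, S.amp_insert hx, h]

theorem amp_erase_comm {C : Finset ℂ} {x y : ℂ} (hx : x ∈ C) (hy : y ∈ C) :
    S.amp (C.erase x) x = S.amp (C.erase y) y := by
  by_cases hxy : x = y
  · rw [hxy]
  have h1 : C.erase x = insert y ((C.erase x).erase y) :=
    (Finset.insert_erase (Finset.mem_erase.2 ⟨Ne.symm hxy, hy⟩)).symm
  have h2 : C.erase y = insert x ((C.erase x).erase y) := by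
    rw [Finset.erase_right_comm]
    exact (Finset.insert_erase (Finset.mem_erase.2 ⟨hxy, hx⟩)).symm
  rw [h1, h2]
  exact S.amp_insert_comm (by simp) (by simp)

theorem coeff_zero_quot {j x : ℂ} (hj : j ∈ U) (hx : x ∈ U) (hxj : x ≠ j) (a b : Fin 2) :
    PowerSeries.coeff 0 (S.quot j x a b) = 0 := by
  have hxj : x - j ≠ 0 := sub_ne_zero.2 hxj
  rw [coeff_quot, S.coeff_zero_W hx, S.coeff_zero_W hj]
  fin_cases a <;> fin_cases b <;> simp [halfJ] <;> field_simp <;> ring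

/-- In leading order `quot` vanishes and only `tr(halfJ²) = -1/2` contributes. The formula is the
fundamental bidifferential of the curve in the variable `x`. -/
theorem coeff_one_amp_singleton {j x : ℂ} (hj : j ∈ U) (hx : x ∈ U) (hxj : x ≠ j) :
    PowerSeries.coeff 1 (S.amp {j} x)
      = (S.s j * S.s x + (u₀ ^ 2 - x * j)) / (2 * (S.s j * S.s x) * (x - j) ^ 2) := by
  have h := congrArg (PowerSeries.coeff 1) (S.s_mul_amp_singleton hj hx hxj)
  have hxj' : x - j ≠ 0 := sub_ne_zero.2 hxj
  have hsj := S.s_ne j hj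
  have hsx := S.s_ne x hx
  have ht : PowerSeries.coeff 0 (trace ((halfJ + S.quot j x) * (halfJ + S.quot j x)))
      = -(1 / 2) := by
    have h0 := S.coeff_zero_quot hj hx hxj
    simp only [PowerSeries.coeff_zero_eq_constantCoeff_apply] at h0 ⊢
    simp only [trace_fin_two, mul_apply, Fin.sum_univ_two, Matrix.add_apply, map_add, map_mul, h0]
    simp [halfJ]
    norm_num
  rw [PowerSeries.coeff_C_mul] at h
  rw [PowerSeries.coeff_succ_X_mul 0, map_sub, PowerSeries.coeff_C_mul, ht,
    PowerSeries.coeff_zero_C] at h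
  rw [eq_div_iff (by simp [hsj, hsx, hxj'])]
  have h' := congrArg (· * (2 * (x - j) ^ 2)) h
  simp only [S.s_sq x hx, S.s_sq j hj] at h'
  have e : ((S.s j * S.s x / 2 + (u₀ ^ 2 - x ^ 2 + (u₀ ^ 2 - j ^ 2)) / 4) / (x - j) ^ 2
      - 1 / 2 * -(1 / 2)) * (2 * (x - j) ^ 2) = S.s j * S.s x + (u₀ ^ 2 - x * j) := by
    field_simp
    ring
  rw [e] at h'
  linear_combination h'

theorem _root_.PainleveII.IsForm.div_s {V : Set ℂ} {s : ℂ → ℂ} {N D : ℕ} {f : ℂ → ℂ}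
    (h : IsForm V s N D (fun x => s x * f x)) : IsForm V s (N + 1) D f := by
  obtain ⟨p, hp, h⟩ := h
  exact ⟨p, hp, fun x hx => by rw [← h x hx]; ring⟩

theorem isForm_trace_const_mul {V : Set ℂ} {s : ℂ → ℂ} {N D K : ℕ} (A : SeriesMatrix)
    {B : ℂ → SeriesMatrix}
    (h : ∀ k ≤ K, ∀ a b, IsForm V s N D (fun x => PowerSeries.coeff k (B x a b))) :
    ∀ k ≤ K, IsForm V s N D (fun x => PowerSeries.coeff k (trace (A * B x))) := by
  intro k hk
  simp only [trace_fin_two, mul_apply, Fin.sum_univ_two, map_add]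
  exact ((IsForm.coeff_mul_left _ (fun k hk => h k hk _ _) k hk).add
    (IsForm.coeff_mul_left _ (fun k hk => h k hk _ _) k hk)).add
    ((IsForm.coeff_mul_left _ (fun k hk => h k hk _ _) k hk).add
    (IsForm.coeff_mul_left _ (fun k hk => h k hk _ _) k hk))

/-- Degree below `2d` over `s^{2d+1}` means decay like `x⁻²`, so that `dx` times the amplitude is
regular over infinity. The same `d` serves all sets `J`, as the interpolation requires. -/
theorem isForm_amp_of_nontrivial (K : ℕ) : ∃ d, ∀ k ≤ K, ∀ J : Finset ℂ, J.Nontrivial →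
    (∀ j ∈ J, j ∈ U) → IsForm (U \ J) S.s (2 * d + 1) (2 * d)
      (fun x => PowerSeries.coeff k (S.amp J x)) := by
  obtain ⟨d, hd⟩ := S.isForm_quot K
  refine ⟨d, fun k hk J hJ hJU => IsForm.div_s ?_⟩
  have h1 : ∀ k ≤ K, IsForm (U \ J) S.s (2 * d) (2 * d) (fun x => PowerSeries.coeff k
      (∑ j ∈ J, trace (pathResidue S.M J j * S.quot j x))) := by
    intro k hk
    simp only [map_sum]
    refine IsForm.sum _ fun j hj => ?_
    refine IsForm.mono_set (isForm_trace_const_mul (pathResidue S.M J j)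
      (fun k hk => hd k hk j (hJU j hj)) k hk) ?_
    exact Set.sdiff_subset_sdiff_right (by simpa using hj)
  refine (IsForm.coeff_mul_left ((PowerSeries.X : PowerSeries ℂ) * (-1) ^ J.card) h1 k hk).congr
    fun x hx => ?_
  rw [← S.s_smul_amp hJ hJU (by simpa using hx.2), map_smul, smul_eq_mul]

/-- The double pole and the constant `tr(halfJ²)` occur only in order one, which `2 ≤ k` excludes;
what is left is linear and quadratic in `quot`. -/
theorem isForm_amp_singleton (K : ℕ) : ∃ d, ∀ k, 2 ≤ k → k ≤ K → ∀ j ∈ U,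
    IsForm (U \ {j}) S.s (2 * d + 1) (2 * d) (fun x => PowerSeries.coeff k (S.amp {j} x)) := by
  obtain ⟨d, hd⟩ := S.isForm_quot K
  refine ⟨d + d, fun k hk2 hk j hj => IsForm.div_s ?_⟩
  obtain ⟨k, rfl⟩ : ∃ k', k = k' + 1 := ⟨k - 1, by omega⟩
  have hm : ∀ k ≤ K, ∀ a b, IsForm (U \ {j}) S.s (2 * (d + d)) (2 * (d + d))
      (fun x => PowerSeries.coeff k (S.quot j x a b)) := fun k hk a b =>
    mul_add 2 d d ▸ IsForm.mono (fun x hx => S.s_sq x hx.1) (hd k hk j hj a b) d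
  have h1 : IsForm (U \ {j}) S.s (2 * (d + d)) (2 * (d + d))
      (fun x => PowerSeries.coeff k (trace (S.quot j x * S.quot j x))) := by
    simp only [trace_fin_two, mul_apply, Fin.sum_univ_two, map_add]
    have := fun a b a' b' => IsForm.coeff_mul (K := K) (fun k hk => hd k hk j hj a b)
      (fun k hk => hd k hk j hj a' b') k (by omega)
    simp only [← mul_add] at this
    exact ((this _ _ _ _).add (this _ _ _ _)).add ((this _ _ _ _).add (this _ _ _ _))
  have h2 := isForm_trace_const_mul (halfJ) hm k (by omega)
  refine (((h1.add (h2.const_mul 2)).const_mul (-(1 / 2))).const_mul (S.s j)⁻¹).congr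
    fun x hx => ?_
  have h := congrArg (PowerSeries.coeff (k + 1)) (S.s_mul_amp_singleton hj hx.1 hx.2)
  have hk0 : k ≠ 0 := by omega
  have hh : PowerSeries.coeff k (trace (halfJ * halfJ)) = 0 := by
    have : trace (halfJ * halfJ) = PowerSeries.C (-(1 / 2)) := by
      simp [halfJ, trace_fin_two, -one_div, ← map_mul, ← map_neg,
        ← map_add]
      norm_num
    rw [this, PowerSeries.coeff_C, if_neg hk0]
  rw [PowerSeries.coeff_C_mul, PowerSeries.coeff_succ_X_mul, map_sub, PowerSeries.coeff_C_mul,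
    PowerSeries.coeff_C, if_neg hk0, mul_add, add_mul, add_mul, trace_add, trace_add, trace_add,
    trace_mul_comm (S.quot j x) halfJ, map_add, map_add, map_add, hh] at h
  have hsj := S.s_ne j hj
  rw [eq_inv_mul_iff_mul_eq₀ hsj]
  linear_combination h

theorem isForm_amp {n k : ℕ} (h : 2 ≤ n ∨ n = 1 ∧ 2 ≤ k) : ∃ d, ∀ J : Finset ℂ, J.card = n →
    (∀ j ∈ J, j ∈ U) → IsForm (U \ J) S.s (2 * d + 1) (2 * d)
      (fun x => PowerSeries.coeff k (S.amp J x)) := by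
  rcases h with h | ⟨rfl, h⟩
  · obtain ⟨d, hd⟩ := S.isForm_amp_of_nontrivial k
    exact ⟨d, fun J hJ hJU => hd k le_rfl J
      (Finset.one_lt_card_iff_nontrivial.1 (by omega)) hJU⟩
  · obtain ⟨d, hd⟩ := S.isForm_amp_singleton k
    refine ⟨d, fun J hJ hJU => ?_⟩
    obtain ⟨j, rfl⟩ := Finset.card_eq_one.1 hJ
    simpa using hd k h le_rfl j (hJU j (Finset.mem_singleton_self j))

/-- The coefficient of `ħ ^ k` of the amplitude of a tuple of points. -/
def tupleAmp (k : ℕ) {n : ℕ} (x : Fin (n + 1) → ℂ) : ℂ :=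
  PowerSeries.coeff k (S.amp ((Finset.univ.image x).erase (x 0)) (x 0))

theorem tupleAmp_eq (k : ℕ) {n : ℕ} (x : Fin (n + 1) → ℂ) (i : Fin (n + 1)) : S.tupleAmp k x
    = PowerSeries.coeff k (S.amp ((Finset.univ.image x).erase (x i)) (x i)) := by
  rw [tupleAmp, S.amp_erase_comm (Finset.mem_image_of_mem x (Finset.mem_univ 0))
    (Finset.mem_image_of_mem x (Finset.mem_univ i))]

theorem _root_.PainleveII.image_update {n : ℕ} {x : Fin n → ℂ} (hx : Function.Injective x)
    (i : Fin n) (y : ℂ) : Finset.univ.image (Function.update x i y)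
      = insert y ((Finset.univ.image x).erase (x i)) := by
  ext a
  simp only [Finset.mem_image, Finset.mem_univ, true_and, Finset.mem_insert, Finset.mem_erase]
  constructor
  · rintro ⟨j, rfl⟩
    by_cases hj : j = i
    · left; rw [hj, Function.update_self]
    · right
      rw [Function.update_of_ne hj]
      exact ⟨fun e => hj (hx e), j, rfl⟩
  · rintro (rfl | ⟨h1, j, rfl⟩)
    · exact ⟨i, Function.update_self ..⟩
    · exact ⟨j, Function.update_of_ne (fun e => h1 (by rw [e])) ..⟩

/-- The amplitude is symmetric in its points, so the bound for one variable holds in each;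
multiplied by powers of `s` it is separately polynomial with uniform degree. -/
theorem exists_tupleAmp_eq_eval {n k : ℕ} (h : ∃ d, ∀ J : Finset ℂ, J.card = n →
    (∀ j ∈ J, j ∈ U) → IsForm (U \ J) S.s (2 * d + 1) (2 * d)
      (fun x => PowerSeries.coeff k (S.amp J x))) :
    ∃ (d : ℕ) (F : MvPolynomial (Fin (n + 1)) ℂ), (∀ i, MvPolynomial.degreeOf i F ≤ 2 * d + 1) ∧
      ∀ x : Fin (n + 1) → ℂ, (∀ i, x i ∈ U) → Function.Injective x →
        S.tupleAmp k x * ∏ i, S.s (x i) ^ (2 * d + 3) = MvPolynomial.eval x F := by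
  obtain ⟨d, hd⟩ := h
  obtain ⟨x₀, hx₀⟩ := S.nonempty
  have hU : U.Infinite := infinite_of_mem_nhds x₀ (S.isOpen.mem_nhds hx₀)
  obtain ⟨F, hF, hF'⟩ := exists_mvPolynomial_of_separately (2 * d + 1) hU
    (fun x : Fin (n + 1) → ℂ => S.tupleAmp k x * ∏ i, S.s (x i) ^ (2 * d + 3)) (by
    intro x hx hinj i
    set J := (Finset.univ.image x).erase (x i) with hJ
    have hJc : J.card = n := by
      rw [hJ, Finset.card_erase_of_mem (Finset.mem_image_of_mem x (Finset.mem_univ i)),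
        Finset.card_image_of_injective _ hinj]
      simp
    have hJU : ∀ j ∈ J, j ∈ U := by
      intro j hj
      obtain ⟨l, -, rfl⟩ := Finset.mem_image.1 (Finset.mem_of_mem_erase hj)
      exact hx l
    -- The extra factor `s²` brings the degree bound into the form `N + 1` with `N = 2d + 1`, also
    -- when `d = 0`.
    obtain ⟨p, hp, hpe⟩ := (hd J hJc hJU).mono (fun y hy => S.s_sq y hy.1) 1
    refine ⟨Polynomial.C (∏ l ∈ Finset.univ.erase i, S.s (x l) ^ (2 * d + 3)) * p, ?_,
      fun y hy hyx => ?_⟩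
    · rw [← Polynomial.smul_eq_C_mul]
      exact Submodule.smul_mem _ _ hp
    · have hyJ : y ∉ J := by
        intro hyJ
        rw [hJ, Finset.mem_erase, Finset.mem_image] at hyJ
        obtain ⟨h1, l, -, rfl⟩ := hyJ
        exact hyx l (fun e => h1 (by rw [e])) rfl
      show S.tupleAmp k (Function.update x i y) * _ = _
      rw [S.tupleAmp_eq k _ i, image_update hinj, Function.update_self, ← hJ,
        Finset.erase_insert hyJ, ← Finset.mul_prod_erase _ _ (Finset.mem_univ i),
        Function.update_self, Polynomial.eval_mul, Polynomial.eval_C, ← hpe y ⟨hy, hyJ⟩]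
      have : ∏ l ∈ Finset.univ.erase i, S.s (Function.update x i y l) ^ (2 * d + 3)
          = ∏ l ∈ Finset.univ.erase i, S.s (x l) ^ (2 * d + 3) :=
        Finset.prod_congr rfl fun l hl => by
          rw [Function.update_of_ne (Finset.ne_of_mem_erase hl)]
      rw [this]
      ring)
  exact ⟨d, F, hF, hF'⟩

/-! ### Coinciding points -/

include S in
theorem eventually_mem_sdiff {x : ℂ} (hx : x ∈ U) (J : Finset ℂ) (hxJ : x ∉ J) :
    ∀ᶠ y in 𝓝[≠] x, y ∈ U ∧ y ∉ J ∧ y ≠ x := by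
  filter_upwards [nhdsWithin_le_nhds (S.isOpen.mem_nhds hx), eventually_mem_nhdsWithin,
    nhdsWithin_le_nhds ((J.finite_toSet.isClosed.isOpen_compl).mem_nhds hxJ)] with y h1 h2 h3
  exact ⟨h1, h3, h2⟩

/-- `B` is the limit of the split amplitude at coinciding points. -/
def IsSplitLimit (J : Finset ℂ) (x : ℂ) (B : PowerSeries ℂ) : Prop :=
  ∀ k, Tendsto (fun y => PowerSeries.coeff k (splitAmplitude S.M S.D J x y)) (𝓝[≠] x)
    (𝓝 (PowerSeries.coeff k B))

/-- The coefficients of the limit of the split amplitude, where the amplitude is regular. -/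
theorem coeff_split_of_eval {n k d : ℕ} {F : MvPolynomial (Fin (n + 2)) ℂ}
    (hF : ∀ x : Fin (n + 2) → ℂ, (∀ i, x i ∈ U) → Function.Injective x →
        S.tupleAmp k x * ∏ i, S.s (x i) ^ (2 * d + 3) = MvPolynomial.eval x F)
    (hnk : n ≠ 0 ∨ k ≠ 1) {x : ℂ} {z : Fin n → ℂ} (hz : ∀ i, z i ∈ U) (hinj : Function.Injective z)
    (hx : x ∈ U) (hxz : x ∉ Finset.univ.image z) {B : PowerSeries ℂ}
    (hB : S.IsSplitLimit (Finset.univ.image z) x B) :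
    PowerSeries.coeff k B * (S.s x ^ (4 * d + 6) * ∏ i, S.s (z i) ^ (2 * d + 3))
      = -MvPolynomial.eval (Fin.cons x (Fin.cons x z)) F := by
  set J := Finset.univ.image z with hJ
  have h1 := hB k
  have hs : Tendsto S.s (𝓝[≠] x) (𝓝 (S.s x)) :=
    ((S.s_cont x hx).continuousAt (S.isOpen.mem_nhds hx)).tendsto.mono_left nhdsWithin_le_nhds
  have h2 := h1.mul ((tendsto_const_nhds (x := S.s x ^ (2 * d + 3))).mul
    ((hs.pow (2 * d + 3)).mul (tendsto_const_nhds (x := ∏ i, S.s (z i) ^ (2 * d + 3)))))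
  -- After the powers of `s` are cleared the amplitude is a polynomial, so letting `y` tend to `x`
  -- is substitution.
  have h3 : Tendsto (fun y : ℂ => -MvPolynomial.eval (Fin.cons x (Fin.cons y z)) F) (𝓝[≠] x)
      (𝓝 (-MvPolynomial.eval (Fin.cons x (Fin.cons x z)) F)) := by
    refine Tendsto.mono_left (Continuous.tendsto ?_ x) nhdsWithin_le_nhds
    refine ((MvPolynomial.continuous_eval F).comp ?_).neg
    refine continuous_pi fun i => ?_
    refine Fin.cases ?_ (fun i => ?_) i
    · exact continuous_const
    · refine Fin.cases ?_ (fun i => ?_) i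
      · exact continuous_id
      · exact continuous_const
  rw [← tendsto_nhds_unique (h2.congr' ?_) h3]
  · ring
  · filter_upwards [S.eventually_mem_sdiff hx J hxz] with y ⟨hyU, hyJ, hyx⟩
    have hxJ : ∀ i, x ≠ z i := fun i e => hxz (e ▸ Finset.mem_image_of_mem z (Finset.mem_univ i))
    have hyJ' : ∀ i, y ≠ z i := fun i e => hyJ (e ▸ Finset.mem_image_of_mem z (Finset.mem_univ i))
    have hi : Function.Injective (Fin.cons x (Fin.cons y z) : Fin (n + 2) → ℂ) := by
      rw [Fin.cons_injective_iff, Fin.cons_injective_iff]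
      refine ⟨?_, ?_, hinj⟩
      · rintro ⟨i, hi⟩
        revert hi
        refine Fin.cases ?_ (fun i => ?_) i
        · exact fun h => hyx h
        · exact fun h => hxJ i h.symm
      · rintro ⟨i, hi⟩
        exact hyJ' i hi.symm
    rw [← hF _ ?_ hi, Fin.prod_univ_succ, Fin.prod_univ_succ]
    · have e1 : S.tupleAmp k (Fin.cons x (Fin.cons y z) : Fin (n + 2) → ℂ)
          = PowerSeries.coeff k (S.amp (insert y J) x) := by
        rw [tupleAmp]
        have : (Finset.univ.image (Fin.cons x (Fin.cons y z) : Fin (n + 2) → ℂ))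
            = insert x (insert y J) := by
          ext a
          simp [Fin.exists_fin_succ, hJ, eq_comm]
        rw [this, Fin.cons_zero, Finset.erase_insert]
        simp only [Finset.mem_insert, not_or]
        exact ⟨hyx.symm, hxz⟩
      have e2 : PowerSeries.coeff k (splitAmplitude S.M S.D J x y)
          = -PowerSeries.coeff k (S.amp (insert y J) x) := by
        rw [splitAmplitude, map_sub]
        have : PowerSeries.coeff k (if J = ∅ then ((x - y) ^ 2)⁻¹ • (PowerSeries.X : PowerSeries ℂ)
            else 0) = 0 := by
          split_ifs with h0
          · have : n = 0 := by
              by_contra hn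
              have : (⟨0, by omega⟩ : Fin n) ∈ (Finset.univ : Finset (Fin n)) := Finset.mem_univ _
              rw [hJ, Finset.image_eq_empty] at h0
              rw [h0] at this
              simp at this
            rw [map_smul, PowerSeries.coeff_X, if_neg (hnk.resolve_left (by simpa using this)),
              smul_zero]
          · simp
        rw [this, zero_sub]
        rfl
      rw [e1, e2]
      simp only [Fin.cons_zero, Fin.cons_succ]
      ring
    · intro i
      refine Fin.cases hx (fun i => ?_) i
      exact Fin.cases hyU (fun i => hz i) i

/-- The double poles cancel by the identity `s(x)² s(y)² - (u₀² - xy)² = -u₀² (x - y)²`. This is the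
one case in which the limit does not come from a polynomial numerator. -/
theorem coeff_one_split {x : ℂ} (hx : x ∈ U) {B : PowerSeries ℂ}
    (hB : S.IsSplitLimit ∅ x B) :
    PowerSeries.coeff 1 B * S.s x ^ 4 = -(u₀ ^ 2 / 4) := by
  have h1 := hB 1
  have hs : Tendsto S.s (𝓝[≠] x) (𝓝 (S.s x)) :=
    ((S.s_cont x hx).continuousAt (S.isOpen.mem_nhds hx)).tendsto.mono_left nhdsWithin_le_nhds
  have hid : Tendsto (fun y : ℂ => y) (𝓝[≠] x) (𝓝 x) := tendsto_id.mono_left nhdsWithin_le_nhds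
  -- Multiplying by `2 s(x) s(y) (s(x) s(y) + u₀² - xy)` clears the conjugate factor, so that the
  -- product is the constant `-u₀²`.
  have h2 := h1.mul (((tendsto_const_nhds (x := 2 * S.s x)).mul hs).mul
    (((tendsto_const_nhds (x := S.s x)).mul hs).add ((tendsto_const_nhds (x := u₀ ^ 2)).sub
      (hid.mul (tendsto_const_nhds (x := x))))))
  have h3 := tendsto_nhds_unique (h2.congr' ?_) (tendsto_const_nhds (x := -u₀ ^ 2))
  · have := S.s_sq x hx
    linear_combination (1 / 4 : ℂ) * h3 + (PowerSeries.coeff 1 B * S.s x ^ 2 / 2) * this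
  · filter_upwards [S.eventually_mem_sdiff hx ∅ (by simp)] with y hy
    obtain ⟨hyU, -, hyx⟩ := hy
    have e2 : PowerSeries.coeff 1 (splitAmplitude S.M S.D ∅ x y)
        = ((x - y) ^ 2)⁻¹ - PowerSeries.coeff 1 (S.amp {y} x) := by
      rw [splitAmplitude, map_sub, if_pos rfl, map_smul, PowerSeries.coeff_one_X, smul_eq_mul,
        mul_one]
      rfl
    rw [e2, S.coeff_one_amp_singleton hyU hx hyx.symm]
    have hxy : x - y ≠ 0 := sub_ne_zero.2 hyx.symm
    have h4 := S.s_ne x hx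
    have h5 := S.s_ne y hyU
    have h6 := S.s_sq x hx
    have h7 := S.s_sq y hyU
    field_simp
    have : S.s x ^ 2 * S.s y ^ 2 = (u₀ ^ 2 - x ^ 2) * (u₀ ^ 2 - y ^ 2) := by rw [h6, h7]
    linear_combination this

end SpectralSystem

end PainleveII

namespace PainleveII

open Matrix

/-! ### Rational functions with prescribed denominators -/

section Rational

/-- `f` is a polynomial divided by a power of `v` on `V`. -/
def IsRational (V : Set ℂ) (v : Polynomial ℂ) (f : ℂ → ℂ) : Prop :=
  ∃ (e : ℕ) (q : Polynomial ℂ), ∀ x ∈ V, f x * v.eval x ^ e = q.eval x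

namespace IsRational

variable {V : Set ℂ} {v : Polynomial ℂ} {f g : ℂ → ℂ}

theorem congr (h : IsRational V v f) (hfg : ∀ x ∈ V, g x = f x) : IsRational V v g := by
  obtain ⟨e, q, h⟩ := h
  exact ⟨e, q, fun x hx => by rw [hfg x hx, h x hx]⟩

theorem polynomial (q : Polynomial ℂ) : IsRational V v (fun x => q.eval x) :=
  ⟨0, q, fun x _ => by rw [pow_zero, mul_one]⟩

theorem const (c : ℂ) : IsRational V v (fun _ => c) :=
  (polynomial (Polynomial.C c)).congr fun x _ => by rw [Polynomial.eval_C]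

theorem add (hf : IsRational V v f) (hg : IsRational V v g) :
    IsRational V v (fun x => f x + g x) := by
  obtain ⟨e, p, hf⟩ := hf
  obtain ⟨c, q, hg⟩ := hg
  refine ⟨e + c, p * v ^ c + q * v ^ e, fun x hx => ?_⟩
  rw [Polynomial.eval_add, Polynomial.eval_mul, Polynomial.eval_mul, ← hf x hx, ← hg x hx,
    Polynomial.eval_pow, Polynomial.eval_pow]
  ring

theorem mul (hf : IsRational V v f) (hg : IsRational V v g) :
    IsRational V v (fun x => f x * g x) := by
  obtain ⟨e, p, hf⟩ := hf
  obtain ⟨c, q, hg⟩ := hg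
  refine ⟨e + c, p * q, fun x hx => ?_⟩
  rw [Polynomial.eval_mul, ← hf x hx, ← hg x hx]
  ring

theorem sum {ι : Type*} (t : Finset ι) {F : ι → ℂ → ℂ} (h : ∀ i ∈ t, IsRational V v (F i)) :
    IsRational V v (fun x => ∑ i ∈ t, F i x) := by
  classical
  induction t using Finset.induction_on with
  | empty => simpa using (const 0 : IsRational V v (fun _ => 0))
  | insert a t ha ih =>
    simp only [Finset.sum_insert ha]
    exact (h a (Finset.mem_insert_self _ _)).add (ih fun i hi => h i (Finset.mem_insert_of_mem hi))

theorem coeff_mul {F G : ℂ → PowerSeries ℂ}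
    (hF : ∀ k, IsRational V v (fun x => PowerSeries.coeff k (F x)))
    (hG : ∀ k, IsRational V v (fun x => PowerSeries.coeff k (G x))) (k : ℕ) :
    IsRational V v (fun x => PowerSeries.coeff k (F x * G x)) := by
  simp only [PowerSeries.coeff_mul]
  exact sum _ fun p _ => (hF _).mul (hG _)

theorem coeff_trace_mul {A B : ℂ → SeriesMatrix}
    (hA : ∀ k a b, IsRational V v (fun x => PowerSeries.coeff k (A x a b)))
    (hB : ∀ k a b, IsRational V v (fun x => PowerSeries.coeff k (B x a b))) (k : ℕ) :
    IsRational V v (fun x => PowerSeries.coeff k (trace (A x * B x))) := by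
  simp only [trace_fin_two, mul_apply, Fin.sum_univ_two, map_add]
  have := fun a b => coeff_mul (fun k => hA k a b) (fun k => hB k b a) k
  exact ((this _ _).add (this _ _)).add ((this _ _).add (this _ _))

end IsRational

/-- `f` is a proper rational function with denominator a power of `s²`. -/
def IsDecaying (V : Set ℂ) (s f : ℂ → ℂ) : Prop := ∃ c, IsForm V s (2 * c) (2 * c) f

theorem IsDecaying.add {V : Set ℂ} {s f g : ℂ → ℂ} {u₀ : ℂ}
    (hs : ∀ x ∈ V, s x ^ 2 = u₀ ^ 2 - x ^ 2) (hf : IsDecaying V s f) (hg : IsDecaying V s g) :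
    IsDecaying V s (fun x => f x + g x) := by
  obtain ⟨c, hf⟩ := hf
  obtain ⟨d, hg⟩ := hg
  refine ⟨c + d, ?_⟩
  have h1 := hf.mono hs d
  have h2 := hg.mono hs c
  rw [← mul_add] at h1 h2
  rw [add_comm d c] at h2
  exact h1.add h2

theorem IsDecaying.const_mul {V : Set ℂ} {s f : ℂ → ℂ} (a : ℂ) (hf : IsDecaying V s f) :
    IsDecaying V s (fun x => a * f x) :=
  hf.imp fun _ h => h.const_mul a

theorem IsDecaying.sum {V : Set ℂ} {s : ℂ → ℂ} {u₀ : ℂ}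
    (hs : ∀ x ∈ V, s x ^ 2 = u₀ ^ 2 - x ^ 2) {ι : Type*} (t : Finset ι) {F : ι → ℂ → ℂ}
    (h : ∀ i ∈ t, IsDecaying V s (F i)) : IsDecaying V s (fun x => ∑ i ∈ t, F i x) := by
  classical
  induction t using Finset.induction_on with
  | empty => exact ⟨0, by simpa using (IsForm.zero : IsForm V s (2 * 0) (2 * 0) (fun _ => 0))⟩
  | insert a t ha ih =>
    simp only [Finset.sum_insert ha]
    exact (h a (Finset.mem_insert_self _ _)).add hs
      (ih fun i hi => h i (Finset.mem_insert_of_mem hi))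

theorem eval_sq_sub (u₀ x : ℂ) :
    (Polynomial.C (u₀ ^ 2) - Polynomial.X ^ 2 : Polynomial ℂ).eval x = u₀ ^ 2 - x ^ 2 := by simp

theorem natDegree_sq_sub (u₀ : ℂ) :
    (Polynomial.C (u₀ ^ 2) - Polynomial.X ^ 2 : Polynomial ℂ).natDegree = 2 := by
  rw [Polynomial.natDegree_sub_eq_right_of_natDegree_lt] <;> simp

/-- A function `f` such that `s f` is rational and `c s f` is the sum of a polynomial of degree less
than that of `c` and a decaying function, decays. -/
theorem isForm_of_curve_mul {V : Set ℂ} (hV : V.Infinite) {s f r : ℂ → ℂ} {u₀ : ℂ}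
    (hs : ∀ x ∈ V, s x ^ 2 = u₀ ^ 2 - x ^ 2) {c q : Polynomial ℂ} (hq : q.degree < c.degree)
    (hf : IsRational V (Polynomial.C (u₀ ^ 2) - Polynomial.X ^ 2) (fun x => s x * f x))
    (hr : IsDecaying V s r) (h : ∀ x ∈ V, s x * c.eval x * f x = q.eval x + r x) :
    ∃ d, IsForm V s (2 * d + 1) (2 * d) f := by
  obtain ⟨d, p, hp⟩ := hf
  obtain ⟨e, w, hw, hw'⟩ := hr
  set v : Polynomial ℂ := Polynomial.C (u₀ ^ 2) - Polynomial.X ^ 2 with hv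
  have hvs : ∀ x ∈ V, v.eval x = s x ^ 2 := fun x hx => by rw [hv, eval_sq_sub, hs x hx]
  have hc0 : c ≠ 0 := by
    rintro rfl
    simp at hq
  have hv0 : v ≠ 0 := by
    intro h0
    have := natDegree_sq_sub u₀
    rw [← hv, h0] at this
    simp at this
  -- Each term on the right has degree less than `deg c + 2(e + d)`, and `v^e` has degree `2e`;
  -- hence `deg p < 2d`.
  have key : c * p * v ^ e = q * v ^ (e + d) + w * v ^ d := by
    refine Polynomial.eq_of_infinite_eval_eq _ _ (hV.mono fun x hx => ?_)
    show Polynomial.eval x _ = Polynomial.eval x _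
    simp only [Polynomial.eval_mul, Polynomial.eval_add, Polynomial.eval_pow, ← hp x hx,
      ← hw' x hx, hvs x hx, pow_mul]
    linear_combination ((s x ^ 2) ^ d * (s x ^ 2) ^ e) * h x hx
  refine ⟨d, p, ?_, fun x hx => ?_⟩
  · have hmem : c * p * v ^ e ∈ Polynomial.degreeLT ℂ (c.natDegree + 2 * (e + d)) := by
      rw [key]
      refine Submodule.add_mem _ (IsForm.sub_sq_mem_degreeLT u₀ ?_ _) ?_
      · rw [Polynomial.mem_degreeLT, ← Polynomial.degree_eq_natDegree hc0]
        exact hq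
      · refine Polynomial.degreeLT_mono ?_ (IsForm.sub_sq_mem_degreeLT u₀ hw d)
        omega
    by_cases hp0 : p = 0
    · rw [hp0]; exact Submodule.zero_mem _
    rw [Polynomial.mem_degreeLT] at hmem ⊢
    rw [Polynomial.degree_eq_natDegree (mul_ne_zero (mul_ne_zero hc0 hp0) (pow_ne_zero _ hv0)),
      Polynomial.natDegree_mul (mul_ne_zero hc0 hp0) (pow_ne_zero _ hv0),
      Polynomial.natDegree_mul hc0 hp0, Polynomial.natDegree_pow, hv, natDegree_sq_sub] at hmem
    rw [Polynomial.degree_eq_natDegree hp0]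
    norm_cast at *
    omega
  · rw [← hp x hx, hvs x hx, pow_succ, pow_mul]
    ring

end Rational

/-! ### The one-point amplitude, order by order. -/

namespace SpectralSystem

variable {U : Set ℂ} {u₀ : ℂ} (S : SpectralSystem U u₀)

include S in
theorem infinite : U.Infinite := by
  obtain ⟨x₀, hx₀⟩ := S.nonempty
  exact infinite_of_mem_nhds x₀ (S.isOpen.mem_nhds hx₀)

/-- The right hand side of the loop equation. -/
def loopRight (J : Finset ℂ) (x : ℂ) : PowerSeries ℂ :=
  (1 / 2 : ℂ) • ∑ I ∈ J.powerset,
    (trace (insertion S.M S.D I x) * trace (insertion S.M S.D (J \ I) x)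
      - trace (insertion S.M S.D I x * insertion S.M S.D (J \ I) x))

theorem exists_loop {J : Finset ℂ} {x : ℂ} (hx : x ∈ U) (hxJ : x ∉ J) :
    ∃ B : PowerSeries ℂ, S.IsSplitLimit J x B ∧
      ∑ I ∈ J.powerset, S.amp I x * (trace (insertion S.M S.D (J \ I) x) - S.amp (J \ I) x)
        + PowerSeries.X * B = S.loopRight J x := by
  obtain ⟨M', hM', hd⟩ := S.M_deriv x hx
  have hU := S.isOpen.mem_nhds hx
  obtain ⟨B, h1, h2⟩ := exists_loop_equation S.M S.D
    (by filter_upwards [hU] with y hy using S.M_trace y hy)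
    (by filter_upwards [hU] with y hy using S.M_mul_self y hy) hM' hd hxJ
  exact ⟨B, fun k => (PowerSeries.WithPiTopology.tendsto_iff_coeff_tendsto ℂ _ _ _).1 h1 k, h2⟩

theorem loopRight_empty {x : ℂ} : S.loopRight ∅ x = det (S.D x) := by
  rw [loopRight]
  simp only [Finset.powerset_empty, Finset.sum_singleton, Finset.sdiff_empty, insertion, if_true,
    trace_fin_two, det_fin_two, mul_apply, Fin.sum_univ_two, PowerSeries.smul_eq_C_mul]
  linear_combination (S.D x 0 0 * S.D x 1 1 - S.D x 0 1 * S.D x 1 0) * C_half_mul_two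

/-- As `D` is traceless, `s tr(D M) = tr(D W)`, and both factors are rational in `x` with
denominators powers of `u₀² - x²`. -/
theorem isRational_s_mul_coeff_amp_empty (k : ℕ) :
    IsRational U (Polynomial.C (u₀ ^ 2) - Polynomial.X ^ 2)
      (fun x => S.s x * PowerSeries.coeff k (S.amp ∅ x)) := by
  have hW : ∀ k a b, IsRational U (Polynomial.C (u₀ ^ 2) - Polynomial.X ^ 2)
      (fun x => PowerSeries.coeff k (S.W x a b)) := by
    intro k a b
    rcases Nat.eq_zero_or_pos k with rfl | hk
    · refine IsRational.congr (f := fun x => (!![0, Polynomial.C (1 / 2) * (Polynomial.C u₀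
        + Polynomial.X); Polynomial.C (1 / 2) * (Polynomial.C u₀ - Polynomial.X), 0] a b).eval x)
        (IsRational.polynomial _) fun x hx => ?_
      rw [S.coeff_zero_W hx]
      fin_cases a <;> fin_cases b <;> simp <;> ring
    · obtain ⟨d, hd⟩ := S.M_form k
      obtain ⟨q, -, hq⟩ := hd k hk le_rfl a b
      refine ⟨d, q, fun x hx => ?_⟩
      rw [← hq x hx, eval_sq_sub, ← S.s_sq x hx, ← pow_mul, pow_succ']
      exact (congrArg (· * S.s x ^ (2 * d)) (S.coeff_W hk x a b)).trans (by ring)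
  have hD : ∀ k a b, IsRational U (Polynomial.C (u₀ ^ 2) - Polynomial.X ^ 2)
      (fun x => PowerSeries.coeff k (S.D x a b)) := by
    intro k a b
    obtain ⟨q, hq⟩ := S.D_form k a b
    exact (IsRational.polynomial q).congr hq
  refine (IsRational.coeff_trace_mul hD hW k).congr fun x hx => ?_
  rw [W, mul_smul_comm, mul_sub, trace_smul, trace_sub, mul_smul_comm, mul_one, trace_smul,
    S.D_trace x hx, smul_zero, sub_zero, map_smul, smul_eq_mul, amp, amplitude, insertion,
    if_pos rfl]

/-- Order one is explicit. In the other orders the numerator of the two-point amplitude is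
restricted to the diagonal, where its degree is at most `4d + 2` against the denominator `s^{4d+6}`.
-/
theorem isDecaying_coeff_split {B : ℂ → PowerSeries ℂ} (hB : ∀ x ∈ U, S.IsSplitLimit ∅ x (B x)) (k : ℕ) :
    IsDecaying U S.s (fun x => PowerSeries.coeff k (B x)) := by
  by_cases hk1 : k = 1
  · subst hk1
    refine ⟨2, Polynomial.C (-(u₀ ^ 2 / 4)), ?_, fun x hx => ?_⟩
    · rw [Polynomial.mem_degreeLT]
      exact lt_of_le_of_lt Polynomial.degree_C_le (by norm_num)
    · rw [Polynomial.eval_C]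
      exact S.coeff_one_split hx (hB x hx)
  · obtain ⟨d, F, hF, hF'⟩ : ∃ (d : ℕ) (F : MvPolynomial (Fin (1 + 1)) ℂ),
        (∀ i, MvPolynomial.degreeOf i F ≤ 2 * d + 1) ∧
        ∀ x : Fin (1 + 1) → ℂ, (∀ i, x i ∈ U) → Function.Injective x →
        S.tupleAmp k x * ∏ i, S.s (x i) ^ (2 * d + 3) = MvPolynomial.eval x F := by
      rcases Nat.eq_zero_or_pos k with rfl | hk
      · refine ⟨0, 0, by simp, fun x _ hinj => ?_⟩
        rw [tupleAmp, S.coeff_zero_amp, zero_mul, map_zero]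
        refine ⟨x 1, Finset.mem_erase.2 ⟨fun h => ?_, Finset.mem_image_of_mem x
          (Finset.mem_univ 1)⟩⟩
        exact absurd (hinj h) (by decide)
      · exact S.exists_tupleAmp_eq_eval (S.isForm_amp (Or.inr ⟨rfl, by omega⟩))
    refine ⟨2 * d + 3, -∑ m ∈ F.support, Polynomial.C (MvPolynomial.coeff m F)
      * Polynomial.X ^ (m 0 + m 1), ?_, fun x hx => ?_⟩
    · refine Submodule.neg_mem _ (Submodule.sum_mem _ fun m hm => ?_)
      rw [← Polynomial.smul_eq_C_mul]
      refine Submodule.smul_mem _ _ ?_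
      rw [Polynomial.mem_degreeLT, Polynomial.degree_X_pow]
      have h0 := MvPolynomial.degreeOf_le_iff.1 (hF 0) m hm
      have h1 := MvPolynomial.degreeOf_le_iff.1 (hF 1) m hm
      norm_cast
      omega
    · have h := S.coeff_split_of_eval (n := 0) hF' (Or.inr hk1) (x := x) (z := ![])
        (fun i => i.elim0) (fun i => i.elim0) hx (by simp) (by simpa using hB x hx)
      rw [Finset.univ_eq_empty, Finset.prod_empty, mul_one, MvPolynomial.eval_eq',
        show 4 * d + 6 = 2 * (2 * d + 3) by ring] at h
      rw [h, Polynomial.eval_neg, Polynomial.eval_finsetSum]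
      congr 1
      refine Finset.sum_congr rfl fun m _ => ?_
      rw [Fin.prod_univ_two, Polynomial.eval_mul, Polynomial.eval_C, Polynomial.eval_pow,
        Polynomial.eval_X, pow_add]
      rfl

theorem coeff_zero_amp_empty {x : ℂ} (hx : x ∈ U) :
    PowerSeries.coeff 0 (S.amp ∅ x) = S.s x * S.curve.eval x := by
  rw [← S.trace_zero x hx, amp, amplitude, insertion, if_pos rfl]

/-- For `J = ∅` the loop equation reads `-a² + ħB = det D` for the one-point amplitude `a`. In order
`k` it determines `2 s c a_k`, where `c` is the factor of the curve, from `det D` in order `k`,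
lower orders of `a`, and `B` in order `k - 1`. The first is a polynomial of degree below that of
`c`; the others decay. -/
theorem isForm_amp_empty {k : ℕ} (hk : 1 ≤ k) :
    ∃ d, IsForm U S.s (2 * d + 1) (2 * d) (fun x => PowerSeries.coeff k (S.amp ∅ x)) := by
  have hB : ∀ x : ℂ, ∃ B : PowerSeries ℂ, x ∈ U →
      S.IsSplitLimit ∅ x B ∧
      S.amp ∅ x * (trace (insertion S.M S.D ∅ x) - S.amp ∅ x)
        + PowerSeries.X * B = S.loopRight ∅ x := by
    intro x
    by_cases hx : x ∈ U
    · obtain ⟨B, h1, h2⟩ := S.exists_loop hx (Finset.notMem_empty x)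
      refine ⟨B, fun _ => ⟨h1, ?_⟩⟩
      simpa using h2
    · exact ⟨0, fun h => absurd h hx⟩
  choose B hB using hB
  induction k using Nat.strong_induction_on with
  | _ k ih =>
  obtain ⟨q, hq, hq'⟩ := S.det_form k hk
  obtain ⟨l, rfl⟩ : ∃ l, k = l + 1 := ⟨k - 1, by omega⟩
  -- The part of positive order, which separates the terms containing the leading coefficient from
  -- the rest of the square.
  set β : ℂ → PowerSeries ℂ := fun x => S.amp ∅ x - PowerSeries.C
    (PowerSeries.coeff 0 (S.amp ∅ x)) with hβ
  have hβ0 : ∀ x, PowerSeries.coeff 0 (β x) = 0 := by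
    intro x
    rw [hβ, map_sub, PowerSeries.coeff_zero_C, sub_self]
  have hβk : ∀ j, 1 ≤ j → ∀ x, PowerSeries.coeff j (β x) = PowerSeries.coeff j (S.amp ∅ x) := by
    intro j hj x
    rw [hβ, map_sub, PowerSeries.coeff_C, if_neg (by omega), sub_zero]
  have hdec : IsDecaying U S.s (fun x => PowerSeries.coeff (l + 1) (β x * β x)) := by
    simp only [PowerSeries.coeff_mul]
    refine IsDecaying.sum S.s_sq _ fun p hp => ?_
    have hp := Finset.HasAntidiagonal.mem_antidiagonal.1 hp
    by_cases h1 : p.1 = 0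
    · simp only [h1, hβ0, zero_mul]
      exact ⟨0, IsForm.zero⟩
    by_cases h2 : p.2 = 0
    · simp only [h2, hβ0, mul_zero]
      exact ⟨0, IsForm.zero⟩
    simp only [hβk p.1 (by omega), hβk p.2 (by omega)]
    obtain ⟨d1, hd1⟩ := ih p.1 (by omega) (by omega)
    obtain ⟨d2, hd2⟩ := ih p.2 (by omega) (by omega)
    refine ⟨d1 + d2 + 1, ?_⟩
    have := (hd1.mul hd2).mono_degree (D' := 2 * (d1 + d2 + 1)) (by omega)
    rwa [show 2 * d1 + 1 + (2 * d2 + 1) = 2 * (d1 + d2 + 1) by ring] at this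
  have hr := ((S.isDecaying_coeff_split (B := B) (fun x hx => (hB x hx).1) l).const_mul
    (1 / 2)).add S.s_sq (hdec.const_mul (-(1 / 2)))
  refine isForm_of_curve_mul S.infinite S.s_sq (c := S.curve) (q := Polynomial.C (-(1 / 2)) * q)
    ?_ (S.isRational_s_mul_coeff_amp_empty (l + 1)) hr fun x hx => ?_
  · rwa [Polynomial.degree_C_mul (by norm_num)]
  · have h := congrArg (PowerSeries.coeff (l + 1)) (hB x hx).2
    rw [loopRight_empty, S.trace_insertion_empty hx, zero_sub, map_add,
      PowerSeries.coeff_succ_X_mul, hq' x hx] at h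
    have h3 : PowerSeries.coeff (l + 1) (S.amp ∅ x * -S.amp ∅ x)
        = -(2 * PowerSeries.coeff 0 (S.amp ∅ x) * PowerSeries.coeff (l + 1) (S.amp ∅ x)
          + PowerSeries.coeff (l + 1) (β x * β x)) := by
      rw [← hβk (l + 1) (by omega)]
      have h4 : β x = S.amp ∅ x - PowerSeries.C (PowerSeries.coeff 0 (S.amp ∅ x)) := rfl
      have : S.amp ∅ x * -S.amp ∅ x = -(PowerSeries.C (PowerSeries.coeff 0 (S.amp ∅ x) ^ 2)
            + (PowerSeries.C (2 * PowerSeries.coeff 0 (S.amp ∅ x)) * β x + β x * β x)) := by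
        rw [h4, map_pow, map_mul, map_ofNat]; ring
      rw [this, map_neg, map_add, map_add, PowerSeries.coeff_C, if_neg (by omega),
        PowerSeries.coeff_C_mul, zero_add]
    rw [h3, S.coeff_zero_amp_empty hx] at h
    rw [Polynomial.eval_mul, Polynomial.eval_C]
    linear_combination (-(1 / 2) : ℂ) * h

/-! ### The right hand side of the loop equation is rational -/

/-- For nonempty `I` the matrices `M` occur only at the points of `I`, so `x` enters through the
denominators `x - j` alone, and for `I = ∅` the insertion is polynomial. The branch points are not
singular. -/
theorem isRational_insertion {I J : Finset ℂ} (hIJ : I ⊆ J) (k : ℕ) (a b : Fin 2) :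
    IsRational (U \ J) (∏ j ∈ J, (Polynomial.X - Polynomial.C j))
      (fun x => PowerSeries.coeff k (insertion S.M S.D I x a b)) := by
  have hinv : ∀ j ∈ J, IsRational (U \ J) (∏ j ∈ J, (Polynomial.X - Polynomial.C j))
      (fun x => (x - j)⁻¹) := by
    intro j hj
    refine ⟨1, ∏ i ∈ J.erase j, (Polynomial.X - Polynomial.C i), fun x hx => ?_⟩
    have : x - j ≠ 0 := sub_ne_zero.2 fun h => hx.2 (h ▸ hj)
    rw [← Finset.mul_prod_erase _ _ hj, pow_one, Polynomial.eval_mul, Polynomial.eval_sub,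
      Polynomial.eval_X, Polynomial.eval_C, ← mul_assoc, inv_mul_cancel₀ this, one_mul]
  have hX : ∀ (c : PowerSeries ℂ) (F : ℂ → PowerSeries ℂ),
      (∀ k, IsRational (U \ J) (∏ j ∈ J, (Polynomial.X - Polynomial.C j))
        (fun x => PowerSeries.coeff k (F x))) →
      ∀ k, IsRational (U \ J) (∏ j ∈ J, (Polynomial.X - Polynomial.C j))
        (fun x => PowerSeries.coeff k (c * F x)) :=
    fun c F hF => IsRational.coeff_mul (fun _ => IsRational.const _) hF
  rcases I.eq_empty_or_nonempty with rfl | hI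
  · obtain ⟨q, hq⟩ := S.D_form k a b
    exact (IsRational.polynomial q).congr fun x hx => by
      rw [insertion, if_pos rfl, hq x hx.1]
  · simp only [insertion, if_neg hI.ne_empty, Matrix.smul_apply, smul_eq_mul]
    refine hX _ _ (fun k => ?_) k
    rcases Finset.eq_singleton_or_nontrivial hI.choose_spec with h1 | h1
    · rw [h1]
      set j := hI.choose
      have hj : j ∈ J := hIJ hI.choose_spec
      refine (((hinv j hj).mul ((hinv j hj).mul (IsRational.const (-1)))).mul
        (IsRational.const (PowerSeries.coeff k (S.M j a b)))).congr fun x hx => ?_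
      have hxj : x ≠ j := fun h => hx.2 (h ▸ hj)
      rw [pathSum_of_nonempty _ (Finset.singleton_nonempty _), Finset.sum_singleton,
        Finset.erase_singleton, pathSum_empty, smul_mul_assoc, one_mul, smul_smul]
      have e : ((x - j)⁻¹ * (j - x)⁻¹) • S.M j a b
          = (((x - j)⁻¹ * (j - x)⁻¹) • S.M j) a b := rfl
      rw [← e, map_smul, smul_eq_mul, ← neg_sub x j, inv_neg]
      ring
    · refine (IsRational.sum I fun j hj => (hinv j (hIJ hj)).mul (IsRational.const
        (PowerSeries.coeff k (pathResidue S.M I j a b)))).congr fun x hx => ?_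
      rw [(pathSum_self S.M h1 (fun h => hx.2 (hIJ h))).1, Matrix.sum_apply, map_sum]
      refine Finset.sum_congr rfl fun j _ => ?_
      have e : ((x - j)⁻¹ • pathResidue S.M I j) a b = (x - j)⁻¹ • pathResidue S.M I j a b := rfl
      rw [e, map_smul, smul_eq_mul]

theorem isRational_loopRight (J : Finset ℂ) (k : ℕ) :
    IsRational (U \ J) (∏ j ∈ J, (Polynomial.X - Polynomial.C j))
      (fun x => PowerSeries.coeff k (S.loopRight J x)) := by
  have htr : ∀ I ⊆ J, ∀ k, IsRational (U \ J) (∏ j ∈ J, (Polynomial.X - Polynomial.C j))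
      (fun x => PowerSeries.coeff k (trace (insertion S.M S.D I x))) := by
    intro I hI k
    simp only [trace_fin_two, map_add]
    exact (S.isRational_insertion hI k 0 0).add (S.isRational_insertion hI k 1 1)
  have hsum := IsRational.sum (V := U \ J) (v := ∏ j ∈ J, (Polynomial.X - Polynomial.C j))
    J.powerset fun I hI => ((IsRational.coeff_mul
      (htr I (Finset.mem_powerset.1 hI)) (htr (J \ I) Finset.sdiff_subset) k).add
      ((IsRational.const (-1)).mul (IsRational.coeff_trace_mul
      (fun k a b => S.isRational_insertion (Finset.mem_powerset.1 hI) k a b)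
      (fun k a b => S.isRational_insertion (Finset.sdiff_subset (t := I)) k a b) k)))
  refine ((IsRational.const (1 / 2)).mul hsum).congr fun x _ => ?_
  rw [loopRight, map_smul, smul_eq_mul, map_sum]
  congr 1
  refine Finset.sum_congr rfl fun I _ => ?_
  rw [map_sub]
  ring

/-! ### Parity and order of the amplitudes -/

theorem coeff_trace_insertion {J : Finset ℂ} (hJU : ∀ j ∈ J, j ∈ U) {x : ℂ} (hx : x ∈ U)
    (hxJ : x ∉ J) {k : ℕ} (hk : J.card ≠ 1 ∨ k ≠ 1) :
    PowerSeries.coeff k (trace (insertion S.M S.D J x)) = 0 := by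
  rcases J.eq_empty_or_nonempty with rfl | ⟨j, hj⟩
  · rw [S.trace_insertion_empty hx, map_zero]
  · rcases Finset.eq_singleton_or_nontrivial hj with rfl | h
    · rw [S.trace_insertion_singleton (hJU j hj) (by simpa using hxJ), PowerSeries.coeff_C_mul,
        PowerSeries.coeff_X, if_neg (hk.resolve_left (by simp)), mul_zero]
    · rw [S.trace_insertion_of_nontrivial h hxJ, map_zero]

/-- Clearing denominators, `(u₀² - x²)^d` divides `c v^e p`, where `c` is the factor of the curve.
It is coprime to `c` and to `v`, whose roots lie in `U`, where `s ≠ 0`. So it divides `p`, whose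
degree is smaller than `2d`. -/
theorem eq_zero_of_curve_mul {J : Finset ℂ} (hJU : ∀ j ∈ J, j ∈ U) {f g : ℂ → ℂ} {d : ℕ}
    (hf : IsForm (U \ J) S.s (2 * d + 1) (2 * d) f)
    (hg : IsRational (U \ J) (∏ j ∈ J, (Polynomial.X - Polynomial.C j)) g)
    (h : ∀ x ∈ U \ (J : Set ℂ), -2 * (S.s x * S.curve.eval x) * f x = g x) :
    ∀ x ∈ U \ (J : Set ℂ), f x = 0 := by
  obtain ⟨p, hp, hpf⟩ := hf
  obtain ⟨e, q, hq⟩ := hg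
  set w : Polynomial ℂ := Polynomial.C (u₀ ^ 2) - Polynomial.X ^ 2 with hw
  set v : Polynomial ℂ := ∏ j ∈ J, (Polynomial.X - Polynomial.C j) with hv
  have hws : ∀ x ∈ U, w.eval x = S.s x ^ 2 := fun x hx => by rw [hw, eval_sq_sub, S.s_sq x hx]
  have key : (Polynomial.C (-2) * S.curve * v ^ e) * p = q * w ^ d := by
    refine Polynomial.eq_of_infinite_eval_eq _ _
      ((S.infinite.sdiff J.finite_toSet).mono fun x hx => ?_)
    show Polynomial.eval x _ = Polynomial.eval x _
    simp only [Polynomial.eval_mul, Polynomial.eval_pow, Polynomial.eval_C, ← hpf x hx, ← hq x hx,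
      hws x hx.1, ← h x hx]
    ring
  have hfac : w = (Polynomial.C u₀ - Polynomial.X) * (Polynomial.C u₀ + Polynomial.X) := by
    rw [hw, Polynomial.C_pow]; ring
  have hcop : ∀ c : Polynomial ℂ, c.eval u₀ ≠ 0 → c.eval (-u₀) ≠ 0 → IsCoprime w c := by
    intro c h1 h2
    rw [hfac]
    refine IsCoprime.mul_left ?_ ?_
    · rw [← neg_sub, IsCoprime.neg_left_iff]
      exact (Polynomial.irreducible_X_sub_C u₀).coprime_iff_not_dvd.2
        fun h => h1 (Polynomial.dvd_iff_isRoot.1 h)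
    · have : Polynomial.C u₀ + Polynomial.X = Polynomial.X - Polynomial.C (-u₀) := by
        rw [Polynomial.C_neg]; ring
      rw [this]
      exact (Polynomial.irreducible_X_sub_C (-u₀)).coprime_iff_not_dvd.2
        fun h => h2 (Polynomial.dvd_iff_isRoot.1 h)
  have hne : ∀ y, w.eval y = 0 → ∀ j ∈ J, y - j ≠ 0 := by
    intro y hy j hj h0
    rw [sub_eq_zero.1 h0, hws j (hJU j hj)] at hy
    exact S.s_ne j (hJU j hj) (pow_eq_zero_iff (two_ne_zero) |>.1 hy)
  have hcop' : IsCoprime w (Polynomial.C (-2) * S.curve * v ^ e) := by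
    refine hcop _ ?_ ?_
    · simp only [Polynomial.eval_mul, Polynomial.eval_pow, Polynomial.eval_C, hv,
        Polynomial.eval_prod, Polynomial.eval_sub, Polynomial.eval_X]
      refine mul_ne_zero (mul_ne_zero (by norm_num) S.curve_eval_ne)
        (pow_ne_zero _ (Finset.prod_ne_zero_iff.2 (hne _ ?_)))
      rw [hw, eval_sq_sub, sub_self]
    · simp only [Polynomial.eval_mul, Polynomial.eval_pow, Polynomial.eval_C, hv,
        Polynomial.eval_prod, Polynomial.eval_sub, Polynomial.eval_X]
      refine mul_ne_zero (mul_ne_zero (by norm_num) S.curve_eval_neg_ne)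
        (pow_ne_zero _ (Finset.prod_ne_zero_iff.2 (hne _ ?_)))
      rw [hw, eval_sq_sub, neg_sq, sub_self]
  have hdvd : w ^ d ∣ p := (hcop'.pow_left).dvd_of_dvd_mul_left (Dvd.intro_left _ key.symm)
  have hp0 : p = 0 := by
    by_contra hp0
    have h1 := Polynomial.natDegree_le_of_dvd hdvd hp0
    rw [Polynomial.natDegree_pow, hw, natDegree_sq_sub] at h1
    rw [Polynomial.mem_degreeLT, Polynomial.degree_eq_natDegree hp0] at hp
    norm_cast at hp
    omega
  intro x hx
  have h1 := hpf x hx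
  rw [hp0, Polynomial.eval_zero, mul_eq_zero] at h1
  exact h1.resolve_right (pow_ne_zero _ (S.s_ne x hx.1))

/-- The coefficients of the amplitude of `n + 1` points vanish except in the orders `n + 2g`. -/
theorem coeff_amp_eq_zero (k : ℕ) : ∀ J : Finset ℂ, (∀ j ∈ J, j ∈ U) →
    (∀ g, k ≠ J.card + 2 * g) → ∀ x ∈ U \ (J : Set ℂ), PowerSeries.coeff k (S.amp J x) = 0 := by
  induction k using Nat.strong_induction_on with
  | _ k ih =>
  intro J hJU hk
  rcases Nat.eq_zero_or_pos k with rfl | hkpos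
  · intro x hx
    refine S.coeff_zero_amp (Finset.card_pos.1 ?_) x
    have := hk 0
    omega
  have hform : ∃ d, IsForm (U \ J) S.s (2 * d + 1) (2 * d)
      (fun x => PowerSeries.coeff k (S.amp J x)) := by
    by_cases hJ : J = ∅
    · subst hJ
      obtain ⟨d, hd⟩ := S.isForm_amp_empty hkpos
      exact ⟨d, hd.mono_set Set.sdiff_subset⟩
    · have h1 : 1 ≤ J.card := Finset.card_pos.2 (Finset.nonempty_iff_ne_empty.2 hJ)
      obtain ⟨d, hd⟩ := S.isForm_amp (n := J.card) (k := k) (by have := hk 0; omega)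
      exact ⟨d, hd J rfl hJU⟩
  obtain ⟨d, hd⟩ := hform
  refine S.eq_zero_of_curve_mul hJU hd (S.isRational_loopRight J k) fun x hx => ?_
  obtain ⟨B, hB, hloop⟩ := S.exists_loop hx.1 hx.2
  obtain ⟨l, rfl⟩ : ∃ l, k = l + 1 := ⟨k - 1, by omega⟩
  -- The limit comes from an amplitude with one more point in order `k - 1`; if `k - 1 = |J| + 1 +
  -- 2g` then `k = |J| + 2(g + 1)`, so the induction hypothesis applies.
  have hBl : PowerSeries.coeff l B = 0 := by
    refine tendsto_nhds_unique (hB l) (tendsto_const_nhds.congr' ?_)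
    filter_upwards [S.eventually_mem_sdiff hx.1 J hx.2] with y hy
    obtain ⟨hyU, hyJ, hyx⟩ := hy
    have h1 : PowerSeries.coeff l (amplitude S.M S.D (insert y J) x) = 0 := by
      refine ih l (by omega) (insert y J) ?_ ?_ x ⟨hx.1, ?_⟩
      · intro j hj
        rcases Finset.mem_insert.1 hj with rfl | hj
        · exact hyU
        · exact hJU j hj
      · intro g hg
        rw [Finset.card_insert_of_notMem hyJ] at hg
        exact hk (g + 1) (by omega)
      · simp only [Finset.coe_insert, Set.mem_insert_iff, not_or]
        exact ⟨hyx.symm, hx.2⟩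
    rw [splitAmplitude, map_sub, h1, sub_zero]
    split_ifs with h0
    · have hl : l ≠ 1 := by
        rintro rfl
        exact hk 1 (by rw [h0]; rfl)
      rw [map_smul, PowerSeries.coeff_X, if_neg hl, smul_zero]
    · rw [map_zero]
  have h := congrArg (PowerSeries.coeff (l + 1)) hloop
  rw [map_add, PowerSeries.coeff_succ_X_mul, hBl, add_zero, map_sum] at h
  simp only [PowerSeries.coeff_mul] at h
  -- If both factors of a product had orders allowed for their sets, the orders would add up to an
  -- allowed one. By induction only the two products with the leading one-point amplitude survive,
  -- and the equation becomes linear in the unknown coefficient.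
  rw [← Finset.sum_product', Finset.sum_eq_add (∅, (0, l + 1)) (J, (l + 1, 0))] at h
  · have h1 := S.coeff_trace_insertion hJU hx.1 hx.2 (k := l + 1) (by
      by_contra hc
      push Not at hc
      exact hk 0 (by omega))
    simp only [Finset.sdiff_empty, Finset.sdiff_self, map_sub, h1,
      S.trace_insertion_empty hx.1, map_zero] at h
    rw [← h, ← S.coeff_zero_amp_empty hx.1]
    ring
  · intro e
    have := congrArg (fun q => q.2.1) e
    simp at this
  · rintro ⟨I, p⟩ hIp ⟨hne1, hne2⟩
    obtain ⟨hI, hp⟩ := Finset.mem_product.1 hIp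
    have hI : I ⊆ J := Finset.mem_powerset.1 hI
    have hp : p.1 + p.2 = l + 1 := Finset.HasAntidiagonal.mem_antidiagonal.1 hp
    have hcard := Finset.card_sdiff_add_card_eq_card hI
    have hIU : ∀ j ∈ I, j ∈ U := fun j hj => hJU j (hI hj)
    have hJIU : ∀ j ∈ J \ I, j ∈ U := fun j hj => hJU j (Finset.sdiff_subset hj)
    have hxI : x ∉ I := fun h => hx.2 (hI h)
    have hxJI : x ∉ J \ I := fun h => hx.2 (Finset.sdiff_subset h)
    show PowerSeries.coeff p.1 (S.amp I x) * PowerSeries.coeff p.2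
        (trace (insertion S.M S.D (J \ I) x) - S.amp (J \ I) x) = 0
    by_cases h1 : p.1 = 0
    · rw [h1, S.coeff_zero_amp ?_, zero_mul]
      refine Finset.nonempty_iff_ne_empty.2 fun h0 => hne1 ?_
      exact Prod.ext h0 (Prod.ext h1 (by simp only; omega))
    by_cases h2 : p.2 = 0
    · rw [h2, map_sub, S.coeff_zero_amp ?_, S.coeff_trace_insertion hJIU hx.1 hxJI (by omega),
        sub_zero, mul_zero]
      rw [Finset.sdiff_nonempty]
      intro h0
      exact hne2 (Prod.ext (Finset.Subset.antisymm hI h0) (Prod.ext (by simp only; omega) h2))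
    by_cases h3 : ∃ g, p.1 = I.card + 2 * g
    · obtain ⟨g, hg⟩ := h3
      have h4 : ∀ g', p.2 ≠ (J \ I).card + 2 * g' := fun g' hg' => hk (g + g') (by omega)
      rw [map_sub, ih p.2 (by omega) _ hJIU h4 x ⟨hx.1, hxJI⟩,
        S.coeff_trace_insertion hJIU hx.1 hxJI ?_, sub_zero, mul_zero]
      have := h4 0
      omega
    · push Not at h3
      rw [ih p.1 (by omega) _ hIU h3 x ⟨hx.1, hxI⟩, zero_mul]
  · intro h0
    exact absurd (Finset.mem_product.2 ⟨Finset.empty_mem_powerset J,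
      Finset.HasAntidiagonal.mem_antidiagonal.2 (zero_add _)⟩) h0
  · intro h0
    exact absurd (Finset.mem_product.2 ⟨Finset.mem_powerset_self J,
      Finset.HasAntidiagonal.mem_antidiagonal.2 (add_zero _)⟩) h0

/-- The loop equation in the order `n + 2g`. -/
theorem exists_loop_coeff {J : Finset ℂ} (hJU : ∀ j ∈ J, j ∈ U) {x : ℂ} (hx : x ∈ U)
    (hxJ : x ∉ J) (g : ℕ) : ∃ B : PowerSeries ℂ, S.IsSplitLimit J x B ∧
      ∑ I ∈ J.powerset, ∑ h ∈ Finset.range (g + 1),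
        PowerSeries.coeff (I.card + 2 * h) (S.amp I x)
          * PowerSeries.coeff ((J \ I).card + 2 * (g - h))
            (trace (insertion S.M S.D (J \ I) x) - S.amp (J \ I) x)
        + PowerSeries.coeff (J.card + 2 * g) (PowerSeries.X * B)
      = PowerSeries.coeff (J.card + 2 * g) (S.loopRight J x) := by
  obtain ⟨B, hB, hloop⟩ := S.exists_loop hx hxJ
  refine ⟨B, hB, ?_⟩
  rw [← hloop, map_add, map_sum]
  congr 1
  refine Finset.sum_congr rfl fun I hI => ?_
  have hI := Finset.mem_powerset.1 hI
  have hcard := Finset.card_sdiff_add_card_eq_card hI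
  rw [PowerSeries.coeff_mul]
  -- By the vanishing of the forbidden orders, only genera `h` and `g - h` contribute to the
  -- product.
  refine Finset.sum_of_injOn (fun h => (I.card + 2 * h, (J \ I).card + 2 * (g - h))) ?_ ?_ ?_ ?_
  · intro a _ b _ hab
    have := (Prod.ext_iff.1 hab).1
    simp only at this
    omega
  · intro h hh
    have := Finset.mem_range.1 hh
    simp only [Finset.mem_coe, Finset.HasAntidiagonal.mem_antidiagonal]
    omega
  · intro p hp hp'
    have hp : p.1 + p.2 = J.card + 2 * g := Finset.HasAntidiagonal.mem_antidiagonal.1 hp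
    by_cases h3 : ∃ h, p.1 = I.card + 2 * h
    · obtain ⟨h, hh⟩ := h3
      have h4 : ∀ g', p.2 ≠ (J \ I).card + 2 * g' := by
        intro g' hg'
        refine hp' ⟨h, ?_, Prod.ext hh.symm ?_⟩
        · simp only [Finset.coe_range, Set.mem_Iio]
          omega
        · simp only
          omega
      have hJIU : ∀ j ∈ J \ I, j ∈ U := fun j hj => hJU j (Finset.sdiff_subset hj)
      have hxJI : x ∉ J \ I := fun h => hxJ (Finset.sdiff_subset h)
      rw [map_sub, S.coeff_amp_eq_zero _ _ hJIU h4 x ⟨hx, hxJI⟩,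
        S.coeff_trace_insertion hJIU hx hxJI ?_, sub_zero, mul_zero]
      have := h4 0
      omega
    · push Not at h3
      rw [S.coeff_amp_eq_zero _ _ (fun j hj => hJU j (hI hj)) h3 x ⟨hx, fun h => hxJ (hI h)⟩,
        zero_mul]
  · exact fun h _ => rfl

end SpectralSystem

end PainleveII

namespace PainleveII

/-! ### Residues -/

section Residues

namespace HasResidueAt

variable {F G : ℂ → ℂ} {a r r' : ℂ}

theorem congr (h : HasResidueAt G a r) (hFG : ∀ᶠ z in 𝓝[≠] a, F z = G z) : HasResidueAt F a r := by
  refine ⟨?_, ?_⟩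
  · have h1 : ∀ᶠ z in 𝓝[≠] a, ∀ᶠ y in 𝓝[≠] a, F y = G y := by
      filter_upwards with z using hFG
    filter_upwards [h.1, eventually_eventually_nhdsWithin.2 hFG, eventually_mem_nhdsWithin]
      with z hz hz' hza
    refine hz.congr ?_
    have : ({a}ᶜ : Set ℂ) ∈ 𝓝 z := isOpen_compl_singleton.mem_nhds hza
    rw [nhdsWithin_eq_nhds.2 this] at hz'
    filter_upwards [hz'] with y hy using hy.symm
  · obtain ⟨ε, hε, hball⟩ := Metric.mem_nhdsWithin_iff.1 hFG
    filter_upwards [h.2, Ioo_mem_nhdsGT hε] with ρ hρ hρ'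
    rw [← hρ]
    congr 1
    refine circleIntegral.integral_congr hρ'.1.le fun z hz => hball ⟨?_, ?_⟩
    · rw [Metric.mem_ball, Metric.mem_sphere.1 hz]
      exact hρ'.2
    · exact Metric.ne_of_mem_sphere hz hρ'.1.ne'

theorem eventually_circleIntegrable (h : ∀ᶠ z in 𝓝[≠] a, AnalyticAt ℂ F z) :
    ∀ᶠ ρ : ℝ in 𝓝[>] 0, CircleIntegrable F a ρ := by
  obtain ⟨ε, hε, hball⟩ := Metric.mem_nhdsWithin_iff.1 h
  filter_upwards [Ioo_mem_nhdsGT hε] with ρ hρ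
  refine ContinuousOn.circleIntegrable hρ.1.le fun z hz => ?_
  refine (AnalyticAt.continuousAt (hball ⟨?_, ?_⟩)).continuousWithinAt
  · rw [Metric.mem_ball, Metric.mem_sphere.1 hz]
    exact hρ.2
  · exact Metric.ne_of_mem_sphere hz hρ.1.ne'

theorem add (hF : HasResidueAt F a r) (hG : HasResidueAt G a r') :
    HasResidueAt (fun z => F z + G z) a (r + r') := by
  refine ⟨?_, ?_⟩
  · filter_upwards [hF.1, hG.1] with z h1 h2 using h1.add h2
  · filter_upwards [hF.2, hG.2, eventually_circleIntegrable hF.1,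
      eventually_circleIntegrable hG.1] with ρ h1 h2 h3 h4
    rw [circleIntegral.integral_add h3 h4, mul_add, h1, h2]

theorem const_mul (hF : HasResidueAt F a r) (c : ℂ) :
    HasResidueAt (fun z => c * F z) a (c * r) := by
  refine ⟨?_, ?_⟩
  · filter_upwards [hF.1] with z h1 using analyticAt_const.mul h1
  · filter_upwards [hF.2] with ρ h1
    rw [circleIntegral.integral_const_mul, ← h1]
    ring

theorem of_analyticAt (hF : AnalyticAt ℂ F a) : HasResidueAt F a 0 := by
  refine ⟨hF.eventually_analyticAt.filter_mono nhdsWithin_le_nhds, ?_⟩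
  obtain ⟨ε, hε, hball⟩ := Metric.eventually_nhds_iff_ball.1 hF.eventually_analyticAt
  filter_upwards [Ioo_mem_nhdsGT hε] with ρ hρ
  have hd : DifferentiableOn ℂ F (Metric.closedBall a ρ) := fun z hz =>
    (hball z (Metric.closedBall_subset_ball hρ.2 hz)).differentiableAt.differentiableWithinAt
  rw [DiffContOnCl.circleIntegral_eq_zero hρ.1.le (hd.diffContOnCl_ball le_rfl), mul_zero]

theorem of_hasDerivAt (h : ∀ᶠ z in 𝓝[≠] a, HasDerivAt G (F z) z)
    (hF : ∀ᶠ z in 𝓝[≠] a, AnalyticAt ℂ F z) : HasResidueAt F a 0 := by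
  refine ⟨hF, ?_⟩
  obtain ⟨ε, hε, hball⟩ := Metric.mem_nhdsWithin_iff.1 h
  filter_upwards [Ioo_mem_nhdsGT hε] with ρ hρ
  rw [circleIntegral.integral_eq_zero_of_hasDerivWithinAt hρ.1.le (f := G) (f' := F), mul_zero]
  intro z hz
  refine (hball ⟨?_, ?_⟩ : HasDerivAt G (F z) z).hasDerivWithinAt
  · rw [Metric.mem_ball, Metric.mem_sphere.1 hz]
    exact hρ.2
  · exact Metric.ne_of_mem_sphere hz hρ.1.ne'

theorem sub_inv (a : ℂ) : HasResidueAt (fun z => (z - a)⁻¹) a 1 := by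
  refine ⟨?_, ?_⟩
  · filter_upwards [eventually_mem_nhdsWithin] with z hz
    exact (analyticAt_id.sub analyticAt_const).inv (sub_ne_zero.2 hz)
  · filter_upwards [eventually_mem_nhdsWithin] with ρ hρ
    rw [circleIntegral.integral_sub_center_inv a (ne_of_gt hρ),
      inv_mul_cancel₀ Complex.two_pi_I_ne_zero]

end HasResidueAt

theorem eventually_sq_sub_one_ne (a : ℂ) : ∀ᶠ w in 𝓝[≠] a, w ^ 2 - 1 ≠ 0 := by
  have h : (({1, -1} : Set ℂ) \ {a}).Finite := (Set.toFinite _).sdiff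
  filter_upwards [nhdsWithin_le_nhds (h.isClosed.isOpen_compl.mem_nhds (x := a) (by simp)),
    eventually_mem_nhdsWithin] with w hw hwa h0
  refine hw ⟨?_, hwa⟩
  have : (w - 1) * (w + 1) = 0 := by linear_combination h0
  rcases mul_eq_zero.1 this with h | h
  · exact Or.inl (by linear_combination h)
  · exact Or.inr (by rw [Set.mem_singleton_iff]; linear_combination h)

/-- The sum of the two residues is minus the residue at infinity, the coefficient of `w^{2e-1}`; the
difference of the residues is left unspecified. The pole order is lowered by subtracting exact
derivatives. -/
theorem exists_hasResidueAt_div {e : ℕ} (he : 1 ≤ e) (b : Polynomial ℂ)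
    (hb : b ∈ Polynomial.degreeLT ℂ (2 * e)) :
    ∃ β : ℂ, ∀ a : ℂ, a ^ 2 = 1 → HasResidueAt (fun w => b.eval w / (w ^ 2 - 1) ^ e) a
      (b.coeff (2 * e - 1) / 2 + a * β) := by
  have han : ∀ (b : Polynomial ℂ) (e : ℕ) (a : ℂ), ∀ᶠ z in 𝓝[≠] a,
      AnalyticAt ℂ (fun w => b.eval w / (w ^ 2 - 1) ^ e) z := by
    intro b e a
    filter_upwards [eventually_sq_sub_one_ne a] with z hz
    exact (AnalyticAt.aeval_polynomial analyticAt_id b).div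
      (((analyticAt_id.pow 2).sub analyticAt_const).pow e) (pow_ne_zero _ hz)
  induction e, he using Nat.le_induction generalizing b with
  | base =>
    refine ⟨b.coeff 0 / 2, fun a ha => ?_⟩
    have hb' : b = Polynomial.C (b.coeff 1) * Polynomial.X + Polynomial.C (b.coeff 0) := by
      refine Polynomial.eq_X_add_C_of_degree_le_one ?_
      rw [Polynomial.mem_degreeLT] at hb
      exact Order.le_of_lt_succ hb
    have ha0 : a ≠ 0 := by rintro rfl; norm_num at ha
    have h1 := ((HasResidueAt.sub_inv a).const_mul (b.coeff 1 / 2 + a * (b.coeff 0 / 2))).add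
      (HasResidueAt.of_analyticAt (F := fun z => (b.coeff 1 / 2 - a * (b.coeff 0 / 2)) * (z + a)⁻¹)
      (a := a) ?_)
    · rw [mul_one, add_zero] at h1
      refine h1.congr ?_
      filter_upwards [eventually_sq_sub_one_ne a] with w hw
      have hfac : w ^ 2 - 1 = (w - a) * (w + a) := by linear_combination ha
      have h2 : w - a ≠ 0 := fun h => hw (by rw [hfac, h, zero_mul])
      have h3 : w + a ≠ 0 := fun h => hw (by rw [hfac, h, mul_zero])
      rw [pow_one, hfac]
      nth_rewrite 1 [hb']
      simp only [Polynomial.eval_add, Polynomial.eval_mul, Polynomial.eval_C, Polynomial.eval_X]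
      field_simp
      linear_combination (-2 * b.coeff 0) * ha
    · refine analyticAt_const.mul ((analyticAt_id.add analyticAt_const).inv ?_)
      show a + a ≠ 0
      rw [← two_mul]
      exact mul_ne_zero two_ne_zero ha0
  | succ e he ih =>
    have he0 : (e : ℂ) ≠ 0 := by exact_mod_cast (by omega : e ≠ 0)
    have hm : (Polynomial.X ^ 2 - 1 : Polynomial ℂ).Monic := by
      have := Polynomial.monic_X_pow_sub_C (1 : ℂ) (n := 2) two_ne_zero
      rwa [map_one] at this
    have hmd : (Polynomial.X ^ 2 - 1 : Polynomial ℂ).natDegree = 2 := by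
      have := Polynomial.natDegree_X_pow_sub_C (n := 2) (r := (1 : ℂ))
      rwa [map_one] at this
    set q := b /ₘ (Polynomial.X ^ 2 - 1) with hq
    set ρ := b %ₘ (Polynomial.X ^ 2 - 1) with hρ
    have hbq : ρ + (Polynomial.X ^ 2 - 1) * q = b := Polynomial.modByMonic_add_div b _
    have hρd : ρ.degree ≤ 1 := by
      have := Polynomial.degree_modByMonic_lt b hm
      rw [Polynomial.degree_eq_natDegree hm.ne_zero, hmd] at this
      exact Order.le_of_lt_succ this
    have hρ' := Polynomial.eq_X_add_C_of_degree_le_one hρd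
    have hqd : q ∈ Polynomial.degreeLT ℂ (2 * e) := by
      by_cases hq0 : q = 0
      · rw [hq0]; exact Submodule.zero_mem _
      have h1 : q.natDegree = b.natDegree - 2 := by
        rw [hq, Polynomial.natDegree_divByMonic _ hm, hmd]
      have hb0 : b ≠ 0 := by rintro rfl; simp [hq] at hq0
      rw [Polynomial.mem_degreeLT, Polynomial.degree_eq_natDegree hb0] at hb
      rw [Polynomial.mem_degreeLT, Polynomial.degree_eq_natDegree hq0, h1]
      norm_cast at *
      omega
    have hcoeff : b.coeff (2 * (e + 1) - 1) = q.coeff (2 * e - 1) := by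
      rw [← hbq, Polynomial.coeff_add, sub_mul, one_mul, Polynomial.coeff_sub,
        show 2 * (e + 1) - 1 = (2 * e - 1) + 2 by omega, Polynomial.coeff_X_pow_mul]
      have h1 : ρ.coeff (2 * e - 1 + 2) = 0 :=
        Polynomial.coeff_eq_zero_of_degree_lt (lt_of_le_of_lt hρd (by norm_cast; omega))
      have h2 : q.coeff (2 * e - 1 + 2) = 0 :=
        Polynomial.coeff_eq_zero_of_degree_lt (lt_of_lt_of_le (Polynomial.mem_degreeLT.1 hqd)
          (by norm_cast; omega))
      rw [h1, h2]
      ring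
    obtain ⟨β₁, h1⟩ := ih q hqd
    obtain ⟨β₂, h2⟩ := ih 1 (Polynomial.mem_degreeLT.2
      (by rw [Polynomial.degree_one]; norm_cast; omega))
    -- The factor comes from `(w/(w² - 1)^e)' = (1 - 2e)/(w² - 1)^e - 2e/(w² - 1)^{e+1}`; the linear
    -- part of `ρ` is itself a multiple of the derivative of `1/(w² - 1)^e`.
    refine ⟨β₁ + ρ.coeff 0 * ((1 - 2 * e) / (2 * e) * β₂), fun a ha => ?_⟩
    have h3 := h1 a ha
    have h4 := h2 a ha
    have hone : (1 : Polynomial ℂ).coeff (2 * e - 1) = 0 := by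
      rw [Polynomial.coeff_one, if_neg (by omega)]
    rw [hone] at h4
    have hd : ∀ (b : Polynomial ℂ) (w : ℂ), w ^ 2 - 1 ≠ 0 →
        HasDerivAt (fun w => b.eval w / (w ^ 2 - 1) ^ e)
          ((b.derivative * (Polynomial.X ^ 2 - 1) - 2 * (e : Polynomial ℂ) * Polynomial.X * b).eval w
            / (w ^ 2 - 1) ^ (e + 1)) w := by
      intro b w hw
      have h5 := (b.hasDerivAt w).div ((((hasDerivAt_id w).pow 2).sub_const 1).pow e)
        (pow_ne_zero e hw)
      refine h5.congr_deriv ?_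
      obtain ⟨e, rfl⟩ : ∃ e', e = e' + 1 := ⟨e - 1, by omega⟩
      simp only [Polynomial.eval_sub, Polynomial.eval_mul, Polynomial.eval_pow, Polynomial.eval_X,
        Polynomial.eval_one, Polynomial.eval_ofNat, Polynomial.eval_natCast, id,
        Nat.add_sub_cancel, Pi.pow_apply]
      field_simp
      push_cast
      ring
    have h6 : ∀ b : Polynomial ℂ, HasResidueAt (fun w => (b.derivative * (Polynomial.X ^ 2 - 1)
        - 2 * (e : Polynomial ℂ) * Polynomial.X * b).eval w / (w ^ 2 - 1) ^ (e + 1)) a 0 := by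
      intro b
      refine HasResidueAt.of_hasDerivAt (G := fun w => b.eval w / (w ^ 2 - 1) ^ e) ?_ (han _ _ a)
      filter_upwards [eventually_sq_sub_one_ne a] with w hw using hd b w hw
    have h7 := (h3.add ((h4.const_mul ((1 - 2 * e) / (2 * e))).const_mul (ρ.coeff 0))).add
      (((h6 Polynomial.X).const_mul (-ρ.coeff 0 / (2 * e))).add
        ((h6 1).const_mul (-ρ.coeff 1 / (2 * e))))
    have h8 := h7.congr (F := fun w => b.eval w / (w ^ 2 - 1) ^ (e + 1)) ?_
    · convert h8 using 1
      rw [hcoeff]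
      ring
    · filter_upwards [eventually_sq_sub_one_ne a] with w hw
      have hρe : ρ.eval w = ρ.coeff 1 * w + ρ.coeff 0 := by
        conv_lhs => rw [hρ']
        simp
      rw [← hbq, Polynomial.eval_add, hρe]
      simp only [Polynomial.eval_sub, Polynomial.eval_mul, Polynomial.eval_pow, Polynomial.eval_X,
        Polynomial.eval_one, Polynomial.eval_ofNat, Polynomial.eval_natCast, Polynomial.derivative_X, Polynomial.derivative_one, Polynomial.eval_zero]
      rw [pow_succ]
      field_simp
      ring

/-- The sum of the residues at `±1` of the recursion kernel times a symmetric differential with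
poles at `±1`. -/
theorem exists_hasResidueAt_kernel_mul {e : ℕ} (he : 1 ≤ e) (P : Polynomial ℂ)
    (hP : P ∈ Polynomial.degreeLT ℂ (2 * e - 1))
    (hsymm : ∀ w : ℂ, w ≠ 0 → w ^ 2 - 1 ≠ 0 → P.eval (1 / w) / ((1 / w) ^ 2 - 1) ^ e
      = w ^ 2 * (P.eval w / (w ^ 2 - 1) ^ e)) {p : ℂ} (hp : p ^ 2 - 1 ≠ 0) :
    ∃ r₁ r₂ : ℂ,
      HasResidueAt (fun w => (w ^ 2 - 1) / (2 * ((w - p) * (1 - p * w)))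
        * (P.eval w / (w ^ 2 - 1) ^ e)) 1 r₁ ∧
      HasResidueAt (fun w => (w ^ 2 - 1) / (2 * ((w - p) * (1 - p * w)))
        * (P.eval w / (w ^ 2 - 1) ^ e)) (-1) r₂ ∧
      r₁ + r₂ = P.eval p / (p ^ 2 - 1) ^ e := by
  set K : Polynomial ℂ := (Polynomial.X - Polynomial.C p) * (1 - Polynomial.C p * Polynomial.X)
    with hK
  set Q : Polynomial ℂ := Polynomial.X ^ 2 - 1 with hQ
  have hm : Q.Monic := by
    have := Polynomial.monic_X_pow_sub_C (1 : ℂ) (n := 2) two_ne_zero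
    rwa [map_one] at this
  have hmd : Q.natDegree = 2 := by
    have := Polynomial.natDegree_X_pow_sub_C (n := 2) (r := (1 : ℂ))
    rwa [map_one] at this
  have hKe : ∀ w, K.eval w = (w - p) * (1 - p * w) := fun w => by simp [hK]
  have hQe : ∀ w, Q.eval w = w ^ 2 - 1 := fun w => by simp [hQ]
  have hKa : ∀ a : ℂ, a ^ 2 = 1 → K.eval a ≠ 0 := by
    intro a ha h0
    rw [hKe] at h0
    apply hp
    rcases mul_eq_zero.1 h0 with h | h
    · rw [← sub_eq_zero.1 h, ha, sub_self]
    · linear_combination (-(p * a + 1)) * h - p ^ 2 * (ha) + (p ^ 2 - p ^ 2) * h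
  have hcop : IsCoprime K (Q ^ e) := by
    refine IsCoprime.pow_right ?_
    have hfac : Q = (Polynomial.X - Polynomial.C 1) * (Polynomial.X - Polynomial.C (-1)) := by
      rw [hQ, map_neg, map_one]; ring
    rw [hfac]
    exact IsCoprime.mul_right
      ((Polynomial.irreducible_X_sub_C (1 : ℂ)).coprime_iff_not_dvd.2 fun h =>
        hKa 1 (by norm_num) (Polynomial.dvd_iff_isRoot.1 h)).symm
      ((Polynomial.irreducible_X_sub_C (-1 : ℂ)).coprime_iff_not_dvd.2 fun h =>
        hKa (-1) (by norm_num) (Polynomial.dvd_iff_isRoot.1 h)).symm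
  have hQem : (Q ^ e).Monic := hm.pow e
  have hQed : (Q ^ e).natDegree = 2 * e := by rw [hm.natDegree_pow, hmd, mul_comm]
  obtain ⟨α, γ, hαγ⟩ := hcop
  set b := (α * P * Q) %ₘ (Q ^ e) with hb
  have hbm := Polynomial.modByMonic_add_div (α * P * Q) (Q ^ e)
  rw [← hb] at hbm
  -- Partial fractions: `P Q / (K Q^e) = b / Q^e + a / K`, the first term having its poles at `±1`
  -- and the second at `p` and `1/p`. Only `b` contributes to the residues at `±1`.
  obtain ⟨a, hab⟩ : ∃ a, P * Q = b * K + a * Q ^ e :=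
    ⟨K * ((α * P * Q) /ₘ (Q ^ e)) + γ * P * Q, by linear_combination (-K) * hbm - P * Q * hαγ⟩
  have hbd : b ∈ Polynomial.degreeLT ℂ (2 * e) := by
    rw [Polynomial.mem_degreeLT, ← hQed, ← Polynomial.degree_eq_natDegree hQem.ne_zero]
    exact Polynomial.degree_modByMonic_lt _ hQem
  have hbz : ∀ i, 2 * e ≤ i → b.coeff i = 0 := fun i hi =>
    Polynomial.coeff_eq_zero_of_degree_lt (lt_of_lt_of_le (Polynomial.mem_degreeLT.1 hbd)
      (by exact_mod_cast hi))
  have hPz : ∀ i, 2 * e - 1 ≤ i → P.coeff i = 0 := fun i hi =>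
    Polynomial.coeff_eq_zero_of_degree_lt (lt_of_lt_of_le (Polynomial.mem_degreeLT.1 hP)
      (by exact_mod_cast hi))
  have hKX : K = Polynomial.C (-p) * Polynomial.X ^ 2 + Polynomial.C (1 + p ^ 2) * Polynomial.X
      + Polynomial.C (-p) := by
    rw [hK]
    simp only [map_neg, map_add, map_pow, map_one]
    ring
  have hbK : ∀ i, (b * K).coeff (i + 2) = -p * b.coeff i + (1 + p ^ 2) * b.coeff (i + 1)
      + -p * b.coeff (i + 2) := by
    intro i
    have : b * K = Polynomial.C (-p) * (b * Polynomial.X ^ 2)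
        + Polynomial.C (1 + p ^ 2) * (b * Polynomial.X) + Polynomial.C (-p) * b := by
      rw [hKX]; ring
    rw [this]
    simp only [Polynomial.coeff_add, Polynomial.coeff_C_mul, Polynomial.coeff_mul_X_pow]
    rw [show i + 2 = (i + 1) + 1 from rfl, Polynomial.coeff_mul_X]
  have hPQ : ∀ i, (P * Q).coeff (i + 2) = P.coeff i - P.coeff (i + 2) := by
    intro i
    rw [hQ, mul_sub, mul_one, Polynomial.coeff_sub, Polynomial.coeff_mul_X_pow]
  have had : a ∈ Polynomial.degreeLT ℂ 2 := by
    by_cases ha0 : a = 0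
    · rw [ha0]; exact Submodule.zero_mem _
    have h1 : (a * Q ^ e).natDegree ≤ 2 * e + 1 := by
      rw [show a * Q ^ e = P * Q - b * K by rw [hab]; ring]
      refine Polynomial.natDegree_le_iff_coeff_eq_zero.2 fun i hi => ?_
      obtain ⟨i, rfl⟩ : ∃ i', i = i' + 2 := ⟨i - 2, by omega⟩
      rw [Polynomial.coeff_sub, hPQ, hbK, hPz _ (by omega), hPz _ (by omega), hbz _ (by omega),
        hbz _ (by omega), hbz _ (by omega)]
      ring
    rw [mul_comm, hQem.natDegree_mul' ha0, hQed] at h1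
    rw [Polynomial.mem_degreeLT, Polynomial.degree_eq_natDegree ha0]
    norm_cast
    omega
  have ha1 : a = Polynomial.C (a.coeff 1) * Polynomial.X + Polynomial.C (a.coeff 0) :=
    Polynomial.eq_X_add_C_of_degree_le_one (Order.le_of_lt_succ (Polynomial.mem_degreeLT.1 had))
  have hae : ∀ w, a.eval w = a.coeff 1 * w + a.coeff 0 := fun w => by
    conv_lhs => rw [ha1]
    simp
  have htop : ∀ i, (a * Q ^ e).coeff (i + 2 * e) = a.coeff i + (if i = 0 then
      a.coeff 1 * (Polynomial.X * Q ^ e).coeff (2 * e) else 0) := by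
    intro i
    have hQtop : (Q ^ e).coeff (2 * e) = 1 := by
      have := hQem.coeff_natDegree
      rwa [hQed] at this
    have hQz : ∀ i, 2 * e < i → (Q ^ e).coeff i = 0 := fun i hi =>
      Polynomial.coeff_eq_zero_of_natDegree_lt (by rwa [hQed])
    have h1 : a * Q ^ e = Polynomial.C (a.coeff 1) * (Polynomial.X * Q ^ e)
        + Polynomial.C (a.coeff 0) * Q ^ e := by
      nth_rewrite 1 [ha1]; ring
    rw [h1, Polynomial.coeff_add, Polynomial.coeff_C_mul, Polynomial.coeff_C_mul]
    rcases i with _ | _ | i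
    · rw [zero_add, if_pos rfl, hQtop]
      ring
    · rw [show 0 + 1 + 2 * e = 2 * e + 1 by ring, Polynomial.coeff_X_mul, hQtop,
        hQz _ (by omega), if_neg (by omega)]
      ring
    · have h2 : a.coeff (i + 1 + 1) = 0 :=
        Polynomial.coeff_eq_zero_of_degree_lt (lt_of_lt_of_le (Polynomial.mem_degreeLT.1 had)
          (by norm_cast; omega))
      rw [show i + 1 + 1 + 2 * e = (i + 1 + 2 * e) + 1 by ring, Polynomial.coeff_X_mul,
        hQz _ (by omega), hQz (i + 1 + 2 * e + 1) (by omega), if_neg (by omega), h2]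
      ring
  -- Comparison of the coefficients of degree `2e + 1`; the left side has none because `P` has
  -- degree below `2e - 1`.
  have e1 : a.coeff 1 = p * b.coeff (2 * e - 1) := by
    have h1 := congrArg (fun q => Polynomial.coeff q ((2 * e - 1) + 2)) hab
    simp only [Polynomial.coeff_add] at h1
    rw [hPQ, hbK, hPz _ (by omega), hPz _ (by omega), hbz (2 * e - 1 + 1) (by omega),
      hbz (2 * e - 1 + 2) (by omega), show 2 * e - 1 + 2 = 1 + 2 * e by omega, htop, if_neg one_ne_zero] at h1
    linear_combination -h1
  have hev : ∀ w, P.eval w * (w ^ 2 - 1) = b.eval w * ((w - p) * (1 - p * w))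
      + (a.coeff 1 * w + a.coeff 0) * (w ^ 2 - 1) ^ e := by
    intro w
    have h1 := congrArg (Polynomial.eval w) hab
    simpa only [Polynomial.eval_add, Polynomial.eval_mul, Polynomial.eval_pow, hKe, hQe, hae]
      using h1
  have hval : b.coeff (2 * e - 1) = 2 * (P.eval p / (p ^ 2 - 1) ^ e) := by
    -- For `p ≠ 0` the values at the two zeros `p` and `1/p` of `K`, related by `hsymm`, determine
    -- the top coefficient of `b`. For `p = 0` the second zero has moved to infinity, and the
    -- leading coefficients take its place.
    by_cases hp0 : p = 0
    · subst hp0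
      have h1 := congrArg (fun q => Polynomial.coeff q ((2 * e - 2) + 2)) hab
      simp only [Polynomial.coeff_add] at h1
      rw [hPQ, hbK, hPz (2 * e - 2 + 2) (by omega), show 2 * e - 2 + 1 = 2 * e - 1 by omega,
        show 2 * e - 2 + 2 = 0 + 2 * e by omega, htop, e1] at h1
      have h2 := hev 0
      -- The symmetry `w ↦ 1/w` as an identity of polynomials; it relates the top coefficient of `P`
      -- to its value at `0`.
      have hrefl : P.reflect (2 * e - 2) = Polynomial.C ((-1) ^ e) * P := by
        have hfin : ({0, 1, -1} : Set ℂ)ᶜ.Infinite := (Set.toFinite _).infinite_compl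
        refine Polynomial.eq_of_infinite_eval_eq _ _ (hfin.mono fun w hw => ?_)
        simp only [Set.mem_compl_iff, Set.mem_insert_iff, Set.mem_singleton_iff, not_or] at hw
        obtain ⟨hw0, hw1, hw2⟩ := hw
        have hw3 : w ^ 2 - 1 ≠ 0 := by
          rw [show w ^ 2 - 1 = (w - 1) * (w + 1) by ring]
          exact mul_ne_zero (sub_ne_zero.2 hw1) (fun h => hw2 (by linear_combination h))
        show Polynomial.eval w _ = Polynomial.eval w _
        have hw0' : w⁻¹ ≠ 0 := inv_ne_zero hw0
        let _ : Invertible (w⁻¹) := invertibleOfNonzero hw0'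
        have h3 := Polynomial.eval₂_reflect_mul_pow (RingHom.id ℂ) (w⁻¹) (2 * e - 2) P
          (Polynomial.natDegree_le_iff_coeff_eq_zero.2 fun i hi => hPz i (by omega))
        simp only [invOf_eq_inv, inv_inv, Polynomial.eval₂_id] at h3
        have h4 := hsymm w hw0 hw3
        rw [one_div, show (w⁻¹) ^ 2 - 1 = -(w ^ 2 - 1) * (w⁻¹) ^ 2 by field_simp; ring, mul_pow,
          neg_pow, ← pow_mul, ← h3] at h4
        have h5 : (w⁻¹) ^ (2 * e) = (w⁻¹) ^ (2 * e - 2) * (w⁻¹) ^ 2 := by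
          rw [← pow_add]; congr 1; omega
        rw [h5] at h4
        have h6 : (-1 : ℂ) ^ e * (-1) ^ e = 1 := by rw [← mul_pow]; norm_num
        have h7 : (-1 : ℂ) ^ e ≠ 0 := pow_ne_zero _ (by norm_num)
        rw [Polynomial.eval_mul, Polynomial.eval_C]
        field_simp at h4
        linear_combination h4
      have h8 := congrArg (fun q => Polynomial.coeff q 0) hrefl
      simp only [Polynomial.coeff_reflect, Polynomial.coeff_C_mul] at h8
      rw [Polynomial.revAt_le (Nat.zero_le _), Nat.sub_zero] at h8
      have h9 : P.coeff 0 = P.eval 0 := Polynomial.coeff_zero_eq_eval_zero P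
      have h6 : (-1 : ℂ) ^ e * (-1) ^ e = 1 := by rw [← mul_pow]; norm_num
      have h10 : ((0 : ℂ) ^ 2 - 1) = -1 := by norm_num
      rw [h10] at h2 ⊢
      rw [e1] at h2
      rw [h9] at h8
      have h7 : (-1 : ℂ) ^ e ≠ 0 := pow_ne_zero _ (by norm_num)
      have h11 : P.eval 0 / (-1) ^ e = (-1) ^ e * P.eval 0 := by
        rw [div_eq_iff h7]
        linear_combination (-P.eval 0) * h6
      rw [h11]
      simp only [if_true] at h1
      linear_combination -h1 + h8 + ((-1) ^ e) * h2 + a.coeff 0 * h6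
    · have h1 := hev p
      have h2 := hev (1 / p)
      have hp1 : (1 / p) ^ 2 - 1 ≠ 0 := by
        rw [show (1 / p) ^ 2 - 1 = -(p ^ 2 - 1) * (1 / p) ^ 2 by field_simp; ring]
        exact mul_ne_zero (neg_ne_zero.2 hp) (pow_ne_zero _ (one_div_ne_zero hp0))
      have h3 := hsymm p hp0 hp
      set ω := P.eval p / (p ^ 2 - 1) ^ e with hω
      have hpe := pow_ne_zero e hp
      have hpe' := pow_ne_zero e hp1
      rw [div_eq_iff hpe'] at h3
      have h4 : P.eval p = ω * (p ^ 2 - 1) ^ e := by rw [hω]; field_simp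
      rw [h3] at h2
      rw [h4] at h1
      have h5 : ω * (p ^ 2 - 1) = a.coeff 1 * p + a.coeff 0 :=
        mul_right_cancel₀ hpe (by linear_combination h1)
      have h6 : p ^ 2 * ω * ((1 / p) ^ 2 - 1) = a.coeff 1 * (1 / p) + a.coeff 0 := by
        refine mul_right_cancel₀ hpe' ?_
        have : 1 - p * (1 / p) = 0 := by field_simp; ring
        rw [this] at h2
        linear_combination h2
      rw [e1] at h5 h6
      field_simp at h6
      refine mul_left_cancel₀ (mul_ne_zero hp hp0) ?_
      linear_combination (-p) * h5 + (p) * h6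
  obtain ⟨β, hβ⟩ := exists_hasResidueAt_div he b hbd
  have main : ∀ x : ℂ, x ^ 2 = 1 → HasResidueAt (fun w => (w ^ 2 - 1) /
      (2 * ((w - p) * (1 - p * w))) * (P.eval w / (w ^ 2 - 1) ^ e)) x
      (1 / 2 * (b.coeff (2 * e - 1) / 2 + x * β)) := by
    intro x hx
    have hKx := hKa x hx
    rw [hKe] at hKx
    have han : AnalyticAt ℂ (fun w => (a.coeff 1 * w + a.coeff 0)
        / (2 * ((w - p) * (1 - p * w)))) x := by
      refine AnalyticAt.div ?_ ?_ (mul_ne_zero two_ne_zero hKx)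
      · exact (analyticAt_const.mul analyticAt_id).add analyticAt_const
      · exact analyticAt_const.mul ((analyticAt_id.sub analyticAt_const).mul
          (analyticAt_const.sub (analyticAt_const.mul analyticAt_id)))
    have h1 := ((hβ x hx).const_mul (1 / 2)).add (HasResidueAt.of_analyticAt han)
    rw [add_zero] at h1
    refine h1.congr ?_
    have hK2 : ∀ᶠ w in 𝓝[≠] x, (w - p) * (1 - p * w) ≠ 0 := by
      refine Filter.Eventually.filter_mono nhdsWithin_le_nhds (ContinuousAt.eventually_ne ?_ hKx)
      fun_prop
    filter_upwards [eventually_sq_sub_one_ne x, hK2] with w hw hw2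
    have := hev w
    generalize (w - p) * (1 - p * w) = κ at *
    field_simp
    linear_combination this
  refine ⟨_, _, main 1 (by norm_num), main (-1) (by norm_num), ?_⟩
  rw [hval]
  ring

end Residues

end PainleveII

namespace PainleveII

/-! ### Symmetric rational differentials -/

section Lift

/-- The branch of `√(u₀² - x²)` in the uniformising coordinate. -/
def sParam (u₀ z : ℂ) : ℂ := Complex.I * u₀ / 2 * (z - 1 / z)

/-- The differential `x^m dx / s^{2d+3}` in the uniformising coordinate. -/
def liftFactor (u₀ : ℂ) (d m : ℕ) (z : ℂ) : ℂ :=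
  u₀ / 2 / (Complex.I * u₀ / 2) ^ (2 * d + 3) * (u₀ / 2) ^ m
    * ((z ^ 2 + 1) ^ m * z ^ (2 * d + 1 - m)) / (z ^ 2 - 1) ^ (2 * d + 2)

/-- The bound on `m` keeps the exponent of `z` nonnegative, so the differential has no pole at `z =
0`. -/
theorem liftFactor_eq {u₀ z : ℂ} (hu : u₀ ≠ 0) (hz : z ≠ 0) (hz' : z ^ 2 - 1 ≠ 0) {d m : ℕ}
    (hm : m ≤ 2 * d + 1) : liftFactor u₀ d m z
      = xParam u₀ z ^ m * (dxParam u₀ z / sParam u₀ z ^ (2 * d + 3)) := by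
  obtain ⟨r, hr⟩ := Nat.exists_eq_add_of_le hm
  have e1 : xParam u₀ z = u₀ / 2 * (z ^ 2 + 1) / z := by rw [xParam]; field_simp
  have e2 : dxParam u₀ z = u₀ / 2 * (z ^ 2 - 1) / z ^ 2 := by rw [dxParam]; field_simp
  have e3 : sParam u₀ z = Complex.I * u₀ / 2 * (z ^ 2 - 1) / z := by rw [sParam]; field_simp
  have hc : Complex.I * u₀ / 2 ≠ 0 := by simp [hu]
  rw [liftFactor, e1, e2, e3, show 2 * d + 1 - m = r by omega]
  generalize z ^ 2 - 1 = q at *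
  generalize z ^ 2 + 1 = q' at *
  generalize Complex.I * u₀ / 2 = c at *
  have e4 : q ^ (2 * d + 3) = q ^ (2 * d + 2) * q := pow_succ _ _
  have e5 : z ^ (2 * d + 3) = z ^ m * z ^ r * z ^ 2 := by
    rw [← pow_add, ← pow_add]; congr 1; omega
  simp only [div_pow, mul_pow, e4, e5]
  field_simp

/-- Under `z ↦ 1/z` the function `x` is invariant and `s` changes sign; `s` enters to an odd power,
so the differential is odd. -/
theorem liftFactor_inv (u₀ : ℂ) {z : ℂ} (hz : z ≠ 0) {d m : ℕ} (hm : m ≤ 2 * d + 1) :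
    liftFactor u₀ d m (1 / z) = z ^ 2 * liftFactor u₀ d m z := by
  obtain ⟨r, hr⟩ := Nat.exists_eq_add_of_le hm
  rw [liftFactor, liftFactor, show 2 * d + 1 - m = r by omega]
  -- At `z = ±1` both sides are zero because division by zero is zero.
  by_cases hz' : z ^ 2 - 1 = 0
  · have : (1 / z) ^ 2 - 1 = 0 := by
      rw [div_pow, sub_eq_zero.1 hz']; norm_num
    rw [this, hz']
    simp
  have e1 : (1 / z) ^ 2 - 1 = -(z ^ 2 - 1) / z ^ 2 := by field_simp; ring
  have e2 : (1 / z) ^ 2 + 1 = (z ^ 2 + 1) / z ^ 2 := by field_simp; ring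
  rw [e1, e2]
  generalize z ^ 2 - 1 = q at *
  generalize z ^ 2 + 1 = q' at *
  have e3 : (-q) ^ (2 * d + 2) = q ^ (2 * d + 2) := by
    rw [show 2 * d + 2 = 2 * (d + 1) by ring, pow_mul, neg_sq, ← pow_mul]
  have e5 : (z ^ 2) ^ (2 * d + 2) = (z ^ 2) ^ m * z ^ r * z ^ r * z ^ 2 := by
    rw [← pow_mul, ← pow_mul, ← pow_add, ← pow_add, ← pow_add]; congr 1; omega
  simp only [div_pow, one_pow, e3, e5]
  field_simp

variable {n : ℕ}

/-- The differential obtained from a symmetric function `F(x₁,…,xₙ) / ∏ s(xᵢ)^{2d+3}`. -/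
def liftForm (u₀ : ℂ) (d : ℕ) (F : MvPolynomial (Fin n) ℂ) (z : Fin n → ℂ) : ℂ :=
  ∑ m ∈ F.support, MvPolynomial.coeff m F * ∏ i, liftFactor u₀ d (m i) (z i)

theorem liftForm_eq {u₀ : ℂ} (hu : u₀ ≠ 0) {d : ℕ} {F : MvPolynomial (Fin n) ℂ}
    (hF : ∀ i, MvPolynomial.degreeOf i F ≤ 2 * d + 1) {z : Fin n → ℂ} (hz : ∀ i, z i ≠ 0)
    (hz' : ∀ i, z i ^ 2 - 1 ≠ 0) : liftForm u₀ d F z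
      = MvPolynomial.eval (fun i => xParam u₀ (z i)) F
        * ∏ i, (dxParam u₀ (z i) / sParam u₀ (z i) ^ (2 * d + 3)) := by
  rw [liftForm, MvPolynomial.eval_eq', Finset.sum_mul]
  refine Finset.sum_congr rfl fun m hm => ?_
  rw [mul_assoc, ← Finset.prod_mul_distrib]
  congr 1
  refine Finset.prod_congr rfl fun i _ => ?_
  rw [liftFactor_eq hu (hz i) (hz' i) (MvPolynomial.degreeOf_le_iff.1 (hF i) m hm)]

theorem liftForm_update_inv (u₀ : ℂ) {d : ℕ} {F : MvPolynomial (Fin n) ℂ}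
    (hF : ∀ i, MvPolynomial.degreeOf i F ≤ 2 * d + 1) (z : Fin n → ℂ) (i : Fin n) {w : ℂ}
    (hw : w ≠ 0) : liftForm u₀ d F (Function.update z i (1 / w))
      = w ^ 2 * liftForm u₀ d F (Function.update z i w) := by
  rw [liftForm, liftForm, Finset.mul_sum]
  refine Finset.sum_congr rfl fun m hm => ?_
  rw [← Finset.mul_prod_erase _ _ (Finset.mem_univ i),
    ← Finset.mul_prod_erase _ _ (Finset.mem_univ i), Function.update_self, Function.update_self,
    liftFactor_inv u₀ hw (MvPolynomial.degreeOf_le_iff.1 (hF i) m hm)]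
  have : ∏ l ∈ Finset.univ.erase i, liftFactor u₀ d (m l) (Function.update z i (1 / w) l)
      = ∏ l ∈ Finset.univ.erase i, liftFactor u₀ d (m l) (Function.update z i w l) :=
    Finset.prod_congr rfl fun l hl => by
      rw [Function.update_of_ne (Finset.ne_of_mem_erase hl),
        Function.update_of_ne (Finset.ne_of_mem_erase hl)]
  rw [this]
  ring

/-- The degree bound expresses decay like `w⁻²`, that is, regularity of the differential at `w = ∞`;
it is the hypothesis of the residue formula. -/
theorem exists_liftForm_update_eq (u₀ : ℂ) {d : ℕ} {F : MvPolynomial (Fin n) ℂ}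
    (hF : ∀ i, MvPolynomial.degreeOf i F ≤ 2 * d + 1) (z : Fin n → ℂ) (i : Fin n) :
    ∃ p ∈ Polynomial.degreeLT ℂ (2 * (2 * d + 2) - 1), ∀ w,
      liftForm u₀ d F (Function.update z i w) = p.eval w / (w ^ 2 - 1) ^ (2 * d + 2) := by
  refine ⟨∑ m ∈ F.support, (MvPolynomial.coeff m F
    * (∏ l ∈ Finset.univ.erase i, liftFactor u₀ d (m l) (z l))
    * (u₀ / 2 / (Complex.I * u₀ / 2) ^ (2 * d + 3) * (u₀ / 2) ^ (m i))) •
      ((Polynomial.X ^ 2 + 1) ^ (m i) * Polynomial.X ^ (2 * d + 1 - m i)),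
    Submodule.sum_mem _ fun m hm => Submodule.smul_mem _ _ ?_, fun w => ?_⟩
  · have hm := MvPolynomial.degreeOf_le_iff.1 (hF i) m hm
    rw [Polynomial.mem_degreeLT]
    refine lt_of_le_of_lt Polynomial.degree_le_natDegree ?_
    norm_cast
    refine lt_of_le_of_lt Polynomial.natDegree_mul_le ?_
    rw [Polynomial.natDegree_X_pow]
    have h1 : ((Polynomial.X ^ 2 + 1 : Polynomial ℂ) ^ (m i)).natDegree ≤ m i * 2 := by
      refine Polynomial.natDegree_pow_le.trans (Nat.mul_le_mul_left _ ?_)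
      refine (Polynomial.natDegree_add_le _ _).trans ?_
      simp
    omega
  · rw [liftForm, Polynomial.eval_finsetSum, Finset.sum_div]
    refine Finset.sum_congr rfl fun m _ => ?_
    rw [← Finset.mul_prod_erase _ _ (Finset.mem_univ i), Function.update_self]
    have : ∏ l ∈ Finset.univ.erase i, liftFactor u₀ d (m l) (Function.update z i w l)
        = ∏ l ∈ Finset.univ.erase i, liftFactor u₀ d (m l) (z l) :=
      Finset.prod_congr rfl fun l hl => by
        rw [Function.update_of_ne (Finset.ne_of_mem_erase hl)]
    rw [this, liftFactor]
    simp only [Polynomial.eval_smul, Polynomial.eval_mul, Polynomial.eval_pow, Polynomial.eval_add,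
      Polynomial.eval_X, Polynomial.eval_one, smul_eq_mul]
    ring

theorem exists_liftForm_eq_div (u₀ : ℂ) (d : ℕ) (F : MvPolynomial (Fin n) ℂ) :
    ∃ P : MvPolynomial (Fin n) ℂ, ∀ z, liftForm u₀ d F z
      = MvPolynomial.eval z P / ∏ i, (z i ^ 2 - 1) ^ (2 * d + 2) := by
  refine ⟨∑ m ∈ F.support, MvPolynomial.C (MvPolynomial.coeff m F) * ∏ i,
    (MvPolynomial.C (u₀ / 2 / (Complex.I * u₀ / 2) ^ (2 * d + 3) * (u₀ / 2) ^ (m i))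
      * ((MvPolynomial.X i ^ 2 + 1) ^ (m i) * MvPolynomial.X i ^ (2 * d + 1 - m i))),
    fun z => ?_⟩
  rw [liftForm, map_sum, Finset.sum_div]
  refine Finset.sum_congr rfl fun m _ => ?_
  rw [map_mul, MvPolynomial.eval_C, map_prod, mul_div_assoc, ← Finset.prod_div_distrib]
  congr 1
  refine Finset.prod_congr rfl fun i _ => ?_
  rw [liftFactor]
  simp only [map_mul, map_pow, map_add, MvPolynomial.eval_C, MvPolynomial.eval_X, map_one]

end Lift

/-! ### Rational functions of a point `w` and parameters `z` -/

section Parametric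

variable {n : ℕ}

/-- Evaluation of a polynomial in `w` with coefficients in `ℂ[z]`. -/
def evalAt (z : Fin n → ℂ) (w : ℂ) : Polynomial (MvPolynomial (Fin n) ℂ) →+* ℂ :=
  Polynomial.eval₂RingHom (MvPolynomial.eval z) w

theorem evalAt_X (z : Fin n → ℂ) (w : ℂ) : evalAt z w Polynomial.X = w := by simp [evalAt]

theorem evalAt_C (z : Fin n → ℂ) (w : ℂ) (p : MvPolynomial (Fin n) ℂ) :
    evalAt z w (Polynomial.C p) = MvPolynomial.eval z p := by simp [evalAt]

/-- The common denominator of the differentials at the points `w`, `1/w` and `z`. -/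
def denomPoly (n : ℕ) : Polynomial (MvPolynomial (Fin n) ℂ) :=
  Polynomial.X * (Polynomial.X ^ 2 - 1) * ∏ i, ((Polynomial.C (MvPolynomial.X i ^ 2 - 1)
    * (Polynomial.X - Polynomial.C (MvPolynomial.X i)))
    * (1 - Polynomial.X * Polynomial.C (MvPolynomial.X i)))

/-- `f` is a polynomial divided by a power of the common denominator. -/
def IsParametric (f : (Fin n → ℂ) → ℂ → ℂ) : Prop :=
  ∃ (e : ℕ) (N : Polynomial (MvPolynomial (Fin n) ℂ)), ∀ z w, evalAt z w (denomPoly n) ≠ 0 →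
    f z w * evalAt z w (denomPoly n) ^ e = evalAt z w N

namespace IsParametric

variable {f g : (Fin n → ℂ) → ℂ → ℂ}

theorem congr (h : IsParametric f) (hfg : ∀ z w, evalAt z w (denomPoly n) ≠ 0 → g z w = f z w) :
    IsParametric g := by
  obtain ⟨e, N, h⟩ := h
  exact ⟨e, N, fun z w hz => by rw [hfg z w hz, h z w hz]⟩

theorem poly (N : Polynomial (MvPolynomial (Fin n) ℂ)) : IsParametric (fun z w => evalAt z w N) :=
  ⟨0, N, fun z w _ => by rw [pow_zero, mul_one]⟩

theorem const (c : ℂ) : IsParametric (fun (_ : Fin n → ℂ) _ => c) :=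
  (poly (Polynomial.C (MvPolynomial.C c))).congr fun z w _ => by
    rw [evalAt_C, MvPolynomial.eval_C]

theorem point : IsParametric (fun (_ : Fin n → ℂ) w => w) :=
  (poly Polynomial.X).congr fun z w _ => by rw [evalAt_X]

theorem param (i : Fin n) : IsParametric (fun (z : Fin n → ℂ) _ => z i) :=
  (poly (Polynomial.C (MvPolynomial.X i))).congr fun z w _ => by
    rw [evalAt_C, MvPolynomial.eval_X]

theorem add (hf : IsParametric f) (hg : IsParametric g) :
    IsParametric (fun z w => f z w + g z w) := by
  obtain ⟨e, p, hf⟩ := hf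
  obtain ⟨c, q, hg⟩ := hg
  refine ⟨e + c, p * denomPoly n ^ c + q * denomPoly n ^ e, fun z w hz => ?_⟩
  rw [map_add, map_mul, map_mul, ← hf z w hz, ← hg z w hz, map_pow, map_pow]
  ring

theorem mul (hf : IsParametric f) (hg : IsParametric g) :
    IsParametric (fun z w => f z w * g z w) := by
  obtain ⟨e, p, hf⟩ := hf
  obtain ⟨c, q, hg⟩ := hg
  refine ⟨e + c, p * q, fun z w hz => ?_⟩
  rw [map_mul, ← hf z w hz, ← hg z w hz]
  ring

theorem pow (hf : IsParametric f) (k : ℕ) : IsParametric (fun z w => f z w ^ k) := by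
  induction k with
  | zero => simpa using (const 1 : IsParametric (fun (_ : Fin n → ℂ) _ => 1))
  | succ k ih =>
    simp only [pow_succ]
    exact ih.mul hf

theorem sum {ι : Type*} (t : Finset ι) {F : ι → (Fin n → ℂ) → ℂ → ℂ}
    (h : ∀ i ∈ t, IsParametric (F i)) : IsParametric (fun z w => ∑ i ∈ t, F i z w) := by
  classical
  induction t using Finset.induction_on with
  | empty => simpa using (const 0 : IsParametric (fun (_ : Fin n → ℂ) _ => 0))
  | insert a t ha ih =>
    simp only [Finset.sum_insert ha]
    exact (h a (Finset.mem_insert_self _ _)).add (ih fun i hi => h i (Finset.mem_insert_of_mem hi))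

theorem prod {ι : Type*} (t : Finset ι) {F : ι → (Fin n → ℂ) → ℂ → ℂ}
    (h : ∀ i ∈ t, IsParametric (F i)) : IsParametric (fun z w => ∏ i ∈ t, F i z w) := by
  classical
  induction t using Finset.induction_on with
  | empty => simpa using (const 1 : IsParametric (fun (_ : Fin n → ℂ) _ => 1))
  | insert a t ha ih =>
    simp only [Finset.prod_insert ha]
    exact (h a (Finset.mem_insert_self _ _)).mul (ih fun i hi => h i (Finset.mem_insert_of_mem hi))

theorem inv_of_dvd {q : Polynomial (MvPolynomial (Fin n) ℂ)} (hq : q ∣ denomPoly n) :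
    IsParametric (fun z w => (evalAt z w q)⁻¹) := by
  obtain ⟨c, hc⟩ := hq
  refine ⟨1, c, fun z w hz => ?_⟩
  rw [hc, map_mul] at hz ⊢
  rw [pow_one, ← mul_assoc, inv_mul_cancel₀ (left_ne_zero_of_mul hz), one_mul]

theorem inv_point : IsParametric (fun (_ : Fin n → ℂ) w => w⁻¹) :=
  (inv_of_dvd (q := Polynomial.X) ((dvd_mul_right _ _).mul_right _)).congr fun z w _ => by
    rw [evalAt_X]

theorem inv_sq_sub_one : IsParametric (fun (_ : Fin n → ℂ) w => (w ^ 2 - 1)⁻¹) :=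
  (inv_of_dvd (q := Polynomial.X ^ 2 - 1) ((dvd_mul_left _ _).mul_right _)).congr fun z w _ => by
    rw [map_sub, map_pow, evalAt_X, map_one]

theorem inv_param (i : Fin n) : IsParametric (fun (z : Fin n → ℂ) _ => (z i ^ 2 - 1)⁻¹) :=
  (inv_of_dvd (q := Polynomial.C (MvPolynomial.X i ^ 2 - 1)) (Dvd.dvd.mul_left
    (((dvd_mul_right _ _).mul_right _).trans (Finset.dvd_prod_of_mem _ (Finset.mem_univ i))) _)).congr
    fun z w _ => by
      rw [evalAt_C, map_sub, map_pow, MvPolynomial.eval_X, map_one]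

theorem inv_sub (i : Fin n) : IsParametric (fun (z : Fin n → ℂ) w => (w - z i)⁻¹) :=
  (inv_of_dvd (q := Polynomial.X - Polynomial.C (MvPolynomial.X i)) (Dvd.dvd.mul_left
    (((dvd_mul_left _ _).mul_right _).trans (Finset.dvd_prod_of_mem _ (Finset.mem_univ i))) _)).congr
    fun z w _ => by
      rw [map_sub, evalAt_C, evalAt_X, MvPolynomial.eval_X]

theorem inv_one_sub (i : Fin n) : IsParametric (fun (z : Fin n → ℂ) w => (1 - w * z i)⁻¹) :=
  (inv_of_dvd (q := 1 - Polynomial.X * Polynomial.C (MvPolynomial.X i)) (Dvd.dvd.mul_left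
    ((dvd_mul_left _ _).trans (Finset.dvd_prod_of_mem _ (Finset.mem_univ i))) _)).congr
    fun z w _ => by
      rw [map_sub, map_mul, evalAt_C, evalAt_X, MvPolynomial.eval_X, map_one]

theorem liftForm {k : ℕ} (u₀ : ℂ) (d : ℕ) (F : MvPolynomial (Fin k) ℂ)
    {t : Fin k → (Fin n → ℂ) → ℂ → ℂ} (ht : ∀ i, IsParametric (t i))
    (ht' : ∀ i, IsParametric (fun z w => (t i z w ^ 2 - 1)⁻¹)) :
    IsParametric (fun z w => PainleveII.liftForm u₀ d F (fun i => t i z w)) := by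
  refine sum _ fun m _ => (const _).mul (prod _ fun i _ => ?_)
  simp only [liftFactor, div_eq_mul_inv, ← inv_pow]
  exact ((const _).mul (((((ht i).pow 2).add (const 1)).pow _).mul ((ht i).pow _))).mul
    ((ht' i).pow _)

end IsParametric

theorem evalAt_denomPoly (z : Fin n → ℂ) (w : ℂ) : evalAt z w (denomPoly n)
    = w * (w ^ 2 - 1) * ∏ i, (((z i ^ 2 - 1) * (w - z i)) * (1 - w * z i)) := by
  simp only [denomPoly, map_mul, map_sub, map_pow, map_prod, evalAt_X, evalAt_C, map_one,
    MvPolynomial.eval_X]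

theorem evalAt_denomPoly_ne_zero {z : Fin n → ℂ} {w : ℂ} : evalAt z w (denomPoly n) ≠ 0 ↔
    (w ≠ 0 ∧ w ^ 2 - 1 ≠ 0) ∧ ∀ i, ((z i ^ 2 - 1 ≠ 0 ∧ w - z i ≠ 0) ∧ 1 - w * z i ≠ 0) := by
  rw [evalAt_denomPoly]
  simp only [mul_ne_zero_iff, Finset.prod_ne_zero_iff, Finset.mem_univ, true_implies, ne_eq]

/-- A parametric function with double zeros in `w` at `±1` for generic parameters has them for all
parameters. -/
theorem IsParametric.exists_double_zero {f : (Fin n → ℂ) → ℂ → ℂ} (hf : IsParametric f)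
    {Z : Set ℂ} (hZ : Z.Infinite)
    (h : ∀ z : Fin n → ℂ, (∀ i, z i ∈ Z) → Function.Injective z →
      ∃ (T K : Polynomial ℂ) (V : Set ℂ), T.eval 1 ≠ 0 ∧ T.eval (-1) ≠ 0 ∧ V.Infinite ∧
        ∀ w ∈ V, evalAt z w (denomPoly n) ≠ 0 ∧
          f z w * T.eval w = (w ^ 2 - 1) ^ 2 * K.eval w) :
    ∃ (e : ℕ) (H : Polynomial (MvPolynomial (Fin n) ℂ)), ∀ z w, evalAt z w (denomPoly n) ≠ 0 →
      f z w * evalAt z w (denomPoly n) ^ e = (w ^ 2 - 1) ^ (e + 2) * evalAt z w H := by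
  obtain ⟨e, N, hN⟩ := hf
  set Q : Polynomial (MvPolynomial (Fin n) ℂ) := (Polynomial.X ^ 2 - 1) ^ (e + 2) with hQ
  have hm : Q.Monic := by
    have := Polynomial.monic_X_pow_sub_C (1 : MvPolynomial (Fin n) ℂ) (n := 2) two_ne_zero
    rw [map_one] at this
    exact this.pow _
  have hdvd : ∀ z : Fin n → ℂ, (∀ i, z i ∈ Z) → Function.Injective z →
      Q.map (MvPolynomial.eval z) ∣ N.map (MvPolynomial.eval z) := by
    intro z hz hinj
    obtain ⟨T, K, V, hT1, hT2, hV, hVf⟩ := h z hz hinj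
    obtain ⟨R, hR⟩ : ∃ R, denomPoly n = Polynomial.X * (Polynomial.X ^ 2 - 1) * R := ⟨_, rfl⟩
    have hQz : Q.map (MvPolynomial.eval z) = (Polynomial.X ^ 2 - 1) ^ (e + 2) := by
      simp [hQ]
    have hev : ∀ (p : Polynomial (MvPolynomial (Fin n) ℂ)) (w : ℂ),
        (p.map (MvPolynomial.eval z)).eval w = evalAt z w p := fun p w => by
      rw [evalAt, Polynomial.coe_eval₂RingHom, Polynomial.eval_map]
    -- For generic parameters the factors `(w² - 1)^e` of the common denominator and the double zero
    -- combine into `(w² - 1)^{e+2}`, up to a `T` that is coprime to it.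
    have key : N.map (MvPolynomial.eval z) * T = (Polynomial.X ^ 2 - 1) ^ (e + 2)
        * (K * Polynomial.X ^ e * R.map (MvPolynomial.eval z) ^ e) := by
      refine Polynomial.eq_of_infinite_eval_eq _ _ (hV.mono fun w hw => ?_)
      show Polynomial.eval w _ = Polynomial.eval w _
      obtain ⟨hw1, hw2⟩ := hVf w hw
      have h1 := hN z w hw1
      rw [hR, map_mul, map_mul, map_sub, map_pow, evalAt_X, map_one] at h1
      simp only [Polynomial.eval_mul, Polynomial.eval_pow, Polynomial.eval_sub, Polynomial.eval_X,
        Polynomial.eval_one, hev, ← h1]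
      rw [mul_pow, mul_pow]
      linear_combination (w ^ e * (w ^ 2 - 1) ^ e * evalAt z w R ^ e) * hw2
    rw [hQz]
    refine IsCoprime.dvd_of_dvd_mul_right (IsCoprime.pow_left ?_) (Dvd.intro _ key.symm)
    have hfac : (Polynomial.X ^ 2 - 1 : Polynomial ℂ)
        = (Polynomial.X - Polynomial.C 1) * (Polynomial.X - Polynomial.C (-1)) := by
      rw [map_neg, map_one]; ring
    rw [hfac]
    exact IsCoprime.mul_left
      ((Polynomial.irreducible_X_sub_C (1 : ℂ)).coprime_iff_not_dvd.2 fun h =>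
        hT1 (Polynomial.dvd_iff_isRoot.1 h))
      ((Polynomial.irreducible_X_sub_C (-1 : ℂ)).coprime_iff_not_dvd.2 fun h =>
        hT2 (Polynomial.dvd_iff_isRoot.1 h))
  -- Since `Q` is monic the division takes place over `ℂ[z]`. The coefficients of the remainder are
  -- polynomials in the parameters that vanish at all generic ones.
  have hmod : N %ₘ Q = 0 := by
    set ν := hZ.natEmbedding
    -- The `i`-th coordinate runs through the points of `Z` with index congruent to `i` modulo `n`.
    -- This gives a product of infinite sets all of whose tuples are injective.
    have hinf : ∀ i : Fin n, (Set.range fun k : ℕ => (ν (n * k + i) : ℂ)).Infinite := by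
      intro i
      refine Set.infinite_range_of_injective fun a b hab => ?_
      have h1 := ν.injective (Subtype.ext hab)
      have hn : 0 < n := i.pos
      exact Nat.eq_of_mul_eq_mul_left hn (by omega)
    refine Polynomial.ext fun j => ?_
    rw [Polynomial.coeff_zero]
    refine MvPolynomial.funext_set _ hinf fun z hz => ?_
    choose k hk using fun i => hz i (Set.mem_univ i)
    have hz1 : ∀ i, z i ∈ Z := fun i => by
      rw [← hk i]
      exact (ν _).2
    have hz2 : Function.Injective z := by
      intro a b hab
      rw [← hk a, ← hk b] at hab
      have h1 := ν.injective (Subtype.ext hab)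
      have h2 := congrArg (· % n) h1
      simp only [Nat.mul_add_mod, Nat.mod_eq_of_lt a.2, Nat.mod_eq_of_lt b.2] at h2
      exact Fin.ext h2
    rw [← Polynomial.coeff_map, Polynomial.map_modByMonic _ hm,
      (Polynomial.modByMonic_eq_zero_iff_dvd (hm.map _)).2 (hdvd z hz1 hz2)]
    simp
  refine ⟨e, N /ₘ Q, fun z w hz => ?_⟩
  have h1 := Polynomial.modByMonic_add_div N Q
  rw [hmod, zero_add] at h1
  rw [hN z w hz]
  conv_lhs => rw [← h1]
  rw [map_mul, hQ, map_pow, map_sub, map_pow, evalAt_X, map_one]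

end Parametric

end PainleveII

namespace PainleveII

open Matrix

namespace SpectralSystem

variable {U : Set ℂ} {u₀ : ℂ} (S : SpectralSystem U u₀)

/-! ### The uniformising coordinate -/

/-- The uniformising coordinate of the point `(x, s(x))`. -/
def zCoord (x : ℂ) : ℂ := (x - Complex.I * S.s x) / u₀

/-- The function `y` in the uniformising coordinate. -/
def y (w : ℂ) : ℂ :=
  Complex.I * u₀ / (2 * w) * (w + 1) * (w - 1) * S.curve.eval (xParam u₀ w)

/-- Changing the sign of the root inverts the coordinate, because `(x - is)(x + is) = x² + s² =
u₀²`. -/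
theorem zCoord_mul {x : ℂ} (hx : x ∈ U) :
    S.zCoord x * ((x + Complex.I * S.s x) / u₀) = 1 := by
  have h := S.s_sq x hx
  have hu := S.u₀_ne
  rw [zCoord, div_mul_div_comm, div_eq_one_iff_eq (mul_ne_zero hu hu)]
  linear_combination h - S.s x ^ 2 * Complex.I_sq

theorem zCoord_ne_zero {x : ℂ} (hx : x ∈ U) : S.zCoord x ≠ 0 :=
  left_ne_zero_of_mul_eq_one (S.zCoord_mul hx)

theorem one_div_zCoord {x : ℂ} (hx : x ∈ U) :
    1 / S.zCoord x = (x + Complex.I * S.s x) / u₀ := by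
  rw [div_eq_iff (S.zCoord_ne_zero hx), mul_comm, S.zCoord_mul hx]

theorem xParam_zCoord {x : ℂ} (hx : x ∈ U) : xParam u₀ (S.zCoord x) = x := by
  have hu := S.u₀_ne
  rw [xParam, S.one_div_zCoord hx, zCoord]
  field_simp
  ring

theorem sParam_zCoord {x : ℂ} (hx : x ∈ U) : sParam u₀ (S.zCoord x) = S.s x := by
  have hu := S.u₀_ne
  rw [sParam, S.one_div_zCoord hx, zCoord]
  field_simp
  linear_combination (-2 * S.s x) * Complex.I_sq

theorem zCoord_sq_sub_one_ne {x : ℂ} (hx : x ∈ U) : S.zCoord x ^ 2 - 1 ≠ 0 := by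
  intro h
  have h1 := S.sParam_zCoord hx
  have hz := S.zCoord_ne_zero hx
  have : S.zCoord x - 1 / S.zCoord x = 0 := by
    field_simp
    rw [h, mul_zero]
  rw [sParam, this, mul_zero] at h1
  exact S.s_ne x hx h1.symm

theorem zCoord_injOn : Set.InjOn S.zCoord U := fun a ha b hb h => by
  rw [← S.xParam_zCoord ha, h, S.xParam_zCoord hb]

theorem y_zCoord {x : ℂ} (hx : x ∈ U) : S.y (S.zCoord x) = S.s x * S.curve.eval x := by
  have hz := S.zCoord_ne_zero hx
  rw [y, S.xParam_zCoord hx, ← S.sParam_zCoord hx, sParam]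
  field_simp
  ring

/-! ### The differentials -/

/-- `F / ∏ s(xᵢ)^{2d+3}` is the correlation function of genus `g` of `n` points. -/
def IsFormDatum (g : ℕ) : (n : ℕ) → ℕ → MvPolynomial (Fin n) ℂ → Prop
  | 0, _, _ => True
  | n + 1, d, F => (∀ i, MvPolynomial.degreeOf i F ≤ 2 * d + 1) ∧
      ∀ x : Fin (n + 1) → ℂ, (∀ i, x i ∈ U) → Function.Injective x →
        S.tupleAmp (n + 2 * g) x * ∏ i, S.s (x i) ^ (2 * d + 3) = MvPolynomial.eval x F

/-- The stability condition stands inside the existential so that numerators can be chosen for all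
`g` and `n`. The one-point case of positive genus relies on `isForm_amp_empty`. -/
theorem exists_isFormDatum (g n : ℕ) : ∃ p : ℕ × MvPolynomial (Fin n) ℂ,
    3 ≤ 2 * g + n → S.IsFormDatum g n p.1 p.2 := by
  rcases n with _ | n
  · exact ⟨(0, 0), fun _ => trivial⟩
  by_cases h : 3 ≤ 2 * g + (n + 1)
  · obtain ⟨d, F, h1, h2⟩ := S.exists_tupleAmp_eq_eval (n := n) (k := n + 2 * g) (by
      rcases Nat.eq_zero_or_pos n with rfl | hn
      · obtain ⟨d, hd⟩ := S.isForm_amp_empty (k := 0 + 2 * g) (by omega)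
        refine ⟨d, fun J hJ _ => ?_⟩
        rw [Finset.card_eq_zero.1 hJ]
        simpa using hd
      · exact S.isForm_amp (by omega))
    exact ⟨(d, F), fun _ => ⟨h1, h2⟩⟩
  · exact ⟨(0, 0), fun h' => absurd h' h⟩

/-- The numerators of the differentials. -/
def formDatum (g n : ℕ) : ℕ × MvPolynomial (Fin n) ℂ := (S.exists_isFormDatum g n).choose

/-- The differentials `𝓦ₙ^{(g)}`. -/
def omega : ℕ → (n : ℕ) → (Fin n → ℂ) → ℂ
  | 0, 1, z => S.y (z 0) * dxParam u₀ (z 0)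
  | 0, 2, z => 1 / (z 0 - z 1) ^ 2
  | g, n, z => liftForm u₀ (S.formDatum g n).1 (S.formDatum g n).2 z

theorem omega_of_stable {g n : ℕ} (h : 3 ≤ 2 * g + n) (z : Fin n → ℂ) :
    S.omega g n z = liftForm u₀ (S.formDatum g n).1 (S.formDatum g n).2 z := by
  unfold omega
  split
  · omega
  · omega
  · rfl

theorem isFormDatum {g n : ℕ} (h : 3 ≤ 2 * g + (n + 1)) :
    S.IsFormDatum g (n + 1) (S.formDatum g (n + 1)).1 (S.formDatum g (n + 1)).2 :=
  (S.exists_isFormDatum g (n + 1)).choose_spec h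

theorem omega_zCoord_of_stable {g n : ℕ} (h : 2 ≤ 2 * g + n) {x : Fin (n + 1) → ℂ}
    (hx : ∀ i, x i ∈ U) (hinj : Function.Injective x) :
    S.omega g (n + 1) (fun i => S.zCoord (x i))
      = S.tupleAmp (n + 2 * g) x * ∏ i, dxParam u₀ (S.zCoord (x i)) := by
  obtain ⟨h1, h2⟩ := S.isFormDatum (g := g) (n := n) (by omega)
  rw [S.omega_of_stable (by omega), liftForm_eq S.u₀_ne h1 (fun i => S.zCoord_ne_zero (hx i))
    (fun i => S.zCoord_sq_sub_one_ne (hx i))]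
  simp only [S.xParam_zCoord (hx _), S.sParam_zCoord (hx _)]
  rw [← h2 x hx hinj, Finset.prod_div_distrib]
  have : ∏ i, S.s (x i) ^ (2 * (S.formDatum g (n + 1)).1 + 3) ≠ 0 :=
    Finset.prod_ne_zero_iff.2 fun i _ => pow_ne_zero _ (S.s_ne _ (hx i))
  field_simp

theorem cons_zCoord {k : ℕ} (X : ℂ) (y : Fin k → ℂ) :
    (Fin.cons (S.zCoord X) (fun i => S.zCoord (y i)) : Fin (k + 1) → ℂ)
      = fun i => S.zCoord ((Fin.cons X y : Fin (k + 1) → ℂ) i) := by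
  funext i
  refine Fin.cases ?_ (fun i => ?_) i <;> simp

theorem tupleAmp_cons (k : ℕ) {n : ℕ} {X : ℂ} {y : Fin n → ℂ} (hX : X ∉ Finset.univ.image y) :
    S.tupleAmp k (Fin.cons X y : Fin (n + 1) → ℂ)
      = PowerSeries.coeff k (S.amp (Finset.univ.image y) X) := by
  have : Finset.univ.image (Fin.cons X y : Fin (n + 1) → ℂ)
      = insert X (Finset.univ.image y) := by
    ext a
    simp [Fin.exists_fin_succ, eq_comm]
  rw [tupleAmp, this, Fin.cons_zero, Finset.erase_insert hX]

theorem cons_injective {n : ℕ} {X : ℂ} {y : Fin n → ℂ} (hX : X ∉ Finset.univ.image y)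
    (hinj : Function.Injective y) : Function.Injective (Fin.cons X y : Fin (n + 1) → ℂ) := by
  rw [Fin.cons_injective_iff]
  refine ⟨?_, hinj⟩
  rintro ⟨i, hi⟩
  exact hX (Finset.mem_image.2 ⟨i, Finset.mem_univ i, hi⟩)

theorem sub_xParam {w z : ℂ} (hw : w ≠ 0) (hz : z ≠ 0) :
    xParam u₀ w - xParam u₀ z = u₀ / 2 * ((w - z) * (w * z - 1)) / (w * z) := by
  rw [xParam, xParam]
  field_simp
  ring

/-- In the coordinates `w` and `z` the numerator `s s' + u₀² - x x'` is `-(u₀²/2)(wz - 1)²/(wz)`. It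
removes the factor `wz - 1` of `x - x'`, and only the pole at `w = z` is left. -/
theorem coeff_one_amp_mul {X j : ℂ} (hX : X ∈ U) (hj : j ∈ U) (hXj : X ≠ j) :
    PowerSeries.coeff 1 (S.amp {j} X) * (dxParam u₀ (S.zCoord X) * dxParam u₀ (S.zCoord j))
      = 1 / (S.zCoord X - S.zCoord j) ^ 2 := by
  rw [S.coeff_one_amp_singleton hj hX hXj]
  have h1 : S.zCoord X - S.zCoord j ≠ 0 := sub_ne_zero.2 fun h => hXj (S.zCoord_injOn hX hj h)
  have h2 := sub_ne_zero.2 hXj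
  have hw := S.zCoord_ne_zero hX
  have hz := S.zCoord_ne_zero hj
  have hw1 := S.zCoord_sq_sub_one_ne hX
  have hz1 := S.zCoord_sq_sub_one_ne hj
  rw [← S.sParam_zCoord hX, ← S.sParam_zCoord hj]
  have e := sub_xParam (u₀ := u₀) hw hz
  rw [S.xParam_zCoord hX, S.xParam_zCoord hj] at e
  have e2 : u₀ ^ 2 - X * j = u₀ ^ 2 - xParam u₀ (S.zCoord X) * xParam u₀ (S.zCoord j) := by
    rw [S.xParam_zCoord hX, S.xParam_zCoord hj]
  rw [e] at h2 ⊢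
  rw [e2, xParam, xParam, sParam, sParam, dxParam, dxParam]
  generalize S.zCoord X = w at *
  generalize S.zCoord j = z at *
  have hu := S.u₀_ne
  have h3 : w * z - 1 ≠ 0 := by
    intro h3
    simp [h3] at h2
  have e3 : Complex.I * u₀ / 2 * (z - 1 / z) * (Complex.I * u₀ / 2 * (w - 1 / w))
      = -(u₀ ^ 2 / 4) * ((z ^ 2 - 1) * (w ^ 2 - 1) / (z * w)) := by
    field_simp
    rw [Complex.I_sq]
    ring
  have e4 : -(u₀ ^ 2 / 4) * ((z ^ 2 - 1) * (w ^ 2 - 1) / (z * w))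
      + (u₀ ^ 2 - u₀ / 2 * (w + 1 / w) * (u₀ / 2 * (z + 1 / z)))
      = -(u₀ ^ 2 / 2) * (w * z - 1) ^ 2 / (w * z) := by
    field_simp
    ring
  rw [e3, e4]
  generalize w ^ 2 - 1 = a at *
  generalize z ^ 2 - 1 = b at *
  generalize w * z - 1 = c at *
  generalize w - z = d at *
  field_simp
  norm_num

/-- The differentials in terms of the amplitudes. -/
theorem omega_cons_zCoord (h : ℕ) {k : ℕ} {X : ℂ} {y : Fin k → ℂ} (hX : X ∈ U)
    (hy : ∀ i, y i ∈ U) (hinj : Function.Injective y) (hXy : X ∉ Finset.univ.image y) :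
    S.omega h (k + 1) (Fin.cons (S.zCoord X) fun i => S.zCoord (y i))
      = PowerSeries.coeff (k + 2 * h) (S.amp (Finset.univ.image y) X)
        * (dxParam u₀ (S.zCoord X) * ∏ i, dxParam u₀ (S.zCoord (y i))) := by
  by_cases hs : 2 ≤ 2 * h + k
  · rw [cons_zCoord, S.omega_zCoord_of_stable hs (fun i => Fin.cases hX hy i)
      (cons_injective hXy hinj), S.tupleAmp_cons _ hXy, Fin.prod_univ_succ]
    simp
  · have h0 : h = 0 := by omega
    subst h0
    have hk : k = 0 ∨ k = 1 := by omega
    rcases hk with rfl | rfl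
    · show S.y (S.zCoord X) * dxParam u₀ (S.zCoord X) = _
      rw [S.y_zCoord hX, Finset.univ_eq_empty, Finset.image_empty, Finset.prod_empty, mul_one,
        mul_zero, add_zero, S.coeff_zero_amp_empty hX]
    · have hXy0 : X ≠ y 0 := fun e => hXy (e ▸ Finset.mem_image_of_mem y (Finset.mem_univ 0))
      have hu : (Finset.univ : Finset (Fin 1)) = {0} := rfl
      show 1 / (S.zCoord X - S.zCoord (y 0)) ^ 2 = _
      rw [hu, Finset.image_singleton, Finset.prod_singleton, ← S.coeff_one_amp_mul hX (hy 0) hXy0]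

/-- The differentials at the conjugate point. -/
theorem omega_cons_inv_zCoord {h k : ℕ} (hk : ¬(h = 0 ∧ k = 0)) {X : ℂ} {y : Fin k → ℂ}
    (hX : X ∈ U) (hy : ∀ i, y i ∈ U) (hinj : Function.Injective y)
    (hXy : X ∉ Finset.univ.image y) :
    S.omega h (k + 1) (Fin.cons (1 / S.zCoord X) fun i => S.zCoord (y i))
      = -(S.zCoord X ^ 2) * PowerSeries.coeff (k + 2 * h)
          (trace (insertion S.M S.D (Finset.univ.image y) X) - S.amp (Finset.univ.image y) X)
        * (dxParam u₀ (S.zCoord X) * ∏ i, dxParam u₀ (S.zCoord (y i))) := by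
  have hmain := S.omega_cons_zCoord h hX hy hinj hXy
  by_cases hs : 2 ≤ 2 * h + k
  · have hyU : ∀ j ∈ Finset.univ.image y, j ∈ U := by
      intro j hj
      obtain ⟨i, -, rfl⟩ := Finset.mem_image.1 hj
      exact hy i
    rw [map_sub, S.coeff_trace_insertion hyU hX hXy (by
      rw [Finset.card_image_of_injective _ hinj, Finset.card_fin]; omega), zero_sub]
    rw [S.omega_of_stable (by omega)] at hmain ⊢
    have h1 := liftForm_update_inv u₀ (S.isFormDatum (g := h) (n := k) (by omega)).1
      (Fin.cons (S.zCoord X) fun i => S.zCoord (y i)) 0 (S.zCoord_ne_zero hX)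
    rw [Fin.update_cons_zero, Fin.update_cons_zero] at h1
    rw [h1, hmain]
    ring
  -- The exceptional two-point case: the sum over the sheets of `dw dz/(w - z)²` is `dx dx'/(x -
  -- x')²`, which is exactly the trace of the one-point insertion.
  · have h0 : h = 0 := by omega
    have hk1 : k = 1 := by omega
    subst h0 hk1
    have hXy0 : X ≠ y 0 := fun e => hXy (e ▸ Finset.mem_image_of_mem y (Finset.mem_univ 0))
    have hu : (Finset.univ : Finset (Fin 1)) = {0} := rfl
    show 1 / (1 / S.zCoord X - S.zCoord (y 0)) ^ 2 = _
    rw [hu, Finset.image_singleton, Finset.prod_singleton, map_sub, mul_zero, add_zero, mul_assoc,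
      sub_mul, S.coeff_one_amp_mul hX (hy 0) hXy0, S.trace_insertion_singleton (hy 0) hXy0,
      PowerSeries.coeff_C_mul, PowerSeries.coeff_one_X, mul_one]
    have hw := S.zCoord_ne_zero hX
    have hz := S.zCoord_ne_zero (hy 0)
    have e := sub_xParam (u₀ := u₀) hw hz
    rw [S.xParam_zCoord hX, S.xParam_zCoord (hy 0)] at e
    have h2 := sub_ne_zero.2 hXy0
    rw [e] at h2 ⊢
    rw [dxParam, dxParam]
    have h1 : S.zCoord X - S.zCoord (y 0) ≠ 0 :=
      sub_ne_zero.2 fun h => hXy0 (S.zCoord_injOn hX (hy 0) h)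
    have hu := S.u₀_ne
    generalize S.zCoord X = w at *
    generalize S.zCoord (y 0) = z at *
    have h3 : w * z - 1 ≠ 0 := by
      intro h3
      simp [h3] at h2
    have e5 : 1 / w - z = -(w * z - 1) / w := by field_simp; ring
    rw [e5]
    field_simp
    ring

/-- The first term of the recursion. -/
theorem omega_cons_cons_zCoord {g n : ℕ} (hgn : 2 ≤ 2 * g + n) {X : ℂ} {x : Fin n → ℂ}
    (hX : X ∈ U) (hx : ∀ i, x i ∈ U) (hinj : Function.Injective x)
    (hXx : X ∉ Finset.univ.image x) {B : PowerSeries ℂ}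
    (hB : S.IsSplitLimit (Finset.univ.image x) X B) :
    (if g = 0 then 0 else S.omega (g - 1) (n + 2)
        (Fin.cons (S.zCoord X) (Fin.cons (1 / S.zCoord X) fun i => S.zCoord (x i))))
      = -(S.zCoord X ^ 2 * dxParam u₀ (S.zCoord X) ^ 2 * ∏ i, dxParam u₀ (S.zCoord (x i)))
        * PowerSeries.coeff (n + 2 * g) (PowerSeries.X * B) := by
  have hxU : ∀ j ∈ Finset.univ.image x, j ∈ U := by
    intro j hj
    obtain ⟨i, -, rfl⟩ := Finset.mem_image.1 hj
    exact hx i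
  have hcard : (Finset.univ.image x).card = n := by
    rw [Finset.card_image_of_injective _ hinj, Finset.card_fin]
  have hw := S.zCoord_ne_zero hX
  have hw1 := S.zCoord_sq_sub_one_ne hX
  split_ifs with hg
  · subst hg
    obtain ⟨l, rfl⟩ : ∃ l, n = l + 1 := ⟨n - 1, by omega⟩
    -- For genus zero the limit sits below the lowest order `n + 1` of an amplitude of `n + 2`
    -- points.
    have hB0 : PowerSeries.coeff l B = 0 := by
      refine tendsto_nhds_unique (hB l) (tendsto_const_nhds.congr' ?_)
      filter_upwards [S.eventually_mem_sdiff hX _ hXx] with y hy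
      obtain ⟨hyU, hyJ, hyx⟩ := hy
      have h1 : PowerSeries.coeff l
          (amplitude S.M S.D (insert y (Finset.univ.image x)) X) = 0 := by
        refine S.coeff_amp_eq_zero l _ ?_ ?_ X ⟨hX, ?_⟩
        · intro j hj
          rcases Finset.mem_insert.1 hj with rfl | hj
          · exact hyU
          · exact hxU j hj
        · intro g hg
          rw [Finset.card_insert_of_notMem hyJ, hcard] at hg
          omega
        · simp only [Finset.coe_insert, Set.mem_insert_iff, not_or]
          exact ⟨hyx.symm, hXx⟩
      rw [splitAmplitude, map_sub, h1, sub_zero, if_neg, map_zero]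
      exact Finset.ne_empty_of_mem (Finset.mem_image_of_mem x (Finset.mem_univ 0))
    have : PowerSeries.coeff (l + 1 + 2 * 0) (PowerSeries.X * B) = 0 := by
      rw [show l + 1 + 2 * 0 = l + 1 by ring, PowerSeries.coeff_succ_X_mul, hB0]
    rw [this, mul_zero]
  · obtain ⟨g, rfl⟩ : ∃ g', g = g' + 1 := ⟨g - 1, by omega⟩
    rw [show n + 2 * (g + 1) = (n + 1 + 2 * g) + 1 by ring, PowerSeries.coeff_succ_X_mul,
      Nat.add_sub_cancel]
    by_cases hs : 3 ≤ 2 * g + (n + 2)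
    · obtain ⟨h1, h2⟩ := S.isFormDatum (g := g) (n := n + 1) hs
      have h3 := S.coeff_split_of_eval h2 (by omega) hx hinj hX hXx hB
      rw [S.omega_of_stable hs]
      have h4 := liftForm_update_inv u₀ h1
        (Fin.cons (S.zCoord X) (Fin.cons (S.zCoord X) fun i => S.zCoord (x i))) 1 hw
      have h5 : ∀ a : ℂ, Function.update (Fin.cons (S.zCoord X) (Fin.cons (S.zCoord X)
          fun i => S.zCoord (x i)) : Fin (n + 2) → ℂ) 1 a
          = Fin.cons (S.zCoord X) (Fin.cons a fun i => S.zCoord (x i)) := by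
        intro a
        rw [show (1 : Fin (n + 2)) = Fin.succ 0 from rfl, ← Fin.cons_update, Fin.update_cons_zero]
      rw [h5, h5] at h4
      have hall : ∀ i, (Fin.cons X (Fin.cons X x) : Fin (n + 2) → ℂ) i ∈ U := fun i =>
        Fin.cases hX (fun i => Fin.cases hX hx i) i
      rw [h4, cons_zCoord, cons_zCoord, liftForm_eq S.u₀_ne h1
        (fun i => S.zCoord_ne_zero (hall i)) (fun i => S.zCoord_sq_sub_one_ne (hall i))]
      simp only [S.xParam_zCoord (hall _), S.sParam_zCoord (hall _)]
      rw [show (fun i => (Fin.cons X (Fin.cons X x) : Fin (n + 2) → ℂ) i)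
        = Fin.cons X (Fin.cons X x) from rfl, ← neg_eq_iff_eq_neg.2 h3, Fin.prod_univ_succ,
        Fin.prod_univ_succ]
      simp only [Fin.cons_zero, Fin.cons_succ, Finset.prod_div_distrib]
      have h6 : ∏ i, S.s (x i) ^ (2 * (S.formDatum g (n + 1 + 1)).1 + 3) ≠ 0 :=
        Finset.prod_ne_zero_iff.2 fun i _ => pow_ne_zero _ (S.s_ne _ (hx i))
      have h7 := S.s_ne X hX
      field_simp
      ring
    · have hg0 : g = 0 := by omega
      have hn0 : n = 0 := by omega
      subst hg0 hn0
      -- The one unstable first term, the two-point differential at `z` and `1/z`, where the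
      -- amplitude itself has a double pole.
      have h3 := S.coeff_one_split hX (by simpa using hB)
      show 1 / (S.zCoord X - 1 / S.zCoord X) ^ 2 = _
      rw [Finset.univ_eq_empty, Finset.prod_empty, mul_one, mul_zero, zero_add, add_zero]
      have h7 := S.s_ne X hX
      have h8 : PowerSeries.coeff 1 B = -(u₀ ^ 2 / 4) / S.s X ^ 4 := by
        rw [eq_div_iff (pow_ne_zero _ h7), h3]
      have hu := S.u₀_ne
      have e3 : sParam u₀ (S.zCoord X) = Complex.I * u₀ / 2 * (S.zCoord X ^ 2 - 1)
          / S.zCoord X := by rw [sParam]; field_simp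
      have e4 : S.zCoord X - 1 / S.zCoord X = (S.zCoord X ^ 2 - 1) / S.zCoord X := by field_simp
      have hI : Complex.I ^ 4 = 1 := Complex.I_pow_four
      rw [h8, ← S.sParam_zCoord hX, e3, e4, dxParam]
      generalize S.zCoord X = w at *
      generalize w ^ 2 - 1 = q at *
      simp only [div_pow, mul_pow, hI]
      field_simp
      ring

/-- The bracket of the recursion and the loop equation. -/
theorem recursionBracket_add_eq {g n : ℕ} (hgn : 2 ≤ 2 * g + n) {X : ℂ} {x : Fin n → ℂ}
    (hX : X ∈ U) (hx : ∀ i, x i ∈ U) (hinj : Function.Injective x)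
    (hXx : X ∉ Finset.univ.image x) :
    recursionBracket S.omega g n (fun i => S.zCoord (x i)) (S.zCoord X)
        + 2 * S.zCoord X ^ 2 * S.y (S.zCoord X) * dxParam u₀ (S.zCoord X)
          * S.omega g (n + 1) (Fin.snoc (fun i => S.zCoord (x i)) (S.zCoord X))
      = -(S.zCoord X ^ 2 * dxParam u₀ (S.zCoord X) ^ 2 * ∏ i, dxParam u₀ (S.zCoord (x i)))
        * PowerSeries.coeff (n + 2 * g) (S.loopRight (Finset.univ.image x) X) := by
  obtain ⟨B, hB, hloop⟩ := S.exists_loop_coeff (J := Finset.univ.image x) (fun j hj => by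
    obtain ⟨i, -, rfl⟩ := Finset.mem_image.1 hj
    exact hx i) hX hXx g
  have hcardI : ∀ I : Finset (Fin n), (I.image x).card = I.card := fun I =>
    Finset.card_image_of_injective _ hinj
  have hsd : ∀ I : Finset (Fin n), Finset.univ.image x \ I.image x = Iᶜ.image x := fun I => by
    rw [Finset.compl_eq_univ_sdiff, Finset.image_sdiff _ _ hinj]
  rw [hcardI, Finset.card_fin] at hloop
  set w := S.zCoord X with hw
  set D := dxParam u₀ w with hD
  set P := ∏ i, dxParam u₀ (S.zCoord (x i)) with hP
  set a : ℕ → Finset (Fin n) → ℂ := fun h I =>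
    PowerSeries.coeff (I.card + 2 * h) (S.amp (I.image x) X) with ha
  set t : ℕ → Finset (Fin n) → ℂ := fun h I => PowerSeries.coeff (I.card + 2 * h)
    (trace (insertion S.M S.D (I.image x) X) - S.amp (I.image x) X) with ht
  have hsum : ∑ I ∈ (Finset.univ.image x).powerset, ∑ h ∈ Finset.range (g + 1),
        PowerSeries.coeff (I.card + 2 * h) (S.amp I X)
          * PowerSeries.coeff ((Finset.univ.image x \ I).card + 2 * (g - h))
            (trace (insertion S.M S.D (Finset.univ.image x \ I) X)
              - S.amp (Finset.univ.image x \ I) X)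
      = ∑ h ∈ Finset.range (g + 1), ∑ I : Finset (Fin n), a h I * t (g - h) Iᶜ := by
    rw [Finset.sum_comm]
    refine Finset.sum_congr rfl fun h _ => ?_
    refine (Finset.sum_bij (fun I _ => I.image x) ?_ ?_ ?_ ?_).symm
    · exact fun I _ => Finset.mem_powerset.2 (Finset.image_subset_image (Finset.subset_univ I))
    · exact fun I _ I' _ e => Finset.image_injective hinj e
    · intro I hI
      obtain ⟨I', -, h'⟩ := Finset.subset_image_iff.1 (Finset.mem_powerset.1 hI)
      exact ⟨I', Finset.mem_univ _, h'⟩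
    · intro I _
      simp only [ha, ht, hsd, hcardI]
  rw [hsum] at hloop
  have hsub : ∀ I : Finset (Fin n), X ∉ Finset.univ.image fun i => x (I.orderEmbOfFin rfl i) := by
    intro I hI
    obtain ⟨i, -, hi⟩ := Finset.mem_image.1 hI
    exact hXx (hi ▸ Finset.mem_image_of_mem x (Finset.mem_univ _))
  have himg : ∀ I : Finset (Fin n),
      (Finset.univ.image fun i => x (I.orderEmbOfFin rfl i)) = I.image x := by
    intro I
    rw [show (fun i => x (I.orderEmbOfFin rfl i)) = x ∘ (I.orderEmbOfFin rfl) from rfl,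
      ← Finset.image_image, Finset.image_orderEmbOfFin_univ]
  have hprod : ∀ I : Finset (Fin n), ∏ i, dxParam u₀ (S.zCoord (x (I.orderEmbOfFin rfl i)))
      = ∏ i ∈ I, dxParam u₀ (S.zCoord (x i)) := by
    intro I
    conv_rhs => rw [← Finset.image_orderEmbOfFin_univ I rfl]
    rw [Finset.prod_image (fun i _ j _ e => (I.orderEmbOfFin rfl).injective e)]
  have hω : ∀ (h : ℕ) (I : Finset (Fin n)), S.omega h (I.card + 1)
      (Fin.cons w fun i => S.zCoord (x (I.orderEmbOfFin rfl i)))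
      = a h I * (D * ∏ i ∈ I, dxParam u₀ (S.zCoord (x i))) := by
    intro h I
    rw [S.omega_cons_zCoord h hX (fun i => hx _)
      (hinj.comp (I.orderEmbOfFin rfl).injective) (hsub I), himg, hprod]
  have hω' : ∀ (h : ℕ) (I : Finset (Fin n)), ¬(h = 0 ∧ I = ∅) → S.omega h (I.card + 1)
      (Fin.cons (1 / w) fun i => S.zCoord (x (I.orderEmbOfFin rfl i)))
      = -(w ^ 2) * t h I * (D * ∏ i ∈ I, dxParam u₀ (S.zCoord (x i))) := by
    intro h I hI
    rw [S.omega_cons_inv_zCoord (by rwa [Finset.card_eq_zero]) hX (fun i => hx _)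
      (hinj.comp (I.orderEmbOfFin rfl).injective) (hsub I), himg, hprod]
  have hfirst := S.omega_cons_cons_zCoord hgn hX hx hinj hXx hB
  have hlast : S.omega g (n + 1) (Fin.snoc (fun i => S.zCoord (x i)) w)
      = a g Finset.univ * (D * P) := by
    have e1 : (Fin.snoc (fun i => S.zCoord (x i)) w : Fin (n + 1) → ℂ)
        = fun i => S.zCoord ((Fin.snoc x X : Fin (n + 1) → ℂ) i) := by
      funext i
      refine Fin.lastCases ?_ (fun i => ?_) i <;> simp [hw]
    have hinj' : Function.Injective (Fin.snoc x X : Fin (n + 1) → ℂ) := by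
      rw [Fin.snoc_injective_iff]
      refine ⟨hinj, ?_⟩
      rintro ⟨i, hi⟩
      exact hXx (Finset.mem_image.2 ⟨i, Finset.mem_univ i, hi⟩)
    rw [e1, S.omega_zCoord_of_stable hgn (fun i => ?_) hinj', S.tupleAmp_eq _ _ (Fin.last n),
      Fin.prod_univ_castSucc]
    · have : Finset.univ.image (Fin.snoc x X : Fin (n + 1) → ℂ)
          = insert X (Finset.univ.image x) := by
        ext a
        simp [Fin.exists_fin_succ', eq_comm, or_comm]
      rw [this]
      simp only [Fin.snoc_last, Fin.snoc_castSucc, Finset.erase_insert hXx, ha, Finset.card_fin]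
      ring
    · refine Fin.lastCases ?_ (fun i => ?_) i
      · simpa using hX
      · simpa using hx i
  -- Each of the two excluded products is `-y` times the unknown differential, up to the factors
  -- `dx`; moved to the left side they produce the term with `2 y`.
  have ht0 : a 0 ∅ * t g Finset.univ = -(S.y w * a g Finset.univ) := by
    have h1 := S.coeff_trace_insertion (J := Finset.univ.image x) (k := n + 2 * g) (fun j hj => by
      obtain ⟨i, -, rfl⟩ := Finset.mem_image.1 hj
      exact hx i) hX hXx (by rw [hcardI, Finset.card_fin]; omega)
    simp only [ha, ht, Finset.card_fin, map_sub, h1, Finset.image_empty, Finset.card_empty,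
      mul_zero, add_zero, S.coeff_zero_amp_empty hX, hw, S.y_zCoord hX]
    ring
  have ht1 : a g Finset.univ * t 0 ∅ = -(S.y w * a g Finset.univ) := by
    simp only [ha, ht, Finset.card_fin, map_sub, Finset.image_empty, Finset.card_empty,
      mul_zero, add_zero, S.coeff_zero_amp_empty hX, hw, S.y_zCoord hX,
      S.trace_insertion_empty hX, map_zero]
    ring
  set c := -(w ^ 2 * D ^ 2 * P) with hc
  have hterm : ∀ h ∈ Finset.range (g + 1), ∀ I : Finset (Fin n),
      (if (h = 0 ∧ I = ∅) ∨ (h = g ∧ I = Finset.univ) then 0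
        else S.omega h (I.card + 1) (Fin.cons w fun i => S.zCoord (x (I.orderEmbOfFin rfl i)))
          * S.omega (g - h) (Iᶜ.card + 1)
            (Fin.cons (1 / w) fun i => S.zCoord (x (Iᶜ.orderEmbOfFin rfl i))))
      = c * (a h I * t (g - h) Iᶜ) - c * (if (h = 0 ∧ I = ∅) ∨ (h = g ∧ I = Finset.univ)
          then a h I * t (g - h) Iᶜ else 0) := by
    intro h hh I
    split_ifs with hcond
    · ring
    · rw [hω, hω' _ _ (fun hn => hcond (Or.inr ⟨?_, ?_⟩)), hc, hP,
        ← Finset.prod_mul_prod_compl I]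
      · ring
      · have := Finset.mem_range.1 hh
        omega
      · rw [Finset.compl_eq_empty_iff] at hn
        exact hn.2
  have hexc : ∑ h ∈ Finset.range (g + 1), ∑ I : Finset (Fin n),
      (if (h = 0 ∧ I = ∅) ∨ (h = g ∧ I = Finset.univ) then a h I * t (g - h) Iᶜ else 0)
      = -2 * (S.y w * a g Finset.univ) := by
    -- The excluded terms `(0, ∅)` and `(g, univ)` are different because `(g, n) ≠ (0, 0)`.
    rw [← Finset.sum_product', Finset.sum_eq_add (0, ∅) (g, Finset.univ)]
    · simp only [Finset.compl_empty, Finset.compl_univ, Nat.sub_zero, Nat.sub_self, ht0, ht1,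
        true_or, or_true, if_true, and_self]
      ring
    · intro e
      have h1 := congrArg Prod.fst e
      have h2 := congrArg (fun p => p.2.card) e
      simp only [Finset.card_empty, Finset.card_fin] at h1 h2
      omega
    · rintro ⟨h, I⟩ - ⟨h1, h2⟩
      rw [if_neg]
      rintro (⟨rfl, rfl⟩ | ⟨rfl, rfl⟩)
      · exact h1 rfl
      · exact h2 rfl
    · exact fun h => absurd (Finset.mem_product.2 ⟨Finset.mem_range.2 (by omega),
        Finset.mem_univ _⟩) h
    · exact fun h => absurd (Finset.mem_product.2 ⟨Finset.mem_range.2 (by omega),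
        Finset.mem_univ _⟩) h
  rw [recursionBracket, hfirst, hlast]
  have hS : ∑ h ∈ Finset.range (g + 1), ∑ I : Finset (Fin n),
      (if (h = 0 ∧ I = ∅) ∨ (h = g ∧ I = Finset.univ) then 0
        else S.omega h (I.card + 1) (Fin.cons w fun i => S.zCoord (x (I.orderEmbOfFin rfl i)))
          * S.omega (g - h) (Iᶜ.card + 1)
            (Fin.cons (1 / w) fun i => S.zCoord (x (Iᶜ.orderEmbOfFin rfl i))))
      = c * ∑ h ∈ Finset.range (g + 1), ∑ I : Finset (Fin n), a h I * t (g - h) Iᶜ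
        - c * (-2 * (S.y w * a g Finset.univ)) := by
    rw [← hexc, Finset.mul_sum, Finset.mul_sum, ← Finset.sum_sub_distrib]
    refine Finset.sum_congr rfl fun h hh => ?_
    rw [Finset.mul_sum, Finset.mul_sum, ← Finset.sum_sub_distrib]
    exact Finset.sum_congr rfl fun I _ => hterm h hh I
  rw [hS, ← hloop]
  rw [hc]
  ring

end SpectralSystem

end PainleveII

namespace PainleveII

/-! ### The bracket of the recursion as a parametric function -/

namespace IsParametric

variable {n : ℕ}

theorem inv_sq_sub_one_inv :
    IsParametric (fun (_ : Fin n → ℂ) w => ((1 / w) ^ 2 - 1)⁻¹) :=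
  (((const (-1)).mul (point.pow 2)).mul inv_sq_sub_one).congr fun z w hz => by
    obtain ⟨⟨h1, h2⟩, -⟩ := evalAt_denomPoly_ne_zero.1 hz
    have : (1 / w) ^ 2 - 1 = -(w ^ 2 - 1) / w ^ 2 := by field_simp; ring
    rw [this, inv_div, div_neg, div_eq_mul_inv]
    ring

theorem inv_inv_sub (i : Fin n) : IsParametric (fun (z : Fin n → ℂ) w => (1 / w - z i)⁻¹) :=
  (point.mul (inv_one_sub i)).congr fun z w hz => by
    obtain ⟨⟨h1, -⟩, -⟩ := evalAt_denomPoly_ne_zero.1 hz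
    have : 1 / w - z i = (1 - w * z i) / w := by field_simp
    rw [this, inv_div, div_eq_mul_inv]

theorem one_div_point : IsParametric (fun (_ : Fin n → ℂ) w => 1 / w) :=
  inv_point.congr fun _ w _ => one_div w

theorem xParam (u₀ : ℂ) : IsParametric (fun (_ : Fin n → ℂ) w => PainleveII.xParam u₀ w) :=
  (const _).mul (point.add one_div_point)

theorem dxParam (u₀ : ℂ) : IsParametric (fun (_ : Fin n → ℂ) w => PainleveII.dxParam u₀ w) :=
  (((const (u₀ / 2)).mul ((point.pow 2).add (const (-1)))).mul (inv_point.pow 2)).congr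
    fun z w hz => by
      obtain ⟨⟨h1, -⟩, -⟩ := evalAt_denomPoly_ne_zero.1 hz
      rw [PainleveII.dxParam]
      field_simp
      ring

end IsParametric

namespace SpectralSystem

variable {U : Set ℂ} {u₀ : ℂ} (S : SpectralSystem U u₀) {n : ℕ}

theorem isParametric_y : IsParametric (fun (_ : Fin n → ℂ) w => S.y w) := by
  have h : IsParametric (fun (_ : Fin n → ℂ) w => S.curve.eval (xParam u₀ w)) := by
    simp only [Polynomial.eval_eq_sum_range]
    exact IsParametric.sum _ fun i _ => (IsParametric.const _).mul ((IsParametric.xParam u₀).pow i)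
  refine (((IsParametric.const (Complex.I * u₀ / 2)).mul IsParametric.inv_point).mul
    (((IsParametric.point.add (IsParametric.const 1)).mul
      (IsParametric.point.add (IsParametric.const (-1)))).mul h)).congr fun z w hz => ?_
  rw [y]
  ring

theorem isParametric_omega_cons {h k : ℕ} (hk : ¬(h = 0 ∧ k = 0)) (j : Fin k → Fin n)
    {a : (Fin n → ℂ) → ℂ → ℂ} (ha : IsParametric a)
    (ha' : IsParametric (fun z w => (a z w ^ 2 - 1)⁻¹))
    (hsub : ∀ i, IsParametric (fun z w => (a z w - z i)⁻¹)) :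
    IsParametric (fun z w => S.omega h (k + 1) (Fin.cons (a z w) fun i => z (j i))) := by
  by_cases hs : 3 ≤ 2 * h + (k + 1)
  · simp only [S.omega_of_stable hs]
    refine (IsParametric.liftForm u₀ (S.formDatum h (k + 1)).1 (S.formDatum h (k + 1)).2
      (t := (Fin.cons a fun i z _ => z (j i) : Fin (k + 1) → (Fin n → ℂ) → ℂ → ℂ))
      (fun i => ?_) fun i => ?_).congr fun z w _ => ?_
    · exact Fin.cases ha (fun i => IsParametric.param (j i)) i
    · exact Fin.cases ha' (fun i => IsParametric.inv_param (j i)) i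
    · congr 1
      funext i
      exact Fin.cases rfl (fun i => rfl) i
  · obtain rfl : h = 0 := by omega
    obtain rfl : k = 1 := by omega
    refine ((hsub (j 0)).pow 2).congr fun z w _ => ?_
    show 1 / (a z w - z (j 0)) ^ 2 = _
    rw [one_div, inv_pow]

theorem isParametric_omega_cons_cons (g : ℕ) : IsParametric (fun (z : Fin n → ℂ) w =>
    S.omega g (n + 2) (Fin.cons w (Fin.cons (1 / w) z))) := by
  by_cases hs : 3 ≤ 2 * g + (n + 2)
  · simp only [S.omega_of_stable hs]
    refine (IsParametric.liftForm u₀ (S.formDatum g (n + 2)).1 (S.formDatum g (n + 2)).2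
      (t := (Fin.cons (fun _ w => w) (Fin.cons (fun _ w => 1 / w) fun i z _ => z i) :
        Fin (n + 2) → (Fin n → ℂ) → ℂ → ℂ)) (fun i => ?_) fun i => ?_).congr fun z w _ => ?_
    · exact Fin.cases IsParametric.point (fun i => Fin.cases IsParametric.one_div_point
        (fun i => IsParametric.param i) i) i
    · exact Fin.cases IsParametric.inv_sq_sub_one (fun i => Fin.cases
        IsParametric.inv_sq_sub_one_inv (fun i => IsParametric.inv_param i) i) i
    · congr 1
      funext i
      exact Fin.cases rfl (fun i => Fin.cases rfl (fun i => rfl) i) i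
  · obtain rfl : g = 0 := by omega
    obtain rfl : n = 0 := by omega
    refine ((IsParametric.point.mul IsParametric.inv_sq_sub_one).pow 2).congr fun z w hz => ?_
    obtain ⟨⟨h1, h2⟩, -⟩ := evalAt_denomPoly_ne_zero.1 hz
    show 1 / (w - 1 / w) ^ 2 = _
    have : w - 1 / w = (w ^ 2 - 1) / w := by field_simp
    rw [this, div_pow, one_div_div, ← div_eq_mul_inv, div_pow]

/-- The bracket of the recursion completed by the excluded terms. -/
def fullBracket (g n : ℕ) (z : Fin n → ℂ) (w : ℂ) : ℂ :=
  recursionBracket S.omega g n z w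
    + 2 * w ^ 2 * S.y w * dxParam u₀ w * S.omega g (n + 1) (Fin.snoc z w)

theorem isParametric_fullBracket {g : ℕ} (hgn : 2 ≤ 2 * g + n) :
    IsParametric (S.fullBracket g n) := by
  refine IsParametric.add (IsParametric.add ?_ ?_) ?_
  · split_ifs
    · exact IsParametric.const 0
    · exact S.isParametric_omega_cons_cons (g - 1)
  · refine IsParametric.sum _ fun h hh => IsParametric.sum _ fun I _ => ?_
    split_ifs with hc
    · exact IsParametric.const 0
    · refine (S.isParametric_omega_cons ?_ _ IsParametric.point IsParametric.inv_sq_sub_one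
        IsParametric.inv_sub).mul (S.isParametric_omega_cons ?_ _ IsParametric.one_div_point
          IsParametric.inv_sq_sub_one_inv IsParametric.inv_inv_sub)
      · rintro ⟨rfl, h2⟩
        exact hc (Or.inl ⟨rfl, Finset.card_eq_zero.1 h2⟩)
      · rintro ⟨h1, h2⟩
        have := Finset.mem_range.1 hh
        exact hc (Or.inr ⟨by omega, (Finset.compl_eq_empty_iff I).1 (Finset.card_eq_zero.1 h2)⟩)
  · refine ((((IsParametric.const 2).mul (IsParametric.point.pow 2)).mul
      S.isParametric_y).mul (IsParametric.dxParam u₀)).mul ?_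
    simp only [S.omega_of_stable (g := g) (n := n + 1) (by omega)]
    refine (IsParametric.liftForm u₀ (S.formDatum g (n + 1)).1 (S.formDatum g (n + 1)).2
      (t := (Fin.snoc (fun i z _ => z i) (fun _ w => w) :
        Fin (n + 1) → (Fin n → ℂ) → ℂ → ℂ)) (fun i => ?_) fun i => ?_).congr fun z w _ => ?_
    · refine Fin.lastCases ?_ (fun i => ?_) i
      · simpa using IsParametric.point
      · simpa using IsParametric.param i
    · refine Fin.lastCases ?_ (fun i => ?_) i
      · simpa using IsParametric.inv_sq_sub_one
      · simpa using IsParametric.inv_param i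
    · congr 1
      funext i
      refine Fin.lastCases ?_ (fun i => ?_) i <;> simp

theorem _root_.PainleveII.exists_eval_xParam (u₀ : ℂ) (q : Polynomial ℂ) : ∃ r : Polynomial ℂ,
    ∀ w : ℂ, w ≠ 0 → r.eval w = w ^ q.natDegree * q.eval (xParam u₀ w) := by
  refine ⟨∑ i ∈ Finset.range (q.natDegree + 1), Polynomial.C (q.coeff i * (u₀ / 2) ^ i)
    * ((Polynomial.X ^ 2 + 1) ^ i * Polynomial.X ^ (q.natDegree - i)), fun w hw => ?_⟩
  rw [Polynomial.eval_finsetSum, Polynomial.eval_eq_sum_range, Finset.mul_sum]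
  refine Finset.sum_congr rfl fun i hi => ?_
  obtain ⟨r, hr⟩ := Nat.exists_eq_add_of_le (Nat.lt_succ_iff.1 (Finset.mem_range.1 hi))
  have : xParam u₀ w = u₀ / 2 * (w ^ 2 + 1) / w := by rw [xParam]; field_simp
  simp only [Polynomial.eval_mul, Polynomial.eval_pow, Polynomial.eval_add, Polynomial.eval_X,
    Polynomial.eval_one, Polynomial.eval_C]
  rw [this, hr, Nat.add_sub_cancel_left, pow_add]
  simp only [div_pow, mul_pow]
  field_simp

/-- For generic parameters the completed bracket is `x'(w)²` times the right hand side of the loop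
equation. The latter is regular at `x = ±u₀`, and `x'` has simple zeros at `w = ±1`. -/
theorem exists_fullBracket_double_zero {g : ℕ} (hgn : 2 ≤ 2 * g + n) :
    ∃ (e : ℕ) (H : Polynomial (MvPolynomial (Fin n) ℂ)), ∀ z w, evalAt z w (denomPoly n) ≠ 0 →
      S.fullBracket g n z w * evalAt z w (denomPoly n) ^ e
        = (w ^ 2 - 1) ^ (e + 2) * evalAt z w H := by
  refine (S.isParametric_fullBracket hgn).exists_double_zero (Z := S.zCoord '' U)
    (S.infinite.image S.zCoord_injOn) fun z hz hinjz => ?_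
  choose x hx hxz using hz
  obtain rfl : z = fun i => S.zCoord (x i) := funext fun i => (hxz i).symm
  have hinj : Function.Injective x := fun a b hab => hinjz (by simp [hab])
  set J := Finset.univ.image x with hJ
  obtain ⟨c, q, hq⟩ := S.isRational_loopRight J (n + 2 * g)
  obtain ⟨r, hr⟩ := exists_eval_xParam u₀ q
  have hu := S.u₀_ne
  set κ : ℂ := ∏ i, (2 / u₀ * S.zCoord (x i)) with hκ
  set P := ∏ i, dxParam u₀ (S.zCoord (x i)) with hP
  set T₁ : Polynomial ℂ := ∏ i, ((Polynomial.X - Polynomial.C (S.zCoord (x i)))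
    * (Polynomial.X * Polynomial.C (S.zCoord (x i)) - 1)) with hT₁
  have hT₁e : ∀ w, T₁.eval w = ∏ i, ((w - S.zCoord (x i)) * (w * S.zCoord (x i) - 1)) := fun w => by
    simp only [hT₁, Polynomial.eval_prod, Polynomial.eval_mul, Polynomial.eval_sub,
      Polynomial.eval_X, Polynomial.eval_C, Polynomial.eval_one]
  have hT : ∀ a : ℂ, a ^ 2 = 1 →
      (Polynomial.X ^ (2 + q.natDegree) * T₁ ^ c).eval a ≠ 0 := by
    intro a ha
    have ha0 : a ≠ 0 := by rintro rfl; simp at ha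
    rw [Polynomial.eval_mul, Polynomial.eval_pow, Polynomial.eval_pow, Polynomial.eval_X, hT₁e]
    refine mul_ne_zero (pow_ne_zero _ ha0) (pow_ne_zero _ (Finset.prod_ne_zero_iff.2 fun i _ => ?_))
    intro h0
    refine S.zCoord_sq_sub_one_ne (hx i) ?_
    rcases mul_eq_zero.1 h0 with h | h
    · linear_combination (-a - S.zCoord (x i)) * h + ha
    · linear_combination (a * S.zCoord (x i) + 1) * h - S.zCoord (x i) ^ 2 * ha
  -- The multiplier clears the `w²` in the denominator of `w² x'(w)²`, the powers of `1/w` in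
  -- `q(x(w))`, and the poles at `x = xᵢ`. None of its factors vanishes at `±1`.
  refine ⟨Polynomial.X ^ (2 + q.natDegree) * T₁ ^ c,
    Polynomial.C (-(u₀ ^ 2 / 4) * P * κ ^ c) * r * Polynomial.X ^ (n * c),
    S.zCoord '' (U \ J), hT 1 (by norm_num), hT (-1) (by norm_num),
    (S.infinite.sdiff J.finite_toSet).image (S.zCoord_injOn.mono Set.sdiff_subset), ?_⟩
  rintro w ⟨X, ⟨hX, hXJ⟩, rfl⟩
  have hXx : X ∉ J := by simpa using hXJ
  have hw := S.zCoord_ne_zero hX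
  have hne : ∀ i, X - x i ≠ 0 := fun i h =>
    hXx (sub_eq_zero.1 h ▸ Finset.mem_image_of_mem x (Finset.mem_univ i))
  have hsub : ∀ i, X - x i = u₀ / 2 * ((S.zCoord X - S.zCoord (x i))
      * (S.zCoord X * S.zCoord (x i) - 1)) / (S.zCoord X * S.zCoord (x i)) := fun i => by
    have := sub_xParam (u₀ := u₀) hw (S.zCoord_ne_zero (hx i))
    rwa [S.xParam_zCoord hX, S.xParam_zCoord (hx i)] at this
  refine ⟨evalAt_denomPoly_ne_zero.2 ⟨⟨hw, S.zCoord_sq_sub_one_ne hX⟩, fun i =>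
    ⟨⟨S.zCoord_sq_sub_one_ne (hx i), fun h => hne i ?_⟩, fun h => hne i ?_⟩⟩, ?_⟩
  · rw [hsub, h]; simp
  · rw [hsub, show S.zCoord X * S.zCoord (x i) - 1 = 0 by linear_combination -h]; simp
  have hv : (∏ j ∈ J, (Polynomial.X - Polynomial.C j)).eval X * (κ * S.zCoord X ^ n)
      = T₁.eval (S.zCoord X) := by
    rw [hT₁e, hJ, Finset.prod_image (fun i _ j _ e => hinj e), Polynomial.eval_prod, hκ,
      show S.zCoord X ^ n = ∏ _i : Fin n, S.zCoord X by simp, ← Finset.prod_mul_distrib,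
      ← Finset.prod_mul_distrib]
    refine Finset.prod_congr rfl fun i _ => ?_
    rw [Polynomial.eval_sub, Polynomial.eval_X, Polynomial.eval_C, hsub]
    have := S.zCoord_ne_zero (hx i)
    field_simp
  have hE := S.recursionBracket_add_eq hgn hX hx hinj hXx
  have hL := hq X ⟨hX, hXJ⟩
  have hr' := hr _ hw
  rw [S.xParam_zCoord hX, ← hL] at hr'
  rw [fullBracket, hE, ← hP]
  simp only [Polynomial.eval_mul, Polynomial.eval_pow, Polynomial.eval_X, Polynomial.eval_C]
  rw [← hv, hr', dxParam, mul_pow, mul_pow, ← pow_mul]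
  generalize S.zCoord X = w at *
  generalize w ^ 2 - 1 = a
  rw [pow_add]
  field_simp
  try ring

theorem eval_curve_xParam_ne {a : ℂ} (ha : a ^ 2 = 1) : S.curve.eval (xParam u₀ a) ≠ 0 := by
  have : (a - 1) * (a + 1) = 0 := by linear_combination ha
  rcases mul_eq_zero.1 this with h | h
  · obtain rfl : a = 1 := by linear_combination h
    rw [show xParam u₀ 1 = u₀ by rw [xParam]; norm_num]
    exact S.curve_eval_ne
  · obtain rfl : a = -1 := by linear_combination h
    rw [show xParam u₀ (-1) = -u₀ by rw [xParam]; norm_num]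
    exact S.curve_eval_neg_ne

/-- The topological recursion. -/
theorem exists_hasResidueAt_recursion {g : ℕ} (hgn : 2 ≤ 2 * g + n) {z : Fin n → ℂ} {p : ℂ}
    (hz : ∀ i, z i ^ 2 - 1 ≠ 0) (hp : p ^ 2 - 1 ≠ 0) :
    ∃ r₁ r₂ : ℂ,
      HasResidueAt (fun w => 1 / (2 * u₀ * S.y w * (1 - p / w) * (1 / w - p))
        * (recursionBracket S.omega g n z w * (-1 / w ^ 2))) 1 r₁ ∧
      HasResidueAt (fun w => 1 / (2 * u₀ * S.y w * (1 - p / w) * (1 / w - p))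
        * (recursionBracket S.omega g n z w * (-1 / w ^ 2))) (-1) r₂ ∧
      S.omega g (n + 1) (Fin.snoc z p) = r₁ + r₂ := by
  have hs : 3 ≤ 2 * g + (n + 1) := by omega
  obtain ⟨h1, -⟩ := S.isFormDatum hs
  obtain ⟨P, hP, hPe⟩ := exists_liftForm_update_eq u₀ h1 (Fin.snoc z 0) (Fin.last n)
  have hsymm := fun w hw => liftForm_update_inv u₀ h1 (Fin.snoc z 0) (Fin.last n) (w := w) hw
  simp only [hPe] at hsymm
  simp only [Fin.update_snoc_last] at hPe
  have hom : ∀ w, S.omega g (n + 1) (Fin.snoc z w)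
      = P.eval w / (w ^ 2 - 1) ^ (2 * (S.formDatum g (n + 1)).1 + 2) := fun w => by
    rw [S.omega_of_stable hs, hPe]
  obtain ⟨r₁, r₂, hr₁, hr₂, hr⟩ := exists_hasResidueAt_kernel_mul (by omega) P hP
    (fun w hw _ => hsymm w hw) hp
  obtain ⟨e, H, hH⟩ := S.exists_fullBracket_double_zero hgn
  have hu := S.u₀_ne
  set R : ℂ → ℂ := fun w => ∏ i, (((z i ^ 2 - 1) * (w - z i)) * (1 - w * z i)) with hR
  set den : ℂ → ℂ := fun w => Complex.I * u₀ ^ 2 * S.curve.eval (xParam u₀ w)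
    * ((w - p) * (1 - p * w)) * (w * R w) ^ e with hden
  -- Replacing the bracket by minus the excluded terms cancels `y` against the kernel and leaves the
  -- Cauchy kernel of `exists_hasResidueAt_kernel_mul`.
  have key : ∀ a r : ℂ, a ^ 2 = 1 →
      HasResidueAt (fun w => (w ^ 2 - 1) / (2 * ((w - p) * (1 - p * w)))
        * (P.eval w / (w ^ 2 - 1) ^ (2 * (S.formDatum g (n + 1)).1 + 2))) a r →
      HasResidueAt (fun w => 1 / (2 * u₀ * S.y w * (1 - p / w) * (1 / w - p))
        * (recursionBracket S.omega g n z w * (-1 / w ^ 2))) a r := by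
    intro a r ha hres
    have ha0 : a ≠ 0 := by rintro rfl; simp at ha
    have hap : ∀ q : ℂ, q ^ 2 - 1 ≠ 0 → a - q ≠ 0 := fun q hq h => hq (by
      linear_combination (-a - q) * h + ha)
    have hap' : ∀ q : ℂ, q ^ 2 - 1 ≠ 0 → 1 - a * q ≠ 0 := fun q hq h => hq (by
      linear_combination (-1 - a * q) * h - q ^ 2 * ha)
    have hRa : R a ≠ 0 := Finset.prod_ne_zero_iff.2 fun i _ =>
      mul_ne_zero (mul_ne_zero (hz i) (hap _ (hz i))) (hap' _ (hz i))
    have hdena : den a ≠ 0 := by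
      refine mul_ne_zero (mul_ne_zero (mul_ne_zero (mul_ne_zero Complex.I_ne_zero
        (pow_ne_zero _ hu)) (S.eval_curve_xParam_ne ha)) (mul_ne_zero (hap p hp) ?_))
        (pow_ne_zero _ (mul_ne_zero ha0 hRa))
      rw [mul_comm p]
      exact hap' p hp
    have hRan : AnalyticAt ℂ R a := by
      refine Finset.analyticAt_fun_prod _ fun i _ => ?_
      fun_prop
    have hxan : AnalyticAt ℂ (xParam u₀) a := by
      unfold xParam
      exact analyticAt_const.mul (analyticAt_id.add (analyticAt_const.div analyticAt_id ha0))
    have hcan : AnalyticAt ℂ (fun w => S.curve.eval (xParam u₀ w)) a :=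
      hxan.aeval_polynomial S.curve
    have hdenan : AnalyticAt ℂ den a := by
      refine ((analyticAt_const.mul hcan).mul ?_).mul ((analyticAt_id.mul hRan).pow e)
      fun_prop
    have hHan : AnalyticAt ℂ (fun w => evalAt z w H) a := by
      have : (fun w => evalAt z w H) = fun w => (H.map (MvPolynomial.eval z)).eval w := by
        funext w
        rw [evalAt, Polynomial.coe_eval₂RingHom, Polynomial.eval_map]
      rw [this]
      exact analyticAt_id.aeval_polynomial _
    -- What remains is regular: the double zero of the completed bracket outweighs the simple zero
    -- of `y`.
    have hG : AnalyticAt ℂ (fun w => -((w ^ 2 - 1) * evalAt z w H * w) / den w) a := by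
      refine AnalyticAt.div ?_ hdenan hdena
      fun_prop
    have hsum := hres.add (HasResidueAt.of_analyticAt hG)
    rw [add_zero] at hsum
    refine hsum.congr ?_
    filter_upwards [nhdsWithin_le_nhds (hdenan.continuousAt.eventually_ne hdena),
      eventually_sq_sub_one_ne a, nhdsWithin_le_nhds (eventually_ne_nhds ha0),
      nhdsWithin_le_nhds (hRan.continuousAt.eventually_ne hRa)]
      with w hw1 hw2 hw0 hwR
    have hc : S.curve.eval (xParam u₀ w) ≠ 0 := by
      intro h
      simp [hden, h] at hw1
    have hk : (w - p) * (1 - p * w) ≠ 0 := by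
      intro h
      simp only [hden, h, mul_zero, zero_mul, ne_eq, not_true_eq_false] at hw1
    have hΔ : evalAt z w (denomPoly n) = w * (w ^ 2 - 1) * R w := evalAt_denomPoly z w
    have hE := hH z w (by
      rw [hΔ]
      exact mul_ne_zero (mul_ne_zero hw0 hw2) hwR)
    rw [hΔ, fullBracket, hom] at hE
    have hE' : (recursionBracket S.omega g n z w + 2 * w ^ 2 * S.y w * dxParam u₀ w
        * (P.eval w / (w ^ 2 - 1) ^ (2 * (S.formDatum g (n + 1)).1 + 2))) * (w * R w) ^ e
        = (w ^ 2 - 1) ^ 2 * evalAt z w H := by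
      refine mul_left_cancel₀ (pow_ne_zero e hw2) ?_
      rw [show w * (w ^ 2 - 1) * R w = (w ^ 2 - 1) * (w * R w) by ring, mul_pow] at hE
      rw [← mul_assoc _ ((w ^ 2 - 1) ^ 2), ← pow_add, ← hE]
      ring
    have hy : S.y w = Complex.I * u₀ / (2 * w) * (w ^ 2 - 1) * S.curve.eval (xParam u₀ w) := by
      rw [y]; ring
    have hky : (1 - p / w) * (1 / w - p) = (w - p) * (1 - p * w) / w ^ 2 := by
      field_simp
    have hB := eq_sub_of_add_eq (eq_div_of_mul_eq (pow_ne_zero e (mul_ne_zero hw0 hwR)) hE')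
    rw [hB, mul_assoc _ (1 - p / w), hky, hden, hy, dxParam]
    generalize P.eval w / (w ^ 2 - 1) ^ (2 * (S.formDatum g (n + 1)).1 + 2) = o at *
    have hwR' := pow_ne_zero e (mul_ne_zero hw0 hwR)
    dsimp only
    generalize (w * R w) ^ e = E at *
    generalize evalAt z w H = h at *
    generalize S.curve.eval (xParam u₀ w) = c at *
    generalize w ^ 2 - 1 = b at *
    generalize (w - p) * (1 - p * w) = k at *
    field_simp
    ring
  exact ⟨r₁, r₂, key 1 r₁ (by norm_num) hr₁, key (-1) r₂ (by norm_num) hr₂, by rw [hom, ← hr]⟩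

end SpectralSystem

end PainleveII

namespace PainleveII

/-! ### The leading coefficients of the Gelfand–Dikii polynomials -/

section Binomial

/-- `binom(2k, k) / 4^k`. -/
def halfBinom (k : ℕ) : ℂ :=
  (Nat.factorial (2 * k) : ℂ) / (2 ^ (2 * k) * (Nat.factorial k : ℂ) ^ 2)

theorem halfBinom_zero : halfBinom 0 = 1 := by simp [halfBinom]

theorem halfBinom_succ (k : ℕ) :
    2 * ((k : ℂ) + 1) * halfBinom (k + 1) = (2 * k + 1) * halfBinom k := by
  rw [halfBinom, halfBinom, show 2 * (k + 1) = 2 * k + 1 + 1 by ring, Nat.factorial_succ,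
    Nat.factorial_succ (2 * k), Nat.factorial_succ k]
  have h1 : (Nat.factorial k : ℂ) ≠ 0 := by exact_mod_cast Nat.factorial_ne_zero k
  have h2 : (k : ℂ) + 1 ≠ 0 := by exact_mod_cast Nat.succ_ne_zero k
  push_cast
  rw [show 2 * k + 1 + 1 = 2 * k + 2 by ring, pow_add]
  field_simp
  ring

/-- The numbers are the Taylor coefficients of `(1 - x)^{-1/2}`, whose square is the geometric
series. The proof combines the recurrence of `halfBinom` with the symmetry `i ↔ n - i`. -/
theorem sum_halfBinom_mul (n : ℕ) :
    ∑ i ∈ Finset.range (n + 1), halfBinom i * halfBinom (n - i) = 1 := by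
  have hsymm : ∀ n, 2 * ∑ i ∈ Finset.range (n + 1), (i : ℂ) * (halfBinom i * halfBinom (n - i))
      = n * ∑ i ∈ Finset.range (n + 1), halfBinom i * halfBinom (n - i) := by
    intro n
    rw [two_mul]
    nth_rewrite 1 [← Finset.sum_range_reflect]
    rw [← Finset.sum_add_distrib, Finset.mul_sum]
    refine Finset.sum_congr rfl fun i hi => ?_
    have hi' := Nat.lt_succ_iff.1 (Finset.mem_range.1 hi)
    rw [show n + 1 - 1 - i = n - i by omega, Nat.sub_sub_self hi', Nat.cast_sub hi']
    ring
  induction n with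
  | zero => simp [halfBinom_zero]
  | succ n ih =>
    have h1 := hsymm (n + 1)
    rw [Finset.sum_range_succ' (fun i => (i : ℂ) * (halfBinom i * halfBinom (n + 1 - i)))] at h1
    have h2 : 2 * ∑ i ∈ Finset.range (n + 1),
          ((i + 1 : ℕ) : ℂ) * (halfBinom (i + 1) * halfBinom (n + 1 - (i + 1)))
        = 2 * ∑ i ∈ Finset.range (n + 1), (i : ℂ) * (halfBinom i * halfBinom (n - i))
          + ∑ i ∈ Finset.range (n + 1), halfBinom i * halfBinom (n - i) := by
      rw [Finset.mul_sum, Finset.mul_sum, ← Finset.sum_add_distrib]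
      refine Finset.sum_congr rfl fun i _ => ?_
      rw [Nat.add_sub_add_right]
      push_cast
      linear_combination halfBinom (n - i) * halfBinom_succ i
    rw [Nat.cast_zero, zero_mul, add_zero, h2, hsymm, ih] at h1
    have h3 : ((n + 1 : ℕ) : ℂ) ≠ 0 := by exact_mod_cast Nat.succ_ne_zero n
    refine mul_left_cancel₀ h3 ?_
    rw [← h1]
    push_cast
    ring

/-- At ħ = 0 the derivative terms of the Gelfand–Dikii recursion disappear, and the remaining
quadratic recursion is solved by central binomial coefficients through their convolution identity.
-/
theorem leading_eq {v : ℂ} {β γ : ℕ → ℂ} (hβ0 : β 0 = v) (hγ0 : 2 * γ 0 = v ^ 2)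
    (hβ : ∀ k, β (k + 1) = v * γ k)
    (hγ : ∀ k, 2 * γ (k + 1) = 2 * (v * β (k + 1))
      + ∑ i ∈ Finset.range k, β (i + 1) * β (k - i)
      - ∑ i ∈ Finset.range (k + 1), γ i * γ (k - i)) (k : ℕ) :
    β k = halfBinom k * v ^ (2 * k + 1) ∧ γ k = halfBinom (k + 1) * v ^ (2 * k + 2) := by
  have h1 : 2 * halfBinom 1 = 1 := by simpa [halfBinom_zero] using halfBinom_succ 0
  induction k using Nat.strong_induction_on with
  | _ k ih =>
  rcases k with _ | k
  · refine ⟨by rw [hβ0, halfBinom_zero]; ring, ?_⟩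
    linear_combination hγ0 / 2 - v ^ 2 / 2 * h1
  · have hb : ∀ i ≤ k + 1, β i = halfBinom i * v ^ (2 * i + 1) := by
      intro i hi
      rcases i with _ | i
      · rw [hβ0, halfBinom_zero]; ring
      · rw [hβ, (ih i (by omega)).2]; ring
    refine ⟨hb _ le_rfl, ?_⟩
    have e1 : ∑ i ∈ Finset.range k, β (i + 1) * β (k - i)
        = v ^ (2 * k + 4) * ∑ i ∈ Finset.range k, halfBinom (i + 1) * halfBinom (k - i) := by
      rw [Finset.mul_sum]
      refine Finset.sum_congr rfl fun i hi => ?_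
      have := Finset.mem_range.1 hi
      rw [hb _ (by omega), hb _ (by omega), show 2 * k + 4 = 2 * (i + 1) + 1 + (2 * (k - i) + 1) by
        omega, pow_add]
      ring
    have e2 : ∑ i ∈ Finset.range (k + 1), γ i * γ (k - i)
        = v ^ (2 * k + 4) * ∑ i ∈ Finset.range (k + 1),
          halfBinom (i + 1) * halfBinom (k + 1 - i) := by
      rw [Finset.mul_sum]
      refine Finset.sum_congr rfl fun i hi => ?_
      have := Finset.mem_range.1 hi
      rw [(ih i (by omega)).2, (ih (k - i) (by omega)).2, show 2 * k + 4
        = 2 * i + 2 + (2 * (k - i) + 2) by omega, pow_add, show k + 1 - i = k - i + 1 by omega]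
      ring
    have s1 := sum_halfBinom_mul (k + 1)
    rw [Finset.sum_range_succ, Finset.sum_range_succ'] at s1
    have s2 := sum_halfBinom_mul (k + 2)
    rw [Finset.sum_range_succ, Finset.sum_range_succ'] at s2
    simp only [Nat.sub_self, Nat.sub_zero, halfBinom_zero, Nat.add_sub_add_right,
      show ∀ i, k + 2 - (i + 1) = k + 1 - i from fun i => by omega] at s1 s2
    have h2 := hγ k
    rw [e1, e2, hb _ le_rfl] at h2
    have h3 : 2 * γ (k + 1) = 2 * (halfBinom (k + 1 + 1) * v ^ (2 * (k + 1) + 2)) := by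
      rw [h2]
      linear_combination v ^ (2 * k + 4) * (s1 - s2)
    linear_combination h3 / 2

end Binomial

/-! ### The determinant of the Lax matrix -/

section SeqPoly

variable {R : Type*} [CommRing R]

/-- The polynomials `Pₖ₊₁ = Y Pₖ + aₖ`, `P₀ = e`. -/
def seqPoly (e : R) (a : ℕ → R) : ℕ → Polynomial R
  | 0 => Polynomial.C e
  | k + 1 => Polynomial.X * seqPoly e a k + Polynomial.C (a k)

theorem seqPoly_coeff (e : R) (a : ℕ → R) (k p : ℕ) : (seqPoly e a k).coeff p
    = if p < k then a (k - 1 - p) else if p = k then e else 0 := by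
  induction k generalizing p with
  | zero =>
    rw [seqPoly, Polynomial.coeff_C]
    simp
  | succ k ih =>
    rw [seqPoly, Polynomial.coeff_add, Polynomial.coeff_C]
    rcases p with _ | p
    · simp
    · rw [Polynomial.coeff_X_mul, ih]
      simp only [Nat.add_lt_add_iff_right, Nat.add_right_cancel_iff, Nat.succ_ne_zero, if_false,
        add_zero]
      split_ifs
      · congr 1
        omega
      · rfl
      · rfl

theorem coeff_mul_seqPoly (e e' : R) (a a' : ℕ → R) (k : ℕ) :
    (seqPoly e a (k + 1) * seqPoly e' a' k).coeff k
      = ∑ i ∈ Finset.range k, a (i + 1 - 1) * a' (k - 1 - i) + a k * e' := by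
  rw [mul_comm, Polynomial.coeff_mul, Finset.Nat.sum_antidiagonal_eq_sum_range_succ
    (fun p q => (seqPoly e' a' k).coeff p * (seqPoly e a (k + 1)).coeff q), Finset.sum_range_succ]
  congr 1
  · refine Finset.sum_congr rfl fun i hi => ?_
    have := Finset.mem_range.1 hi
    rw [seqPoly_coeff, seqPoly_coeff, if_pos this, if_pos (by omega), mul_comm]
    congr 2
    omega
  · rw [seqPoly_coeff, seqPoly_coeff, if_neg (lt_irrefl _), if_pos rfl, if_pos (by omega), mul_comm]
    congr 2
    omega

variable (a b c : ℕ → R)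

/-- The bilinear form whose value is the determinant of the Lax matrix, up to its leading part. -/
def detForm (k l : ℕ) : Polynomial R :=
  seqPoly 0 a k * seqPoly 0 a l + Polynomial.X * (seqPoly 0 b k * seqPoly 0 b l)
    - seqPoly 1 c k * seqPoly 1 c l + Polynomial.X ^ (k + l)

theorem detForm_comm (k l : ℕ) : detForm a b c k l = detForm a b c l k := by
  rw [detForm, detForm, add_comm k l]
  ring

variable {a b c}

theorem coeff_detForm_eq_zero (h0 : 2 * c 0 = b 0 ^ 2)
    (h : ∀ k, 2 * c (k + 1) = 2 * (b 0 * b (k + 1))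
      + ∑ i ∈ Finset.range k, b (i + 1) * b (k - i)
      - ∑ i ∈ Finset.range (k + 1), c i * c (k - i)
      + ∑ i ∈ Finset.range (k + 1), a i * a (k - i))
    {k l p : ℕ} (hk : k ≤ p) (hl : l ≤ p) : (detForm a b c k l).coeff p = 0 := by
  set H : ℕ → ℕ → Polynomial R := fun k l => Polynomial.C (a k) * seqPoly 0 a l
    + Polynomial.X * (Polynomial.C (b k) * seqPoly 0 b l) - Polynomial.C (c k) * seqPoly 1 c l
    with hH
  have hstep : ∀ k l, detForm a b c (k + 1) l = Polynomial.X * detForm a b c k l + H k l := by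
    intro k l
    simp only [detForm, hH, seqPoly]
    ring
  have hcoeff : ∀ k l p, l < p → (H k l).coeff p = 0 := by
    intro k l p hp
    obtain ⟨p, rfl⟩ : ∃ p', p = p' + 1 := ⟨p - 1, by omega⟩
    simp only [hH, Polynomial.coeff_sub, Polynomial.coeff_add, Polynomial.coeff_C_mul,
      Polynomial.coeff_X_mul, seqPoly_coeff]
    rw [if_neg (show ¬p + 1 < l by omega), if_neg (show ¬p + 1 = l by omega),
      if_neg (show ¬p < l by omega), if_neg (show ¬p + 1 < l by omega),
      if_neg (show ¬p + 1 = l by omega), ite_self]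
    ring
  -- The convolution sums in the hypothesis are the coefficients of degree `k` of the three
  -- products; this is where the explicit primitive is used.
  have hcrit : ∀ k, (detForm a b c (k + 1) k).coeff k + b k * b 0 - c k = 0 := by
    intro k
    simp only [detForm, Polynomial.coeff_sub, Polynomial.coeff_add, coeff_mul_seqPoly,
      Polynomial.coeff_X_pow]
    rw [if_neg (by omega)]
    rcases k with _ | k
    · simp only [Polynomial.mul_coeff_zero, Polynomial.coeff_X_zero, Finset.range_zero,
        Finset.sum_empty]
      linear_combination -h0
    · rw [Polynomial.coeff_X_mul, Polynomial.coeff_mul, Finset.Nat.sum_antidiagonal_eq_sum_range_succ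
        (fun p q => (seqPoly 0 b (k + 1 + 1)).coeff p * (seqPoly 0 b (k + 1)).coeff q)]
      have e1 : ∑ i ∈ Finset.range (k + 1), (seqPoly 0 b (k + 1 + 1)).coeff i
            * (seqPoly 0 b (k + 1)).coeff (k - i)
          = ∑ i ∈ Finset.range k, b (i + 1) * b (k - i) + b (k + 1) * b 0 := by
        rw [← Finset.sum_range_reflect, Finset.sum_range_succ]
        congr 1
        · refine Finset.sum_congr rfl fun i hi => ?_
          have := Finset.mem_range.1 hi
          rw [seqPoly_coeff, seqPoly_coeff, if_pos (by omega), if_pos (by omega)]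
          congr 2 <;> omega
        · rw [seqPoly_coeff, seqPoly_coeff, if_pos (by omega), if_pos (by omega)]
          congr 2 <;> omega
      rw [e1]
      have hk := h k
      simp only [Nat.add_sub_cancel]
      linear_combination -hk
  have key : ∀ k l p, l ≤ k → k ≤ p → (detForm a b c k l).coeff p = 0 := by
    intro k
    induction k with
    | zero =>
      intro l p hl _
      obtain rfl : l = 0 := by omega
      simp [detForm, seqPoly]
    | succ k ih =>
      have h1 : ∀ l p, l ≤ k → k + 1 ≤ p → (detForm a b c (k + 1) l).coeff p = 0 := by
        intro l p hl hp
        obtain ⟨p, rfl⟩ : ∃ p', p = p' + 1 := ⟨p - 1, by omega⟩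
        rw [hstep, Polynomial.coeff_add, Polynomial.coeff_X_mul, ih l p hl (by omega),
          hcoeff k l _ (by omega), add_zero]
      intro l p hl hp
      rcases Nat.lt_or_ge l (k + 1) with hlt | hge
      · exact h1 l p (by omega) hp
      -- On the diagonal the recursion adds `b k * b 0 - c k` to the critical coefficient, which
      -- `hcrit` cancels.
      obtain rfl : l = k + 1 := by omega
      obtain ⟨p, rfl⟩ : ∃ p', p = p' + 1 := ⟨p - 1, by omega⟩
      rw [hstep, Polynomial.coeff_add, Polynomial.coeff_X_mul, detForm_comm]
      rcases Nat.lt_or_ge k p with hlt | hge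
      · rw [h1 k p le_rfl (by omega), hcoeff k (k + 1) _ (by omega), add_zero]
      · obtain rfl : p = k := by omega
        rw [← hcrit p]
        simp only [hH, Polynomial.coeff_sub, Polynomial.coeff_add, Polynomial.coeff_C_mul,
          Polynomial.coeff_X_mul, seqPoly_coeff]
        simp
        ring
  rcases le_total l k with hlk | hlk
  · exact key k l p hlk hk
  · rw [detForm_comm]
    exact key l k p hlk hl

end SeqPoly

/-- The coefficients of a polynomial with coefficients in the formal series. -/
theorem exists_coeff_eval_sq (P : Polynomial (PowerSeries ℂ)) (k : ℕ) :
    ∃ q : Polynomial ℂ, (∀ N, (∀ p, N ≤ p → PowerSeries.coeff k (P.coeff p) = 0) →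
        q.degree < ((2 * N - 1 : ℕ) : WithBot ℕ)) ∧
      ∀ x : ℂ, PowerSeries.coeff k (P.eval (PowerSeries.C (x ^ 2))) = q.eval x := by
  refine ⟨∑ i ∈ Finset.range (P.natDegree + 1),
    Polynomial.monomial (2 * i) (PowerSeries.coeff k (P.coeff i)), fun N hN => ?_, fun x => ?_⟩
  · refine (Polynomial.degree_sum_le _ _).trans_lt ((Finset.sup_lt_iff (WithBot.bot_lt_coe _)).2
      fun i _ => ?_)
    rcases Nat.lt_or_ge i N with hi | hi
    · refine (Polynomial.degree_monomial_le _ _).trans_lt ?_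
      norm_cast
      omega
    · rw [hN i hi, map_zero, Polynomial.degree_zero]
      exact WithBot.bot_lt_coe _
  · rw [Polynomial.eval_eq_sum_range, map_sum, Polynomial.eval_finsetSum]
    refine Finset.sum_congr rfl fun i _ => ?_
    rw [Polynomial.eval_monomial, ← map_pow, PowerSeries.coeff_mul_C, ← pow_mul]

end PainleveII

namespace PainleveII

open Matrix

/-! ### The entries of the Lax matrix -/

section Lax

/-- The spectral curve as a polynomial. -/
def curvePoly (m : ℕ) (τ : ℕ → ℂ) (u₀ : ℂ) : Polynomial ℂ :=
  ∑ j ∈ Finset.Icc 1 m, Polynomial.C (τ j) * ∑ k ∈ Finset.range j,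
    Polynomial.C (halfBinom k * u₀ ^ (2 * k)) * Polynomial.X ^ (2 * (j - k) - 1)

theorem eval_curvePoly (m : ℕ) (τ : ℕ → ℂ) (u₀ x : ℂ) :
    (curvePoly m τ u₀).eval x = curveFactor m τ u₀ x := by
  simp only [curvePoly, curveFactor, Polynomial.eval_finsetSum, Polynomial.eval_mul,
    Polynomial.eval_C, Polynomial.eval_pow, Polynomial.eval_X]
  refine Finset.sum_congr rfl fun j _ => ?_
  congr 1
  refine Finset.sum_congr rfl fun k _ => ?_
  rw [halfBinom]
  ring

/-- `N` is the last positive index with a nonzero time. Its top term `x^{2N-1}` has coefficient `τ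
N`, and no other index reaches that degree. -/
theorem exists_le_degree_curvePoly {m : ℕ} {τ : ℕ → ℂ} {u₀ : ℂ} (h : curvePoly m τ u₀ ≠ 0) :
    ∃ N, 1 ≤ N ∧ (∀ j ≤ m, N < j → τ j = 0) ∧
      ((2 * N - 1 : ℕ) : WithBot ℕ) ≤ (curvePoly m τ u₀).degree := by
  classical
  have hne : ((Finset.Icc 1 m).filter fun j => τ j ≠ 0).Nonempty := by
    by_contra hne
    rw [Finset.not_nonempty_iff_eq_empty, Finset.filter_eq_empty_iff] at hne
    refine h (Finset.sum_eq_zero fun j hj => ?_)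
    rw [not_not.1 (hne hj), map_zero, zero_mul]
  obtain ⟨N, hN, hmax⟩ := Finset.exists_max_image _ id hne
  obtain ⟨hN1, hN0⟩ := Finset.mem_filter.1 hN
  have hN2 := Finset.mem_Icc.1 hN1
  refine ⟨N, hN2.1, fun j hj hlt => ?_, Polynomial.le_degree_of_ne_zero ?_⟩
  · by_contra h0
    have := hmax j (Finset.mem_filter.2 ⟨Finset.mem_Icc.2 ⟨by omega, hj⟩, h0⟩)
    simp only [id] at this
    omega
  · simp only [curvePoly, Polynomial.finsetSum_coeff, Polynomial.coeff_C_mul,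
      Polynomial.coeff_X_pow]
    rw [Finset.sum_eq_single N, Finset.sum_eq_single 0]
    · simpa [halfBinom_zero] using hN0
    · intro k hk hk0
      have := Finset.mem_range.1 hk
      rw [if_neg (by omega), mul_zero]
    · intro h0
      exact absurd (Finset.mem_range.2 hN2.1) h0
    · intro j hj hjN
      have hj' := Finset.mem_Icc.1 hj
      by_cases h0 : τ j = 0
      · rw [h0, zero_mul]
      · have := hmax j (Finset.mem_filter.2 ⟨hj, h0⟩)
        simp only [id] at this
        rw [Finset.sum_eq_zero, mul_zero]
        intro k _
        rw [if_neg (by omega), mul_zero]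
    · exact fun h0 => absurd hN1 h0

variable {m : ℕ} {τ : ℕ → ℂ} {T : Set ℂ} {u : ℕ → ℂ → ℂ}

theorem coeff_zero_dotT (f : ℂ → PowerSeries ℂ) (t : ℂ) :
    PowerSeries.constantCoeff (dotT f t) = 0 := by
  rw [dotT, map_mul, PowerSeries.constantCoeff_X, zero_mul]

variable (u) (t : ℂ)

/-- Half the time derivative of `R̂ₖ`. -/
def gdA (k : ℕ) : PowerSeries ℂ := (1 / 2 : ℂ) • dotT (gdHat dotT (uSeries u) k) t

/-- `R̂ₖ` at the time `t`. -/
def gdB (k : ℕ) : PowerSeries ℂ := gdHat dotT (uSeries u) k t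

/-- `Řₖ` at the time `t`. -/
def gdC (k : ℕ) : PowerSeries ℂ := gdCheck dotT (uSeries u) k t

theorem two_mul_gdC_zero : 2 * gdC u t 0 = gdB u t 0 ^ 2 := by
  rw [gdC, gdB, gdCheck_zero, gdHat_zero]
  show 2 * ((1 / 2 : ℂ) • uSeries u t ^ 2) = _
  rw [mul_smul_comm, two_mul, ← two_smul ℂ, smul_smul]
  norm_num

theorem two_mul_gdC_succ (k : ℕ) : 2 * gdC u t (k + 1) = 2 * (gdB u t 0 * gdB u t (k + 1))
    + ∑ i ∈ Finset.range k, gdB u t (i + 1) * gdB u t (k - i)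
    - ∑ i ∈ Finset.range (k + 1), gdC u t i * gdC u t (k - i)
    + ∑ i ∈ Finset.range (k + 1), gdA u t i * gdA u t (k - i) := by
  have h := congrFun (gdCheck_succ dotT (uSeries u) k) t
  simp only [Pi.smul_apply, Pi.add_apply, Pi.sub_apply, Pi.mul_apply, Finset.sum_apply] at h
  rw [two_smul, ← two_mul] at h
  have e : ∑ i ∈ Finset.range (k + 1), gdA u t i * gdA u t (k - i)
      = (1 / 4 : ℂ) • ∑ i ∈ Finset.range (k + 1), dotT (gdHat dotT (uSeries u) i) t
        * dotT (gdHat dotT (uSeries u) (k - i)) t := by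
    rw [Finset.smul_sum]
    refine Finset.sum_congr rfl fun i _ => ?_
    rw [gdA, gdA, smul_mul_smul_comm]
    norm_num
  rw [e, show gdB u t 0 = uSeries u t by rw [gdB, gdHat_zero]]
  exact h

theorem constantCoeff_uSeries : PowerSeries.constantCoeff (uSeries u t) = u 0 t := by
  rw [uSeries, ← PowerSeries.coeff_zero_eq_constantCoeff_apply, PowerSeries.coeff_mk]
  simp

theorem constantCoeff_gd (k : ℕ) :
    PowerSeries.constantCoeff (gdB u t k) = halfBinom k * u 0 t ^ (2 * k + 1) ∧
      PowerSeries.constantCoeff (gdC u t k) = halfBinom (k + 1) * u 0 t ^ (2 * k + 2) := by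
  have h0 : PowerSeries.constantCoeff (gdB u t 0) = u 0 t := by
    rw [gdB, gdHat_zero, constantCoeff_uSeries]
  refine leading_eq (β := fun k => PowerSeries.constantCoeff (gdB u t k))
    (γ := fun k => PowerSeries.constantCoeff (gdC u t k)) h0 ?_ (fun k => ?_) (fun k => ?_) k
  · have := congrArg PowerSeries.constantCoeff (two_mul_gdC_zero u t)
    rw [map_mul, map_pow, h0, map_ofNat] at this
    exact this
  · have := congrArg PowerSeries.constantCoeff (congrFun (gdHat_succ dotT (uSeries u) k) t)
    simp only [Pi.sub_apply, Pi.mul_apply, Pi.smul_apply, map_sub, map_mul,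
      PowerSeries.smul_eq_C_mul, coeff_zero_dotT, mul_zero, sub_zero, constantCoeff_uSeries] at this
    exact this
  · have := congrArg PowerSeries.constantCoeff (two_mul_gdC_succ u t k)
    have hA : ∀ i, PowerSeries.constantCoeff (gdA u t i) = 0 := fun i => by
      rw [gdA, PowerSeries.smul_eq_C_mul, map_mul, coeff_zero_dotT, mul_zero]
    simp only [map_sub, map_add, map_mul, map_sum, map_ofNat, h0, hA, zero_mul,
      Finset.sum_const_zero, add_zero] at this
    exact this

theorem laxA_eq_eval (k : ℕ) (x : ℂ) :
    laxA u k x t = (seqPoly 0 (gdA u t) k).eval (PowerSeries.C (x ^ 2)) := by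
  induction k with
  | zero => simp [laxA, seqPoly]
  | succ k ih =>
    rw [laxA, ih, seqPoly, PowerSeries.smul_eq_C_mul]
    simp [gdA]

theorem laxB_eq_eval (k : ℕ) (x : ℂ) :
    laxB u k x t = (seqPoly 0 (gdB u t) k).eval (PowerSeries.C (x ^ 2)) := by
  induction k with
  | zero => simp [laxB, seqPoly]
  | succ k ih =>
    rw [laxB, ih, seqPoly, PowerSeries.smul_eq_C_mul]
    simp [gdB]

theorem laxC_eq_eval (k : ℕ) (x : ℂ) :
    laxC u k x t = (seqPoly 1 (gdC u t) k).eval (PowerSeries.C (x ^ 2)) := by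
  induction k with
  | zero => simp [laxC, seqPoly]
  | succ k ih =>
    rw [laxC, ih, seqPoly, PowerSeries.smul_eq_C_mul]
    simp [gdC]

/-- The times, with `t` added to the first one. -/
def shiftedTimes (τ : ℕ → ℂ) (t : ℂ) (k : ℕ) : ℂ := if k = 0 then τ 0 + t else τ k

variable (m τ)

/-- The combination of the polynomials `Pₖ` that occurs in the Lax matrix. -/
def laxPoly (e : PowerSeries ℂ) (a : ℕ → PowerSeries ℂ) : Polynomial (PowerSeries ℂ) :=
  ∑ k ∈ Finset.range (m + 1), Polynomial.C (PowerSeries.C (shiftedTimes τ t k)) * seqPoly e a k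

/-- The lower diagonal entry of the Lax matrix. -/
def laxDA (x : ℂ) : PowerSeries ℂ := (laxPoly m τ t 0 (gdA u t)).eval (PowerSeries.C (x ^ 2))

/-- The part of the off-diagonal entries of the Lax matrix that is odd in `x`, divided by `x`. -/
def laxDB (x : ℂ) : PowerSeries ℂ := (laxPoly m τ t 0 (gdB u t)).eval (PowerSeries.C (x ^ 2))

/-- The part of the off-diagonal entries of the Lax matrix that is even in `x`. -/
def laxDC (x : ℂ) : PowerSeries ℂ := (laxPoly m τ t 1 (gdC u t)).eval (PowerSeries.C (x ^ 2))

theorem eval_laxPoly (e : PowerSeries ℂ) (a : ℕ → PowerSeries ℂ) (y : PowerSeries ℂ) :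
    (laxPoly m τ t e a).eval y
      = ∑ k ∈ Finset.range (m + 1), τ k • (seqPoly e a k).eval y + t • e := by
  rw [laxPoly, Polynomial.eval_finsetSum, Finset.sum_range_succ', Finset.sum_range_succ', add_assoc]
  simp only [Polynomial.eval_mul, Polynomial.eval_C, ← PowerSeries.smul_eq_C_mul, seqPoly,
    shiftedTimes, if_neg (Nat.succ_ne_zero _), if_true, add_smul]

theorem laxD_eq (x : ℂ) : laxD m τ u x t
    = !![-laxDA m τ u t x, x • laxDB m τ u t x + laxDC m τ u t x;
      x • laxDB m τ u t x - laxDC m τ u t x, laxDA m τ u t x] := by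
  have hA : laxDA m τ u t x = ∑ k ∈ Finset.range (m + 1), τ k • laxA u k x t := by
    rw [laxDA, eval_laxPoly, smul_zero, add_zero]
    simp only [laxA_eq_eval]
  have hB : laxDB m τ u t x = ∑ k ∈ Finset.range (m + 1), τ k • laxB u k x t := by
    rw [laxDB, eval_laxPoly, smul_zero, add_zero]
    simp only [laxB_eq_eval]
  have hC : laxDC m τ u t x = ∑ k ∈ Finset.range (m + 1), τ k • laxC u k x t + t • 1 := by
    rw [laxDC, eval_laxPoly]
    simp only [laxC_eq_eval]
  rw [hA, hB, hC]
  ext i j : 2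
  have e : laxD m τ u x t i j = ∑ k ∈ Finset.range (m + 1), τ k •
      (!![-laxA u k x t, x • laxB u k x t + laxC u k x t;
        x • laxB u k x t - laxC u k x t, laxA u k x t] : SeriesMatrix) i j
      + t • (!![0, 1; -1, 0] : SeriesMatrix) i j := by
    rw [laxD, Matrix.add_apply, Matrix.sum_apply]
    rfl
  rw [e]
  fin_cases i <;> fin_cases j <;>
    simp [Finset.smul_sum, smul_smul, mul_comm x, Finset.sum_add_distrib, smul_add,
      Finset.sum_neg_distrib, add_assoc, sub_eq_add_neg, add_comm]

theorem exists_coeff_laxD_eq (k : ℕ) (i j : Fin 2) : ∃ q : Polynomial ℂ, ∀ x : ℂ,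
    PowerSeries.coeff k (laxD m τ u x t i j) = q.eval x := by
  obtain ⟨a, -, ha⟩ := exists_coeff_eval_sq (laxPoly m τ t 0 (gdA u t)) k
  obtain ⟨b, -, hb⟩ := exists_coeff_eval_sq (laxPoly m τ t 0 (gdB u t)) k
  obtain ⟨c, -, hc⟩ := exists_coeff_eval_sq (laxPoly m τ t 1 (gdC u t)) k
  refine ⟨!![-a, Polynomial.X * b + c; Polynomial.X * b - c, a] i j, fun x => ?_⟩
  rw [laxD_eq]
  fin_cases i <;> fin_cases j <;> simp [laxDA, laxDB, laxDC, -map_pow, ha, hb, hc]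

theorem trace_laxD (x : ℂ) : trace (laxD m τ u x t) = 0 := by
  rw [laxD_eq, trace_fin_two]
  simp

/-- With `Y = x²` the determinant is `C² - A² - Y B²`. Up to the square of `∑ τₖ Yᵏ`, which is
constant in ħ, it is a combination of the bilinear forms `detForm`, of degree below `N` in `Y`. -/
theorem exists_coeff_det_laxD_eq {N : ℕ} (hN : ∀ j ≤ m, N < j → τ j = 0) {k : ℕ} (hk : 1 ≤ k) :
    ∃ q : Polynomial ℂ, q.degree < ((2 * N - 1 : ℕ) : WithBot ℕ) ∧
      ∀ x : ℂ, PowerSeries.coeff k (det (laxD m τ u x t)) = q.eval x := by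
  set P : Polynomial (PowerSeries ℂ) := laxPoly m τ t 1 (gdC u t) ^ 2
    - laxPoly m τ t 0 (gdA u t) ^ 2 - Polynomial.X * laxPoly m τ t 0 (gdB u t) ^ 2 with hP
  have hdet : ∀ x, det (laxD m τ u x t) = P.eval (PowerSeries.C (x ^ 2)) := by
    intro x
    rw [laxD_eq, det_fin_two_of, hP, laxDA, laxDB, laxDC]
    simp only [Polynomial.eval_sub, Polynomial.eval_mul, Polynomial.eval_pow, Polynomial.eval_X,
      PowerSeries.smul_eq_C_mul, map_pow]
    ring
  have hPe : P = (Polynomial.map PowerSeries.C (∑ k ∈ Finset.range (m + 1),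
        Polynomial.C (shiftedTimes τ t k) * Polynomial.X ^ k)) ^ 2
      - ∑ k ∈ Finset.range (m + 1), ∑ l ∈ Finset.range (m + 1),
        Polynomial.C (PowerSeries.C (shiftedTimes τ t k * shiftedTimes τ t l))
          * detForm (gdA u t) (gdB u t) (gdC u t) k l := by
    simp only [hP, laxPoly, sq, Polynomial.map_sum, Polynomial.map_mul, Polynomial.map_C,
      Polynomial.map_pow, Polynomial.map_X, Finset.sum_mul_sum]
    simp only [Finset.mul_sum, ← Finset.sum_sub_distrib]
    refine Finset.sum_congr rfl fun k _ => Finset.sum_congr rfl fun l _ => ?_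
    rw [detForm, map_mul, map_mul, pow_add]
    ring
  obtain ⟨q, hq1, hq2⟩ := exists_coeff_eval_sq P k
  refine ⟨q, hq1 N fun p hp => ?_, fun x => by rw [hdet, hq2]⟩
  rw [hPe, Polynomial.coeff_sub, ← Polynomial.map_pow, Polynomial.coeff_map, map_sub,
    PowerSeries.coeff_C, if_neg (by omega), zero_sub, neg_eq_zero, Polynomial.finsetSum_coeff,
    Finset.sum_eq_zero, map_zero]
  intro i hi
  rw [Polynomial.finsetSum_coeff]
  refine Finset.sum_eq_zero fun j hj => ?_
  have hsh : ∀ i ∈ Finset.range (m + 1), N < i → shiftedTimes τ t i = 0 := fun i hi hlt => by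
    rw [shiftedTimes, if_neg (by omega), hN i (Nat.lt_succ_iff.1 (Finset.mem_range.1 hi)) hlt]
  rw [Polynomial.coeff_C_mul]
  rcases Nat.lt_or_ge N i with h1 | h1
  · rw [hsh i hi h1]; simp
  rcases Nat.lt_or_ge N j with h2 | h2
  · rw [hsh j hj h2]; simp
  rw [coeff_detForm_eq_zero (two_mul_gdC_zero u t) (two_mul_gdC_succ u t) (h1.trans hp)
    (h2.trans hp), mul_zero]

theorem constantCoeff_laxDA (x : ℂ) : PowerSeries.constantCoeff (laxDA m τ u t x) = 0 := by
  have h : ∀ k, PowerSeries.constantCoeff (laxA u k x t) = 0 := fun k => by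
    induction k with
    | zero => simp [laxA]
    | succ k ih =>
      rw [laxA, PowerSeries.smul_eq_C_mul, PowerSeries.smul_eq_C_mul]
      simp [ih, coeff_zero_dotT]
  rw [laxDA, eval_laxPoly, smul_zero, add_zero, map_sum]
  refine Finset.sum_eq_zero fun k _ => ?_
  rw [← laxA_eq_eval, PowerSeries.smul_eq_C_mul, map_mul, h, mul_zero]

theorem constantCoeff_laxB (k : ℕ) (x : ℂ) : PowerSeries.constantCoeff (laxB u k x t)
    = ∑ i ∈ Finset.range k, halfBinom i * u 0 t ^ (2 * i + 1) * x ^ (2 * (k - 1 - i)) := by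
  induction k with
  | zero => simp [laxB]
  | succ k ih =>
    have h := (constantCoeff_gd u t k).1
    rw [gdB] at h
    rw [laxB, PowerSeries.smul_eq_C_mul, map_add, map_mul, PowerSeries.constantCoeff_C, ih, h,
      Finset.sum_range_succ, Finset.mul_sum]
    congr 1
    · refine Finset.sum_congr rfl fun i hi => ?_
      have := Finset.mem_range.1 hi
      rw [show 2 * (k + 1 - 1 - i) = 2 + 2 * (k - 1 - i) by omega, pow_add]
      ring
    · simp

theorem constantCoeff_laxC (k : ℕ) (x : ℂ) : PowerSeries.constantCoeff (laxC u k x t)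
    = halfBinom k * u 0 t ^ (2 * k)
      + ∑ i ∈ Finset.range k, halfBinom i * u 0 t ^ (2 * i) * x ^ (2 * (k - i)) := by
  induction k with
  | zero => simp [laxC, halfBinom_zero]
  | succ k ih =>
    have h := (constantCoeff_gd u t k).2
    rw [gdC] at h
    rw [laxC, PowerSeries.smul_eq_C_mul, map_add, map_mul, PowerSeries.constantCoeff_C, ih, h,
      Finset.sum_range_succ, mul_add, Finset.mul_sum]
    have : ∀ i ∈ Finset.range k, halfBinom i * u 0 t ^ (2 * i) * x ^ (2 * (k + 1 - i))
        = x ^ 2 * (halfBinom i * u 0 t ^ (2 * i) * x ^ (2 * (k - i))) := fun i hi => by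
      have := Finset.mem_range.1 hi
      rw [show 2 * (k + 1 - i) = 2 + 2 * (k - i) by omega, pow_add]
      ring
    rw [Finset.sum_congr rfl this, show 2 * (k + 1 - k) = 2 by omega]
    ring

theorem mul_constantCoeff_laxDB (x : ℂ) : x * PowerSeries.constantCoeff (laxDB m τ u t x)
    = u 0 t * curveFactor m τ (u 0 t) x := by
  rw [laxDB, eval_laxPoly, smul_zero, add_zero, map_sum, curveFactor, Finset.mul_sum,
    Finset.mul_sum]
  have hsub : Finset.Icc 1 m ⊆ Finset.range (m + 1) := fun j hj => by
    have := Finset.mem_Icc.1 hj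
    exact Finset.mem_range.2 (by omega)
  rw [← Finset.sum_subset hsub]
  · refine Finset.sum_congr rfl fun j _ => ?_
    rw [← laxB_eq_eval, PowerSeries.smul_eq_C_mul, map_mul, PowerSeries.constantCoeff_C,
      constantCoeff_laxB, Finset.mul_sum, Finset.mul_sum, Finset.mul_sum, Finset.mul_sum]
    refine Finset.sum_congr rfl fun i hi => ?_
    have := Finset.mem_range.1 hi
    rw [show 2 * (j - i) - 1 = 2 * (j - 1 - i) + 1 by omega, halfBinom]
    ring
  · intro j hj hj'
    have h0 : j = 0 := by
      by_contra h0
      exact hj' (Finset.mem_Icc.2 ⟨by omega, Nat.lt_succ_iff.1 (Finset.mem_range.1 hj)⟩)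
    rw [h0]
    simp [seqPoly]

variable {m τ}

/-- Multiplied by `u₀`, the even part exceeds `x²` times the odd part by the leading order of the
string equation, which is zero. This is what makes the spectral curve factorise. -/
theorem constantCoeff_laxDC (hu : IsStringSolution m τ T u) {t : ℂ} (ht : t ∈ T) (x : ℂ) :
    PowerSeries.constantCoeff (laxDC m τ u t x) = x * curveFactor m τ (u 0 t) x := by
  have hu0 := hu.leading_ne_zero t ht
  have hstr := congrArg PowerSeries.constantCoeff (hu.string_eq t ht)
  have hgd : ∀ k, PowerSeries.constantCoeff (gdHat dotT (uSeries u) k t)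
      = halfBinom k * u 0 t ^ (2 * k + 1) := fun k => (constantCoeff_gd u t k).1
  simp only [map_sum, PowerSeries.smul_eq_C_mul, map_mul, PowerSeries.constantCoeff_C, map_neg,
    hgd, constantCoeff_uSeries] at hstr
  have h1 := mul_constantCoeff_laxDB m τ u t x
  refine mul_left_cancel₀ hu0 ?_
  have h2 : u 0 t * PowerSeries.constantCoeff (laxDC m τ u t x)
      = x ^ 2 * PowerSeries.constantCoeff (laxDB m τ u t x)
        + (∑ k ∈ Finset.range (m + 1), τ k * (halfBinom k * u 0 t ^ (2 * k + 1)) + t * u 0 t) := by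
    rw [laxDB, laxDC, eval_laxPoly, eval_laxPoly, smul_zero, add_zero, map_add, map_sum, map_sum,
      mul_add, Finset.mul_sum, Finset.mul_sum, ← add_assoc, ← Finset.sum_add_distrib]
    congr 1
    · refine Finset.sum_congr rfl fun k _ => ?_
      rw [← laxB_eq_eval, ← laxC_eq_eval, PowerSeries.smul_eq_C_mul, PowerSeries.smul_eq_C_mul,
        map_mul, map_mul, PowerSeries.constantCoeff_C, constantCoeff_laxB, constantCoeff_laxC]
      have : ∑ i ∈ Finset.range k, halfBinom i * u 0 t ^ (2 * i + 1) * x ^ (2 * (k - 1 - i)) * x ^ 2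
          = u 0 t * ∑ i ∈ Finset.range k, halfBinom i * u 0 t ^ (2 * i) * x ^ (2 * (k - i)) := by
        rw [Finset.mul_sum]
        refine Finset.sum_congr rfl fun i hi => ?_
        have := Finset.mem_range.1 hi
        rw [show 2 * (k - i) = 2 * (k - 1 - i) + 2 by omega]
        ring
      rw [← Finset.sum_mul] at this
      linear_combination -(τ k) * this
    · rw [PowerSeries.smul_eq_C_mul, map_mul]
      simp [mul_comm]
  rw [h2, hstr]
  linear_combination x * h1

end Lax

end PainleveII

namespace PainleveII

/-! ### Functions of `x` and `t` of the form `p(x, t) / s^{2d+1}` -/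

section TimeForms

/-- Polynomials in `x` whose coefficients are analytic in `t`. -/
structure IsTimePoly (T : Set ℂ) (D : ℕ) (P : ℂ → Polynomial ℂ) : Prop where
  natDegree_le : ∀ t, (P t).natDegree ≤ D
  analytic : ∀ i, AnalyticOnNhd ℂ (fun t => (P t).coeff i) T

namespace IsTimePoly

variable {T : Set ℂ} {D D' : ℕ} {P Q : ℂ → Polynomial ℂ}

theorem mono (h : IsTimePoly T D P) (hD : D ≤ D') : IsTimePoly T D' P :=
  ⟨fun t => (h.1 t).trans hD, h.2⟩

theorem add (hP : IsTimePoly T D P) (hQ : IsTimePoly T D Q) :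
    IsTimePoly T D (fun t => P t + Q t) :=
  ⟨fun t => (Polynomial.natDegree_add_le _ _).trans (max_le (hP.1 t) (hQ.1 t)), fun i => by
    simp only [Polynomial.coeff_add]
    exact AnalyticOnNhd.add (hP.2 i) (hQ.2 i)⟩

theorem mul (hP : IsTimePoly T D P) (hQ : IsTimePoly T D' Q) :
    IsTimePoly T (D + D') (fun t => P t * Q t) :=
  ⟨fun t => Polynomial.natDegree_mul_le.trans (add_le_add (hP.1 t) (hQ.1 t)), fun i => by
    simp only [Polynomial.coeff_mul]
    exact Finset.analyticOnNhd_fun_sum _ fun p _ => AnalyticOnNhd.mul (hP.2 _) (hQ.2 _)⟩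

theorem const {c : ℂ → ℂ} (hc : AnalyticOnNhd ℂ c T) :
    IsTimePoly T 0 (fun t => Polynomial.C (c t)) :=
  ⟨fun t => by rw [Polynomial.natDegree_C], fun i => by
    simp only [Polynomial.coeff_C]
    split_ifs
    · exact hc
    · exact analyticOnNhd_const⟩

theorem X : IsTimePoly T 1 (fun _ => Polynomial.X) :=
  ⟨fun _ => Polynomial.natDegree_X_le, fun _ => analyticOnNhd_const⟩

theorem pow (hP : IsTimePoly T D P) (n : ℕ) : IsTimePoly T (n * D) (fun t => P t ^ n) := by
  induction n with
  | zero =>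
    simp only [pow_zero, zero_mul]
    simpa using const (T := T) (analyticOnNhd_const (v := (1 : ℂ)))
  | succ n ih =>
    simp only [pow_succ, Nat.succ_mul]
    exact ih.mul hP

theorem exists_hasDerivAt (hP : IsTimePoly T D P) : ∃ P' : ℂ → Polynomial ℂ,
    IsTimePoly T D P' ∧
      ∀ x, ∀ t ∈ T, HasDerivAt (fun t => (P t).eval x) ((P' t).eval x) t := by
  refine ⟨fun t => ∑ i ∈ Finset.range (D + 1),
    Polynomial.monomial i (deriv (fun t => (P t).coeff i) t), ⟨fun t => ?_, fun i => ?_⟩, ?_⟩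
  · refine Polynomial.natDegree_sum_le_of_forall_le _ _ fun i hi => ?_
    exact (Polynomial.natDegree_monomial_le _).trans (Nat.lt_succ_iff.1 (Finset.mem_range.1 hi))
  · simp only [Polynomial.finsetSum_coeff, Polynomial.coeff_monomial]
    refine Finset.analyticOnNhd_fun_sum _ fun j _ => ?_
    split_ifs
    · exact (hP.2 j).deriv
    · exact analyticOnNhd_const
  · intro x t ht
    have h1 : (fun t => (P t).eval x)
        = fun t => ∑ i ∈ Finset.range (D + 1), (P t).coeff i * x ^ i := by
      funext t
      exact Polynomial.eval_eq_sum_range' (Nat.lt_succ_of_le (hP.1 t)) x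
    rw [h1, Polynomial.eval_finsetSum]
    refine HasDerivAt.fun_sum fun i _ => ?_
    rw [Polynomial.eval_monomial]
    exact ((hP.2 i t ht).differentiableAt.hasDerivAt).mul_const _

end IsTimePoly

/-- A branch `s(x, t)` of `√(u₀(t)² - x²)` on `U × T`. -/
structure IsTimeRoot (U T : Set ℂ) (u₀ : ℂ → ℂ) (s : ℂ → ℂ → ℂ) : Prop where
  isOpen : IsOpen T
  analytic : AnalyticOnNhd ℂ u₀ T
  u₀_ne : ∀ t ∈ T, u₀ t ≠ 0
  sq : ∀ x ∈ U, ∀ t ∈ T, s x t ^ 2 = u₀ t ^ 2 - x ^ 2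
  differentiableAt : ∀ x ∈ U, ∀ t ∈ T, DifferentiableAt ℂ (s x) t

/-- `f = p / s^{2d+1}` for a polynomial `p` in `x` of degree at most `2d + e` with coefficients
analytic in `t`. -/
def IsTimeForm (U T : Set ℂ) (s : ℂ → ℂ → ℂ) (d e : ℕ) (f : ℂ → ℂ → ℂ) : Prop :=
  ∃ P, IsTimePoly T (2 * d + e) P ∧ ∀ x ∈ U, ∀ t ∈ T, f x t * s x t ^ (2 * d + 1) = (P t).eval x

variable {U T : Set ℂ} {u₀ : ℂ → ℂ} {s : ℂ → ℂ → ℂ}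

theorem IsTimeRoot.mul_deriv (hs : IsTimeRoot U T u₀ s) {x t : ℂ} (hx : x ∈ U) (ht : t ∈ T) :
    s x t * deriv (s x) t = u₀ t * deriv u₀ t := by
  have h1 := ((hs.differentiableAt x hx t ht).hasDerivAt).pow 2
  have h2 := (((hs.analytic t ht).differentiableAt.hasDerivAt).pow 2).sub_const (x ^ 2)
  have h3 := h1.congr_of_eventuallyEq (f₁ := fun t => u₀ t ^ 2 - x ^ 2) (by
    filter_upwards [hs.isOpen.mem_nhds ht] with t' ht'
    exact (hs.sq x hx t' ht').symm)
  have h4 := h3.unique h2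
  simp only [Nat.cast_ofNat, Nat.add_one_sub_one, pow_one] at h4
  linear_combination h4 / 2

namespace IsTimeForm

variable {d e e' : ℕ} {f g : ℂ → ℂ → ℂ}

theorem congr (h : IsTimeForm U T s d e f) (hfg : ∀ x ∈ U, ∀ t ∈ T, g x t = f x t) :
    IsTimeForm U T s d e g := by
  obtain ⟨P, hP, h⟩ := h
  exact ⟨P, hP, fun x hx t ht => by rw [hfg x hx t ht, h x hx t ht]⟩

theorem mono_degree (h : IsTimeForm U T s d e f) (he : e ≤ e') : IsTimeForm U T s d e' f := by
  obtain ⟨P, hP, h⟩ := h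
  exact ⟨P, hP.mono (by omega), h⟩

theorem sq_poly (hs : IsTimeRoot U T u₀ s) :
    IsTimePoly T 2 (fun t => Polynomial.C (u₀ t ^ 2) + Polynomial.C (-1) * Polynomial.X ^ 2) :=
  ((IsTimePoly.const (hs.analytic.pow 2)).mono (by omega)).add
    (((IsTimePoly.const analyticOnNhd_const).mul (IsTimePoly.X.pow 2)).mono (by omega))

theorem eval_sq_poly (hs : IsTimeRoot U T u₀ s) {x t : ℂ} (hx : x ∈ U) (ht : t ∈ T) :
    (Polynomial.C (u₀ t ^ 2) + Polynomial.C (-1) * Polynomial.X ^ 2).eval x = s x t ^ 2 := by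
  rw [hs.sq x hx t ht]
  simp
  ring

theorem mono (hs : IsTimeRoot U T u₀ s) (h : IsTimeForm U T s d e f) {d' : ℕ} (hd : d ≤ d') :
    IsTimeForm U T s d' e f := by
  obtain ⟨c, rfl⟩ := Nat.exists_eq_add_of_le hd
  obtain ⟨P, hP, h⟩ := h
  refine ⟨_, (hP.mul ((sq_poly hs).pow c)).mono (by omega), fun x hx t ht => ?_⟩
  rw [Polynomial.eval_mul, Polynomial.eval_pow, eval_sq_poly hs hx ht, ← h x hx t ht]
  ring

theorem add (hf : IsTimeForm U T s d e f) (hg : IsTimeForm U T s d e g) :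
    IsTimeForm U T s d e (fun x t => f x t + g x t) := by
  obtain ⟨P, hP, hf⟩ := hf
  obtain ⟨Q, hQ, hg⟩ := hg
  exact ⟨_, hP.add hQ, fun x hx t ht => by
    rw [Polynomial.eval_add, ← hf x hx t ht, ← hg x hx t ht, add_mul]⟩

theorem time_mul {c : ℂ → ℂ} (hc : AnalyticOnNhd ℂ c T) (hf : IsTimeForm U T s d e f) :
    IsTimeForm U T s d e (fun x t => c t * f x t) := by
  obtain ⟨P, hP, hf⟩ := hf
  exact ⟨_, ((IsTimePoly.const hc).mul hP).mono (by omega), fun x hx t ht => by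
    rw [Polynomial.eval_mul, ← hf x hx t ht, Polynomial.eval_C, mul_assoc]⟩

theorem x_mul (hf : IsTimeForm U T s d e f) :
    IsTimeForm U T s d (e + 1) (fun x t => x * f x t) := by
  obtain ⟨P, hP, hf⟩ := hf
  exact ⟨_, (IsTimePoly.X.mul hP).mono (by omega), fun x hx t ht => by
    rw [Polynomial.eval_mul, ← hf x hx t ht, Polynomial.eval_X, mul_assoc]⟩

theorem zero : IsTimeForm U T s d e (fun _ _ => 0) :=
  ⟨fun _ => 0, ⟨fun _ => by simp, fun i => by simpa using analyticOnNhd_const⟩, by simp⟩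

theorem sum {ι : Type*} (J : Finset ι) {F : ι → ℂ → ℂ → ℂ}
    (h : ∀ i ∈ J, IsTimeForm U T s d e (F i)) :
    IsTimeForm U T s d e (fun x t => ∑ i ∈ J, F i x t) := by
  classical
  induction J using Finset.induction_on with
  | empty => simpa using zero
  | insert a J ha ih =>
    simp only [Finset.sum_insert ha]
    exact (h a (Finset.mem_insert_self _ _)).add (ih fun i hi => h i (Finset.mem_insert_of_mem hi))

theorem root_mul_mul {d' : ℕ} (hf : IsTimeForm U T s d e f) (hg : IsTimeForm U T s d' e' g) :
    IsTimeForm U T s (d + d') (e + e') (fun x t => s x t * (f x t * g x t)) := by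
  obtain ⟨P, hP, hf⟩ := hf
  obtain ⟨Q, hQ, hg⟩ := hg
  exact ⟨_, (hP.mul hQ).mono (by omega), fun x hx t ht => by
    rw [Polynomial.eval_mul, ← hf x hx t ht, ← hg x hx t ht]
    ring⟩

theorem div_sq (hf : IsTimeForm U T s d (e + 2) f)
    (hg : ∀ x ∈ U, ∀ t ∈ T, g x t * s x t ^ 2 = f x t) : IsTimeForm U T s (d + 1) e g := by
  obtain ⟨P, hP, hf⟩ := hf
  exact ⟨P, hP.mono (by omega), fun x hx t ht => by
    rw [← hf x hx t ht, ← hg x hx t ht]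
    ring⟩

/-- The derivative of the root is eliminated by `s ∂ₜs = u₀ ∂ₜu₀`, at the price of one further
factor `s²` in the denominator. -/
theorem deriv (hs : IsTimeRoot U T u₀ s) (hf : IsTimeForm U T s d e f)
    (hg : ∀ x ∈ U, ∀ t ∈ T, HasDerivAt (f x) (g x t) t) : IsTimeForm U T s (d + 1) e g := by
  obtain ⟨P, hP, hf⟩ := hf
  obtain ⟨P', hP', hd⟩ := hP.exists_hasDerivAt
  refine ⟨_, ((hP'.mul (sq_poly hs)).mono (D' := 2 * (d + 1) + e) (by omega)).add
    (((IsTimePoly.const ((AnalyticOnNhd.mul (analyticOnNhd_const (v := -(2 * (d : ℂ) + 1)))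
      hs.analytic).mul hs.analytic.deriv)).mul hP).mono (by omega)), fun x hx t ht => ?_⟩
  have h1 := (hg x hx t ht).mul (((hs.differentiableAt x hx t ht).hasDerivAt).pow (2 * d + 1))
  have h2 := h1.unique ((hd x t ht).congr_of_eventuallyEq (by
    filter_upwards [hs.isOpen.mem_nhds ht] with t' ht'
    exact hf x hx t' ht'))
  have h3 := hs.mul_deriv hx ht
  rw [Polynomial.eval_add, Polynomial.eval_mul, Polynomial.eval_mul, eval_sq_poly hs hx ht,
    ← h2, ← hf x hx t ht, Polynomial.eval_C]
  simp only [Pi.pow_apply, Nat.add_sub_cancel]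
  push_cast
  linear_combination -(2 * (d : ℂ) + 1) * f x t * s x t ^ (2 * d + 1) * h3

theorem isForm (h : IsTimeForm U T s d 0 f) {t : ℂ} (ht : t ∈ T) :
    IsForm U (fun x => s x t) (2 * d + 1) (2 * d + 1) (fun x => f x t) := by
  obtain ⟨P, hP, h⟩ := h
  refine ⟨P t, Polynomial.mem_degreeLT.2 ?_, fun x hx => h x hx t ht⟩
  refine Polynomial.degree_le_natDegree.trans_lt ?_
  have := hP.1 t
  norm_cast
  omega

end IsTimeForm

/-! ### The recursion in `ħ` for the projector -/

theorem coeff_succ_mul (F G : PowerSeries ℂ) (n : ℕ) : PowerSeries.coeff (n + 1) (F * G)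
    = PowerSeries.coeff 0 F * PowerSeries.coeff (n + 1) G
      + PowerSeries.coeff (n + 1) F * PowerSeries.coeff 0 G
      + ∑ i ∈ Finset.range n, PowerSeries.coeff (i + 1) F * PowerSeries.coeff (n - i) G := by
  rw [PowerSeries.coeff_mul, Finset.Nat.sum_antidiagonal_eq_sum_range_succ
    (fun i j => PowerSeries.coeff i F * PowerSeries.coeff j G), Finset.sum_range_succ,
    Finset.sum_range_succ']
  simp only [Nat.sub_zero, Nat.sub_self, Nat.add_sub_add_right]
  ring

/-- The solution of the time evolution of a projector, order by order in `ħ`. -/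
structure IsTimeProjector (U T : Set ℂ) (u₀ : ℂ → ℂ) (s : ℂ → ℂ → ℂ) (v : ℂ → PowerSeries ℂ)
    (a b c a' c' : ℂ → ℂ → PowerSeries ℂ) : Prop where
  root : IsTimeRoot U T u₀ s
  coeff_analytic : ∀ k, AnalyticOnNhd ℂ (fun t => PowerSeries.coeff k (v t)) T
  coeff_zero : ∀ t ∈ T, PowerSeries.coeff 0 (v t) = u₀ t
  a_zero : ∀ x ∈ U, ∀ t ∈ T, PowerSeries.coeff 0 (a x t) = 0
  b_zero : ∀ x ∈ U, ∀ t ∈ T, PowerSeries.coeff 0 (b x t) * (2 * s x t) = u₀ t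
  c_zero : ∀ x ∈ U, ∀ t ∈ T, PowerSeries.coeff 0 (c x t) * (2 * s x t) = x
  a_deriv : ∀ k, ∀ x ∈ U, ∀ t ∈ T, HasDerivAt (fun t => PowerSeries.coeff k (a x t))
    (PowerSeries.coeff k (a' x t)) t
  c_deriv : ∀ k, ∀ x ∈ U, ∀ t ∈ T, HasDerivAt (fun t => PowerSeries.coeff k (c x t))
    (PowerSeries.coeff k (c' x t)) t
  -- These are the diagonal and the antisymmetric part of `ħ ∂ₜM = [𝓡, M]` for `M = 1/2 + (a, b + c;
  -- b - c, -a)`; the quadratic relation below replaces the symmetric part.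
  a_eq : ∀ x ∈ U, ∀ t ∈ T, PowerSeries.X * a' x t = 2 * (PowerSeries.C x * b x t - v t * c x t)
  c_eq : ∀ x ∈ U, ∀ t ∈ T, PowerSeries.X * c' x t = -2 * (v t * a x t)
  sq_eq : ∀ x ∈ U, ∀ t ∈ T, a x t * a x t + b x t * b x t - c x t * c x t = PowerSeries.C (1 / 4)

namespace IsTimeProjector

variable {v : ℂ → PowerSeries ℂ} {a b c a' c' : ℂ → ℂ → PowerSeries ℂ}

theorem coeff_two_mul (n : ℕ) (F : PowerSeries ℂ) :
    PowerSeries.coeff n (2 * F) = 2 * PowerSeries.coeff n F := by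
  rw [two_mul, map_add, two_mul]

theorem coeff_zero_c' (h : IsTimeProjector U T u₀ s v a b c a' c') {x t : ℂ} (hx : x ∈ U)
    (ht : t ∈ T) : PowerSeries.coeff 0 (c' x t) * s x t ^ 3 = -(x / 2) * (u₀ t * deriv u₀ t) := by
  have hs := h.root
  have h1 := ((h.c_deriv 0 x hx t ht).mul
    ((hs.differentiableAt x hx t ht).hasDerivAt.const_mul 2)).congr_of_eventuallyEq
      (f₁ := fun _ => x) (by
        filter_upwards [hs.isOpen.mem_nhds ht] with t' ht'
        exact (h.c_zero x hx t' ht').symm)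
  have h2 := h1.unique (hasDerivAt_const t x)
  linear_combination (s x t ^ 2 / 2) * h2
    - (PowerSeries.coeff 0 (c x t) * s x t) * hs.mul_deriv hx ht
    - (u₀ t * deriv u₀ t / 2) * h.c_zero x hx t ht

theorem coeff_succ_a (h : IsTimeProjector U T u₀ s v a b c a' c') (n : ℕ) {x t : ℂ} (hx : x ∈ U)
    (ht : t ∈ T) : PowerSeries.coeff (n + 1) (a x t) = (u₀ t)⁻¹ *
      (-1 / 2 * PowerSeries.coeff n (c' x t) + -1 * ∑ i ∈ Finset.range n,
        PowerSeries.coeff (i + 1) (v t) * PowerSeries.coeff (n - i) (a x t)) := by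
  have h1 := congrArg (PowerSeries.coeff (n + 1)) (h.c_eq x hx t ht)
  rw [PowerSeries.coeff_succ_X_mul, neg_mul, map_neg, coeff_two_mul, coeff_succ_mul,
    h.coeff_zero t ht, h.a_zero x hx t ht] at h1
  have := h.root.u₀_ne t ht
  rw [eq_inv_mul_iff_mul_eq₀ this]
  linear_combination h1 / 2

/-- The inhomogeneous term of the equation for `a`. -/
def rhsA (v : ℂ → PowerSeries ℂ) (c a' : ℂ → ℂ → PowerSeries ℂ) (n : ℕ) (x t : ℂ) : ℂ :=
  1 / 2 * PowerSeries.coeff n (a' x t)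
    + (PowerSeries.coeff (n + 1) (v t) * PowerSeries.coeff 0 (c x t)
      + ∑ i ∈ Finset.range n, PowerSeries.coeff (i + 1) (v t) * PowerSeries.coeff (n - i) (c x t))

/-- The inhomogeneous term of the quadratic equation, multiplied by `s`. -/
def rhsSq (s : ℂ → ℂ → ℂ) (a b c : ℂ → ℂ → PowerSeries ℂ) (n : ℕ) (x t : ℂ) : ℂ :=
  ∑ i ∈ Finset.range n,
    (s x t * (PowerSeries.coeff (i + 1) (a x t) * PowerSeries.coeff (n - i) (a x t))
      + s x t * (PowerSeries.coeff (i + 1) (b x t) * PowerSeries.coeff (n - i) (b x t))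
      + -1 * (s x t * (PowerSeries.coeff (i + 1) (c x t) * PowerSeries.coeff (n - i) (c x t))))

/-- The evolution of `a` and the quadratic relation are two linear equations for the new
coefficients of `b` and `c`, with determinant `u₀² - x² = s²` after the second is multiplied by `s`.
-/
theorem coeff_succ_b_c (h : IsTimeProjector U T u₀ s v a b c a' c') (n : ℕ) {x t : ℂ} (hx : x ∈ U)
    (ht : t ∈ T) : PowerSeries.coeff (n + 1) (b x t) * s x t ^ 2
        = -u₀ t * rhsSq s a b c n x t + -1 * (x * rhsA v c a' n x t) ∧
      PowerSeries.coeff (n + 1) (c x t) * s x t ^ 2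
        = -1 * (x * rhsSq s a b c n x t) + -u₀ t * rhsA v c a' n x t := by
  have h1 := congrArg (PowerSeries.coeff (n + 1)) (h.a_eq x hx t ht)
  rw [PowerSeries.coeff_succ_X_mul, coeff_two_mul, map_sub, PowerSeries.coeff_C_mul,
    coeff_succ_mul, h.coeff_zero t ht] at h1
  have h2 := congrArg (PowerSeries.coeff (n + 1)) (h.sq_eq x hx t ht)
  rw [map_sub, map_add, coeff_succ_mul, coeff_succ_mul, coeff_succ_mul, PowerSeries.coeff_C,
    if_neg (Nat.succ_ne_zero n), h.a_zero x hx t ht] at h2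
  have hA : x * PowerSeries.coeff (n + 1) (b x t) - u₀ t * PowerSeries.coeff (n + 1) (c x t)
      = rhsA v c a' n x t := by
    rw [rhsA]
    linear_combination -h1 / 2
  have hB : u₀ t * PowerSeries.coeff (n + 1) (b x t) - x * PowerSeries.coeff (n + 1) (c x t)
      = -rhsSq s a b c n x t := by
    have e : rhsSq s a b c n x t = s x t *
        (∑ i ∈ Finset.range n, PowerSeries.coeff (i + 1) (a x t) * PowerSeries.coeff (n - i) (a x t)
        + ∑ i ∈ Finset.range n, PowerSeries.coeff (i + 1) (b x t) * PowerSeries.coeff (n - i) (b x t)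
        - ∑ i ∈ Finset.range n,
          PowerSeries.coeff (i + 1) (c x t) * PowerSeries.coeff (n - i) (c x t)) := by
      rw [rhsSq, ← Finset.sum_add_distrib, ← Finset.sum_sub_distrib, Finset.mul_sum]
      exact Finset.sum_congr rfl fun i _ => by ring
    rw [e]
    linear_combination s x t * h2 - PowerSeries.coeff (n + 1) (b x t) * h.b_zero x hx t ht
      + PowerSeries.coeff (n + 1) (c x t) * h.c_zero x hx t ht
  rw [h.root.sq x hx t ht]
  constructor
  · linear_combination u₀ t * hB - x * hA
  · linear_combination x * hB - u₀ t * hA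

/-- The coefficients of the projector are polynomials divided by odd powers of `s`. -/
theorem exists_isTimeForm (h : IsTimeProjector U T u₀ s v a b c a' c') (k : ℕ) (hk : 1 ≤ k) :
    ∃ d, IsTimeForm U T s d 0 (fun x t => PowerSeries.coeff k (a x t)) ∧
      IsTimeForm U T s d 0 (fun x t => PowerSeries.coeff k (b x t)) ∧
      IsTimeForm U T s d 0 (fun x t => PowerSeries.coeff k (c x t)) := by
  have hs := h.root
  induction k using Nat.strong_induction_on with
  | _ k ih =>
  obtain ⟨n, rfl⟩ : ∃ n, k = n + 1 := ⟨k - 1, by omega⟩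
  -- One exponent for all lower orders, so that their forms can be added.
  obtain ⟨d, hd⟩ : ∃ d, ∀ k, 1 ≤ k → k < n + 1 →
      IsTimeForm U T s d 0 (fun x t => PowerSeries.coeff k (a x t)) ∧
      IsTimeForm U T s d 0 (fun x t => PowerSeries.coeff k (b x t)) ∧
      IsTimeForm U T s d 0 (fun x t => PowerSeries.coeff k (c x t)) := by
    choose! δ hδ using fun k (hk : k < n + 1) (hk' : 1 ≤ k) => ih k hk hk'
    refine ⟨∑ k ∈ Finset.range (n + 1), δ k, fun k hk hk' => ?_⟩
    have hle : δ k ≤ ∑ k ∈ Finset.range (n + 1), δ k :=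
      Finset.single_le_sum (fun _ _ => Nat.zero_le _) (Finset.mem_range.2 hk')
    obtain ⟨h1, h2, h3⟩ := hδ k hk' hk
    exact ⟨h1.mono hs hle, h2.mono hs hle, h3.mono hs hle⟩
  have hc0 : IsTimeForm U T s (d + d + 1) 1 (fun x t => PowerSeries.coeff 0 (c x t)) := by
    refine IsTimeForm.mono hs (d := 0) ⟨_, ((IsTimePoly.const (analyticOnNhd_const
      (v := (1 / 2 : ℂ)))).mul IsTimePoly.X).mono (by omega), fun x hx t ht => ?_⟩ (by omega)
    have := h.c_zero x hx t ht
    simp only [Polynomial.eval_mul, Polynomial.eval_C, Polynomial.eval_X]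
    linear_combination this / 2
  have hc' : IsTimeForm U T s (d + d + 1) 0 (fun x t => PowerSeries.coeff n (c' x t)) := by
    rcases n with _ | n
    · refine IsTimeForm.mono hs (d := 1) ⟨_, ((IsTimePoly.const (AnalyticOnNhd.mul (analyticOnNhd_const
        (v := (-1 / 2 : ℂ))) (hs.analytic.mul hs.analytic.deriv))).mul
        IsTimePoly.X).mono (by omega), fun x hx t ht => ?_⟩ (by omega)
      simp only [Polynomial.eval_mul, Polynomial.eval_C, Polynomial.eval_X]
      linear_combination h.coeff_zero_c' hx ht
    · exact ((hd (n + 1) (by omega) (by omega)).2.2.deriv hs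
        fun x hx t ht => h.c_deriv _ x hx t ht).mono hs (by omega)
  have ha' : IsTimeForm U T s (d + d + 1) 0 (fun x t => PowerSeries.coeff n (a' x t)) := by
    have h0 : IsTimeForm U T s d 0 (fun x t => PowerSeries.coeff n (a x t)) := by
      rcases n with _ | n
      · exact IsTimeForm.zero.congr h.a_zero
      · exact (hd (n + 1) (by omega) (by omega)).1
    exact (h0.deriv hs fun x hx t ht => h.a_deriv _ x hx t ht).mono hs (by omega)
  have hA : IsTimeForm U T s (d + d + 1) 1 (rhsA v c a' n) := by
    refine IsTimeForm.add ((ha'.time_mul analyticOnNhd_const).mono_degree (by omega))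
      (IsTimeForm.add (hc0.time_mul (h.coeff_analytic _)) (IsTimeForm.sum _ fun i hi => ?_))
    have := Finset.mem_range.1 hi
    exact (((hd (n - i) (by omega) (by omega)).2.2.time_mul (h.coeff_analytic _)).mono hs
      (by omega)).mono_degree (by omega)
  have hB : IsTimeForm U T s (d + d + 1) 0 (rhsSq s a b c n) := by
    refine IsTimeForm.sum _ fun i hi => ?_
    have := Finset.mem_range.1 hi
    obtain ⟨a1, b1, c1⟩ := hd (i + 1) (by omega) (by omega)
    obtain ⟨a2, b2, c2⟩ := hd (n - i) (by omega) (by omega)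
    exact (((a1.root_mul_mul a2).add (b1.root_mul_mul b2)).add
      ((c1.root_mul_mul c2).time_mul analyticOnNhd_const)).mono hs (by omega)
  refine ⟨d + d + 1 + 1, ?_, ?_, ?_⟩
  · refine IsTimeForm.congr (IsTimeForm.mono hs (d := d + d + 1) (IsTimeForm.time_mul
      (hs.analytic.inv hs.u₀_ne) (IsTimeForm.add (hc'.time_mul analyticOnNhd_const)
        ((IsTimeForm.sum _ fun i hi => ?_).time_mul analyticOnNhd_const))) (by omega))
      fun x hx t ht => h.coeff_succ_a n hx ht
    have := Finset.mem_range.1 hi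
    exact ((hd (n - i) (by omega) (by omega)).1.time_mul (h.coeff_analytic _)).mono hs (by omega)
  · exact IsTimeForm.div_sq (IsTimeForm.add ((hB.time_mul hs.analytic.neg).mono_degree (by omega))
      (hA.x_mul.time_mul analyticOnNhd_const)) fun x hx t ht => (h.coeff_succ_b_c n hx ht).1
  · exact IsTimeForm.div_sq (IsTimeForm.add ((hB.x_mul.time_mul analyticOnNhd_const).mono_degree
      (by omega)) ((hA.time_mul hs.analytic.neg).mono_degree (by omega)))
      fun x hx t ht => (h.coeff_succ_b_c n hx ht).2

end IsTimeProjector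

end TimeForms

end PainleveII

namespace PainleveII

open Matrix

/-! ### The spectral system of a formal WKB solution -/

section Projector

/-- The projector `A diag(1, 0) A⁻¹` for a matrix `A` of determinant one. -/
def projector (A : SeriesMatrix) : SeriesMatrix :=
  !![A 0 0 * A 1 1, -(A 0 0 * A 0 1); A 1 0 * A 1 1, -(A 1 0 * A 0 1)]

/-- The derivative of `projector A` for a derivative `A'` of `A`. -/
def projectorDeriv (A A' : SeriesMatrix) : SeriesMatrix :=
  !![A' 0 0 * A 1 1 + A 0 0 * A' 1 1, -(A' 0 0 * A 0 1 + A 0 0 * A' 0 1);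
    A' 1 0 * A 1 1 + A 1 0 * A' 1 1, -(A' 1 0 * A 0 1 + A 1 0 * A' 0 1)]

theorem projector_mul_self {A : SeriesMatrix} (h : A.det = 1) :
    projector A * projector A = projector A := by
  rw [det_fin_two] at h
  rw [projector, mul_fin_two]
  congr 1
  funext i j
  fin_cases i <;> fin_cases j
  · show A 0 0 * A 1 1 * (A 0 0 * A 1 1) + -(A 0 0 * A 0 1) * (A 1 0 * A 1 1)
      = A 0 0 * A 1 1
    linear_combination (A 0 0 * A 1 1) * h
  · show A 0 0 * A 1 1 * -(A 0 0 * A 0 1) + -(A 0 0 * A 0 1) * -(A 1 0 * A 0 1)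
      = -(A 0 0 * A 0 1)
    linear_combination -(A 0 0 * A 0 1) * h
  · show A 1 0 * A 1 1 * (A 0 0 * A 1 1) + -(A 1 0 * A 0 1) * (A 1 0 * A 1 1)
      = A 1 0 * A 1 1
    linear_combination (A 1 0 * A 1 1) * h
  · show A 1 0 * A 1 1 * -(A 0 0 * A 0 1) + -(A 1 0 * A 0 1) * -(A 1 0 * A 0 1)
      = -(A 1 0 * A 0 1)
    linear_combination -(A 1 0 * A 0 1) * h

theorem trace_projector {A : SeriesMatrix} (h : A.det = 1) : trace (projector A) = 1 := by
  rw [det_fin_two] at h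
  rw [projector, trace_fin_two_of]
  linear_combination h

/-- The diagonal contribution of the formal exponentials commutes with `diag(1,0)` and drops out.
Tracelessness of `L` lets the adjugate, which stands for the inverse of `A`, satisfy the dual
equation. -/
theorem X_smul_projectorDeriv {A A' L : SeriesMatrix} {σ : PowerSeries ℂ} (hL : trace L = 0)
    (h : A * diagonal ![σ, -σ] + of (fun i j => PowerSeries.X * A' i j) = L * A) :
    (PowerSeries.X : PowerSeries ℂ) • projectorDeriv A A' = L * projector A - projector A * L := by
  rw [trace_fin_two] at hL
  have h' : ∀ i j, A i j * (![σ, -σ] : Fin 2 → PowerSeries ℂ) j + PowerSeries.X * A' i j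
      = L i 0 * A 0 j + L i 1 * A 1 j := by
    intro i j
    have := congrFun (congrFun h i) j
    rwa [Matrix.add_apply, mul_diagonal, mul_apply, Fin.sum_univ_two] at this
  have h00 := h' 0 0
  have h01 := h' 0 1
  have h10 := h' 1 0
  have h11 := h' 1 1
  simp only [cons_val_zero, cons_val_one] at h00 h01 h10 h11
  funext i j
  have e : ((PowerSeries.X : PowerSeries ℂ) • projectorDeriv A A') i j
      = PowerSeries.X * projectorDeriv A A' i j := rfl
  rw [e, Matrix.sub_apply, mul_apply, mul_apply, Fin.sum_univ_two, Fin.sum_univ_two]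
  fin_cases i <;> fin_cases j
  · show PowerSeries.X * (A' 0 0 * A 1 1 + A 0 0 * A' 1 1)
      = L 0 0 * (A 0 0 * A 1 1) + L 0 1 * (A 1 0 * A 1 1)
        - (A 0 0 * A 1 1 * L 0 0 + -(A 0 0 * A 0 1) * L 1 0)
    linear_combination A 1 1 * h00 + A 0 0 * h11 + A 0 0 * A 1 1 * hL
  · show PowerSeries.X * -(A' 0 0 * A 0 1 + A 0 0 * A' 0 1)
      = L 0 0 * -(A 0 0 * A 0 1) + L 0 1 * -(A 1 0 * A 0 1)
        - (A 0 0 * A 1 1 * L 0 1 + -(A 0 0 * A 0 1) * L 1 1)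
    linear_combination -(A 0 1) * h00 - A 0 0 * h01 - A 0 0 * A 0 1 * hL
  · show PowerSeries.X * (A' 1 0 * A 1 1 + A 1 0 * A' 1 1)
      = L 1 0 * (A 0 0 * A 1 1) + L 1 1 * (A 1 0 * A 1 1)
        - (A 1 0 * A 1 1 * L 0 0 + -(A 1 0 * A 0 1) * L 1 0)
    linear_combination A 1 1 * h10 + A 1 0 * h11 + A 1 0 * A 1 1 * hL
  · show PowerSeries.X * -(A' 1 0 * A 0 1 + A 1 0 * A' 0 1)
      = L 1 0 * -(A 0 0 * A 0 1) + L 1 1 * -(A 1 0 * A 0 1)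
        - (A 1 0 * A 1 1 * L 0 1 + -(A 1 0 * A 0 1) * L 1 1)
    linear_combination -(A 0 1) * h10 - A 1 0 * h01 - A 1 0 * A 0 1 * hL

theorem hasDerivAt_coeff_mul {f g : ℂ → PowerSeries ℂ} {f' g' : PowerSeries ℂ} {x : ℂ}
    (hf : ∀ k, HasDerivAt (fun y => PowerSeries.coeff k (f y)) (PowerSeries.coeff k f') x)
    (hg : ∀ k, HasDerivAt (fun y => PowerSeries.coeff k (g y)) (PowerSeries.coeff k g') x) (k : ℕ) :
    HasDerivAt (fun y => PowerSeries.coeff k (f y * g y))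
      (PowerSeries.coeff k (f' * g x + f x * g')) x := by
  simp only [map_add, PowerSeries.coeff_mul, ← Finset.sum_add_distrib]
  exact HasDerivAt.fun_sum fun p _ => (hf p.1).mul (hg p.2)

theorem hasDerivAt_coeff_projector {A : ℂ → SeriesMatrix} {A' : SeriesMatrix} {x : ℂ}
    (h : ∀ k i j, HasDerivAt (fun y => PowerSeries.coeff k (A y i j))
      (PowerSeries.coeff k (A' i j)) x) (k : ℕ) (i j : Fin 2) :
    HasDerivAt (fun y => PowerSeries.coeff k (projector (A y) i j))
      (PowerSeries.coeff k (projectorDeriv (A x) A' i j)) x := by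
  have hm : ∀ i j i' j', HasDerivAt (fun y => PowerSeries.coeff k (A y i j * A y i' j'))
      (PowerSeries.coeff k (A' i j * A x i' j' + A x i j * A' i' j')) x := fun i j i' j' =>
    hasDerivAt_coeff_mul (fun k => h k i j) (fun k => h k i' j') k
  have hn : ∀ i j i' j', HasDerivAt (fun y => PowerSeries.coeff k (-(A y i j * A y i' j')))
      (PowerSeries.coeff k (-(A' i j * A x i' j' + A x i j * A' i' j'))) x := fun i j i' j' => by
    simp only [map_neg]
    exact (hm i j i' j').neg
  fin_cases i <;> fin_cases j
  · exact hm 0 0 1 1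
  · exact hn 0 0 0 1
  · exact hm 1 0 1 1
  · exact hn 1 0 0 1

end Projector

/-! ### From a formal WKB solution to a spectral system. -/

namespace WKBSolution

variable {m : ℕ} {τ : ℕ → ℂ} {u : ℕ → ℂ → ℂ} {U T : Set ℂ} (Ψ : WKBSolution m τ u U T)

include Ψ in
theorem sq_sub_ne {x t : ℂ} (hx : x ∈ U) (ht : t ∈ T) : u 0 t + x ≠ 0 := by
  intro h
  have h1 := Ψ.root_sq x hx t ht
  rw [show u 0 t ^ 2 - x ^ 2 = (u 0 t + x) * (u 0 t - x) by ring, h, zero_mul] at h1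
  exact Ψ.root_ne_zero x hx t ht (pow_eq_zero_iff two_ne_zero |>.1 h1)

theorem quart_ne_zero {x t : ℂ} (hx : x ∈ U) (ht : t ∈ T) : Ψ.quart x t ≠ 0 := by
  intro h
  have h1 := Ψ.quart_sq x hx t ht
  rw [h, zero_pow two_ne_zero, eq_comm, div_eq_zero_iff] at h1
  exact h1.elim (Ψ.sq_sub_ne hx ht) (Ψ.root_ne_zero x hx t ht)

theorem coeff_amp (x t : ℂ) (i j : Fin 2) (k : ℕ) : PowerSeries.coeff k (Ψ.amp x t i j)
    = !![Ψ.quart x t, -Ψ.quart x t; (Ψ.quart x t)⁻¹, (Ψ.quart x t)⁻¹] i j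
      / ((Real.sqrt 2 : ℝ) : ℂ) * Ψ.coef i j k x t := by
  rw [Ψ.amp_def]
  show PowerSeries.coeff k (PowerSeries.C _ * PowerSeries.mk _) = _
  rw [PowerSeries.coeff_C_mul, PowerSeries.coeff_mk]

theorem analyticAt_coeff_amp (i j : Fin 2) (k : ℕ) {x t : ℂ} (hx : x ∈ U) (ht : t ∈ T) :
    AnalyticAt ℂ (fun p : ℂ × ℂ => PowerSeries.coeff k (Ψ.amp p.1 p.2 i j)) (x, t) := by
  simp only [coeff_amp]
  have hq := Ψ.quart_analytic (x, t) ⟨hx, ht⟩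
  have hq' := hq.inv (Ψ.quart_ne_zero hx ht)
  refine AnalyticAt.mul (AnalyticAt.mul ?_ analyticAt_const) (Ψ.coef_analytic i j k (x, t) ⟨hx, ht⟩)
  fin_cases i <;> fin_cases j
  · exact hq
  · exact hq.neg
  · exact hq'
  · exact hq'

theorem hasDerivAt_coeff_amp_x (k : ℕ) (i j : Fin 2) {x t : ℂ} (hx : x ∈ U) (ht : t ∈ T) :
    HasDerivAt (fun y => PowerSeries.coeff k (Ψ.amp y t i j))
      (PowerSeries.coeff k (PowerSeries.mk fun k => deriv (fun y =>
        PowerSeries.coeff k (Ψ.amp y t i j)) x)) x := by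
  rw [PowerSeries.coeff_mk]
  have := (Ψ.analyticAt_coeff_amp i j k hx ht).differentiableAt
  exact (DifferentiableAt.comp (f := fun y : ℂ => (y, t)) x this
    (differentiableAt_id.prodMk (differentiableAt_const t))).hasDerivAt

theorem hasDerivAt_coeff_amp_t (k : ℕ) (i j : Fin 2) {x t : ℂ} (hx : x ∈ U) (ht : t ∈ T) :
    HasDerivAt (fun y => PowerSeries.coeff k (Ψ.amp x y i j))
      (PowerSeries.coeff k (PowerSeries.mk fun k => deriv (fun y =>
        PowerSeries.coeff k (Ψ.amp x y i j)) t)) t := by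
  rw [PowerSeries.coeff_mk]
  have := (Ψ.analyticAt_coeff_amp i j k hx ht).differentiableAt
  exact (DifferentiableAt.comp (f := fun y : ℂ => (x, y)) t this
    ((differentiableAt_const x).prodMk differentiableAt_id)).hasDerivAt

/-- The projector of a WKB solution. -/
def proj (t x : ℂ) : SeriesMatrix := projector (Ψ.amp x t)

theorem exists_proj_deriv_x {x t : ℂ} (hx : x ∈ U) (ht : t ∈ T) : ∃ M' : SeriesMatrix,
    (PowerSeries.X : PowerSeries ℂ) • M' = laxD m τ u x t * Ψ.proj t x - Ψ.proj t x * laxD m τ u x t ∧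
      ∀ k i j, HasDerivAt (fun y => PowerSeries.coeff k (Ψ.proj t y i j))
        (PowerSeries.coeff k (M' i j)) x :=
  ⟨_, X_smul_projectorDeriv (A' := fun i j => PowerSeries.mk fun k => deriv (fun y =>
      PowerSeries.coeff k (Ψ.amp y t i j)) x) (trace_laxD m τ u t x) (Ψ.lax_x x hx t ht),
    hasDerivAt_coeff_projector fun k i j => Ψ.hasDerivAt_coeff_amp_x k i j hx ht⟩

/-- The time derivative of the projector. -/
def projDeriv (t x : ℂ) : SeriesMatrix :=
  projectorDeriv (Ψ.amp x t) fun i j => PowerSeries.mk fun k => deriv (fun y =>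
    PowerSeries.coeff k (Ψ.amp x y i j)) t

theorem X_smul_projDeriv {x t : ℂ} (hx : x ∈ U) (ht : t ∈ T) :
    (PowerSeries.X : PowerSeries ℂ) • Ψ.projDeriv t x
      = laxR u x t * Ψ.proj t x - Ψ.proj t x * laxR u x t :=
  X_smul_projectorDeriv (by rw [laxR, trace_fin_two_of, add_zero]) (Ψ.lax_t x hx t ht)

theorem hasDerivAt_coeff_proj (k : ℕ) (i j : Fin 2) {x t : ℂ} (hx : x ∈ U) (ht : t ∈ T) :
    HasDerivAt (fun t => PowerSeries.coeff k (Ψ.proj t x i j))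
      (PowerSeries.coeff k (Ψ.projDeriv t x i j)) t :=
  hasDerivAt_coeff_projector (fun k i j => Ψ.hasDerivAt_coeff_amp_t k i j hx ht) k i j

theorem coeff_zero_proj {x t : ℂ} (hx : x ∈ U) (ht : t ∈ T) (i j : Fin 2) :
    PowerSeries.coeff 0 (Ψ.proj t x i j) = !![1 / 2, (u 0 t + x) / (2 * Ψ.root x t);
      (u 0 t - x) / (2 * Ψ.root x t), 1 / 2] i j := by
  have hA : ∀ i j, PowerSeries.constantCoeff (Ψ.amp x t i j)
      = !![Ψ.quart x t, -Ψ.quart x t; (Ψ.quart x t)⁻¹, (Ψ.quart x t)⁻¹] i j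
      / ((Real.sqrt 2 : ℝ) : ℂ) := fun i j => by
    rw [← PowerSeries.coeff_zero_eq_constantCoeff_apply, coeff_amp, Ψ.coef_zero i j x hx t ht,
      mul_one]
  have h2 : ((Real.sqrt 2 : ℝ) : ℂ) ^ 2 = 2 := by
    rw [← Complex.ofReal_pow, Real.sq_sqrt (by norm_num)]
    norm_num
  have h20 : ((Real.sqrt 2 : ℝ) : ℂ) ≠ 0 := by
    intro h0
    rw [h0] at h2
    norm_num at h2
  have hq := Ψ.quart_ne_zero hx ht
  have hq2 := Ψ.quart_sq x hx t ht
  have hs := Ψ.root_ne_zero x hx t ht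
  have hs2 := Ψ.root_sq x hx t ht
  have hp := Ψ.sq_sub_ne hx ht
  rw [PowerSeries.coeff_zero_eq_constantCoeff_apply]
  generalize ((Real.sqrt 2 : ℝ) : ℂ) = r at *
  have hinv : (Ψ.quart x t)⁻¹ ^ 2 = (u 0 t - x) / Ψ.root x t := by
    rw [inv_pow, hq2, inv_div, div_eq_div_iff hp hs]
    linear_combination hs2
  fin_cases i <;> fin_cases j
  · show PowerSeries.constantCoeff (Ψ.amp x t 0 0 * Ψ.amp x t 1 1) = 1 / 2
    rw [map_mul, hA, hA]
    show Ψ.quart x t / r * ((Ψ.quart x t)⁻¹ / r) = 1 / 2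
    rw [← h2]
    field_simp
  · show PowerSeries.constantCoeff (-(Ψ.amp x t 0 0 * Ψ.amp x t 0 1)) = (u 0 t + x) / (2 * Ψ.root x t)
    rw [map_neg, map_mul, hA, hA]
    show -(Ψ.quart x t / r * (-Ψ.quart x t / r)) = _
    rw [mul_comm 2, ← div_div, ← hq2, ← h2]
    field_simp
  · show PowerSeries.constantCoeff (Ψ.amp x t 1 0 * Ψ.amp x t 1 1) = (u 0 t - x) / (2 * Ψ.root x t)
    rw [map_mul, hA, hA]
    show (Ψ.quart x t)⁻¹ / r * ((Ψ.quart x t)⁻¹ / r) = _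
    rw [mul_comm 2, ← div_div, ← hinv, ← h2]
    field_simp
  · show PowerSeries.constantCoeff (-(Ψ.amp x t 1 0 * Ψ.amp x t 0 1)) = 1 / 2
    rw [map_neg, map_mul, hA, hA]
    show -((Ψ.quart x t)⁻¹ / r * (-Ψ.quart x t / r)) = 1 / 2
    rw [← h2]
    field_simp

/-- The traceless diagonal part of the projector. -/
def projA (x t : ℂ) : PowerSeries ℂ := Ψ.proj t x 0 0 - PowerSeries.C (1 / 2)

/-- The symmetric off-diagonal part of the projector. -/
def projB (x t : ℂ) : PowerSeries ℂ :=
  PowerSeries.C (1 / 2) * (Ψ.proj t x 0 1 + Ψ.proj t x 1 0)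

/-- The antisymmetric off-diagonal part of the projector. -/
def projC (x t : ℂ) : PowerSeries ℂ :=
  PowerSeries.C (1 / 2) * (Ψ.proj t x 0 1 - Ψ.proj t x 1 0)

theorem two_mul_C_half : (2 : PowerSeries ℂ) * PowerSeries.C (1 / 2) = 1 := by
  rw [← map_ofNat PowerSeries.C 2, ← map_mul]
  norm_num

theorem proj_zero_one (x t : ℂ) : Ψ.proj t x 0 1 = Ψ.projB x t + Ψ.projC x t := by
  rw [projB, projC]
  linear_combination -(Ψ.proj t x 0 1) * two_mul_C_half

theorem proj_one_zero (x t : ℂ) : Ψ.proj t x 1 0 = Ψ.projB x t - Ψ.projC x t := by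
  rw [projB, projC]
  linear_combination -(Ψ.proj t x 1 0) * two_mul_C_half

theorem proj_zero_zero (x t : ℂ) : Ψ.proj t x 0 0 = PowerSeries.C (1 / 2) + Ψ.projA x t := by
  rw [projA]
  ring

theorem proj_one_one {x t : ℂ} (hx : x ∈ U) (ht : t ∈ T) :
    Ψ.proj t x 1 1 = PowerSeries.C (1 / 2) - Ψ.projA x t := by
  have h := trace_projector (Ψ.det_eq_one x hx t ht)
  rw [trace_fin_two] at h
  rw [projA]
  rw [← proj] at h
  linear_combination h - two_mul_C_half

theorem isTimeRoot (hT : IsOpen T) (hu : IsStringSolution m τ T u) :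
    IsTimeRoot U T (u 0) Ψ.root where
  isOpen := hT
  analytic := hu.analytic 0
  u₀_ne := hu.leading_ne_zero
  sq := Ψ.root_sq
  differentiableAt := fun x hx t ht =>
    DifferentiableAt.comp (f := fun y : ℂ => (x, y)) t
      (Ψ.root_analytic (x, t) ⟨hx, ht⟩).differentiableAt
      ((differentiableAt_const x).prodMk differentiableAt_id)

theorem isTimeProjector (hT : IsOpen T) (hu : IsStringSolution m τ T u) :
    IsTimeProjector U T (u 0) Ψ.root (uSeries u) Ψ.projA Ψ.projB Ψ.projC
      (fun x t => Ψ.projDeriv t x 0 0)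
      (fun x t => PowerSeries.C (1 / 2) * (Ψ.projDeriv t x 0 1 - Ψ.projDeriv t x 1 0)) where
  root := Ψ.isTimeRoot hT hu
  coeff_analytic := fun k => by
    simp only [uSeries, PowerSeries.coeff_mk]
    split_ifs
    · exact hu.analytic _
    · exact analyticOnNhd_const
  coeff_zero := fun t _ =>
    (PowerSeries.coeff_zero_eq_constantCoeff_apply _).trans (constantCoeff_uSeries u t)
  a_zero := fun x hx t ht => by
    rw [projA, map_sub, Ψ.coeff_zero_proj hx ht, PowerSeries.coeff_zero_C]
    exact sub_self _
  b_zero := fun x hx t ht => by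
    have := Ψ.root_ne_zero x hx t ht
    rw [projB, PowerSeries.coeff_C_mul, map_add, Ψ.coeff_zero_proj hx ht,
      Ψ.coeff_zero_proj hx ht]
    show 1 / 2 * ((u 0 t + x) / (2 * Ψ.root x t) + (u 0 t - x) / (2 * Ψ.root x t))
      * (2 * Ψ.root x t) = u 0 t
    field_simp
    ring
  c_zero := fun x hx t ht => by
    have := Ψ.root_ne_zero x hx t ht
    rw [projC, PowerSeries.coeff_C_mul, map_sub, Ψ.coeff_zero_proj hx ht,
      Ψ.coeff_zero_proj hx ht]
    show 1 / 2 * ((u 0 t + x) / (2 * Ψ.root x t) - (u 0 t - x) / (2 * Ψ.root x t))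
      * (2 * Ψ.root x t) = x
    field_simp
    ring
  a_deriv := fun k x hx t ht => by
    simp only [projA, map_sub]
    exact (Ψ.hasDerivAt_coeff_proj k 0 0 hx ht).sub_const _
  c_deriv := fun k x hx t ht => by
    simp only [projC, PowerSeries.coeff_C_mul, map_sub]
    exact ((Ψ.hasDerivAt_coeff_proj k 0 1 hx ht).sub
      (Ψ.hasDerivAt_coeff_proj k 1 0 hx ht)).const_mul _
  a_eq := fun x hx t ht => by
    have h := congrFun (congrFun (Ψ.X_smul_projDeriv hx ht) 0) 0
    rw [Matrix.sub_apply, mul_apply, mul_apply, Fin.sum_univ_two, Fin.sum_univ_two,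
      Ψ.proj_zero_one, Ψ.proj_one_zero] at h
    simp only [laxR, of_apply, cons_val_zero, cons_val_one, Matrix.smul_apply, smul_eq_mul,
      cons_val'] at h
    linear_combination h
  c_eq := fun x hx t ht => by
    have h1 := congrFun (congrFun (Ψ.X_smul_projDeriv hx ht) 0) 1
    have h2 := congrFun (congrFun (Ψ.X_smul_projDeriv hx ht) 1) 0
    rw [Matrix.sub_apply, mul_apply, mul_apply, Fin.sum_univ_two, Fin.sum_univ_two,
      Ψ.proj_zero_zero, Ψ.proj_one_one hx ht] at h1 h2
    simp only [laxR, of_apply, cons_val_zero, cons_val_one, Matrix.smul_apply, smul_eq_mul,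
      cons_val'] at h1 h2
    linear_combination PowerSeries.C (1 / 2) * (h1 - h2)
      - 2 * (uSeries u t * Ψ.projA x t) * two_mul_C_half
  sq_eq := fun x hx t ht => by
    have h : Ψ.proj t x 0 0 * Ψ.proj t x 1 1 - Ψ.proj t x 0 1 * Ψ.proj t x 1 0 = 0 := by
      simp only [proj, projector, of_apply, cons_val_zero, cons_val_one, cons_val']
      ring
    rw [Ψ.proj_zero_zero, Ψ.proj_one_one hx ht, Ψ.proj_zero_one, Ψ.proj_one_zero] at h
    have h4 : PowerSeries.C (1 / 2) * PowerSeries.C (1 / 2) = PowerSeries.C (1 / 4 : ℂ) := by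
      rw [← map_mul]; norm_num
    linear_combination -h + h4

include Ψ in
-- Comparing `∂ₓ` of the leading symmetric part `u₀/(2s)` with the order ħ of `[𝓓, M]`, whose
-- ingredient `a₁ = x ∂ₜu₀/(4s³)` comes from the equation in `t`, gives the polynomial identity
-- `key`. At `x = ±u₀` a zero of the factor of the curve would make its right side vanish, against
-- `u₀ ≠ 0`.
theorem curve_eval_ne (hU : IsOpen U) (hUne : U.Nonempty) (hT : IsOpen T)
    (hu : IsStringSolution m τ T u) {t : ℂ} (ht : t ∈ T) {a : ℂ} (ha : a ^ 2 = u 0 t ^ 2) :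
    (curvePoly m τ (u 0 t)).eval a ≠ 0 := by
  obtain ⟨q, -, hq⟩ := exists_coeff_eval_sq (laxPoly m τ t 0 (gdA u t)) 1
  have hu0 := hu.leading_ne_zero t ht
  have hP := Ψ.isTimeProjector hT hu
  have key : Polynomial.C (u 0 t) = -2 * q * (Polynomial.C (u 0 t ^ 2) - Polynomial.X ^ 2)
      - Polynomial.X * curvePoly m τ (u 0 t) * Polynomial.C (deriv (u 0) t) := by
    -- The origin is removed because the identity is derived after multiplication by `x`.
    have hinf : (U \ {0}).Infinite := by
      obtain ⟨x₀, hx₀⟩ := hUne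
      exact (infinite_of_mem_nhds x₀ (hU.mem_nhds hx₀)).sdiff (Set.finite_singleton 0)
    refine Polynomial.eq_of_infinite_eval_eq _ _ (hinf.mono fun x hx => ?_)
    obtain ⟨hx, hx0⟩ := hx
    show Polynomial.eval x _ = Polynomial.eval x _
    simp only [Polynomial.eval_sub, Polynomial.eval_mul, Polynomial.eval_C, Polynomial.eval_X,
      Polynomial.eval_pow, Polynomial.eval_neg, Polynomial.eval_ofNat]
    rw [← Ψ.root_sq x hx t ht]
    have hs := Ψ.root_ne_zero x hx t ht
    obtain ⟨M', hM', hd⟩ := Ψ.exists_proj_deriv_x hx ht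
    have hb : HasDerivAt (fun y => PowerSeries.coeff 0 (Ψ.projB y t))
        (1 / 2 * (PowerSeries.coeff 0 (M' 0 1) + PowerSeries.coeff 0 (M' 1 0))) x := by
      simp only [projB, PowerSeries.coeff_C_mul, map_add]
      exact ((hd 0 0 1).add (hd 0 1 0)).const_mul _
    have hsd : DifferentiableAt ℂ (fun y => Ψ.root y t) x :=
      DifferentiableAt.comp (f := fun y : ℂ => (y, t)) x
        (Ψ.root_analytic (x, t) ⟨hx, ht⟩).differentiableAt
        (differentiableAt_id.prodMk (differentiableAt_const t))
    have h1 := ((hb.mul (hsd.hasDerivAt.const_mul 2)).congr_of_eventuallyEq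
      (f₁ := fun _ => u 0 t) (by
        filter_upwards [hU.mem_nhds hx] with y hy
        exact (hP.b_zero y hy t ht).symm)).unique (hasDerivAt_const x _)
    have h2 := ((hsd.hasDerivAt.pow 2).congr_of_eventuallyEq
      (f₁ := fun y => u 0 t ^ 2 - y ^ 2) (by
        filter_upwards [hU.mem_nhds hx] with y hy
        exact (Ψ.root_sq y hy t ht).symm)).unique (((hasDerivAt_id x).pow 2).const_sub _)
    -- The symmetric off-diagonal part of `ħ ∂ₓM = [𝓓, M]` in order ħ; the diagonal entries of both
    -- matrices start only in that order, apart from the scalar `1/2`.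
    have h3 : (1 / 2 * (PowerSeries.coeff 0 (M' 0 1) + PowerSeries.coeff 0 (M' 1 0)))
        = -2 * (PowerSeries.coeff 1 (laxDA m τ u t x) * PowerSeries.coeff 0 (Ψ.projC x t))
          - 2 * (PowerSeries.coeff 1 (Ψ.projA x t) * PowerSeries.coeff 0 (laxDC m τ u t x)) := by
      have e1 := congrFun (congrFun hM' 0) 1
      have e2 := congrFun (congrFun hM' 1) 0
      rw [Matrix.sub_apply, mul_apply, mul_apply, Fin.sum_univ_two, Fin.sum_univ_two, laxD_eq,
        Ψ.proj_zero_zero, Ψ.proj_one_one hx ht] at e1 e2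
      rw [Ψ.proj_zero_one] at e1
      rw [Ψ.proj_one_zero] at e2
      simp only [of_apply, cons_val_zero, cons_val_one, Matrix.smul_apply, smul_eq_mul,
        cons_val'] at e1 e2
      have e3 : PowerSeries.X * (M' 0 1 + M' 1 0)
          = -4 * (laxDA m τ u t x * Ψ.projC x t) - 4 * (Ψ.projA x t * laxDC m τ u t x) := by
        linear_combination e1 + e2
      have e4 := congrArg (PowerSeries.coeff (0 + 1)) e3
      have h4 : ∀ F : PowerSeries ℂ, PowerSeries.coeff 1 (4 * F) = 4 * PowerSeries.coeff 1 F := by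
        intro F
        rw [← map_ofNat PowerSeries.C 4, PowerSeries.coeff_C_mul]
      rw [PowerSeries.coeff_succ_X_mul, neg_mul, map_sub, map_neg, h4, h4, coeff_succ_mul,
        coeff_succ_mul, hP.a_zero x hx t ht, PowerSeries.coeff_zero_eq_constantCoeff_apply
        (laxDA m τ u t x), constantCoeff_laxDA, map_add] at e4
      simp only [Finset.range_zero, Finset.sum_empty, zero_mul, zero_add, add_zero] at e4
      linear_combination e4 / 2
    have h5 := hP.coeff_succ_a 0 hx ht
    have h6 := hP.coeff_zero_c' hx ht
    rw [Finset.range_zero, Finset.sum_empty, mul_zero, add_zero, eq_inv_mul_iff_mul_eq₀ hu0] at h5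
    have h7 := hP.c_zero x hx t ht
    have h8 := hP.b_zero x hx t ht
    rw [PowerSeries.coeff_zero_eq_constantCoeff_apply (laxDC m τ u t x),
      constantCoeff_laxDC u hu ht] at h3
    have h9 : PowerSeries.coeff 1 (laxDA m τ u t x) = q.eval x := hq x
    rw [h9] at h3
    rw [eval_curvePoly]
    rw [h3] at h1
    simp only [Nat.cast_ofNat, Nat.add_one_sub_one, pow_one, id] at h2
    have h10 : PowerSeries.coeff 1 (Ψ.projA x t) * Ψ.root x t ^ 3 = x / 4 * deriv (u 0) t := by
      refine mul_left_cancel₀ hu0 ?_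
      simp only [zero_add] at h5
      linear_combination Ψ.root x t ^ 3 * h5 - h6 / 2
    refine mul_left_cancel₀ hx0 ?_
    generalize PowerSeries.coeff 1 (Ψ.projA x t) = A1 at *
    generalize PowerSeries.coeff 0 (Ψ.projC x t) = C0 at *
    generalize PowerSeries.coeff 0 (Ψ.projB x t) = B0 at *
    generalize deriv (fun y => Ψ.root y t) x = s' at *
    generalize Ψ.root x t = s at *
    linear_combination -s ^ 2 * h1 - 2 * q.eval x * s ^ 2 * h7
      - 4 * x * curveFactor m τ (u 0 t) x * h10 + s * s' * h8 + u 0 t / 2 * h2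
  intro h0
  have h1 := congrArg (Polynomial.eval a) key
  simp only [Polynomial.eval_sub, Polynomial.eval_mul, Polynomial.eval_C, Polynomial.eval_X,
    Polynomial.eval_pow, h0, ha] at h1
  apply hu0
  rw [h1]
  ring

/-- The spectral system of a formal WKB solution. -/
def spectralSystem (hU : IsOpen U) (hUne : U.Nonempty) (hT : IsOpen T)
    (hu : IsStringSolution m τ T u) {t : ℂ} (ht : t ∈ T) : SpectralSystem U (u 0 t) where
  s := fun x => Ψ.root x t
  M := Ψ.proj t
  D := fun x => laxD m τ u x t
  curve := curvePoly m τ (u 0 t)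
  isOpen := hU
  nonempty := hUne
  u₀_ne := hu.leading_ne_zero t ht
  s_sq := fun x hx => Ψ.root_sq x hx t ht
  s_ne := fun x hx => Ψ.root_ne_zero x hx t ht
  s_cont := fun x hx => (ContinuousAt.comp (f := fun y : ℂ => (y, t)) (x := x)
    (Ψ.root_analytic (x, t) ⟨hx, ht⟩).continuousAt
    (continuousAt_id.prodMk continuousAt_const)).continuousWithinAt
  M_mul_self := fun x hx => projector_mul_self (Ψ.det_eq_one x hx t ht)
  M_trace := fun x hx => trace_projector (Ψ.det_eq_one x hx t ht)
  D_trace := fun x _ => trace_laxD m τ u t x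
  M_deriv := fun x hx => Ψ.exists_proj_deriv_x hx ht
  M_form := fun K => by
    have hP := Ψ.isTimeProjector hT hu
    choose! δ hδ using hP.exists_isTimeForm
    -- The sum of the exponents bounds each of them, which gives a common denominator up to order
    -- `K`.
    refine ⟨∑ k ∈ Finset.range (K + 1), δ k, fun k hk hk' i j => ?_⟩
    have hle : δ k ≤ ∑ k ∈ Finset.range (K + 1), δ k :=
      Finset.single_le_sum (fun _ _ => Nat.zero_le _) (Finset.mem_range.2 (by omega))
    obtain ⟨h1, h2, h3⟩ := hδ k hk
    have ha := (h1.mono hP.root hle).isForm ht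
    have hb := (h2.mono hP.root hle).isForm ht
    have hc := (h3.mono hP.root hle).isForm ht
    have hk0 : k ≠ 0 := by omega
    fin_cases i <;> fin_cases j
    · refine ha.congr fun x hx => ?_
      show PowerSeries.coeff k (Ψ.proj t x 0 0) = _
      rw [Ψ.proj_zero_zero, map_add, PowerSeries.coeff_C, if_neg hk0, zero_add]
    · refine (hb.add hc).congr fun x hx => ?_
      show PowerSeries.coeff k (Ψ.proj t x 0 1) = _
      rw [Ψ.proj_zero_one, map_add]
    · refine (hb.add (hc.const_mul (-1))).congr fun x hx => ?_
      show PowerSeries.coeff k (Ψ.proj t x 1 0) = _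
      rw [Ψ.proj_one_zero, map_sub]
      ring
    · refine (ha.const_mul (-1)).congr fun x hx => ?_
      show PowerSeries.coeff k (Ψ.proj t x 1 1) = _
      rw [Ψ.proj_one_one hx ht, map_sub, PowerSeries.coeff_C, if_neg hk0]
      ring
  M_zero := fun x hx => Ψ.coeff_zero_proj hx ht
  D_form := fun k i j => by
    obtain ⟨q, hq⟩ := exists_coeff_laxD_eq m τ u t k i j
    exact ⟨q, fun x _ => hq x⟩
  curve_eval_ne := Ψ.curve_eval_ne hU hUne hT hu ht rfl
  curve_eval_neg_ne := Ψ.curve_eval_ne hU hUne hT hu ht (neg_sq _)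
  trace_zero := fun x hx => by
    have hs := Ψ.root_ne_zero x hx t ht
    have h1 := mul_constantCoeff_laxDB m τ u t x
    have hM : ∀ i j, PowerSeries.constantCoeff (Ψ.proj t x i j) = _ := fun i j =>
      (PowerSeries.coeff_zero_eq_constantCoeff_apply _).symm.trans (Ψ.coeff_zero_proj hx ht i j)
    rw [laxD_eq, trace_fin_two, mul_apply, mul_apply, Fin.sum_univ_two, Fin.sum_univ_two,
      PowerSeries.coeff_zero_eq_constantCoeff_apply]
    simp only [of_apply, cons_val_zero, cons_val_one, cons_val', map_add, map_mul, map_sub, map_neg,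
      hM, PowerSeries.smul_eq_C_mul, PowerSeries.constantCoeff_C, constantCoeff_laxDA, h1,
      constantCoeff_laxDC u hu ht, eval_curvePoly]
    have hs2 := Ψ.root_sq x hx t ht
    field_simp
    linear_combination (-2 * curveFactor m τ (u 0 t) x) * hs2
  det_form := fun k hk => by
    have hne : curvePoly m τ (u 0 t) ≠ 0 := fun h =>
      Ψ.curve_eval_ne hU hUne hT hu ht rfl (by rw [h, Polynomial.eval_zero])
    obtain ⟨N, -, hN, hdeg⟩ := exists_le_degree_curvePoly hne
    obtain ⟨q, hq, hq'⟩ := exists_coeff_det_laxD_eq m τ u t hN hk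
    exact ⟨q, hq.trans_le hdeg, fun x _ => hq' x⟩

end WKBSolution

end PainleveII

namespace PainleveII

open Matrix

/-! ### The correlation functions and the amplitudes of the spectral system -/

/-- Removing the first entry of an injective tuple leaves the entries of its tail. -/
theorem erase_image_univ {α : Type*} [DecidableEq α] {n : ℕ} {x : Fin (n + 1) → α}
    (hinj : Function.Injective x) :
    (Finset.univ.image x).erase (x 0) = Finset.univ.image (Fin.tail x) := by
  ext a
  simp only [Finset.mem_erase, Finset.mem_image, Finset.mem_univ, true_and, Fin.exists_fin_succ,
    Fin.tail]
  constructor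
  · rintro ⟨h, rfl | ⟨i, rfl⟩⟩
    · exact absurd rfl h
    · exact ⟨i, rfl⟩
  · rintro ⟨i, rfl⟩
    exact ⟨fun h => Fin.succ_ne_zero i (hinj h), Or.inr ⟨i, rfl⟩⟩

namespace WKBSolution

variable {m : ℕ} {τ : ℕ → ℂ} {u : ℕ → ℂ → ℂ} {U T : Set ℂ} (Ψ : WKBSolution m τ u U T)

theorem vecMulVec_eq_proj (t x : ℂ) :
    vecMulVec (fun i => Ψ.amp x t i 0) ![Ψ.amp x t 1 1, -Ψ.amp x t 0 1] = Ψ.proj t x := by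
  funext i j
  fin_cases i <;> fin_cases j
  · rfl
  · exact mul_neg _ _
  · rfl
  · exact mul_neg _ _

theorem kernel_eq (t x₁ x₂ : ℂ) : Ψ.kernel t x₁ x₂ = (x₁ - x₂)⁻¹ •
    ((![Ψ.amp x₂ t 1 1, -Ψ.amp x₂ t 0 1] : Fin 2 → PowerSeries ℂ) ⬝ᵥ
      fun i => Ψ.amp x₁ t i 0) := by
  rw [kernel, PowerSeries.smul_eq_C_mul, dotProduct, Fin.sum_univ_two]
  simp only [cons_val_zero, cons_val_one]
  ring

theorem cycleSum_eq (t : ℂ) {n : ℕ} {x : Fin (n + 2) → ℂ} (hx : Function.Injective x) :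
    Ψ.cycleSum t (n + 2) x = trace (pathSum (Ψ.proj t) (Finset.univ.image (Fin.tail x)) (x 0) (x 0)
      * Ψ.proj t (x 0)) := by
  have h := transitiveSum_eq_trace (fun x i => Ψ.amp x t i 0)
    (fun x => ![Ψ.amp x t 1 1, -Ψ.amp x t 0 1]) x hx
  simp only [← kernel_eq, vecMulVec_eq_proj] at h
  rw [← h, transitiveSum, cycleSum]
  simp only [isCycle_and_forall_ne_iff]
  exact Finset.sum_congr (by ext; simp) fun _ _ => rfl

/-- The derivative of the first column, with its exponential, is `𝓓/ħ` times the column, and pairing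
with the first row of `Ψ⁻¹` is a trace against the projector. -/
theorem X_mul_corrOne {x t : ℂ} (hx : x ∈ U) (ht : t ∈ T) :
    HahnSeries.single (1 : ℤ) (1 : ℂ) * Ψ.corrOne t x
      = ((trace (laxD m τ u x t * Ψ.proj t x) : PowerSeries ℂ) : LaurentSeries ℂ) := by
  have hcol : ∀ i, HahnSeries.single (1 : ℤ) (1 : ℂ) * Ψ.firstColumnDeriv t x i
      = ((laxD m τ u x t i 0 * Ψ.amp x t 0 0 + laxD m τ u x t i 1 * Ψ.amp x t 1 0 : PowerSeries ℂ) :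
        LaurentSeries ℂ) := by
    intro i
    have h := congrFun (congrFun (Ψ.lax_x x hx t ht) i) 0
    rw [Matrix.add_apply, mul_diagonal, mul_apply, Fin.sum_univ_two] at h
    rw [← h]
    simp only [cons_val_zero, of_apply, PowerSeries.coe_add, PowerSeries.coe_mul, PowerSeries.coe_C,
      PowerSeries.coe_X]
    rw [firstColumnDeriv, mul_add, ← mul_assoc, HahnSeries.single_mul_single, one_mul,
      show (1 : ℤ) + -1 = 0 by norm_num, HahnSeries.C_apply]
    ring
  rw [corrOne, mul_sub, ← mul_assoc, ← mul_assoc, hcol, hcol, ← PowerSeries.coe_mul,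
    ← PowerSeries.coe_mul, ← PowerSeries.coe_sub]
  congr 1
  rw [trace_fin_two, mul_apply, mul_apply, Fin.sum_univ_two, Fin.sum_univ_two]
  simp only [proj, projector, of_apply, cons_val_zero, cons_val_one, cons_val']
  ring

variable (hU : IsOpen U) (hUne : U.Nonempty) (hT : IsOpen T) (hu : IsStringSolution m τ T u)
  {t : ℂ} (ht : t ∈ T)

/-- Amplitudes carry one extra factor ħ, hence the shift of the index. The subtraction in the
two-point function is the only deviation. -/
theorem coeff_corr {n : ℕ} {x : Fin (n + 1) → ℂ} (hx : ∀ i, x i ∈ U)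
    (hinj : Function.Injective x) (k : ℤ) : (Ψ.corr t (n + 1) x).coeff k
      = (((Ψ.spectralSystem hU hUne hT hu ht).amp (Finset.univ.image (Fin.tail x)) (x 0) :
          PowerSeries ℂ) : LaurentSeries ℂ).coeff (k + 1)
        - if n = 1 ∧ k = 0 then 1 / (x 0 - x (Fin.last n)) ^ 2 else 0 := by
  set S := Ψ.spectralSystem hU hUne hT hu ht
  have hshift : ∀ (f : LaurentSeries ℂ) (g : PowerSeries ℂ),
      HahnSeries.single (1 : ℤ) (1 : ℂ) * f = (g : LaurentSeries ℂ) →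
      f.coeff k = (g : LaurentSeries ℂ).coeff (k + 1) := by
    intro f g h
    rw [← h, HahnSeries.coeff_single_mul_add, one_mul]
  have hcard : (Finset.univ.image (Fin.tail x)).card = n := by
    rw [Finset.card_image_of_injective _ (f := Fin.tail x)
      (hinj.comp (Fin.succ_injective n)), Finset.card_fin]
  rcases n with _ | n
  · rw [if_neg (by omega), sub_zero]
    refine hshift _ _ ?_
    rw [Finset.univ_eq_empty, Finset.image_empty, SpectralSystem.amp, amplitude, insertion,
      if_pos rfl]
    exact Ψ.X_mul_corrOne (hx 0) ht
  · have hne : (Finset.univ.image (Fin.tail x)).Nonempty := by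
      rw [← Finset.card_pos, hcard]
      omega
    have hamp : S.amp (Finset.univ.image (Fin.tail x)) (x 0)
        = PowerSeries.X * ((-1) ^ (n + 1) * Ψ.cycleSum t (n + 2) x) := by
      rw [S.amp_eq_X_mul hne, hcard, Ψ.cycleSum_eq t hinj]
      rfl
    rcases n with _ | n
    · have h := hshift (((-1) ^ (0 + 1) * Ψ.cycleSum t (0 + 2) x : PowerSeries ℂ) :
        LaurentSeries ℂ) (S.amp (Finset.univ.image (Fin.tail x)) (x 0)) (by
          rw [hamp, PowerSeries.coe_mul PowerSeries.X, PowerSeries.coe_X])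
      rw [← h]
      show ((-PowerSeries.C (1 / (x 0 - x 1) ^ 2) - Ψ.cycleSum t 2 x : PowerSeries ℂ) :
        LaurentSeries ℂ).coeff k = _
      rw [show (-PowerSeries.C (1 / (x 0 - x 1) ^ 2) - Ψ.cycleSum t 2 x : PowerSeries ℂ)
        = (-1) ^ (0 + 1) * Ψ.cycleSum t (0 + 2) x - PowerSeries.C (1 / (x 0 - x 1) ^ 2) by ring,
        PowerSeries.coe_sub, HahnSeries.coeff_sub, PowerSeries.coe_C, HahnSeries.C_apply,
        HahnSeries.coeff_single]
      simp only [zero_add, true_and]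
      split_ifs <;> rfl
    · rw [if_neg (by omega), sub_zero]
      refine hshift _ _ ?_
      rw [hamp, PowerSeries.coe_mul, PowerSeries.coe_X]
      congr 1
      show ((-((-1) ^ (n + 3) * Ψ.cycleSum t (n + 3) x) : PowerSeries ℂ) : LaurentSeries ℂ) = _
      congr 1
      ring

include hU hUne hT hu ht in
theorem coeff_corr_eq_zero {n : ℕ} {x : Fin (n + 1) → ℂ} (hx : ∀ i, x i ∈ U)
    (hinj : Function.Injective x) {k : ℤ} (hk : ∀ g : ℕ, k ≠ 2 * (g : ℤ) - 2 + ((n + 1 : ℕ) : ℤ)) :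
    (Ψ.corr t (n + 1) x).coeff k = 0 := by
  have hcard : (Finset.univ.image (Fin.tail x)).card = n := by
    rw [Finset.card_image_of_injective _ (f := Fin.tail x)
      (hinj.comp (Fin.succ_injective n)), Finset.card_fin]
  have hk0 := hk 0
  push_cast at hk hk0
  rw [Ψ.coeff_corr hU hUne hT hu ht hx hinj, if_neg (by omega), sub_zero, PowerSeries.coeff_coe]
  split_ifs with hneg
  · rfl
  refine SpectralSystem.coeff_amp_eq_zero _ _ _ (fun j hj => ?_) (fun g hg => ?_) _ ⟨hx 0, ?_⟩
  · obtain ⟨i, -, rfl⟩ := Finset.mem_image.1 hj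
    exact hx _
  · rw [hcard] at hg
    have := hk g
    omega
  · intro h0
    obtain ⟨i, -, hi⟩ := Finset.mem_image.1 (Finset.mem_coe.1 h0)
    exact Fin.succ_ne_zero i (hinj hi)

theorem corrCoeff_eq (g : ℕ) {n : ℕ} {x : Fin (n + 1) → ℂ} (hx : ∀ i, x i ∈ U)
    (hinj : Function.Injective x) : Ψ.corrCoeff t g (n + 1) x
      = (Ψ.spectralSystem hU hUne hT hu ht).tupleAmp (n + 2 * g) x
        - if n = 1 ∧ g = 0 then 1 / (x 0 - x (Fin.last n)) ^ 2 else 0 := by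
  rw [corrCoeff, Ψ.coeff_corr hU hUne hT hu ht hx hinj, PowerSeries.coeff_coe,
    if_neg (by push_cast; omega), SpectralSystem.tupleAmp, erase_image_univ hinj]
  refine congrArg₂ (· - ·) (congrArg₂ _ ?_ rfl) (if_congr ?_ rfl rfl)
  · congr 1
    push_cast
    omega
  · constructor
    · intro h
      exact ⟨h.1, by have := h.2; push_cast at this; omega⟩
    · intro h
      exact ⟨h.1, by have := h.2; push_cast; omega⟩

/-- For two points in genus zero the double pole subtracted in the correlation function is the one
that `diagonalTerm` adds back. -/
theorem omega_zCoord (g : ℕ) {n : ℕ} {x : Fin (n + 1) → ℂ} (hx : ∀ i, x i ∈ U)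
    (hinj : Function.Injective x) :
    (Ψ.spectralSystem hU hUne hT hu ht).omega g (n + 1) (fun i => Ψ.zCoord t (x i))
      = Ψ.differential t g (n + 1) x := by
  rw [differential, Ψ.corrCoeff_eq hU hUne hT hu ht g hx hinj]
  set S := Ψ.spectralSystem hU hUne hT hu ht
  have hz : ∀ x, Ψ.zCoord t x = S.zCoord x := fun _ => rfl
  simp only [hz]
  by_cases hs : 2 ≤ 2 * g + n
  · rw [S.omega_zCoord_of_stable hs hx hinj]
    by_cases h1 : n = 1 ∧ g = 0
    · omega
    rw [if_neg h1, sub_zero]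
    have : diagonalTerm (u 0 t) g (n + 1) (fun i => S.zCoord (x i)) = 0 := by
      unfold diagonalTerm
      split
      · omega
      · rfl
    rw [this, add_zero]
  · obtain rfl : g = 0 := by omega
    have hn : n = 0 ∨ n = 1 := by omega
    rcases hn with rfl | rfl
    · rw [if_neg (by omega), sub_zero]
      show S.y (S.zCoord (x 0)) * dxParam (u 0 t) (S.zCoord (x 0)) = _ + 0
      rw [S.y_zCoord (hx 0), SpectralSystem.tupleAmp, show (Finset.univ.image x).erase (x 0) = ∅ by
        simp, S.coeff_zero_amp_empty (hx 0), Fin.prod_univ_one, add_zero]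
    · have h01 : x 0 ≠ x 1 := fun h => absurd (hinj h) (by simp)
      rw [if_pos ⟨rfl, rfl⟩]
      show 1 / (S.zCoord (x 0) - S.zCoord (x 1)) ^ 2 = (_ - 1 / (x 0 - x 1) ^ 2) * _
        + dxParam (u 0 t) (S.zCoord (x 0)) * dxParam (u 0 t) (S.zCoord (x 1))
          / (xParam (u 0 t) (S.zCoord (x 0)) - xParam (u 0 t) (S.zCoord (x 1))) ^ 2
      have himg : (Finset.univ.image x).erase (x 0) = {x 1} := by
        rw [erase_image_univ hinj]
        rfl
      rw [← S.coeff_one_amp_mul (hx 0) (hx 1) h01, S.xParam_zCoord (hx 0), S.xParam_zCoord (hx 1),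
        SpectralSystem.tupleAmp, himg, Fin.prod_univ_two]
      ring

theorem y_eq_yParam (w : ℂ) :
    (Ψ.spectralSystem hU hUne hT hu ht).y w = yParam m τ (u 0 t) w := by
  rw [SpectralSystem.y, yParam, ← eval_curvePoly]
  rfl

end WKBSolution

end PainleveII

end

/-! ### The genus expansion and the topological recursion of the Painlevé II hierarchy. -/

theorem mainTheorem3 (m : ℕ) (hm : 1 ≤ m) (τ : ℕ → ℂ) (U T : Set ℂ)
    (hU : IsOpen U) (hUne : U.Nonempty) (hT : IsOpen T) (u : ℕ → ℂ → ℂ)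
    (hu : PainleveII.IsStringSolution m τ T u) (Ψ : PainleveII.WKBSolution m τ u U T)
    (t : ℂ) (ht : t ∈ T) :
    -- the expansion `Wₙ = ∑_g N^{2-2g-n} Wₙ^{(g)}`
    (∀ n : ℕ, 1 ≤ n → ∀ x : Fin n → ℂ, (∀ i, x i ∈ U) → Function.Injective x →
      ∀ k : ℤ, (∀ g : ℕ, k ≠ 2 * (g : ℤ) - 2 + (n : ℤ)) → (Ψ.corr t n x).coeff k = 0) ∧
    ∃ ω : ℕ → (n : ℕ) → (Fin n → ℂ) → ℂ,
      -- `ω g n` is the differential `𝓦ₙ^{(g)}`, as a function of `z₁,…,zₙ`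
      (∀ g n : ℕ, 1 ≤ n → ∀ x : Fin n → ℂ, (∀ i, x i ∈ U) → Function.Injective x →
        ω g n (fun i => Ψ.zCoord t (x i)) = Ψ.differential t g n x) ∧
      (∀ z : Fin 1 → ℂ, ω 0 1 z
        = PainleveII.yParam m τ (u 0 t) (z 0) * PainleveII.dxParam (u 0 t) (z 0)) ∧
      (∀ z : Fin 2 → ℂ, ω 0 2 z = 1 / (z 0 - z 1) ^ 2) ∧
      -- the others are rational, with poles at `zᵢ = ±1` only
      (∀ g n : ℕ, 1 ≤ n → 2 < 2 * g + n → ∃ (d : ℕ) (P : MvPolynomial (Fin n) ℂ),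
        ∀ z : Fin n → ℂ, ω g n z = MvPolynomial.eval z P / ∏ i, (z i ^ 2 - 1) ^ d) ∧
      -- the recursion
      (∀ g n : ℕ, 2 ≤ 2 * g + n → ∀ (z : Fin n → ℂ) (p : ℂ),
        (∀ i, z i ≠ 1 ∧ z i ≠ -1) → p ≠ 1 → p ≠ -1 →
        ∃ r₁ r₂ : ℂ,
          PainleveII.HasResidueAt
            (PainleveII.recursionIntegrand m τ (u 0 t) ω g n z p) 1 r₁ ∧
          PainleveII.HasResidueAt
            (PainleveII.recursionIntegrand m τ (u 0 t) ω g n z p) (-1) r₂ ∧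
          ω g (n + 1) (Fin.snoc z p) = r₁ + r₂) := by
  refine ⟨fun n hn x hx hinj k hk => ?_,
    (Ψ.spectralSystem hU hUne hT hu ht).omega, fun g n hn x hx hinj => ?_, fun z => ?_, fun z => rfl,
    fun g n hn hs => ?_, fun g n hgn z p hz hp hp' => ?_⟩
  · obtain ⟨n, rfl⟩ := Nat.exists_eq_add_of_le' hn
    exact Ψ.coeff_corr_eq_zero hU hUne hT hu ht hx hinj hk
  · obtain ⟨n, rfl⟩ := Nat.exists_eq_add_of_le' hn
    exact Ψ.omega_zCoord hU hUne hT hu ht g hx hinj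
  · rw [← Ψ.y_eq_yParam hU hUne hT hu ht]
    rfl
  · obtain ⟨P, hP⟩ := PainleveII.exists_liftForm_eq_div (u 0 t)
      ((Ψ.spectralSystem hU hUne hT hu ht).formDatum g n).1
      ((Ψ.spectralSystem hU hUne hT hu ht).formDatum g n).2
    exact ⟨_, P, fun z => by
      rw [PainleveII.SpectralSystem.omega_of_stable _ (by omega), hP]⟩
  · have hsq : ∀ a : ℂ, a ≠ 1 → a ≠ -1 → a ^ 2 - 1 ≠ 0 := fun a h1 h2 h => by
      have : (a - 1) * (a + 1) = 0 := by linear_combination h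
      rcases mul_eq_zero.1 this with h | h
      · exact h1 (by linear_combination h)
      · exact h2 (by linear_combination h)
    have h := (Ψ.spectralSystem hU hUne hT hu ht).exists_hasResidueAt_recursion hgn
      (fun i => hsq _ (hz i).1 (hz i).2) (hsq p hp hp')
    simp only [Ψ.y_eq_yParam hU hUne hT hu ht] at h
    exact h
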